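/- Let $n\ge 2$, $\varepsilon=\frac1n$, $Q=(0,\infty)\times\mathbb R$. **Particle system.** Let $\mathcal Z_n$ be the set of $(\mathbf x,\mathbf b)\in\mathbb R^n\times\{-1,0,1\}^n$ such that $x_i>x_j$ whenever $i>j$ and $b_ib_j\ne0$. Given $(\mathbf x^\circ,\mathbf b^\circ)\in\mathcal Z_n$, a solution of $(P_n)$ on $[0,T]$ is a map $(\mathbf x,\mathbf b):[0,T]\to\mathcal Z_n$ with $(\mathbf x,\mathbf b)(0)=(\mathbf x^\circ,\mathbf b^\circ)$ for which there is a finite set $S\subset(0,T]$ such that: each $x_i$ is in $C([0,T])\cap C^1([0,T]\setminus S)$ and each $b_i$ is right-continuous; each $b_i$ jumps at most once, and if it jumps at $t$, then $t\in S$, $|b_i(t-)|=1$ and $b_i(t)=0$; $\sum_{i:\,x_i(\tau)=y}\big(b_i(\tau)-b_i(\tau-)\big)=0$ for all $(\tau,y)\in S\times\mathbb R$; and on $(0,T)\setminus S$ $$\frac{dx_i}{dt}=\frac1n\sum_{j\neq i}\frac{b_ib_j}{x_i-x_j},\qquad i=1,\dots,n .$$ A solution on $[0,\infty)$ is a map whose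 restriction to $[0,T]$ is a solution for every $T>0$. Put $u_n(t,y)=\frac1n\sum_i b_i(t)H(y-x_i(t))$ and $u_n^\circ(y)=\frac1n\sum_i b_i^\circ H(y-x_i^\circ)$, where $H=\mathbf 1_{[0,\infty)}$. **Equation.** Consider $(\mathrm{HJ}_\varepsilon)$: $u_t=\mathcal M_\varepsilon[u]\,|u_x|$ on $Q$, with the formal operator $\mathcal M_\varepsilon[w](x)=\int_{\mathbb R} E_\varepsilon[w(x+z)-w(x)]\frac{dz}{z^2}$, in the following sense. Let $E^*_\varepsilon(\alpha)=\varepsilon\big(\lfloor\alpha/\varepsilon\rfloor+\frac12\big)$ and $E_{\varepsilon,*}(\alpha)=\varepsilon\big(\lceil\alpha/\varepsilon\rceil-\frac12\big)$. For $\rho>0$ let $$\overline H_{\rho,\varepsilon}[\phi,u](t,x)=\Big(\mathrm{pv}\!\int_{|z|<\rho}E^*_\varepsilon[\phi(t,x+z)-\phi(t,x)]\frac{dz}{z^2}+\int_{|z|\ge\rho}E^*_\varepsilon[u(t,x+z)-u(t,x)]\frac{dz}{z^2}\Big)|\phi_x(t,x)|,$$ and let $\underline H_{\rho,\varepsilon}$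 be the same expression with $E_{\varepsilon,*}$ in place of $E_\varepsilon^*$. A bounded upper semicontinuous $u:Q\to\mathbb R$ is a $\rho$-subsolution if, whenever $\phi\in C^2(Q)$ and $u-\phi$ has a global maximum over $Q$ at $(\bar t,\bar x)$: $\phi_t(\bar t,\bar x)\le\overline H_{\rho,\varepsilon}[\phi,u](\bar t,\bar x)$ if $\phi_x(\bar t,\bar x)\ne0$, and $\phi_t(\bar t,\bar x)\le0$ if $\phi(t,x)=c|x-\bar x|^4+g(t)$ on $Q$ for some constant $c$ and function $g$ (and no condition otherwise). A bounded lower semicontinuous $v:Q\to\mathbb R$ is a $\rho$-supersolution if, whenever $\psi\in C^2(Q)$ and $v-\psi$ has a global minimum over $Q$ at $(\bar t,\bar x)$: $\psi_t(\bar t,\bar x)\ge\underline H_{\rho,\varepsilon}[\psi,v](\bar t,\bar x)$ if $\psi_x(\bar t,\bar x)\ne0$, and $\psi_t(\bar t,\bar x)\ge0$ if $\psi$ is of the form $c|x-\bar x|^4+g(t)$ on $Q$. A bounded function $v:Q\to\mathbb R$, with upper and lower semicontinuous envelopes $v^*,v_*$ (taken from within $Q$ and defined on $[0,\infty)\times\mathbb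 R$), is a viscosity solution ($\rho$-solution) if $v^*$ is a $\rho$-subsolution and $v_*$ is a $\rho$-supersolution. **Proposition.** Let $n\ge2$ and $(\mathbf x^\circ,\mathbf b^\circ)\in\mathcal Z_n$. Then $(P_n)$ has a solution on $[0,\infty)$ with initial datum $(\mathbf x^\circ,\mathbf b^\circ)$. For every such solution and every $\rho>0$, the step function $u_n$ is a viscosity solution of $(\mathrm{HJ}_\varepsilon)$ with $\varepsilon=\frac1n$ and satisfies $u_n^*(0,\cdot)=(u_n^\circ)^*$ and $(u_n)_*(0,\cdot)=(u_n^\circ)_*$. It is the unique one, up to the choice of values between the envelopes: every viscosity solution $v$ with $$v^*(0,\cdot)=(u_n^\circ)^*,\qquad v_*(0,\cdot)=(u_n^\circ)_*$$ satisfies $v^*=u_n^*$ and $v_*=(u_n)_*$ on $Q$. -/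

import Mathlib

open Set Filter Topology MeasureTheory

noncomputable section

namespace AnnihilatingParticles

/-! ### Semicontinuous envelopes -/

/-- Upper semicontinuous envelope, at a point `a` of the closure of `s`, of a (bounded) function
`f` on `s`: the limsup of `f` at `a` along `s`, the value at `a` itself being included when
`a ∈ s`. -/
def upperEnv {α : Type*} [TopologicalSpace α] (s : Set α) (f : α → ℝ) (a : α) : ℝ :=
  limsup f (𝓝[s] a)

/-- Lower semicontinuous envelope, at a point `a` of the closure of `s`, of a (bounded) function
`f` on `s`. -/
def lowerEnv {α : Type*} [TopologicalSpace α] (s : Set α) (f : α → ℝ) (a : α) : ℝ :=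
  liminf f (𝓝[s] a)

/-! ### The particle system -/

/-- The state space `Z_n`: positions `x` and charges `b ∈ {-1, 0, 1}`, the charged particles being
numbered strictly from left to right. -/
def stateSpace (n : ℕ) : Set ((Fin n → ℝ) × (Fin n → ℤ)) :=
  {p | (∀ i, p.2 i = -1 ∨ p.2 i = 0 ∨ p.2 i = 1) ∧
    ∀ i j, j < i → p.2 i * p.2 j ≠ 0 → p.1 j < p.1 i}

/-- The jump times in `[0, T]` of a charge `β`. -/
def jumpTimes (T : ℝ) (β : ℝ → ℤ) : Set ℝ :=
  {t | t ∈ Icc 0 T ∧ ¬ ContinuousWithinAt β (Icc 0 T) t}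

/-- `(x, b)` is a solution on `[0, T]`, with initial datum `(x₀, b₀)`, of the system
`dx_i/dt = (1/n) ∑_{j ≠ i} b_i b_j / (x_i - x_j)` with annihilation upon collision.
A right-continuous charge `β` has the jump bracket `β τ - β (τ-)` at `τ`. -/
def IsParticleSolutionOn {n : ℕ} (x₀ : Fin n → ℝ) (b₀ : Fin n → ℤ) (T : ℝ)
    (x : ℝ → Fin n → ℝ) (b : ℝ → Fin n → ℤ) : Prop :=
  (∀ t ∈ Icc 0 T, (x t, b t) ∈ stateSpace n) ∧
  ∃ S : Set ℝ, S.Finite ∧ S ⊆ Ioc 0 T ∧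
    -- regularity
    (∀ i, ContinuousOn (fun t => x t i) (Icc 0 T) ∧
      ContDiffOn ℝ 1 (fun t => x t i) (Icc 0 T \ S) ∧
      ∀ t ∈ Icc 0 T, ContinuousWithinAt (fun s => b s i) (Icc t T) t) ∧
    -- initial condition
    (x 0 = x₀ ∧ b 0 = b₀) ∧
    -- annihilation rule
    (∀ i, (jumpTimes T (fun s => b s i)).Subsingleton ∧
      ∀ t ∈ jumpTimes T (fun s => b s i),
        t ∈ S ∧ |Function.leftLim (fun s => b s i) t| = 1 ∧ b t i = 0) ∧
    (∀ τ ∈ S, ∀ y : ℝ,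
      ∑ i with x τ i = y, (b τ i - Function.leftLim (fun s => b s i) τ) = 0) ∧
    -- differential equation
    ∀ t ∈ Ioo 0 T \ S, ∀ i,
      HasDerivAt (fun s => x s i)
        ((1 / (n : ℝ)) * ∑ j with j ≠ i, (b t i : ℝ) * (b t j : ℝ) / (x t i - x t j)) t

/-- A solution of the particle system on `[0, ∞)`. -/
def IsParticleSolution {n : ℕ} (x₀ : Fin n → ℝ) (b₀ : Fin n → ℤ)
    (x : ℝ → Fin n → ℝ) (b : ℝ → Fin n → ℤ) : Prop :=
  ∀ T : ℝ, 0 < T → IsParticleSolutionOn x₀ b₀ T x b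

/-- The step function `y ↦ (1/n) ∑_i b_i H(y - x_i)`, with the Heaviside function `H`,
`H(0) = 1`. -/
def stepFunction {n : ℕ} (x : Fin n → ℝ) (b : Fin n → ℤ) (y : ℝ) : ℝ :=
  (1 / (n : ℝ)) * ∑ i, (b i : ℝ) * (if 0 ≤ y - x i then 1 else 0)

/-- The space-time step function `(t, y) ↦ (1/n) ∑_i b_i(t) H(y - x_i(t))`. -/
def particleStep {n : ℕ} (x : ℝ → Fin n → ℝ) (b : ℝ → Fin n → ℤ) (p : ℝ × ℝ) : ℝ :=
  stepFunction (x p.1) (b p.1) p.2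

/-! ### The Hamilton--Jacobi equation `u_t = M_ε[u] |u_x|`

A point of space-time is a pair `(t, x)`, time first. -/

/-- The open half-plane `Q = (0, ∞) × ℝ`. -/
def Q : Set (ℝ × ℝ) := {p | 0 < p.1}

/-- The staircase function `E_ε(α) = ε (⌊α/ε⌋ + 1/2)`; it is upper semicontinuous. -/
def stairUpper (ε α : ℝ) : ℝ := ε * ((⌊α / ε⌋ : ℝ) + 1 / 2)

/-- The lower semicontinuous envelope `ε ⌈α/ε⌉ - ε/2` of the staircase function. -/
def stairLower (ε α : ℝ) : ℝ := ε * ((⌈α / ε⌉ : ℝ) - 1 / 2)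

/-- The principal value `pv ∫_{B_ρ} f(z) dz/z²`. -/
def pvIntegral (ρ : ℝ) (f : ℝ → ℝ) : ℝ :=
  limUnder (𝓝[>] (0 : ℝ)) fun r => ∫ z in {z : ℝ | r < |z| ∧ |z| < ρ}, f z / z ^ 2

/-- The nonlocal operator
`pv ∫_{B_ρ} E[φ(x+z) - φ(x)] dz/z² + ∫_{B_ρ^c} E[u(x+z) - u(x)] dz/z²`. -/
def nonlocalOp (E : ℝ → ℝ) (ρ : ℝ) (φ u : ℝ → ℝ) (x : ℝ) : ℝ :=
  pvIntegral ρ (fun z => E (φ (x + z) - φ x)) +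
    ∫ z in {z : ℝ | ρ ≤ |z|}, E (u (x + z) - u x) / z ^ 2

/-- The time derivative `φ_t`. -/
def dt (φ : ℝ × ℝ → ℝ) (p : ℝ × ℝ) : ℝ := deriv (fun t => φ (t, p.2)) p.1

/-- The space derivative `φ_x`. -/
def dx (φ : ℝ × ℝ → ℝ) (p : ℝ × ℝ) : ℝ := deriv (fun x => φ (p.1, x)) p.2

/-- The Hamiltonian `M_ρ[φ(t,·), u(t,·)](x) |φ_x(t,x)|` at `p = (t, x)`, for the staircase `E`.
It is only used for `φ` of class `C²` with `φ_x(p) ≠ 0` and for bounded semicontinuous `u`; there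
the principal value exists (its integrand is odd near `0`) and the far integral converges. -/
def hamiltonian (E : ℝ → ℝ) (ρ : ℝ) (φ u : ℝ × ℝ → ℝ) (p : ℝ × ℝ) : ℝ :=
  nonlocalOp E ρ (fun x => φ (p.1, x)) (fun x => u (p.1, x)) p.2 * |dx φ p|

/-- On `Q` the function `φ` has the form `φ(t, x) = c |x - x̄|⁴ + g(t)`, where `p = (t̄, x̄)`. -/
def IsQuarticAt (φ : ℝ × ℝ → ℝ) (p : ℝ × ℝ) : Prop :=
  ∃ (c : ℝ) (g : ℝ → ℝ), ∀ q ∈ Q, φ q = c * |q.2 - p.2| ^ 4 + g q.1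

/-- `f` is bounded on `Q`. -/
def BoundedOnQ (f : ℝ × ℝ → ℝ) : Prop := ∃ C : ℝ, ∀ p ∈ Q, |f p| ≤ C

/-- `u` is a `ρ`-subsolution in `Q`. Nothing is required of a test function `φ` with
`φ_x(p) = 0` that is not of the quartic form. -/
def IsSubsolution (ρ ε : ℝ) (u : ℝ × ℝ → ℝ) : Prop :=
  UpperSemicontinuousOn u Q ∧ BoundedOnQ u ∧
  ∀ φ : ℝ × ℝ → ℝ, ContDiffOn ℝ 2 φ Q →
    ∀ p ∈ Q, IsMaxOn (fun q => u q - φ q) Q p →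
      (dx φ p ≠ 0 → dt φ p ≤ hamiltonian (stairUpper ε) ρ φ u p) ∧
      (IsQuarticAt φ p → dt φ p ≤ 0)

/-- `v` is a `ρ`-supersolution in `Q`. -/
def IsSupersolution (ρ ε : ℝ) (v : ℝ × ℝ → ℝ) : Prop :=
  LowerSemicontinuousOn v Q ∧ BoundedOnQ v ∧
  ∀ ψ : ℝ × ℝ → ℝ, ContDiffOn ℝ 2 ψ Q →
    ∀ p ∈ Q, IsMinOn (fun q => v q - ψ q) Q p →
      (dx ψ p ≠ 0 → hamiltonian (stairLower ε) ρ ψ v p ≤ dt ψ p) ∧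
      (IsQuarticAt ψ p → 0 ≤ dt ψ p)

/-- `u : Q → ℝ` is a viscosity solution (a `ρ`-solution) in `Q`: it is bounded, its upper envelope
is a subsolution and its lower envelope is a supersolution. Values of `u` off `Q` play no role. -/
def IsViscositySolution (ρ ε : ℝ) (u : ℝ × ℝ → ℝ) : Prop :=
  BoundedOnQ u ∧ IsSubsolution ρ ε (upperEnv Q u) ∧ IsSupersolution ρ ε (lowerEnv Q u)

/-- The upper and lower envelopes of `u : Q → ℝ` at `t = 0` are those of the function `u₀` on the
real line. -/
def HasInitialEnvelopes (u : ℝ × ℝ → ℝ) (u₀ : ℝ → ℝ) : Prop :=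
  ∀ y : ℝ, upperEnv Q u (0, y) = upperEnv univ u₀ y ∧ lowerEnv Q u (0, y) = lowerEnv univ u₀ y

end AnnihilatingParticles

end

open AnnihilatingParticles

noncomputable section

namespace AnnihilatingParticles

/-! ### Envelopes of bounded functions -/

section Envelopes

variable {α : Type*} [TopologicalSpace α] {s : Set α} {f : α → ℝ} {a : α} {C c : ℝ}

/-! On small nonzero increments the staircase only takes the values ±ε/2. For a step function with
jumps b_j/n at x_j, the integral against dz/z² taken at the particle i is therefore ∑_{j≠i} b_j / (n
(x_j - x_i)): the own jump enters as an odd function and cancels in the principal value, and a unit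
step at signed distance a contributes 1/a (`integral_stepIncrement`). This is -b_i times the
velocity of the particle, so that away from collisions the equation just transports the jumps with
the particle system. Three things remain: collisions, comparison, and solvability of the system.

Collisions. Two neighbouring charges of equal sign at the smallest such distance move apart
(`velocity_lt_of_isTwin`). Hence these distances stay bounded below, and particles that meet at one
point have alternating signs; their partial sums of charges take only the values 0 and one sign s
(`IsFlow.exists_cluster_sums`). So the step function takes at most two values near the collision.
Symmetrising the forces shows that the first moment of the group about the collision point is O(τ -
t), while its second moment is O(τ - t) and, for at least two particles, also bounded below by a
multiple of τ - t (`IsFlow.exists_moment_bounds`). A test function with nonzero slope would push all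
particles to one side up to O(τ - t), which contradicts this (`false_of_transversal_collision`); a
quartic test function only sees |x_i - y|⁴ = O((τ - t)²), which does not affect its time derivative.
This gives `ParticleEvolution.isSubsolution`, and negating the charges gives the supersolution
property.

Comparison. An arbitrary subsolution V is compared directly with the particle system. From a time τ
on, each charge is replaced by a smooth wall of width of order δ that follows its particle with an
offset increasing in time. Points occupied only by neutral particles, among them those of a complete
annihilation at time τ, are covered by bumps of radius δ that die out within a time of order δ², and
walls far away make the barrier high at infinity. The result is a strict enough barrier
(`LayerConfig.isBarrierAt`), and V stays below barriers (`IsSubsolution.le_of_barrier`). Since the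
length of the time interval does not depend on δ, small δ gives V ≤ u_n^* on that interval
(`ParticleEvolution.exists_forward_comparison`). A slowly rising well carries the inequality from
earlier times to a limit time (`IsSubsolution.le_of_past`), so there is no first time of failure
(`ParticleEvolution.comparison`). With the negated statement, (u_n)_* ≤ v_* ≤ v^* ≤ u_n^*. Equality
follows from semicontinuity, since u_n is continuous from the right in space and locally constant
off the particles (`ParticleEvolution.upperEnv_le_of_lowerEnv_le`).

Existence. By the same symmetrisation, sums of φ(x_i) with Lipschitz φ' vary at a bounded rate, and
the sums of (a - x_i)_+² determine a weakly ordered configuration. Hence trajectories have limits at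
the end of bounded intervals (`exists_tendsto_of_ode`), and a flow runs forever or into a collision
(`exists_flow`). There the net charge of each group is 0 or ±1, so at most one particle of the group
has to keep its charge (`IsFlow.exists_annihilation`). The number of charged particles drops, and
induction concludes. -/

theorem isBoundedUnder_le_nhdsWithin (hf : ∀ p ∈ s, |f p| ≤ C) :
    IsBoundedUnder (· ≤ ·) (𝓝[s] a) f :=
  isBoundedUnder_of_eventually_le (a := C)
    (eventually_mem_nhdsWithin.mono fun p hp => (abs_le.1 (hf p hp)).2)

theorem isBoundedUnder_ge_nhdsWithin (hf : ∀ p ∈ s, |f p| ≤ C) :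
    IsBoundedUnder (· ≥ ·) (𝓝[s] a) f :=
  isBoundedUnder_of_eventually_ge (a := -C)
    (eventually_mem_nhdsWithin.mono fun p hp => (abs_le.1 (hf p hp)).1)

theorem upperEnv_le (ha : a ∈ closure s) (hf : ∀ p ∈ s, |f p| ≤ C)
    (h : ∀ᶠ p in 𝓝[s] a, f p ≤ c) : upperEnv s f a ≤ c := by
  have := mem_closure_iff_nhdsWithin_neBot.1 ha
  exact limsup_le_of_le (isBoundedUnder_ge_nhdsWithin hf).isCoboundedUnder_le h

theorem le_upperEnv (hf : ∀ p ∈ s, |f p| ≤ C) (h : ∃ᶠ p in 𝓝[s] a, c ≤ f p) :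
    c ≤ upperEnv s f a :=
  le_limsup_of_frequently_le h (isBoundedUnder_le_nhdsWithin hf)

theorem self_le_upperEnv (ha : a ∈ s) (hf : ∀ p ∈ s, |f p| ≤ C) : f a ≤ upperEnv s f a := by
  refine le_upperEnv hf fun h => ?_
  exact (h.self_of_nhdsWithin ha) le_rfl

theorem eventually_lt_of_upperEnv_lt (hf : ∀ p ∈ s, |f p| ≤ C) (h : upperEnv s f a < c) :
    ∀ᶠ p in 𝓝[s] a, f p < c :=
  eventually_lt_of_limsup_lt h (isBoundedUnder_le_nhdsWithin hf)

theorem abs_upperEnv_le (ha : a ∈ closure s) (hf : ∀ p ∈ s, |f p| ≤ C) :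
    |upperEnv s f a| ≤ C := by
  have := mem_closure_iff_nhdsWithin_neBot.1 ha
  refine abs_le.2 ⟨?_, ?_⟩
  · exact le_upperEnv hf
      (eventually_mem_nhdsWithin.mono fun p hp => (abs_le.1 (hf p hp)).1).frequently
  · exact upperEnv_le ha hf (eventually_mem_nhdsWithin.mono fun p hp => (abs_le.1 (hf p hp)).2)

/-- Semicontinuity is needed on the closure and not only on `s`: the comparison argument starts at
time 0, which lies outside `Q`. -/
theorem upperSemicontinuousOn_upperEnv (hf : ∀ p ∈ s, |f p| ≤ C) :
    UpperSemicontinuousOn (upperEnv s f) (closure s) := by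
  intro a _ c hc
  obtain ⟨c', hc', hcc'⟩ := exists_between hc
  obtain ⟨o, ho, hao, hos⟩ :=
    mem_nhdsWithin.1 (eventually_lt_of_upperEnv_lt hf hc')
  filter_upwards [mem_nhdsWithin_of_mem_nhds (ho.mem_nhds hao), self_mem_nhdsWithin] with p hp hps
  refine (upperEnv_le hps hf ?_).trans_lt hcc'
  filter_upwards [mem_nhdsWithin_of_mem_nhds (ho.mem_nhds hp), self_mem_nhdsWithin] with q hq hqs
  exact (hos ⟨hq, hqs⟩).le

/-- This reflection reduces all statements on lower envelopes to statements on upper ones for the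
negated function. -/
theorem lowerEnv_eq_neg (ha : a ∈ closure s) (hf : ∀ p ∈ s, |f p| ≤ C) :
    lowerEnv s f a = -upperEnv s (-f) a := by
  have := mem_closure_iff_nhdsWithin_neBot.1 ha
  have hf' : ∀ p ∈ s, |(-f) p| ≤ C := fun p hp => by simpa using hf p hp
  refine le_antisymm ?_ ?_
  · rw [le_neg]
    refine le_of_forall_gt fun c hc => ?_
    obtain ⟨c', h1, h2⟩ := exists_between hc
    refine (upperEnv_le ha hf' ?_).trans_lt h2
    have : -c' < liminf f (𝓝[s] a) := by
      have : lowerEnv s f a = liminf f (𝓝[s] a) := rfl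
      linarith
    filter_upwards [eventually_lt_of_lt_liminf this (isBoundedUnder_ge_nhdsWithin hf)] with p hp
    simp only [Pi.neg_apply]; linarith
  · refine le_of_forall_lt fun c hc => ?_
    have h1 : upperEnv s (-f) a < -c := by linarith
    obtain ⟨c', h1, h2⟩ := exists_between h1
    refine lt_of_lt_of_le (b := -c') (by linarith) ?_
    refine le_liminf_of_le (isBoundedUnder_le_nhdsWithin hf).isCoboundedUnder_ge ?_
    filter_upwards [eventually_lt_of_upperEnv_lt hf' h1] with p hp
    simp only [Pi.neg_apply] at hp; linarith

theorem lowerEnv_le_upperEnv (ha : a ∈ closure s) (hf : ∀ p ∈ s, |f p| ≤ C) :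
    lowerEnv s f a ≤ upperEnv s f a := by
  have := mem_closure_iff_nhdsWithin_neBot.1 ha
  exact liminf_le_limsup (isBoundedUnder_le_nhdsWithin hf) (isBoundedUnder_ge_nhdsWithin hf)

end Envelopes

theorem isOpen_Q : IsOpen Q := isOpen_lt continuous_const continuous_fst

theorem mem_closure_Q {p : ℝ × ℝ} (hp : 0 ≤ p.1) : p ∈ closure Q := by
  have h : Q = Ioi (0 : ℝ) ×ˢ univ := by ext q; simp [Q]
  rw [h, closure_prod_eq, closure_Ioi, closure_univ]
  exact ⟨hp, trivial⟩

/-! ### The staircase -/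

section Stair

variable {ε : ℝ}

theorem stairUpper_mono (hε : 0 < ε) : Monotone (stairUpper ε) := by
  intro a b hab
  unfold stairUpper
  gcongr

theorem measurable_stairUpper : Measurable (stairUpper ε) := by
  unfold stairUpper
  fun_prop

theorem abs_stairUpper_le (hε : 0 < ε) (α : ℝ) : |stairUpper ε α| ≤ |α| + ε := by
  have h1 := Int.floor_le (α / ε)
  have h2 := Int.lt_floor_add_one (α / ε)
  have h3 : α = ε * (α / ε) := by field_simp
  unfold stairUpper
  rw [abs_le]
  have h4 := neg_abs_le α
  have h5 := le_abs_self α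
  constructor <;> nlinarith

theorem stairUpper_of_nonneg (hε : 0 < ε) {α : ℝ} (h : 0 ≤ α) (h' : α < ε) :
    stairUpper ε α = ε / 2 := by
  have : ⌊α / ε⌋ = 0 := Int.floor_eq_zero_iff.2 ⟨by positivity, by rwa [div_lt_one hε]⟩
  simp [stairUpper, this]; ring

theorem stairUpper_of_neg (hε : 0 < ε) {α : ℝ} (h : α < 0) (h' : -ε ≤ α) :
    stairUpper ε α = -(ε / 2) := by
  have : ⌊α / ε⌋ = -1 := by
    rw [Int.floor_eq_iff]
    constructor
    · rw [le_div_iff₀ hε]; push_cast; linarith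
    · rw [div_lt_iff₀ hε]; push_cast; linarith
  simp [stairUpper, this]; ring

theorem stairUpper_int_mul (hε : 0 < ε) (m : ℤ) : stairUpper ε (ε * m) = ε * (m + 1 / 2) := by
  simp [stairUpper, mul_div_cancel_left₀ _ hε.ne']

theorem stairLower_eq_neg (α : ℝ) : stairLower ε α = -stairUpper ε (-α) := by
  unfold stairLower stairUpper
  rw [neg_div, Int.floor_neg]
  push_cast; ring

end Stair

/-! ### Integrals against `dz / z²` -/

section Integrals

theorem measurableSet_lt_abs (r : ℝ) : MeasurableSet {z : ℝ | r < |z|} :=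
  measurableSet_lt measurable_const measurable_norm

theorem measurableSet_annulus (r ρ : ℝ) : MeasurableSet {z : ℝ | r < |z| ∧ |z| < ρ} :=
  (measurableSet_lt_abs r).inter (measurableSet_lt measurable_norm measurable_const)

theorem integrableOn_Ici_inv_sq {a : ℝ} (ha : 0 < a) :
    IntegrableOn (fun z : ℝ => 1 / z ^ 2) (Ici a) := by
  rw [integrableOn_Ici_iff_integrableOn_Ioi]
  refine (integrableOn_Ioi_rpow_of_lt (a := -2) (by norm_num) ha).congr_fun (fun z hz => ?_)
    measurableSet_Ioi
  have hz : 0 < z := ha.trans hz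
  simp only [Real.rpow_neg hz.le, one_div]
  norm_cast

theorem integral_Ici_inv_sq {a : ℝ} (ha : 0 < a) : ∫ z in Ici a, 1 / z ^ 2 = 1 / a := by
  rw [integral_Ici_eq_integral_Ioi]
  have h := integral_Ioi_rpow_of_lt (a := -2) (by norm_num) ha
  have h2 : ∫ z in Ioi a, 1 / z ^ 2 = ∫ z in Ioi a, z ^ (-2 : ℝ) := by
    refine setIntegral_congr_fun measurableSet_Ioi fun z hz => ?_
    have hz : 0 < z := ha.trans hz
    simp only [Real.rpow_neg hz.le, one_div]
    norm_cast
  rw [h2, h]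
  norm_num
  rw [Real.rpow_neg_one]

theorem integral_Iio_inv_sq {a : ℝ} (ha : 0 < a) : ∫ z in Iio (-a), 1 / z ^ 2 = 1 / a := by
  rw [← integral_Iic_eq_integral_Iio]
  have := integral_comp_neg_Ioi a (fun z : ℝ => 1 / z ^ 2)
  simp only [neg_sq] at this
  rw [← this, ← integral_Ici_eq_integral_Ioi, integral_Ici_inv_sq ha]

theorem integrableOn_Iio_inv_sq {a : ℝ} (ha : 0 < a) :
    IntegrableOn (fun z : ℝ => 1 / z ^ 2) (Iio (-a)) := by
  have h := (integrableOn_Ici_inv_sq ha).mono_set Ioi_subset_Ici_self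
  have := h.comp_neg
  simpa using this

theorem integrableOn_lt_abs_inv_sq {r : ℝ} (hr : 0 < r) :
    IntegrableOn (fun z : ℝ => 1 / z ^ 2) {z | r < |z|} := by
  refine ((integrableOn_Ici_inv_sq hr).union (integrableOn_Iio_inv_sq hr)).mono_set fun z hz => ?_
  have hz : r < |z| := hz
  rcases lt_abs.1 hz with h | h
  · exact Or.inl h.le
  · exact Or.inr (by simp only [mem_Iio]; linarith)

/-- A bounded measurable function is integrable against `dz / z²` away from the origin. -/
theorem integrableOn_div_sq {r : ℝ} (hr : 0 < r) {f : ℝ → ℝ} {s : Set ℝ}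
    (hs : MeasurableSet s) (hsr : s ⊆ {z | r < |z|}) {B : ℝ} (hf : Measurable f)
    (hB : ∀ z ∈ s, |f z| ≤ B) : IntegrableOn (fun z => f z / z ^ 2) s := by
  refine Integrable.mono' (((integrableOn_lt_abs_inv_sq hr).mono_set hsr).const_mul B) ?_ ?_
  · exact (hf.div (by fun_prop)).aestronglyMeasurable
  · refine (ae_restrict_iff' hs).2 (ae_of_all _ fun z hz => ?_)
    rw [norm_div, Real.norm_eq_abs, Real.norm_eq_abs, abs_of_nonneg (sq_nonneg z), mul_one_div]
    gcongr
    exact hB z hz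

theorem setIntegral_odd_eq_zero {f : ℝ → ℝ} {s : Set ℝ} (hs : MeasurableSet s)
    (hsym : ∀ z, -z ∈ s ↔ z ∈ s) (hodd : ∀ z ∈ s, f (-z) = -f z) : ∫ z in s, f z = 0 := by
  have h1 : ∫ z in s, f (-z) = ∫ z in s, f z := by
    rw [← integral_indicator hs, ← integral_indicator hs,
      ← integral_neg_eq_self (s.indicator f)]
    congr 1; ext z
    by_cases hz : z ∈ s <;> simp [indicator, hsym, hz]
  have h2 : ∫ z in s, f (-z) = -∫ z in s, f z := by
    rw [← integral_neg]
    exact setIntegral_congr_fun hs hodd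
  linarith

/-- The principal value of a function that is odd near the origin. -/
theorem pvIntegral_eq {f : ℝ → ℝ} {ρ r B : ℝ} (hr : 0 < r) (hf : Measurable f)
    (hB : ∀ z, |z| < ρ → |f z| ≤ B) (hodd : ∀ z, |z| ≤ r → z ≠ 0 → f (-z) = -f z) (hρ : r < ρ) :
    pvIntegral ρ f = ∫ z in {z : ℝ | r < |z| ∧ |z| < ρ}, f z / z ^ 2 := by
  refine Tendsto.limUnder_eq (tendsto_const_nhds.congr' ?_)
  filter_upwards [Ioo_mem_nhdsGT hr] with q hq
  have hq0 : 0 < q := hq.1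
  have h1 : {z : ℝ | q < |z| ∧ |z| < ρ} =
      {z | q < |z| ∧ |z| ≤ r} ∪ {z | r < |z| ∧ |z| < ρ} := by
    ext z
    simp only [mem_ofPred_eq, mem_union]
    rcases le_or_gt |z| r with h | h
    · simp [h, h.trans_lt hρ, not_lt.2 h]
    · simp [h, hq.2.trans h, not_le.2 h]
  have hm : MeasurableSet {z : ℝ | q < |z| ∧ |z| ≤ r} :=
    (measurableSet_lt_abs q).inter (measurableSet_le measurable_norm measurable_const)
  have hi : IntegrableOn (fun z => f z / z ^ 2) {z : ℝ | q < |z| ∧ |z| < ρ} :=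
    integrableOn_div_sq hq0 (measurableSet_annulus q ρ) (fun z hz => hz.1) hf
      fun z hz => hB z hz.2
  rw [h1] at hi ⊢
  rw [setIntegral_union _ (measurableSet_annulus r ρ) hi.left_of_union hi.right_of_union,
    setIntegral_odd_eq_zero hm, zero_add]
  · intro z; simp
  · intro z hz
    have hz0 : z ≠ 0 := abs_pos.1 (hq0.trans hz.1)
    rw [hodd z hz.2 hz0, neg_sq, neg_div]
  · rw [Set.disjoint_left]
    intro z hz hz'
    exact absurd hz'.1 (not_lt.2 hz.2)

/-- The increment between `0` and `z` of a unit step located at `a`. -/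
def stepIncrement (a z : ℝ) : ℝ := (if a ≤ z then 1 else 0) - if a ≤ 0 then 1 else 0

theorem measurable_stepIncrement (a : ℝ) : Measurable (stepIncrement a) :=
  (Measurable.ite measurableSet_Ici measurable_const measurable_const).sub measurable_const

theorem abs_stepIncrement_le (a z : ℝ) : |stepIncrement a z| ≤ 1 := by
  unfold stepIncrement
  split_ifs <;> norm_num

/-- The source of the interaction 1/(x_i - x_j). A step to the right of the origin adds the integral
over a right half-line; one to the left subtracts over a left half-line, so the sign agrees with
that of `a`. The truncation at `r` is invisible because the step lies farther out. -/
theorem integral_stepIncrement {a r : ℝ} (hr : 0 < r) (ha : r < |a|) :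
    ∫ z in {z : ℝ | r < |z|}, stepIncrement a z / z ^ 2 = 1 / a := by
  rcases lt_abs.1 ha with h | h
  · have ha0 : 0 < a := hr.trans h
    have h1 : (fun z => stepIncrement a z / z ^ 2) = (Ici a).indicator fun z => 1 / z ^ 2 := by
      ext z
      simp only [stepIncrement, indicator, mem_Ici, not_le.2 ha0, if_false, sub_zero]
      split_ifs <;> simp
    rw [h1, setIntegral_indicator measurableSet_Ici, inter_eq_right.2, integral_Ici_inv_sq ha0]
    intro z hz
    exact (h.trans_le hz).trans_le (le_abs_self z)
  · have ha0 : 0 < -a := hr.trans h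
    have h1 : (fun z => stepIncrement a z / z ^ 2) =
        (Iio (-(-a))).indicator fun z => -(1 / z ^ 2) := by
      ext z
      simp only [stepIncrement, indicator, neg_neg, mem_Iio, (neg_pos.1 ha0).le, if_true]
      by_cases hz : a ≤ z
      · simp [hz, not_lt.2 hz]
      · simp [hz, not_le.1 hz]; ring
    rw [h1, setIntegral_indicator measurableSet_Iio, inter_eq_right.2, integral_neg,
      integral_Iio_inv_sq ha0]
    · rw [one_div_neg_eq_neg_one_div, neg_neg]
    · intro z hz
      simp only [neg_neg, mem_Iio] at hz
      have := neg_le_abs z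
      simp only [mem_ofPred_eq]; linarith

end Integrals

/-! ### The nonlocal operator -/

section Operator

variable {ε ρ : ℝ}

/-- Near a noncritical point the staircase of the increment is odd. -/
theorem exists_stairUpper_odd (hε : 0 < ε) {f : ℝ → ℝ} {f' x : ℝ} (hf : HasDerivAt f f' x)
    (hf' : f' ≠ 0) : ∃ r > 0, ∀ z, |z| ≤ r → z ≠ 0 →
      stairUpper ε (f (x + -z) - f x) = -stairUpper ε (f (x + z) - f x) := by
  have h1 : ∀ᶠ z in 𝓝 (0 : ℝ), |f (x + z) - f x - f' * z| ≤ |f'| / 2 * |z| := by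
    have h := (hasDerivAt_iff_isLittleO_nhds_zero.1 hf).def (c := |f'| / 2) (by positivity)
    filter_upwards [h] with z hz
    simpa [mul_comm] using hz
  have h2 : ∀ᶠ z in 𝓝 (0 : ℝ), |f (x + z) - f x| < ε := by
    have hc : Tendsto (fun z => |f (x + z) - f x|) (𝓝 0) (𝓝 |f (x + 0) - f x|) := by
      have : Tendsto (fun z => f (x + z)) (𝓝 0) (𝓝 (f (x + 0))) := by
        have h3 : Tendsto (fun z => x + z) (𝓝 0) (𝓝 x) := by
          simpa using (continuous_const_add x).tendsto 0
        simpa [Function.comp_def] using hf.continuousAt.tendsto.comp h3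
      exact (this.sub_const _).abs
    exact hc.eventually_lt_const (by simpa using hε)
  obtain ⟨r, hr, hrz⟩ := Metric.eventually_nhds_iff.1 (h1.and h2)
  refine ⟨r / 2, by positivity, fun z hz hz0 => ?_⟩
  have hz1 := hrz (y := z) (by simp; linarith)
  have hz2 := hrz (y := -z) (by simp; linarith)
  have hzpos : 0 < |z| := abs_pos.2 hz0
  have hfpos : 0 < |f'| := abs_pos.2 hf'
  have hp : |f' * z| = |f'| * |z| := abs_mul _ _
  obtain ⟨⟨a1, a2⟩, a3, a4⟩ := And.imp abs_le.1 abs_lt.1 hz1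
  obtain ⟨⟨b1, b2⟩, b3, b4⟩ := And.imp abs_le.1 abs_lt.1 hz2
  rw [abs_neg] at b1 b2
  have hm : 0 < |f'| * |z| := by positivity
  -- For small `z ≠ 0` the increment has the sign of `f' * z` and modulus below `ε`, so the
  -- staircase is `±ε/2` and the two values at `±z` are opposite.
  rcases abs_cases (f' * z) with ⟨h, _⟩ | ⟨h, _⟩
  · rw [stairUpper_of_neg hε (by nlinarith) b3.le, stairUpper_of_nonneg hε (by nlinarith) a4]
  · rw [stairUpper_of_nonneg hε (by nlinarith) b4, stairUpper_of_neg hε (by nlinarith) a3.le,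
      neg_neg]

/-- Since the near integrand is odd close to the origin, the truncated integrals do not depend on
the truncation once it is small, and the principal value is one of them. From here on only
convergent integrals over `r < |z|` occur. -/
theorem nonlocalOp_eq (hε : 0 < ε) (hρ : 0 < ρ) {f u : ℝ → ℝ} {f' x : ℝ}
    (hf : HasDerivAt f f' x) (hf' : f' ≠ 0) (hc : Continuous f) :
    ∃ r₀ > 0, ∀ r ∈ Ioo 0 r₀, r < ρ ∧ nonlocalOp (stairUpper ε) ρ f u x =
      (∫ z in {z : ℝ | r < |z| ∧ |z| < ρ}, stairUpper ε (f (x + z) - f x) / z ^ 2) +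
        ∫ z in {z : ℝ | ρ ≤ |z|}, stairUpper ε (u (x + z) - u x) / z ^ 2 := by
  obtain ⟨r, hr, h⟩ := exists_stairUpper_odd hε hf hf'
  refine ⟨min r ρ, by positivity, fun q hq => ⟨hq.2.trans_le (min_le_right _ _), ?_⟩⟩
  have hm : Measurable fun z => stairUpper ε (f (x + z) - f x) :=
    measurable_stairUpper.comp (by fun_prop)
  obtain ⟨B, hB⟩ := (isCompact_Icc (a := x - ρ) (b := x + ρ)).exists_bound_of_continuousOn
    (f := fun y => f y - f x) (by fun_prop)
  have hB' : ∀ z, |z| < ρ → |stairUpper ε (f (x + z) - f x)| ≤ B + ε := fun z hz => by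
    refine (abs_stairUpper_le hε _).trans ?_
    have := abs_lt.1 hz
    gcongr
    exact hB (x + z) ⟨by linarith, by linarith⟩
  unfold nonlocalOp
  rw [pvIntegral_eq hq.1 hm hB' (fun z hz => h z (hz.trans (hq.2.le.trans (min_le_left _ _))))
    (hq.2.trans_le (min_le_right _ _))]

theorem setOf_lt_abs_eq_union {r : ℝ} (hr : r < ρ) :
    {z : ℝ | r < |z|} = {z | r < |z| ∧ |z| < ρ} ∪ {z | ρ ≤ |z|} := by
  ext z
  simp only [mem_ofPred_eq, mem_union]
  rcases lt_or_ge |z| ρ with h | h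
  · simp [h, not_le.2 h]
  · simp [h, not_lt.2 h, hr.trans_le h]

theorem setIntegral_lt_abs_eq {r : ℝ} (hr : r < ρ) {g : ℝ → ℝ}
    (hg : IntegrableOn g {z : ℝ | r < |z|}) :
    ∫ z in {z : ℝ | r < |z|}, g z =
      (∫ z in {z : ℝ | r < |z| ∧ |z| < ρ}, g z) + ∫ z in {z : ℝ | ρ ≤ |z|}, g z := by
  have hm : MeasurableSet {z : ℝ | ρ ≤ |z|} := measurableSet_le measurable_const measurable_norm
  rw [setOf_lt_abs_eq_union hr] at hg ⊢
  rw [setIntegral_union _ hm hg.left_of_union hg.right_of_union]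
  rw [Set.disjoint_left]
  intro z hz hz'
  exact absurd hz.2 (not_lt.2 hz')

/-- Upper bound for the nonlocal operator when the test function touches from above. -/
theorem nonlocalOp_le (hε : 0 < ε) (hρ : 0 < ρ) {f u : ℝ → ℝ} {f' x B : ℝ}
    (hf : HasDerivAt f f' x) (hf' : f' ≠ 0) (hc : Continuous f) (hB : ∀ y, |f y| ≤ B)
    (hu : Measurable u) {C : ℝ} (huC : ∀ y, |u y| ≤ C) (hle : ∀ z, u (x + z) - u x ≤ f (x + z) - f x) :
    ∃ r₀ > 0, ∀ r ∈ Ioo 0 r₀, nonlocalOp (stairUpper ε) ρ f u x ≤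
      ∫ z in {z : ℝ | r < |z|}, stairUpper ε (f (x + z) - f x) / z ^ 2 := by
  obtain ⟨r₀, hr₀, h⟩ := nonlocalOp_eq (u := u) hε hρ hf hf' hc
  refine ⟨r₀, hr₀, fun r hr => ?_⟩
  obtain ⟨hrρ, hr'⟩ := h r hr
  have hm : MeasurableSet {z : ℝ | ρ ≤ |z|} := measurableSet_le measurable_const measurable_norm
  have bound : ∀ (g : ℝ → ℝ) (D : ℝ), (∀ y, |g y| ≤ D) → ∀ z,
      |stairUpper ε (g (x + z) - g x)| ≤ 2 * D + ε := fun g D hg z => by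
    refine (abs_stairUpper_le hε _).trans ?_
    have := abs_sub (g (x + z)) (g x)
    linarith [hg (x + z), hg x]
  have hfm : Measurable fun z => stairUpper ε (f (x + z) - f x) :=
    measurable_stairUpper.comp (by fun_prop)
  have hi := integrableOn_div_sq hr.1 (measurableSet_lt_abs r) subset_rfl hfm
    fun z _ => bound f B hB z
  rw [hr', setIntegral_lt_abs_eq hrρ hi]
  refine add_le_add le_rfl (setIntegral_mono_on ?_ ?_ hm fun z _ => ?_)
  · have hum : Measurable fun z => stairUpper ε (u (x + z) - u x) :=
      measurable_stairUpper.comp (by fun_prop)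
    exact integrableOn_div_sq hr.1 hm (fun z hz => lt_of_lt_of_le hrρ hz) hum
      fun z _ => bound u C huC z
  · exact hi.mono_set fun z hz => lt_of_lt_of_le hrρ hz
  · gcongr
    exact stairUpper_mono hε (hle z)

/-- Lower bound for the nonlocal operator when the test function touches from above. -/
theorem le_nonlocalOp (hε : 0 < ε) (hρ : 0 < ρ) {f u : ℝ → ℝ} {f' x : ℝ}
    (hf : HasDerivAt f f' x) (hf' : f' ≠ 0) (hc : Continuous f)
    (hu : Measurable u) {C : ℝ} (huC : ∀ y, |u y| ≤ C) (hle : ∀ z, u (x + z) - u x ≤ f (x + z) - f x)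
    {g : ℝ → ℝ} {D : ℝ} (hg : Measurable g) (hgD : ∀ z, |g z| ≤ D)
    (hgu : ∀ z ≠ 0, g z ≤ stairUpper ε (u (x + z) - u x)) :
    ∃ r₀ > 0, ∀ r ∈ Ioo 0 r₀, ∫ z in {z : ℝ | r < |z|}, g z / z ^ 2 ≤
      nonlocalOp (stairUpper ε) ρ f u x := by
  obtain ⟨r₀, hr₀, h⟩ := nonlocalOp_eq (u := u) hε hρ hf hf' hc
  refine ⟨r₀, hr₀, fun r hr => ?_⟩
  obtain ⟨hrρ, hr'⟩ := h r hr
  have hm : MeasurableSet {z : ℝ | ρ ≤ |z|} := measurableSet_le measurable_const measurable_norm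
  have hi := integrableOn_div_sq hr.1 (measurableSet_lt_abs r) subset_rfl hg fun z _ => hgD z
  have hfm : Measurable fun z => stairUpper ε (f (x + z) - f x) :=
    measurable_stairUpper.comp (by fun_prop)
  have hum : Measurable fun z => stairUpper ε (u (x + z) - u x) :=
    measurable_stairUpper.comp (by fun_prop)
  rw [hr', setIntegral_lt_abs_eq hrρ hi]
  refine add_le_add (setIntegral_mono_on ?_ ?_ (measurableSet_annulus r ρ) fun z hz => ?_)
    (setIntegral_mono_on ?_ ?_ hm fun z hz => ?_)
  · exact hi.mono_set fun z hz => hz.1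
  · obtain ⟨B, hB⟩ := (isCompact_Icc (a := x - ρ) (b := x + ρ)).exists_bound_of_continuousOn
      (f := fun y => f y - f x) (by fun_prop)
    refine integrableOn_div_sq (B := B + ε) hr.1 (measurableSet_annulus r ρ) (fun z hz => hz.1) hfm
      fun z hz => (abs_stairUpper_le hε _).trans ?_
    have := abs_lt.1 hz.2
    gcongr
    exact hB (x + z) ⟨by linarith, by linarith⟩
  · have hz0 : z ≠ 0 := abs_pos.1 (hr.1.trans hz.1)
    gcongr
    exact (hgu z hz0).trans (stairUpper_mono hε (hle z))
  · exact hi.mono_set fun z hz => lt_of_lt_of_le hrρ hz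
  · refine integrableOn_div_sq (B := 2 * C + ε) hr.1 hm (fun z hz => lt_of_lt_of_le hrρ hz) hum
      fun z _ => (abs_stairUpper_le hε _).trans ?_
    have := abs_sub (u (x + z)) (u x)
    linarith [huC (x + z), huC x]
  · have hz0 : z ≠ 0 := abs_pos.1 ((hr.1.trans hrρ).trans_le hz)
    gcongr
    exact hgu z hz0

end Operator

/-! ### Comparison of subsolutions with smooth barriers -/

section Barrier

variable {ρ ε : ℝ}

/-- A smooth time change that is the identity near `t` and stays near `t`. -/
theorem exists_time_localization {a T t : ℝ} (ht : t ∈ Ioo a T) :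
    ∃ κ μ : ℝ → ℝ, ∃ r > 0, ContDiff ℝ 2 κ ∧ ContDiff ℝ 2 μ ∧ (∀ s, κ s ∈ Ioo a T) ∧
      (∀ s, 0 ≤ μ s) ∧ (∀ s, |s - t| ≤ r → μ s = 0) ∧ (∀ s, κ s = s ∨ μ s = 1) ∧
      ∀ s, |s - t| ≤ r → κ s = s := by
  obtain ⟨r, hr, hr1, hr2⟩ : ∃ r > 0, a < t - 3 * r ∧ t + 3 * r < T := by
    refine ⟨min (t - a) (T - t) / 4, ?_, ?_, ?_⟩
    · have h1 := sub_pos.2 ht.1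
      have h2 := sub_pos.2 ht.2
      positivity
    · have := min_le_left (t - a) (T - t)
      linarith [ht.1]
    · have := min_le_right (t - a) (T - t)
      linarith [ht.2]
  -- The plateau of `χ` has the radius `2r` of the support of `η`. So wherever the time change `κ`
  -- is not the identity, `μ = 1 - η` has already reached the value 1.
  let χ : ContDiffBump t := ⟨2 * r, 3 * r, by positivity, by linarith⟩
  let η : ContDiffBump t := ⟨r, 2 * r, by positivity, by linarith⟩
  refine ⟨fun s => t + (s - t) * χ s, fun s => 1 - η s, r, hr, ?_, ?_, fun s => ?_, fun s => ?_,
    fun s hs => ?_, fun s => ?_, fun s hs => ?_⟩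
  · exact contDiff_const.add ((contDiff_id.sub contDiff_const).mul χ.contDiff)
  · exact contDiff_const.sub η.contDiff
  · rcases le_or_gt (3 * r) |s - t| with h | h
    · beta_reduce; rw [χ.zero_of_le_dist (by simpa [Real.dist_eq] using h)]
      simpa using ht
    · have h1 : |(s - t) * χ s| ≤ 3 * r := by
        rw [abs_mul, abs_of_nonneg χ.nonneg]
        calc |s - t| * χ s ≤ 3 * r * 1 := mul_le_mul h.le χ.le_one χ.nonneg (by positivity)
          _ = 3 * r := mul_one _
      have := abs_le.1 h1
      constructor <;> linarith
  · linarith [η.le_one (x := s)]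
  · beta_reduce; rw [η.one_of_mem_closedBall (by simpa [Real.dist_eq] using hs), sub_self]
  · rcases le_or_gt (2 * r) |s - t| with h | h
    · right
      beta_reduce; rw [η.zero_of_le_dist (by simpa [Real.dist_eq] using h), sub_zero]
    · left
      beta_reduce; rw [χ.one_of_mem_closedBall (by simpa [Real.dist_eq] using h.le)]
      ring
  · beta_reduce; rw [χ.one_of_mem_closedBall]
    · ring
    · rw [Metric.mem_closedBall, Real.dist_eq]
      exact hs.trans (by change r ≤ 2 * r; linarith)

theorem dt_congr {φ ψ : ℝ × ℝ → ℝ} {t x : ℝ} (h : ∀ᶠ s in 𝓝 t, φ (s, x) = ψ (s, x)) :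
    dt φ (t, x) = dt ψ (t, x) :=
  EventuallyEq.deriv_eq (f := fun s => ψ (s, x)) (f₁ := fun s => φ (s, x)) h

theorem hamiltonian_congr {E : ℝ → ℝ} {φ ψ V : ℝ × ℝ → ℝ} {t x : ℝ}
    (h : ∀ y, φ (t, y) = ψ (t, y)) :
    hamiltonian E ρ φ V (t, x) = hamiltonian E ρ ψ V (t, x) := by
  unfold hamiltonian dx
  simp only [h]

/-- The subsolution inequality may be tested with functions that are only given on a time slab. -/
theorem IsSubsolution.of_slab {V : ℝ × ℝ → ℝ} (hV : IsSubsolution ρ ε V) {C : ℝ}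
    (hC : ∀ p ∈ Q, V p ≤ C) {a T : ℝ} (ha : 0 ≤ a) {ψ : ℝ × ℝ → ℝ}
    (hψ : ContDiffOn ℝ 2 ψ (Ioo a T ×ˢ univ)) {B : ℝ}
    (hB : ∀ p ∈ Ioo a T ×ˢ (univ : Set ℝ), B ≤ ψ p) {t x : ℝ} (ht : t ∈ Ioo a T)
    (hmax : ∀ s ∈ Ioo a T, ∀ y, V (s, y) - ψ (s, y) ≤ V (t, x) - ψ (t, x)) :
    (dx ψ (t, x) ≠ 0 → dt ψ (t, x) ≤ hamiltonian (stairUpper ε) ρ ψ V (t, x)) ∧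
      ((∃ (c : ℝ) (g : ℝ → ℝ), ∀ s ∈ Ioo a T, ∀ y, ψ (s, y) = c * |y - x| ^ 4 + g s) →
        dt ψ (t, x) ≤ 0) := by
  obtain ⟨κ, μ, r, hr, hκ, hμ, hκm, hμ0, hμr, hor, hκr⟩ := exists_time_localization ht
  -- The global test function is `ψ` after the time change plus `K μ`. Where `μ = 1` its excess is
  -- at most `C - B - K`, which is exactly the value at the contact point.
  set K := C - B - (V (t, x) - ψ (t, x)) with hK
  have hBt := hB (t, x) ⟨ht, trivial⟩
  have hCt := hC (t, x) (ha.trans_lt ht.1)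
  let φ : ℝ × ℝ → ℝ := fun q => ψ (κ q.1, q.2) + K * μ q.1
  have hφ2 : ContDiffOn ℝ 2 φ Q := by
    refine ContDiffOn.add (hψ.comp (t := Ioo a T ×ˢ univ) (g := ψ)
      (f := fun q : ℝ × ℝ => (κ q.1, q.2)) ?_ fun q _ => ⟨hκm _, trivial⟩) ?_
    · exact ((hκ.comp contDiff_fst).prodMk contDiff_snd).contDiffOn
    · exact (contDiff_const.mul (hμ.comp contDiff_fst)).contDiffOn
  have hκt : κ t = t := hκr t (by simpa using hr.le)
  have hμt : μ t = 0 := hμr t (by simpa using hr.le)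
  have hslice : ∀ y, φ (t, y) = ψ (t, y) := fun y => by simp [φ, hκt, hμt]
  have hK0 : 0 ≤ K := by rw [hK]; linarith
  have hmax' : IsMaxOn (fun q => V q - φ q) Q (t, x) := by
    rintro ⟨s, y⟩ hs
    simp only [mem_ofPred_eq, hslice, φ]
    rcases hor s with h | h
    · have hsm := hκm s
      rw [h] at hsm ⊢
      have := hmax s hsm y
      have := mul_nonneg hK0 (hμ0 s)
      linarith
    · have h1 := hB (κ s, y) ⟨hκm s, trivial⟩
      have h2 := hC (s, y) hs
      rw [h]
      linarith
  have hdt : dt φ (t, x) = dt ψ (t, x) := by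
    refine dt_congr ?_
    filter_upwards [Metric.closedBall_mem_nhds t hr] with s hs
    rw [Metric.mem_closedBall, Real.dist_eq] at hs
    simp [φ, hκr s hs, hμr s hs]
  obtain ⟨h1, h2⟩ := hV.2.2 φ hφ2 (t, x) (ha.trans_lt ht.1) hmax'
  rw [hdt] at h1 h2
  refine ⟨fun h => ?_, fun ⟨c, g, hg⟩ => h2 ⟨c, fun s => g (κ s) + K * μ s, fun q _ => ?_⟩⟩
  · rw [← hamiltonian_congr hslice]
    refine h1 ?_
    have : dx φ (t, x) = dx ψ (t, x) := by unfold dx; simp only [hslice]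
    rwa [this]
  · simp only [φ, hg _ (hκm q.1)]; ring

/-- The condition that makes `φ` a barrier for subsolutions at the point `(t, y)`. -/
def IsBarrierAt (ε : ℝ) (φ : ℝ × ℝ → ℝ) (t y : ℝ) : Prop :=
  (dx φ (t, y) ≠ 0 → ∃ r₀ > 0, ∀ r ∈ Ioo 0 r₀,
    (∫ z in {z : ℝ | r < |z|}, stairUpper ε (φ (t, y + z) - φ (t, y)) / z ^ 2) * |dx φ (t, y)| ≤
      dt φ (t, y)) ∧
  (dx φ (t, y) = 0 → 0 ≤ dt φ (t, y) ∨
    ∃ A > 0, ∀ᶠ h in 𝓝 (0 : ℝ), φ (t, y + h) ≤ φ (t, y) - A * h ^ 2)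

theorem measurable_slice_of_upperSemicontinuousOn {V : ℝ × ℝ → ℝ}
    (hV : UpperSemicontinuousOn V Q) {t : ℝ} (ht : 0 < t) : Measurable fun y => V (t, y) := by
  have : UpperSemicontinuous fun y => V (t, y) := by
    intro y c hc
    have h := hV (t, y) ht c hc
    rw [isOpen_Q.nhdsWithin_eq ht] at h
    exact (Continuous.prodMk_right t).continuousAt.eventually h
  exact this.measurable

/-- At the contact point of a subsolution with a translate of a barrier we get a contradiction. -/
theorem false_of_barrier_contact (hε : 0 < ε) (hρ : 0 < ρ) {V : ℝ × ℝ → ℝ}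
    (hV : IsSubsolution ρ ε V) {a T : ℝ} (ha : 0 ≤ a) {φ : ℝ × ℝ → ℝ}
    (hφ : ContDiffOn ℝ 2 φ (Ioo a T ×ˢ univ)) {B : ℝ}
    (hB : ∀ t ∈ Ioo a T, ∀ y, |φ (t, y)| ≤ B)
    (hbar : ∀ t ∈ Ioo a T, ∀ y, IsBarrierAt ε φ t y) {η c : ℝ} (hη : 0 < η) (hc : 0 < c)
    {t x h : ℝ} (ht : t ∈ Ioo a T)
    (hmax : ∀ s ∈ Ioo a T, ∀ y k, V (s, y) - φ (s, y - k) - η / (T - s) - c * k ^ 4 ≤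
      V (t, x) - φ (t, x - h) - η / (T - t) - c * h ^ 4) : False := by
  have hopen : IsOpen (Ioo a T ×ˢ (univ : Set ℝ)) := isOpen_Ioo.prod isOpen_univ
  obtain ⟨C, hVC⟩ := hV.2.1
  have hCC : ∀ p ∈ Q, V p ≤ C := fun p hp => (abs_le.1 (hVC p hp)).2
  have ht0 : 0 < t := ha.trans_lt ht.1
  have hdiff : ∀ y, DifferentiableAt ℝ φ (t, y) := fun y =>
    (hφ.differentiableOn (by norm_num)).differentiableAt (hopen.mem_nhds ⟨ht, trivial⟩)
  have hdtφ : ∀ y, HasDerivAt (fun s => φ (s, y)) (dt φ (t, y)) t := fun y =>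
    (DifferentiableAt.comp (f := fun s : ℝ => (s, y)) t (hdiff y) (by fun_prop)).hasDerivAt
  have hdxφ : ∀ y, HasDerivAt (fun z => φ (t, z)) (dx φ (t, y)) y := fun y =>
    (DifferentiableAt.comp (f := fun z : ℝ => (t, z)) y (hdiff y) (by fun_prop)).hasDerivAt
  have hTt : 0 < T - t := sub_pos.2 ht.2
  have hpen : HasDerivAt (fun s => η / (T - s)) (η / (T - t) ^ 2) t := by
    have h1 : HasDerivAt (fun s : ℝ => T - s) (-1) t := by
      simpa using (hasDerivAt_id t).const_sub T
    have := (h1.inv hTt.ne').const_mul η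
    simpa [div_eq_mul_inv] using this
  have hη' : 0 < η / (T - t) ^ 2 := by positivity
  have hpenC : ContDiffOn ℝ 2 (fun q : ℝ × ℝ => η / (T - q.1)) (Ioo a T ×ˢ univ) := by
    refine contDiffOn_const.div ?_ fun q hq => (sub_pos.2 hq.1.2).ne'
    exact (contDiff_const.sub contDiff_fst).contDiffOn
  by_cases hx : dx φ (t, x - h) = 0
  · -- critical contact point
    have hmaxh : ∀ k, φ (t, x - h) + c * h ^ 4 ≤ φ (t, x - k) + c * k ^ 4 := fun k => by
      have := hmax t ht x k
      linarith
    -- The translate `h` minimises `φ (t, x - k) + c k⁴` over `k`; at a critical point of `φ` this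
    -- forces `4 c h³ = 0`.
    have hh : h = 0 := by
      have h1 : HasDerivAt (fun k => φ (t, x - k) + c * k ^ 4)
          (-(dx φ (t, x - h)) + c * (4 * h ^ 3)) h := by
        have h2 : HasDerivAt (fun k => φ (t, x - k)) (-(dx φ (t, x - h))) h := by
          have h3 : HasDerivAt (fun k : ℝ => x - k) (-1) h := by
            simpa using (hasDerivAt_id h).const_sub x
          simpa [Function.comp_def] using HasDerivAt.comp h (hdxφ (x - h)) h3
        exact h2.add (by simpa using (hasDerivAt_pow 4 h).const_mul c)
      have h4 := IsLocalMin.hasDerivAt_eq_zero (Eventually.of_forall hmaxh) h1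
      rw [hx] at h4
      simpa [hc.ne'] using h4
    subst hh
    rw [sub_zero] at hx hmaxh hmax
    have hdt : 0 ≤ dt φ (t, x) := by
      -- A strict quadratic maximum of the barrier cannot be a contact point: minimality at `k = 0`
      -- would give `A k² ≤ c k⁴` for all small `k`.
      rcases (hbar t ht x).2 hx with h | ⟨A, hA, h⟩
      · exact h
      · exfalso
        have h1 : ∀ᶠ k in 𝓝 (0 : ℝ), c * k ^ 2 < A := by
          have h2 : Tendsto (fun k : ℝ => c * k ^ 2) (𝓝 0) (𝓝 (c * 0 ^ 2)) :=
            Continuous.tendsto (by fun_prop) 0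
          exact h2.eventually_lt_const (by simpa using hA)
        have h2 : ∀ᶠ k in 𝓝[≠] (0 : ℝ), False := by
          filter_upwards [nhdsWithin_le_nhds h, nhdsWithin_le_nhds h1, self_mem_nhdsWithin]
            with k hk1 hk2 hk3
          have := hmaxh (-k)
          rw [sub_neg_eq_add] at this
          have hk4 : 0 < k ^ 2 := by
            have : k ≠ 0 := hk3
            positivity
          nlinarith
        exact h2.exists.elim fun _ => id
    -- The choice `k = y - x` freezes the space argument of `φ` at `x`. What depends on space is
    -- then the quartic penalty alone, which is admissible at a critical point.
    let ψ : ℝ × ℝ → ℝ := fun q => c * |q.2 - x| ^ 4 + (φ (q.1, x) + η / (T - q.1))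
    have hψ : ContDiffOn ℝ 2 ψ (Ioo a T ×ˢ univ) := by
      refine ContDiffOn.add ?_ (ContDiffOn.add ?_ hpenC)
      · have : (fun q : ℝ × ℝ => c * |q.2 - x| ^ 4) = fun q => c * (q.2 - x) ^ 4 := by
          ext q; rw [Even.pow_abs (by decide)]
        rw [this]
        exact (contDiff_const.mul ((contDiff_snd.sub contDiff_const).pow 4)).contDiffOn
      · exact hφ.comp (f := fun q : ℝ × ℝ => (q.1, x))
          (contDiff_fst.prodMk contDiff_const).contDiffOn fun q hq => ⟨hq.1, trivial⟩
    have hdtψ : dt ψ (t, x) = dt φ (t, x) + η / (T - t) ^ 2 := by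
      have h1 : (fun s => ψ (s, x)) = (fun s => φ (s, x)) + fun s => η / (T - s) := by
        ext s; simp [ψ]
      unfold dt
      simp only [h1]
      exact ((hdtφ x).add hpen).deriv
    have := (hV.of_slab hCC ha hψ (B := -B) (t := t) (x := x) ?_ ht ?_).2
      ⟨c, fun s => φ (s, x) + η / (T - s), fun s _ y => rfl⟩
    · linarith
    · rintro ⟨s, y⟩ ⟨hs, -⟩
      have h1 := (abs_le.1 (hB s hs x)).1
      have h2 : 0 < T - s := sub_pos.2 hs.2
      simp only [ψ]
      have : 0 ≤ c * |y - x| ^ 4 := by positivity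
      have : 0 ≤ η / (T - s) := by positivity
      linarith
    · intro s hs y
      have := hmax s hs y (y - x)
      simp only [ψ, Even.pow_abs (show Even 4 by decide)]
      simp only [sub_sub_cancel] at this
      simp only [sub_self]
      linarith
  · -- noncritical contact point
    -- The choice `k = h` leaves a translate of `φ`, with the same increments as `φ` at `x - h`. The
    -- penalty in time adds `η / (T - t)² > 0` to the time derivative, which makes the barrier
    -- inequality contradictory.
    let ψ : ℝ × ℝ → ℝ := fun q => φ (q.1, q.2 - h) + η / (T - q.1)
    have hψ : ContDiffOn ℝ 2 ψ (Ioo a T ×ˢ univ) := by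
      refine ContDiffOn.add ?_ hpenC
      exact hφ.comp (f := fun q : ℝ × ℝ => (q.1, q.2 - h))
        (contDiff_fst.prodMk (contDiff_snd.sub contDiff_const)).contDiffOn
        fun q hq => ⟨hq.1, trivial⟩
    have hdtψ : dt ψ (t, x) = dt φ (t, x - h) + η / (T - t) ^ 2 := by
      unfold dt
      exact HasDerivAt.deriv ((hdtφ (x - h)).add hpen)
    have hdxψ' : HasDerivAt (fun y => ψ (t, y)) (dx φ (t, x - h)) x := by
      have h3 : HasDerivAt (fun k : ℝ => k - h) 1 x := by
        simpa using (hasDerivAt_id x).sub_const h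
      simpa [Function.comp_def, ψ] using HasDerivAt.comp x (hdxφ (x - h)) h3
    have hdxψ : dx ψ (t, x) = dx φ (t, x - h) := hdxψ'.deriv
    have hmaxψ : ∀ s ∈ Ioo a T, ∀ y, V (s, y) - ψ (s, y) ≤ V (t, x) - ψ (t, x) := by
      intro s hs y
      have := hmax s hs y h
      simp only [ψ]
      linarith
    have key := (hV.of_slab hCC ha hψ (B := -B) (t := t) (x := x) ?_ ht hmaxψ).1 (by rwa [hdxψ])
    · have hcont : Continuous fun y => ψ (t, y) := continuous_iff_continuousAt.2 fun y => by
        have h5 : ContinuousAt ψ (t, y) :=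
          (hψ.continuousOn).continuousAt (hopen.mem_nhds ⟨ht, trivial⟩)
        exact ContinuousAt.comp (f := fun y : ℝ => (t, y)) h5 (by fun_prop)
      have hbd : ∀ y, |ψ (t, y)| ≤ B + η / (T - t) := fun y =>
        (abs_add_le _ _).trans (add_le_add (hB t ht _) (abs_of_pos (by positivity)).le)
      have hle : ∀ z, V (t, x + z) - V (t, x) ≤ ψ (t, x + z) - ψ (t, x) := fun z => by
        have := hmaxψ t ht (x + z)
        linarith
      obtain ⟨r₀, hr₀, hop⟩ := nonlocalOp_le hε hρ hdxψ' hx hcont hbd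
        (measurable_slice_of_upperSemicontinuousOn hV.1 ht0) (fun y => hVC (t, y) ht0) hle
      obtain ⟨r₁, hr₁, hb⟩ := (hbar t ht (x - h)).1 hx
      set r := min r₀ r₁ / 2 with hr
      have hr0 : 0 < r := by positivity
      have h1 := hop r ⟨hr0, by have := min_le_left r₀ r₁; have : 0 < min r₀ r₁ := (by positivity); linarith⟩
      have h2 := hb r ⟨hr0, by have := min_le_right r₀ r₁; have : 0 < min r₀ r₁ := (by positivity); linarith⟩
      have h3 : ∀ z, ψ (t, x + z) - ψ (t, x) = φ (t, x - h + z) - φ (t, x - h) := fun z => by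
        simp only [ψ]
        rw [show x + z - h = x - h + z by ring]; ring
      simp only [h3] at h1
      rw [hdtψ, hamiltonian, hdxψ] at key
      have h4 := mul_le_mul_of_nonneg_right h1 (abs_nonneg (dx φ (t, x - h)))
      linarith
    · rintro ⟨s, y⟩ ⟨hs, -⟩
      have h1 := (abs_le.1 (hB s hs (y - h))).1
      have h2 : 0 < T - s := sub_pos.2 hs.2
      simp only [ψ]
      have : 0 ≤ η / (T - s) := by positivity
      linarith

end Barrier

/-! ### The maximum principle with a barrier on a time slab -/

section Barrier

variable {ρ ε : ℝ}

/-- At the initial time a maximum over translates may use a shift `h`, which costs at most `L |h|`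
by the Lipschitz bound for the barrier. The quartic penalty has to absorb this up to a small `m`;
the two cases are separated at `|h| = m / (|L| + 1)`. -/
theorem exists_quartic_dominating {L m : ℝ} (hm : 0 < m) :
    ∃ c > 0, ∀ h : ℝ, L * |h| - c * h ^ 4 ≤ m := by
  set h₀ := m / (|L| + 1) with hh₀
  have hL : 0 < |L| + 1 := by positivity
  have h₀p : 0 < h₀ := by positivity
  refine ⟨(|L| + 1) / h₀ ^ 3, by positivity, fun h => ?_⟩
  have h1 : L * |h| ≤ (|L| + 1) * |h| := by
    gcongr
    linarith [le_abs_self L]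
  rcases le_or_gt |h| h₀ with hh | hh
  · have h2 : (|L| + 1) * |h| ≤ (|L| + 1) * h₀ := by gcongr
    have h3 : (|L| + 1) * h₀ = m := by rw [hh₀]; field_simp
    have h4 : 0 ≤ (|L| + 1) / h₀ ^ 3 * h ^ 4 := by positivity
    linarith
  · have h2 : h₀ ^ 3 ≤ |h| ^ 3 := by gcongr
    have h3 : (|L| + 1) * |h| ≤ (|L| + 1) / h₀ ^ 3 * h ^ 4 := by
      rw [← Even.pow_abs (show Even 4 by decide), div_mul_eq_mul_div, le_div_iff₀ (by positivity)]
      calc (|L| + 1) * |h| * h₀ ^ 3 ≤ (|L| + 1) * |h| * |h| ^ 3 := by gcongr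
        _ = (|L| + 1) * |h| ^ 4 := by ring
    linarith

/-- A bounded subsolution stays below a smooth barrier that dominates it initially and at infinity.
-/
theorem IsSubsolution.le_of_barrier (hε : 0 < ε) (hρ : 0 < ρ) {V : ℝ × ℝ → ℝ}
    (hV : IsSubsolution ρ ε V) (hVu : UpperSemicontinuousOn V (closure Q)) {C : ℝ}
    (hVC : ∀ t, 0 ≤ t → ∀ y, |V (t, y)| ≤ C) {a T : ℝ} (ha : 0 ≤ a) {φ : ℝ × ℝ → ℝ}
    (hφ : ContDiffOn ℝ 2 φ (Ioo a T ×ˢ univ)) (hφc : ContinuousOn φ (Ico a T ×ˢ univ)) {B : ℝ}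
    (hB : ∀ t ∈ Ico a T, ∀ y, |φ (t, y)| ≤ B) {L : ℝ}
    (hL : ∀ x y, φ (a, x) - φ (a, y) ≤ L * |x - y|) {R : ℝ}
    (hR : ∀ t ∈ Ico a T, ∀ y, R ≤ |y| → C ≤ φ (t, y))
    (hbar : ∀ t ∈ Ioo a T, ∀ y, IsBarrierAt ε φ t y)
    (hinit : ∀ y, V (a, y) ≤ φ (a, y)) : ∀ t ∈ Ico a T, ∀ y, V (t, y) ≤ φ (t, y) := by
  by_contra! hcon
  obtain ⟨t₁, ht₁, x₁, hx₁⟩ := hcon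
  have hat₁ : a < t₁ := by
    rcases ht₁.1.eq_or_lt with h | h
    · rw [← h] at hx₁; linarith [hinit x₁]
    · exact h
  set T₁ := (t₁ + T) / 2 with hT₁
  have ht₁T₁ : t₁ < T₁ := by linarith [ht₁.2]
  have hT₁T : T₁ < T := by linarith [ht₁.2]
  set m := (V (t₁, x₁) - φ (t₁, x₁)) / 2 with hm
  have hm0 : 0 < m := by linarith
  -- With this `η` the time penalty at `(t₁, x₁)` equals `m`, half of the excess `2 m`, so that the
  -- penalised maximum is still at least `m`.
  set η := m * (T₁ - t₁) with hη
  have hη0 : 0 < η := mul_pos hm0 (by linarith)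
  obtain ⟨c, hc, hcL⟩ := exists_quartic_dominating (L := L) (m := m / 2) (by positivity)
  have hsub : ∀ s, s ∈ Ico a T₁ → s ∈ Ico a T := fun s hs => ⟨hs.1, hs.2.trans hT₁T⟩
  have hVφ : ∀ s ∈ Ico a T, ∀ y z, V (s, y) - φ (s, z) ≤ C + B := fun s hs y z => by
    have h1 := (abs_le.1 (hVC s (ha.trans hs.1) y)).2
    have h2 := (abs_le.1 (hB s hs z)).1
    linarith
  have hCB : 2 * m ≤ C + B := by
    have := hVφ t₁ ht₁ x₁ x₁
    linarith
  -- After `T₂` the time penalty exceeds `C + B`, the largest possible difference, so the maximum is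
  -- not attained there.
  set T₂ := T₁ - η / (C + B + 1) with hT₂
  have hCB1 : 0 < C + B + 1 := by linarith
  have hT₂T₁ : T₂ < T₁ := by
    have : 0 < η / (C + B + 1) := by positivity
    linarith
  have ht₁T₂ : t₁ ≤ T₂ := by
    have : η / (C + B + 1) ≤ T₁ - t₁ := by
      rw [div_le_iff₀ hCB1, hη, mul_comm]
      gcongr
      · linarith
    linarith
  -- A shift beyond `H` is excluded since then `c k⁴ ≥ c H ≥ C + B`. Positions beyond `R'` are
  -- excluded since there the barrier is already at least `C`.
  set H := (C + B) / c + 1 with hH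
  have hH1 : 1 ≤ H := by
    have : 0 ≤ (C + B) / c := div_nonneg (by linarith) hc.le
    linarith
  set R' := |R| + H + |x₁| with hR'
  let G : ℝ × ℝ × ℝ → ℝ :=
    fun q => V (q.1, q.2.1) - φ (q.1, q.2.1 - q.2.2) - η / (T₁ - q.1) - c * q.2.2 ^ 4
  let K : Set (ℝ × ℝ × ℝ) := Icc a T₂ ×ˢ Icc (-R') R' ×ˢ Icc (-H) H
  have hKT : ∀ q ∈ K, q.1 ∈ Ico a T₁ := fun q hq => ⟨hq.1.1, hq.1.2.trans_lt hT₂T₁⟩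
  have hGu : UpperSemicontinuousOn G K := by
    have h1 : UpperSemicontinuousOn (fun q : ℝ × ℝ × ℝ => V (q.1, q.2.1)) K := by
      intro q hq d hd
      have h2 := hVu (q.1, q.2.1) (mem_closure_Q (ha.trans hq.1.1)) d hd
      have h3 : Tendsto (fun q : ℝ × ℝ × ℝ => (q.1, q.2.1)) (𝓝[K] q)
          (𝓝[closure Q] (q.1, q.2.1)) := by
        refine tendsto_nhdsWithin_of_tendsto_nhds_of_eventually_within _ ?_ ?_
        · exact tendsto_nhdsWithin_of_tendsto_nhds (Continuous.tendsto (by fun_prop) q)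
        · filter_upwards [self_mem_nhdsWithin] with p hp
          exact mem_closure_Q (ha.trans hp.1.1)
      exact h3.eventually h2
    have h2 : ContinuousOn (fun q : ℝ × ℝ × ℝ =>
        -φ (q.1, q.2.1 - q.2.2) + (-(η / (T₁ - q.1)) + -(c * q.2.2 ^ 4))) K := by
      refine ContinuousOn.add (ContinuousOn.neg ?_) (ContinuousOn.add (ContinuousOn.neg ?_) ?_)
      · exact hφc.comp (f := fun q : ℝ × ℝ × ℝ => (q.1, q.2.1 - q.2.2)) (by fun_prop)
          fun q hq => ⟨hsub _ (hKT q hq), trivial⟩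
      · exact continuousOn_const.div (by fun_prop) fun q hq => (sub_pos.2 (hKT q hq).2).ne'
      · fun_prop
    have h3 := h1.add h2.upperSemicontinuousOn
    have h4 : G = fun q => V (q.1, q.2.1) +
        (-φ (q.1, q.2.1 - q.2.2) + (-(η / (T₁ - q.1)) + -(c * q.2.2 ^ 4))) := by
      ext q; simp only [G]; ring
    rw [h4]; exact h3
  have hR'0 : |x₁| ≤ R' := by
    have := abs_nonneg R
    linarith
  have hmem : (t₁, x₁, (0 : ℝ)) ∈ K :=
    ⟨⟨hat₁.le, ht₁T₂⟩, abs_le.1 hR'0, ⟨by linarith, by linarith⟩⟩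
  obtain ⟨⟨t, x, h⟩, htxh, hmax⟩ := hGu.exists_isMaxOn ⟨_, hmem⟩
    (isCompact_Icc.prod (isCompact_Icc.prod isCompact_Icc))
  have hmG : m ≤ G (t, x, h) := by
    refine le_trans (le_of_eq ?_) (hmax hmem)
    have : η / (T₁ - t₁) = m := by rw [hη]; field_simp [(sub_pos.2 ht₁T₁).ne']
    simp only [G, sub_zero, this]
    rw [hm]; ring
  have hTt : 0 < T₁ - t := sub_pos.2 (hKT _ htxh).2
  -- At time `a` the initial ordering, the Lipschitz bound and the quartic penalty leave at most `m
  -- / 2`.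
  have hta : a < t := by
    rcases htxh.1.1.eq_or_lt with h' | h'
    · exfalso
      simp only at h'
      subst h'
      simp only [G] at hmG
      have h1 := hinit x
      have h2 := hL x (x - h)
      have h3 := hcL h
      have h4 : 0 < η / (T₁ - a) := by positivity
      rw [sub_sub_cancel] at h2
      linarith
    · exact h'
  have hball : ∀ s ∈ Ioo a T₁, ∀ y k, G (s, y, k) ≤ G (t, x, h) := by
    intro s hs y k
    by_cases hsk : (s, y, k) ∈ K
    · exact hmax hsk
    refine le_trans ?_ (hm0.le.trans hmG)
    simp only [G]
    have hsT : s ∈ Ico a T := hsub s ⟨hs.1.le, hs.2⟩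
    have hTs : 0 < T₁ - s := sub_pos.2 hs.2
    have hηs : 0 < η / (T₁ - s) := by positivity
    have h1 := hVφ s hsT y (y - k)
    have hck : 0 ≤ c * k ^ 4 := by positivity
    by_cases hs2 : s ≤ T₂
    · by_cases hk : |k| ≤ H
      · have hy : R' < |y| := by
          by_contra! hy
          exact hsk ⟨⟨hs.1.le, hs2⟩, abs_le.1 hy, abs_le.1 hk⟩
        have h2 : R ≤ |y - k| := by
          have := abs_sub_abs_le_abs_sub y k
          have := le_abs_self R
          have := abs_nonneg x₁
          linarith
        have h3 := hR s hsT _ h2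
        have h4 := (abs_le.1 (hVC s (ha.trans hsT.1) y)).2
        linarith
      · push Not at hk
        have h2 : H ≤ k ^ 4 := by
          rw [← Even.pow_abs (show Even 4 by decide)]
          calc H ≤ |k| ^ 1 := by rw [pow_one]; exact hk.le
            _ ≤ |k| ^ 4 := pow_le_pow_right₀ (hH1.trans hk.le) (by norm_num)
        have h3 : c * H ≤ c * k ^ 4 := by gcongr
        have h4 : c * H = C + B + c := by rw [hH]; field_simp
        linarith
    · push Not at hs2
      have h2 : C + B + 1 ≤ η / (T₁ - s) := by
        rw [le_div_iff₀ hTs]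
        have h3 : T₁ - s ≤ η / (C + B + 1) := by linarith
        rw [le_div_iff₀ hCB1] at h3
        linarith
      linarith
  refine false_of_barrier_contact (T := T₁) (φ := φ) (B := B) hε hρ hV ha
    (hφ.mono (prod_mono (Ioo_subset_Ioo_right hT₁T.le) subset_rfl))
    (fun s hs y => hB s (hsub s ⟨hs.1.le, hs.2⟩) y)
    (fun s hs y => hbar s ⟨hs.1, hs.2.trans hT₁T⟩ y) hη0 hc (t := t) (x := x) (h := h)
    ⟨hta, by linarith⟩ hball

end Barrier

/-! ### Structure of the particle system -/

section Evolution

variable {n : ℕ}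

/-- The velocity of particle `i`. -/
def velocity (b : Fin n → ℤ) (x : Fin n → ℝ) (i : Fin n) : ℝ :=
  (1 / (n : ℝ)) * ∑ j with j ≠ i, (b i : ℝ) * (b j : ℝ) / (x i - x j)

/-- The local description of a solution of the particle system. -/
structure ParticleEvolution (x : ℝ → Fin n → ℝ) (b : ℝ → Fin n → ℤ) : Prop where
  mem : ∀ t, 0 ≤ t → (x t, b t) ∈ stateSpace n
  cont : ∀ i, ContinuousOn (fun t => x t i) (Ici 0)
  right : ∀ τ, 0 ≤ τ → ∃ δ > 0, ∀ t ∈ Ico τ (τ + δ), b t = b τ ∧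
    (τ < t → ∀ i, HasDerivAt (fun s => x s i) (velocity (b τ) (x t) i) t)
  left : ∀ τ, 0 < τ → ∃ δ > 0, δ ≤ τ ∧ ∃ β : Fin n → ℤ,
    (∀ t ∈ Ioo (τ - δ) τ, b t = β ∧
      ∀ i, HasDerivAt (fun s => x s i) (velocity β (x t) i) t) ∧
    (∀ i, b τ i = β i ∨ b τ i = 0) ∧
    ∀ y, ∑ i with x τ i = y, b τ i = ∑ i with x τ i = y, β i

theorem velocity_neg (b : Fin n → ℤ) (x : Fin n → ℝ) : velocity (-b) x = velocity b x := by
  ext i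
  simp [velocity]

theorem neg_mem_stateSpace {x : Fin n → ℝ} {b : Fin n → ℤ} (h : (x, b) ∈ stateSpace n) :
    (x, -b) ∈ stateSpace n := by
  refine ⟨fun i => ?_, fun i j hij hb => h.2 i j hij ?_⟩
  · rcases h.1 i with h | h | h <;> simp_all
  · simpa using hb

theorem ParticleEvolution.neg {x : ℝ → Fin n → ℝ} {b : ℝ → Fin n → ℤ}
    (h : ParticleEvolution x b) : ParticleEvolution x (-b) where
  mem t ht := neg_mem_stateSpace (h.mem t ht)
  cont := h.cont
  right τ hτ := by
    obtain ⟨δ, hδ, h1⟩ := h.right τ hτ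
    refine ⟨δ, hδ, fun t ht => ⟨by simp [(h1 t ht).1], fun hlt i => ?_⟩⟩
    simpa [velocity_neg] using (h1 t ht).2 hlt i
  left τ hτ := by
    obtain ⟨δ, hδ, hδτ, β, h1, h2, h3⟩ := h.left τ hτ
    refine ⟨δ, hδ, hδτ, -β, fun t ht => ⟨by simp [(h1 t ht).1], fun i => ?_⟩, fun i => ?_,
      fun y => ?_⟩
    · simpa [velocity_neg] using (h1 t ht).2 i
    · rcases h2 i with h | h <;> simp [h]
    · simpa using h3 y

theorem exists_punctured_avoid {S : Set ℝ} (hS : S.Finite) (τ : ℝ) :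
    ∃ δ > 0, ∀ t, |t - τ| < δ → t ≠ τ → t ∉ S := by
  have h : (S \ {τ})ᶜ ∈ 𝓝 τ := (hS.subset sdiff_subset).isClosed.isOpen_compl.mem_nhds (by simp)
  obtain ⟨δ, hδ, h⟩ := Metric.mem_nhds_iff.1 h
  refine ⟨δ, hδ, fun t ht hne hS => ?_⟩
  exact h (by simpa [Real.dist_eq] using ht) ⟨hS, hne⟩

/-- The exceptional set is finite, so each time has punctured one-sided neighbourhoods without it.
There every charge is continuous with integer values, hence constant. The later arguments only use
this local description, not the set `S`. -/
theorem IsParticleSolution.evolution {x₀ : Fin n → ℝ} {b₀ : Fin n → ℤ} {x : ℝ → Fin n → ℝ}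
    {b : ℝ → Fin n → ℤ} (h : IsParticleSolution x₀ b₀ x b) : ParticleEvolution x b where
  mem t ht := (h (t + 1) (by linarith)).1 t ⟨ht, by linarith⟩
  cont i := by
    intro t ht
    have ht : 0 ≤ t := ht
    obtain ⟨-, S, -, -, hreg, -⟩ := h (t + 1) (by linarith)
    have := (hreg i).1 t ⟨ht, by linarith⟩
    refine this.mono_of_mem_nhdsWithin ?_
    rw [← Ici_inter_Iic]
    exact inter_mem_nhdsWithin _ (Iic_mem_nhds (by linarith))
  right τ hτ := by
    obtain ⟨-, S, hfin, hS, hreg, -, hann, -, hode⟩ := h (τ + 1) (by linarith)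
    obtain ⟨δ, hδ, hav⟩ := exists_punctured_avoid hfin τ
    have hδ1 := min_le_left δ 1
    have hδ2 := min_le_right δ 1
    have hconst : ∀ t ∈ Ico τ (τ + min δ 1), b t = b τ := fun t ht => by
      ext i
      -- At the left end only right-continuity is available, and it suffices because the interval is
      -- closed on that side.
      refine IsPreconnected.constant (isPreconnected_Ico (a := τ) (b := τ + min δ 1))
        (f := fun s => b s i) (fun s hs => ?_) ht ⟨le_rfl, by linarith [ht.1, ht.2]⟩
      rcases hs.1.eq_or_lt with hs' | hs'
      · subst hs'
        exact ((hreg i).2.2 τ ⟨hτ, by linarith⟩).mono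
          fun r hr => ⟨hr.1, by linarith [hr.2]⟩
      · have hc : ContinuousWithinAt (fun s => b s i) (Icc 0 (τ + 1)) s := by
          by_contra hc
          refine hav s ?_ hs'.ne' ((hann i).2 s ⟨⟨by linarith, by linarith [hs.2]⟩, hc⟩).1
          rw [abs_of_pos (by linarith)]; linarith [hs.2]
        exact hc.mono fun r hr => ⟨by linarith [hr.1], by linarith [hr.2]⟩
    refine ⟨min δ 1, by positivity, fun t ht => ⟨hconst t ht, fun hlt i => ?_⟩⟩
    rw [← hconst t ht]
    refine hode t ⟨⟨by linarith, by linarith [ht.2]⟩, ?_⟩ i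
    refine hav t ?_ hlt.ne'
    rw [abs_of_pos (by linarith)]; linarith [ht.2]
  left τ hτ := by
    obtain ⟨-, S, hfin, hS, hreg, -, hann, hjump, hode⟩ := h (τ + 1) (by linarith)
    obtain ⟨δ₀, hδ₀, hav⟩ := exists_punctured_avoid hfin τ
    set δ := min δ₀ τ with hδ
    have hδ1 : δ ≤ δ₀ := min_le_left _ _
    have hδ2 : δ ≤ τ := min_le_right _ _
    have hδ0 : 0 < δ := by positivity
    have hSt : ∀ t ∈ Ioo (τ - δ) τ, t ∉ S := fun t ht => hav t
      (by rw [abs_of_neg (by linarith [ht.2])]; linarith [ht.1]) ht.2.ne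
    have hconst : ∀ t ∈ Ioo (τ - δ) τ, b t = b (τ - δ / 2) := fun t ht => by
      ext i
      refine IsPreconnected.constant (isPreconnected_Ioo (a := τ - δ) (b := τ))
        (f := fun s => b s i) (fun s hs => ?_) ht ⟨by linarith, by linarith⟩
      have hc : ContinuousWithinAt (fun s => b s i) (Icc 0 (τ + 1)) s := by
        by_contra hc
        exact hSt s hs ((hann i).2 s ⟨⟨by linarith [hs.1], by linarith [hs.2]⟩, hc⟩).1
      exact hc.mono fun r hr => ⟨by linarith [hr.1], by linarith [hr.2]⟩
    have htend : ∀ i, Tendsto (fun s => b s i) (𝓝[<] τ) (𝓝 (b (τ - δ / 2) i)) := fun i => by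
      refine tendsto_const_nhds.congr' ?_
      filter_upwards [Ioo_mem_nhdsLT (show τ - δ < τ by linarith)] with t ht
      rw [hconst t ht]
    have hlim : ∀ i, Function.leftLim (fun s => b s i) τ = b (τ - δ / 2) i := fun i =>
      leftLim_eq_of_tendsto (htend i)
    have hnj : ∀ i, τ ∉ jumpTimes (τ + 1) (fun s => b s i) → b τ i = b (τ - δ / 2) i := by
      intro i hi
      have hc : ContinuousWithinAt (fun s => b s i) (Icc 0 (τ + 1)) τ := by
        by_contra hc
        exact hi ⟨⟨hτ.le, by linarith⟩, hc⟩
      have h1 : Tendsto (fun s => b s i) (𝓝[<] τ) (𝓝 (b τ i)) := by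
        refine hc.tendsto.mono_left (nhdsWithin_le_iff.2 ?_)
        filter_upwards [Ioo_mem_nhdsLT hτ] with t ht
        exact ⟨ht.1.le, by linarith [ht.2]⟩
      exact tendsto_nhds_unique h1 (htend i)
    refine ⟨δ, hδ0, hδ2, b (τ - δ / 2), fun t ht => ⟨hconst t ht, fun i => ?_⟩, fun i => ?_,
      fun y => ?_⟩
    · rw [← hconst t ht]
      exact hode t ⟨⟨by linarith [ht.1], by linarith [ht.2]⟩, hSt t ht⟩ i
    · by_cases hi : τ ∈ jumpTimes (τ + 1) (fun s => b s i)
      · exact Or.inr ((hann i).2 τ hi).2.2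
      · exact Or.inl (hnj i hi)
    · by_cases hτS : τ ∈ S
      · have := hjump τ hτS y
        simp only [hlim, Finset.sum_sub_distrib] at this
        linarith
      · refine Finset.sum_congr rfl fun i _ => hnj i fun hi => hτS ((hann i).2 τ hi).1

theorem IsParticleSolution.initial {x₀ : Fin n → ℝ} {b₀ : Fin n → ℤ} {x : ℝ → Fin n → ℝ}
    {b : ℝ → Fin n → ℤ} (h : IsParticleSolution x₀ b₀ x b) : x 0 = x₀ ∧ b 0 = b₀ := by
  obtain ⟨-, S, -, -, -, hi, -⟩ := h 1 one_pos
  exact hi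

end Evolution

/-! ### Particles of equal sign do not collide -/

section Gap

/-- In a chain of charges whose consecutive positive members are at distance at least `d`, the
weighted sum of the charges is controlled by the chain of positive charges of spacing `d`. -/
theorem sum_charge_weight_lt {ι : Type*} [DecidableEq ι] (f σ : ι → ℝ) {d : ℝ} (hd : 0 < d)
    (s : Finset ι) (hσ : ∀ i ∈ s, σ i = 1 ∨ σ i = -1)
    (hinj : ∀ i ∈ s, ∀ j ∈ s, f i = f j → i = j)
    (hadj : ∀ i ∈ s, ∀ j ∈ s, f i < f j → (∀ k ∈ s, ¬(f i < f k ∧ f k < f j)) →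
      σ i = 1 → σ j = 1 → f i + d ≤ f j) :
    (∀ a, 0 ≤ a → (∀ i ∈ s, a < f i) →
      (∀ j ∈ s, (∀ k ∈ s, f j ≤ f k) → σ j = 1 → a + d ≤ f j) →
      ∑ i ∈ s, σ i / (f i * (f i + d)) < 1 / (d * (a + d))) ∧
    (∀ a, 0 < a → (∀ i ∈ s, a < f i) → ∑ i ∈ s, σ i / (f i * (f i + d)) < 1 / (d * a)) := by
  induction s using Finset.induction_on_min_value f with
  | empty =>
    refine ⟨fun a ha _ _ => ?_, fun a ha _ => ?_⟩ <;> simp only [Finset.sum_empty] <;> positivity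
  | insert q s hq hmin ih =>
    have hlt : ∀ i ∈ s, f q < f i := fun i hi => lt_of_le_of_ne (hmin i hi) fun h =>
      hq (hinj q (Finset.mem_insert_self _ _) i (Finset.mem_insert_of_mem hi) h ▸ hi)
    obtain ⟨ihA, ihB⟩ := ih (fun i hi => hσ i (Finset.mem_insert_of_mem hi))
      (fun i hi j hj => hinj i (Finset.mem_insert_of_mem hi) j (Finset.mem_insert_of_mem hj))
      (fun i hi j hj hij hk => hadj i (Finset.mem_insert_of_mem hi) j (Finset.mem_insert_of_mem hj)
        hij fun k hk' => by
          rcases Finset.mem_insert.1 hk' with rfl | hk'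
          · exact fun h => absurd h.1 (not_lt.2 (hmin i hi))
          · exact hk k hk')
    rw [Finset.sum_insert hq]
    -- Induction from the nearest charge outwards. A positive charge at `q` pushes the next
    -- consecutive positive one to `f q + d` or beyond, so the first bound applies to the rest;
    -- after a negative charge only the second one does. In both cases a partial fraction identity
    -- telescopes exactly.
    have key : ∀ a, 0 ≤ a → a < f q →
        (σ q = 1 → σ q / (f q * (f q + d)) + ∑ i ∈ s, σ i / (f i * (f i + d)) < 1 / (d * f q)) ∧
        (σ q = -1 → σ q / (f q * (f q + d)) + ∑ i ∈ s, σ i / (f i * (f i + d)) <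
          1 / (d * (f q + d))) := by
      intro a ha haq
      have hq0 : 0 < f q := ha.trans_lt haq
      refine ⟨fun h1 => ?_, fun h1 => ?_⟩
      · have := ihA (f q) hq0.le hlt fun j hj hk hj1 =>
          hadj q (Finset.mem_insert_self _ _) j (Finset.mem_insert_of_mem hj) (hlt j hj)
            (fun k hk' h => by
              rcases Finset.mem_insert.1 hk' with rfl | hk'
              · exact lt_irrefl _ h.1
              · exact absurd h.2 (not_lt.2 (hk k hk'))) h1 hj1
        have e : 1 / (f q * (f q + d)) + 1 / (d * (f q + d)) = 1 / (d * f q) := by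
          field_simp; ring
        rw [h1]; linarith
      · have := ihB (f q) hq0 hlt
        have e : -1 / (f q * (f q + d)) + 1 / (d * f q) = 1 / (d * (f q + d)) := by
          field_simp; ring
        rw [h1]; linarith
    have hqmem := Finset.mem_insert_self q s
    refine ⟨fun a ha hlt' hfirst => ?_, fun a ha hlt' => ?_⟩
    · have haq := hlt' q hqmem
      obtain ⟨k1, k2⟩ := key a ha haq
      rcases hσ q hqmem with h | h
      · refine (k1 h).trans_le ?_
        have := hfirst q hqmem (fun k hk => by
          rcases Finset.mem_insert.1 hk with rfl | hk
          · exact le_rfl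
          · exact hmin k hk) h
        gcongr
      · refine (k2 h).trans_le ?_
        gcongr
    · have haq := hlt' q hqmem
      obtain ⟨k1, k2⟩ := key a ha.le haq
      rcases hσ q hqmem with h | h
      · exact (k1 h).trans_le (by gcongr)
      · refine (k2 h).trans_le ?_
        gcongr
        linarith

/-- A finite family of functions whose minimal member always increases stays above its initial
minimum. -/
theorem le_of_min_increasing {ι : Type*} (s : Finset ι) (g : ι → ℝ → ℝ) {α τ d : ℝ}
    (hg : ∀ i ∈ s, ContinuousOn (g i) (Ico α τ)) (hd : ∀ i ∈ s, d ≤ g i α)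
    (hder : ∀ t ∈ Ioo α τ, ∀ i ∈ s, g i t < d → (∀ j ∈ s, g i t ≤ g j t) →
      ∃ g' > 0, HasDerivAt (g i) g' t) :
    ∀ i ∈ s, ∀ t ∈ Ico α τ, d ≤ g i t := by
  by_contra! hcon
  obtain ⟨i₀, hi₀, t₁, ht₁, hlt⟩ := hcon
  have hsub : Icc α t₁ ⊆ Ico α τ := fun t ht => ⟨ht.1, ht.2.trans_lt ht₁.2⟩
  have hmin : ∀ i, ∃ t ∈ Icc α t₁, i ∈ s → ∀ t' ∈ Icc α t₁, g i t ≤ g i t' := fun i => by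
    by_cases hi : i ∈ s
    · obtain ⟨t, ht, h⟩ := isCompact_Icc.exists_isMinOn ⟨t₁, ht₁.1, le_rfl⟩ ((hg i hi).mono hsub)
      exact ⟨t, ht, fun _ t' ht' => h ht'⟩
    · exact ⟨t₁, ⟨ht₁.1, le_rfl⟩, fun h => absurd h hi⟩
  choose tm htm hmin using hmin
  obtain ⟨i, hi, himin⟩ := s.exists_min_image (fun i => g i (tm i)) ⟨i₀, hi₀⟩
  have hall : ∀ j ∈ s, ∀ t ∈ Icc α t₁, g i (tm i) ≤ g j t := fun j hj t ht =>
    (himin j hj).trans (hmin j hj t ht)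
  have hlow : g i (tm i) < d := (hall i₀ hi₀ t₁ ⟨ht₁.1, le_rfl⟩).trans_lt hlt
  have hα : α < tm i := by
    rcases (htm i).1.eq_or_lt with h | h
    · rw [← h] at hlow; linarith [hd i hi]
    · exact h
  obtain ⟨g', hg', hder⟩ := hder (tm i) ⟨hα, (htm i).2.trans_lt ht₁.2⟩ i hi hlow
    fun j hj => hall j hj _ (htm i)
  -- The overall minimum over all members and times is attained after `α`, where the minimal member
  -- increases; it was therefore smaller just before.
  have hslope : ∀ᶠ t in 𝓝[<] tm i, 0 < slope (g i) (tm i) t :=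
    ((hasDerivAt_iff_tendsto_slope.1 hder).mono_left (nhdsLT_le_nhdsNE _)).eventually
      (lt_mem_nhds hg')
  obtain ⟨t, ht1, ht2⟩ := (hslope.and (Ioo_mem_nhdsLT hα)).exists
  rw [slope_def_field, div_pos_iff] at ht1
  have h3 := hall i hi t ⟨ht2.1.le, ht2.2.le.trans (htm i).2⟩
  rcases ht1 with h | h
  · linarith [ht2.2]
  · linarith [h.1]

end Gap

/-! ### Smooth stretches of the evolution -/

section Flow

variable {n : ℕ}

/-- `x` follows the particle system with the fixed charges `β` on `[α, τ)`, and it is continuous up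
to `τ`, where collisions may occur. -/
structure IsFlow (x : ℝ → Fin n → ℝ) (β : Fin n → ℤ) (α τ : ℝ) : Prop where
  lt : α < τ
  mem : ∀ t ∈ Ico α τ, (x t, β) ∈ stateSpace n
  cont : ∀ i, ContinuousOn (fun t => x t i) (Icc α τ)
  ode : ∀ t ∈ Ioo α τ, ∀ i, HasDerivAt (fun s => x s i) (velocity β (x t) i) t

variable {x : ℝ → Fin n → ℝ} {β : Fin n → ℤ} {α τ : ℝ}

/-- The particles `i < j` carry equal charges and no charged particle lies between them. -/
def IsTwin (β : Fin n → ℤ) (i j : Fin n) : Prop :=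
  i < j ∧ β i ≠ 0 ∧ β j = β i ∧ ∀ k, i < k → k < j → β k = 0

theorem one_div_nat_pos (i : Fin n) : (0 : ℝ) < 1 / (n : ℝ) := by
  have : 0 < n := i.pos
  positivity

/-- Twins at minimal distance repel. -/
theorem velocity_lt_of_isTwin {y : Fin n → ℝ} (hy : (y, β) ∈ stateSpace n) {i j : Fin n}
    (hij : IsTwin β i j) (hmin : ∀ k l, IsTwin β k l → y j - y i ≤ y l - y k) :
    velocity β y i < velocity β y j := by
  obtain ⟨hlt, hi, hji, hbetween⟩ := hij
  have hord : ∀ k l, k < l → β k ≠ 0 → β l ≠ 0 → y k < y l := fun k l hkl hk hl =>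
    hy.2 l k hkl (mul_ne_zero hl hk)
  have hj : β j ≠ 0 := hji ▸ hi
  set d := y j - y i with hd
  have hd0 : 0 < d := sub_pos.2 (hord i j hlt hi hj)
  have hpm : ∀ k, β k ≠ 0 → β k = 1 ∨ β k = -1 := fun k hk => by
    rcases hy.1 k with h | h | h
    · exact Or.inr h
    · exact absurd h hk
    · exact Or.inl h
  have hii : (β i : ℝ) * β i = 1 := by rcases hpm i hi with h | h <;> simp [h]
  -- Signs are measured relative to the twins, which thus count as positive.
  let σ : Fin n → ℝ := fun k => (β i : ℝ) * β k
  have hσ : ∀ k, β k ≠ 0 → σ k = 1 ∨ σ k = -1 := fun k hk => by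
    rcases hpm i hi with h | h <;> rcases hpm k hk with h' | h' <;> simp [σ, h, h']
  have hσeq : ∀ k, β k ≠ 0 → σ k = 1 → β k = β i := fun k hk h1 => by
    rcases hpm i hi with h | h <;> rcases hpm k hk with h' | h' <;>
      simp [σ, h, h'] at h1 ⊢ <;> norm_num at h1
  let Rt : Finset (Fin n) := {k | j < k ∧ β k ≠ 0}
  let Lt : Finset (Fin n) := {k | k < i ∧ β k ≠ 0}
  have hRt : ∀ k, k ∈ Rt ↔ j < k ∧ β k ≠ 0 := fun k => by simp [Rt]
  have hLt : ∀ k, k ∈ Lt ↔ k < i ∧ β k ≠ 0 := fun k => by simp [Lt]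
  have hlt_iff : ∀ k l, β k ≠ 0 → β l ≠ 0 → (y k < y l ↔ k < l) := fun k l hk hl =>
    ⟨fun h => by
      by_contra! hlk
      rcases hlk.eq_or_lt with h' | h'
      · subst h'; exact lt_irrefl _ h
      · exact lt_asymm h (hord l k h' hl hk), fun h => hord k l h hk hl⟩
  -- Consecutive positive charges on the right are twins, hence at distance at least `d` by
  -- minimality. The first one, if positive, is a twin of `j`, which gives the additional hypothesis
  -- of the chain bound at `a = 0`.
  have hright : ∑ k ∈ Rt, σ k / ((y k - y j) * (y k - y j + d)) < 1 / (d * (0 + d)) := by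
    refine (sum_charge_weight_lt (fun k => y k - y j) σ hd0 Rt (fun k hk => hσ k ((hRt k).1 hk).2)
      ?_ ?_).1 0 le_rfl ?_ ?_
    · intro k hk l hl hkl
      have hk := (hRt k).1 hk
      have hl := (hRt l).1 hl
      by_contra hne
      rcases lt_or_gt_of_ne hne with h | h
      · have := hord k l h hk.2 hl.2; linarith
      · have := hord l k h hl.2 hk.2; linarith
    · intro k hk l hl hkl hbt h1 h2
      have hk := (hRt k).1 hk
      have hl := (hRt l).1 hl
      have hkl' : k < l := (hlt_iff k l hk.2 hl.2).1 (by linarith)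
      have := hmin k l ⟨hkl', hk.2, by rw [hσeq k hk.2 h1, hσeq l hl.2 h2], fun m hm1 hm2 => by
        by_contra hm
        refine hbt m ((hRt m).2 ⟨hk.1.trans hm1, hm⟩) ⟨?_, ?_⟩
        · have := hord k m hm1 hk.2 hm; linarith
        · have := hord m l hm2 hm hl.2; linarith⟩
      linarith
    · intro k hk
      have hk := (hRt k).1 hk
      have := hord j k hk.1 hj hk.2
      linarith
    · intro k hk hfirst h1
      have hk := (hRt k).1 hk
      have := hmin j k ⟨hk.1, hj, by rw [hσeq k hk.2 h1, hji], fun m hm1 hm2 => by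
        by_contra hm
        have h3 := hfirst m ((hRt m).2 ⟨hm1, hm⟩)
        have := hord m k hm2 hm hk.2
        linarith⟩
      linarith
  have hleft : ∑ k ∈ Lt, σ k / ((y i - y k) * (y i - y k + d)) < 1 / (d * (0 + d)) := by
    refine (sum_charge_weight_lt (fun k => y i - y k) σ hd0 Lt (fun k hk => hσ k ((hLt k).1 hk).2)
      ?_ ?_).1 0 le_rfl ?_ ?_
    · intro k hk l hl hkl
      have hk := (hLt k).1 hk
      have hl := (hLt l).1 hl
      by_contra hne
      rcases lt_or_gt_of_ne hne with h | h
      · have := hord k l h hk.2 hl.2; linarith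
      · have := hord l k h hl.2 hk.2; linarith
    · intro l hl k hk hkl hbt h2 h1
      have hk := (hLt k).1 hk
      have hl := (hLt l).1 hl
      have hkl' : k < l := (hlt_iff k l hk.2 hl.2).1 (by linarith)
      have := hmin k l ⟨hkl', hk.2, by rw [hσeq k hk.2 h1, hσeq l hl.2 h2], fun m hm1 hm2 => by
        by_contra hm
        refine hbt m ((hLt m).2 ⟨hm2.trans hl.1, hm⟩) ⟨?_, ?_⟩
        · have := hord m l hm2 hm hl.2; linarith
        · have := hord k m hm1 hk.2 hm; linarith⟩
      linarith
    · intro k hk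
      have hk := (hLt k).1 hk
      have := hord k i hk.1 hk.2 hi
      linarith
    · intro k hk hfirst h1
      have hk := (hLt k).1 hk
      have := hmin k i ⟨hk.1, hk.2, by rw [hσeq k hk.2 h1], fun m hm1 hm2 => by
        by_contra hm
        have h3 := hfirst m ((hLt m).2 ⟨hm2, hm⟩)
        have := hord k m hm1 hk.2 hm
        linarith⟩
      linarith
  have hvel : ∀ (a : Fin n), a = i ∨ a = j → ∑ k with k ≠ a, (β a : ℝ) * β k / (y a - y k) =
      (if a = i then -(1 / d) else 1 / d) + (∑ k ∈ Rt, σ k / (y a - y k) +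
        ∑ k ∈ Lt, σ k / (y a - y k)) := by
    intro a ha
    have hβa : (β a : ℝ) = β i := by rcases ha with rfl | rfl <;> simp [hji]
    have h1 : ∀ k, (β a : ℝ) * β k / (y a - y k) = σ k / (y a - y k) := fun k => by
      rw [hβa]
    simp only [h1]
    have hdisj : Disjoint Rt Lt := Finset.disjoint_left.2 fun k h h' =>
      absurd (((hRt k).1 h).1.trans ((hLt k).1 h').1) (not_lt.2 hlt.le)
    rw [← Finset.sum_union hdisj]
    rcases ha with rfl | rfl
    · have hnot : j ∉ Rt ∪ Lt := by
        simp only [Finset.mem_union, hRt, hLt, lt_irrefl, false_and, false_or, not_and]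
        intro h; exact absurd (h.trans hlt) (lt_irrefl _)
      rw [if_pos rfl]
      have h2 : σ j / (y a - y j) = -(1 / d) := by
        have : σ j = 1 := by simp only [σ, hji]; exact_mod_cast hii
        rw [this, hd, ← neg_sub, ← one_div_neg_eq_neg_one_div]
      rw [← h2]
      refine Eq.trans ?_ (Finset.sum_insert (f := fun k => σ k / (y a - y k)) hnot)
      symm
      refine Finset.sum_subset (fun k hk => ?_) fun k hk hk' => ?_
      · simp only [Finset.mem_insert, Finset.mem_union, hRt, hLt] at hk
        simp only [Finset.mem_filter, Finset.mem_univ, true_and]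
        rcases hk with rfl | hk | hk
        · exact hlt.ne'
        · exact (hlt.trans hk.1).ne'
        · exact hk.1.ne
      · simp only [Finset.mem_insert, Finset.mem_union, hRt, hLt, not_or] at hk'
        simp only [Finset.mem_filter, Finset.mem_univ, true_and] at hk
        have : β k = 0 := by
          by_contra hk0
          rcases lt_or_gt_of_ne hk with h | h
          · exact hk'.2.2 ⟨h, hk0⟩
          · rcases lt_or_gt_of_ne hk'.1 with h'' | h''
            · exact hk0 (hbetween k h h'')
            · exact hk'.2.1 ⟨h'', hk0⟩
        simp [σ, this]
    · have hnot : i ∉ Rt ∪ Lt := by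
        simp only [Finset.mem_union, hRt, hLt, lt_irrefl, false_and, or_false, not_and]
        intro h; exact absurd (h.trans hlt) (lt_irrefl _)
      rw [if_neg hlt.ne']
      have h2 : σ i / (y a - y i) = 1 / d := by
        have : σ i = 1 := hii
        rw [this]
      rw [← h2]
      refine Eq.trans ?_ (Finset.sum_insert (f := fun k => σ k / (y a - y k)) hnot)
      symm
      refine Finset.sum_subset (fun k hk => ?_) fun k hk hk' => ?_
      · simp only [Finset.mem_insert, Finset.mem_union, hRt, hLt] at hk
        simp only [Finset.mem_filter, Finset.mem_univ, true_and]
        rcases hk with rfl | hk | hk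
        · exact hlt.ne
        · exact hk.1.ne'
        · exact (hk.1.trans hlt).ne
      · simp only [Finset.mem_insert, Finset.mem_union, hRt, hLt, not_or] at hk'
        simp only [Finset.mem_filter, Finset.mem_univ, true_and] at hk
        have : β k = 0 := by
          by_contra hk0
          rcases lt_or_gt_of_ne hk with h | h
          · rcases lt_or_gt_of_ne hk'.1 with h'' | h''
            · exact hk'.2.2 ⟨h'', hk0⟩
            · exact hk0 (hbetween k h'' h)
          · exact hk'.2.1 ⟨h, hk0⟩
        simp [σ, this]
  unfold velocity
  refine mul_lt_mul_of_pos_left ?_ (one_div_nat_pos i)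
  rw [hvel i (Or.inl rfl), hvel j (Or.inr rfl), if_pos rfl, if_neg hlt.ne', ← sub_pos]
  -- With `f = y k - y j`, the difference of the forces of `k` on `j` and on `i` is `-d / (f (f +
  -- d))` times the sign. Each side therefore removes less than `d · 1/d² = 1/d` from the mutual
  -- repulsion `2/d`.
  have hR : ∑ k ∈ Rt, σ k / (y j - y k) - ∑ k ∈ Rt, σ k / (y i - y k) =
      -(d * ∑ k ∈ Rt, σ k / ((y k - y j) * (y k - y j + d))) := by
    rw [Finset.mul_sum, ← Finset.sum_neg_distrib, ← Finset.sum_sub_distrib]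
    refine Finset.sum_congr rfl fun k hk => ?_
    have hk := (hRt k).1 hk
    have h1 := hord j k hk.1 hj hk.2
    have h2 : y k - y j ≠ 0 := by linarith
    have h3 : y k - y j + d ≠ 0 := by linarith
    have h4 : y j - y k ≠ 0 := by linarith
    have h5 : y i - y k ≠ 0 := by linarith
    field_simp
    rw [hd]; ring
  have hL : ∑ k ∈ Lt, σ k / (y j - y k) - ∑ k ∈ Lt, σ k / (y i - y k) =
      -(d * ∑ k ∈ Lt, σ k / ((y i - y k) * (y i - y k + d))) := by
    rw [Finset.mul_sum, ← Finset.sum_neg_distrib, ← Finset.sum_sub_distrib]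
    refine Finset.sum_congr rfl fun k hk => ?_
    have hk := (hLt k).1 hk
    have h1 := hord k i hk.1 hk.2 hi
    have h2 : y i - y k ≠ 0 := by linarith
    have h3 : y i - y k + d ≠ 0 := by linarith
    have h4 : y j - y k ≠ 0 := by linarith
    field_simp
    rw [hd]; ring
  have e : d * (1 / (d * (0 + d))) = 1 / d := by field_simp; simp
  have h1 := mul_lt_mul_of_pos_left hright hd0
  have h2 := mul_lt_mul_of_pos_left hleft hd0
  rw [e] at h1 h2
  linarith

/-- Along a flow the twins keep a positive distance, up to the final time. -/
theorem IsFlow.exists_twin_gap (h : IsFlow x β α τ) :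
    ∃ d > 0, ∀ i j, IsTwin β i j → ∀ t ∈ Icc α τ, d ≤ x t j - x t i := by
  classical
  let s : Finset (Fin n × Fin n) := Finset.univ.filter fun q => IsTwin β q.1 q.2
  have hs : ∀ i j, (i, j) ∈ s ↔ IsTwin β i j := fun i j => by simp [s]
  have hαm : α ∈ Ico α τ := ⟨le_rfl, h.lt⟩
  obtain ⟨d, hd, hdα⟩ : ∃ d > 0, ∀ q ∈ s, d ≤ x α q.2 - x α q.1 := by
    rcases s.eq_empty_or_nonempty with he | hne
    · exact ⟨1, one_pos, by simp [he]⟩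
    · obtain ⟨q, hq, hmin⟩ := s.exists_min_image (fun q => x α q.2 - x α q.1) hne
      refine ⟨_, ?_, hmin⟩
      have hq := (hs q.1 q.2).1 hq
      have := (h.mem α hαm).2 q.2 q.1 hq.1 (by
        simp only [hq.2.2.1]; exact mul_ne_zero hq.2.1 hq.2.1)
      exact sub_pos.2 this
  have hIco : ∀ q ∈ s, ∀ t ∈ Ico α τ, d ≤ x t q.2 - x t q.1 := by
    refine le_of_min_increasing s (fun q t => x t q.2 - x t q.1) (fun q _ => ?_) hdα ?_
    · exact ((h.cont q.2).sub (h.cont q.1)).mono Ico_subset_Icc_self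
    · intro t ht q hq _ hmin
      refine ⟨velocity β (x t) q.2 - velocity β (x t) q.1, sub_pos.2 ?_,
        (h.ode t ht q.2).sub (h.ode t ht q.1)⟩
      exact velocity_lt_of_isTwin (h.mem t ⟨ht.1.le, ht.2⟩) ((hs _ _).1 hq)
        fun k l hkl => hmin (k, l) ((hs _ _).2 hkl)
  refine ⟨d, hd, fun i j hij t ht => ?_⟩
  have hcl : closure (Ico α τ) = Icc α τ := closure_Ico h.lt.ne
  have := le_on_closure (f := fun _ => d) (g := fun t => x t j - x t i) (s := Ico α τ)
    (fun t ht => hIco (i, j) ((hs i j).2 hij) t ht) continuousOn_const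
    (by rw [hcl]; exact (h.cont j).sub (h.cont i))
  exact this (by rw [hcl]; exact ht)

end Flow

/-! ### Groups of colliding particles: alternating charges and moments -/

section Cluster

variable {n : ℕ}

/-- If the signs alternate along `C`, then the sums over all initial segments lie in `{0, s}` for
one sign `s`. -/
theorem exists_initial_sums {C : Finset (Fin n)} {β : Fin n → ℤ}
    (h1 : ∀ i ∈ C, β i = 1 ∨ β i = -1)
    (halt : ∀ i ∈ C, ∀ j ∈ C, i < j → (∀ k ∈ C, ¬(i < k ∧ k < j)) → β j = -β i) :
    ∃ s : ℤ, (s = 1 ∨ s = -1) ∧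
      ∀ D ⊆ C, (∀ i ∈ D, ∀ j ∈ C, j < i → j ∈ D) → ∑ i ∈ D, β i = 0 ∨ ∑ i ∈ D, β i = s := by
  -- For the induction the last charge has to be known as well: it is `s` if the total is `s` and
  -- `-s` if the total is 0, which is the formula `2 * total - s`. The next charge, being opposite,
  -- keeps the total in `{0, s}`.
  suffices H : C = ∅ ∨ ∃ s : ℤ, (s = 1 ∨ s = -1) ∧
      (∀ D ⊆ C, (∀ i ∈ D, ∀ j ∈ C, j < i → j ∈ D) → ∑ i ∈ D, β i = 0 ∨ ∑ i ∈ D, β i = s) ∧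
      ∀ a ∈ C, (∀ k ∈ C, k ≤ a) → β a = 2 * ∑ i ∈ C, β i - s by
    rcases H with rfl | ⟨s, hs, h, -⟩
    · refine ⟨1, Or.inl rfl, fun D hD _ => Or.inl ?_⟩
      rw [Finset.subset_empty.1 hD, Finset.sum_empty]
    · exact ⟨s, hs, h⟩
  induction C using Finset.induction_on_max with
  | empty => exact Or.inl rfl
  | insert a C hmax ih =>
    right
    have ha : a ∉ C := fun h => lt_irrefl _ (hmax a h)
    have hins : ∀ D ⊆ insert a C, (∀ i ∈ D, ∀ j ∈ insert a C, j < i → j ∈ D) →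
        D = insert a C ∨ (D ⊆ C ∧ ∀ i ∈ D, ∀ j ∈ C, j < i → j ∈ D) := by
      intro D hD hlow
      by_cases haD : a ∈ D
      · left
        refine Finset.Subset.antisymm hD fun k hk => ?_
        rcases Finset.mem_insert.1 hk with rfl | hk'
        · exact haD
        · exact hlow a haD k hk (hmax k hk')
      · right
        refine ⟨fun k hk => ?_, fun i hi j hj => hlow i hi j (Finset.mem_insert_of_mem hj)⟩
        rcases Finset.mem_insert.1 (hD hk) with rfl | hk'
        · exact absurd hk haD
        · exact hk'
    have hlast : ∀ b ∈ insert a C, (∀ k ∈ insert a C, k ≤ b) → b = a := fun b hb hbm =>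
      le_antisymm (by
        rcases Finset.mem_insert.1 hb with rfl | hb
        · exact le_rfl
        · exact (hmax b hb).le) (hbm a (Finset.mem_insert_self _ _))
    rcases ih (fun i hi => h1 i (Finset.mem_insert_of_mem hi)) (fun i hi j hj hij hk =>
      halt i (Finset.mem_insert_of_mem hi) j (Finset.mem_insert_of_mem hj) hij fun k hk' => by
        rcases Finset.mem_insert.1 hk' with rfl | hk'
        · exact fun h => absurd h.2 (not_lt.2 (hmax j hj).le)
        · exact hk k hk') with rfl | ⟨s, hs, hD, hl⟩
    · refine ⟨β a, h1 a (Finset.mem_insert_self _ _), fun D hD hlow => ?_, fun b hb hbm => ?_⟩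
      · rcases hins D hD hlow with rfl | ⟨h, -⟩
        · right; simp
        · left; rw [Finset.subset_empty.1 h, Finset.sum_empty]
      · rw [hlast b hb hbm]; simp; ring
    · rcases C.eq_empty_or_nonempty with rfl | hne
      · refine ⟨β a, h1 a (Finset.mem_insert_self _ _), fun D hD hlow => ?_, fun b hb hbm => ?_⟩
        · rcases hins D hD hlow with rfl | ⟨h, -⟩
          · right; simp
          · left; rw [Finset.subset_empty.1 h, Finset.sum_empty]
        · rw [hlast b hb hbm]; simp; ring
      have hm := C.max'_mem hne
      have hβa : β a = -β (C.max' hne) := by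
        refine halt _ (Finset.mem_insert_of_mem hm) a (Finset.mem_insert_self _ _) (hmax _ hm)
          fun k hk h => ?_
        rcases Finset.mem_insert.1 hk with rfl | hk
        · exact lt_irrefl _ h.2
        · exact absurd h.1 (not_lt.2 (C.le_max' k hk))
      have hlm := hl _ hm fun k hk => C.le_max' k hk
      have htot := hD C subset_rfl fun i _ j hj _ => hj
      refine ⟨s, hs, fun D hD' hlow => ?_, fun b hb hbm => ?_⟩
      · rcases hins D hD' hlow with rfl | ⟨h, h'⟩
        · rw [Finset.sum_insert ha]; omega
        · exact hD D h h'
      · rw [hlast b hb hbm, Finset.sum_insert ha]; omega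

/-- The charged particles that sit at `y`. -/
def cluster (β : Fin n → ℤ) (ξ : Fin n → ℝ) (y : ℝ) : Finset (Fin n) :=
  {i | β i ≠ 0 ∧ ξ i = y}

variable {x : ℝ → Fin n → ℝ} {β : Fin n → ℤ} {α τ : ℝ}

theorem mem_cluster {ξ : Fin n → ℝ} {y : ℝ} {i : Fin n} :
    i ∈ cluster β ξ y ↔ β i ≠ 0 ∧ ξ i = y := by simp [cluster]

theorem charge_eq_of_ne_zero {ξ : Fin n → ℝ} (h : (ξ, β) ∈ stateSpace n) {i : Fin n}
    (hi : β i ≠ 0) : β i = 1 ∨ β i = -1 := by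
  rcases h.1 i with h | h | h
  · exact Or.inr h
  · exact absurd h hi
  · exact Or.inl h

theorem IsFlow.charge_eq (h : IsFlow x β α τ) {i : Fin n} (hi : β i ≠ 0) :
    β i = 1 ∨ β i = -1 :=
  charge_eq_of_ne_zero (h.mem α ⟨le_rfl, h.lt⟩) hi

/-- The strict order on `[α, τ)` survives at `τ` as a weak one; only there can equality occur. -/
theorem IsFlow.le_of_lt (h : IsFlow x β α τ) {i j : Fin n} (hij : i < j) (hi : β i ≠ 0)
    (hj : β j ≠ 0) {t : ℝ} (ht : t ∈ Icc α τ) : x t i ≤ x t j := by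
  have hcl : closure (Ico α τ) = Icc α τ := closure_Ico h.lt.ne
  exact le_on_closure (f := fun t => x t i) (g := fun t => x t j) (s := Ico α τ)
    (fun t ht => ((h.mem t ht).2 j i hij (mul_ne_zero hj hi)).le)
    (by rw [hcl]; exact h.cont i) (by rw [hcl]; exact h.cont j) (by rw [hcl]; exact ht)

/-- Colliding particles carry alternating charges. -/
theorem IsFlow.exists_cluster_sums (h : IsFlow x β α τ) (y : ℝ) :
    ∃ s : ℤ, (s = 1 ∨ s = -1) ∧ ∀ D ⊆ cluster β (x τ) y,
      (∀ i ∈ D, ∀ j ∈ cluster β (x τ) y, j < i → j ∈ D) →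
        ∑ i ∈ D, β i = 0 ∨ ∑ i ∈ D, β i = s := by
  obtain ⟨d, hd, hgap⟩ := h.exists_twin_gap
  have hτ : τ ∈ Icc α τ := ⟨h.lt.le, le_rfl⟩
  refine exists_initial_sums (fun i hi => h.charge_eq (mem_cluster.1 hi).1) ?_
  intro i hi j hj hij hbt
  have hi := mem_cluster.1 hi
  have hj := mem_cluster.1 hj
  by_contra hne
  have heq : β j = β i := by
    rcases h.charge_eq hi.1 with h1 | h1 <;> rcases h.charge_eq hj.1 with h2 | h2 <;> omega
  have := hgap i j ⟨hij, hi.1, heq, fun k hik hkj => by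
    by_contra hk
    refine hbt k (mem_cluster.2 ⟨hk, ?_⟩) ⟨hik, hkj⟩
    have h1 := h.le_of_lt hik hi.1 hk hτ
    have h2 := h.le_of_lt hkj hk hj.1 hτ
    linarith [hi.2, hj.2]⟩ τ hτ
  linarith [hi.2, hj.2]

/-- Exchanging the two indices replaces the weight `a i` by half the difference `a i - a j`. For the
forces 1/(ξ_i - ξ_j) that difference compensates the singularity; all moment estimates rest on this.
-/
theorem sum_mul_antisymm {ι : Type*} [DecidableEq ι] (C : Finset ι) (a : ι → ℝ) (F : ι → ι → ℝ)
    (hF : ∀ i j, F i j = -F j i) :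
    ∑ i ∈ C, a i * ∑ j ∈ C with j ≠ i, F i j =
      1 / 2 * ∑ i ∈ C, ∑ j ∈ C with j ≠ i, (a i - a j) * F i j := by
  have h1 : ∑ i ∈ C, ∑ j ∈ C with j ≠ i, a j * F i j =
      -∑ i ∈ C, ∑ j ∈ C with j ≠ i, a i * F i j := by
    simp only [Finset.sum_filter]
    rw [Finset.sum_comm, ← Finset.sum_neg_distrib]
    refine Finset.sum_congr rfl fun i _ => ?_
    rw [← Finset.sum_neg_distrib]
    refine Finset.sum_congr rfl fun j _ => ?_
    rw [hF j i]
    simp only [ne_comm (a := i)]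
    split_ifs <;> simp
  simp only [sub_mul, Finset.sum_sub_distrib, h1, Finset.mul_sum]
  simp only [← Finset.mul_sum]
  ring

/-- The force on the particle `i ∈ C` by the particles outside `C`. -/
def externalForce (β : Fin n → ℤ) (C : Finset (Fin n)) (ξ : Fin n → ℝ) (i : Fin n) : ℝ :=
  (1 / (n : ℝ)) * ∑ j with j ∉ C, (β i : ℝ) * (β j : ℝ) / (ξ i - ξ j)

theorem velocity_eq_internal_add {C : Finset (Fin n)} {i : Fin n} (hi : i ∈ C) (ξ : Fin n → ℝ) :
    velocity β ξ i = (1 / (n : ℝ)) * ∑ j ∈ C with j ≠ i, (β i : ℝ) * (β j : ℝ) / (ξ i - ξ j) +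
      externalForce β C ξ i := by
  unfold velocity externalForce
  rw [← mul_add, ← Finset.sum_union]
  · congr 1
    refine Finset.sum_congr ?_ fun _ _ => rfl
    ext j
    simp only [Finset.mem_filter, Finset.mem_univ, true_and, Finset.mem_union]
    by_cases hj : j ∈ C
    · simp [hj]
    · simp only [hj, false_and, not_false_eq_true, or_true, iff_true]
      rintro rfl; exact hj hi
  · rw [Finset.disjoint_left]
    intro j hj hj'
    simp only [Finset.mem_filter] at hj hj'
    exact hj'.2 hj.1

/-- Internal forces are antisymmetric and drop out of the sum, which is the symmetrisation with
constant weights. -/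
theorem sum_velocity_cluster {C : Finset (Fin n)} (ξ : Fin n → ℝ) :
    ∑ i ∈ C, velocity β ξ i = ∑ i ∈ C, externalForce β C ξ i := by
  rw [Finset.sum_congr rfl fun i hi => velocity_eq_internal_add (β := β) hi ξ,
    Finset.sum_add_distrib, ← Finset.mul_sum]
  have := sum_mul_antisymm C (fun _ => 1) (fun i j => (β i : ℝ) * (β j : ℝ) / (ξ i - ξ j))
    fun i j => by rw [← div_neg]; congr 1 <;> ring
  simp only [one_mul, sub_self, zero_mul, Finset.sum_const_zero, mul_zero] at this
  rw [this]; simp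

/-- A virial identity: with the weights `ξ i - y` the internal part becomes the sum of `β i * β j`
over ordered pairs of distinct members, that is, the square of the total charge minus the number of
members. -/
theorem sum_mul_velocity_cluster {C : Finset (Fin n)} {ξ : Fin n → ℝ}
    (hC : ∀ i ∈ C, β i = 1 ∨ β i = -1) (hinj : ∀ i ∈ C, ∀ j ∈ C, j ≠ i → ξ i ≠ ξ j) (y : ℝ) :
    2 * ∑ i ∈ C, (ξ i - y) * velocity β ξ i =
      (1 / (n : ℝ)) * ((∑ i ∈ C, (β i : ℝ)) ^ 2 - C.card) +
        2 * ∑ i ∈ C, (ξ i - y) * externalForce β C ξ i := by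
  rw [Finset.sum_congr rfl fun i hi => by rw [velocity_eq_internal_add (β := β) hi ξ, mul_add],
    Finset.sum_add_distrib, mul_add]
  congr 1
  have := sum_mul_antisymm C (fun i => ξ i - y) (fun i j => (β i : ℝ) * (β j : ℝ) / (ξ i - ξ j))
    fun i j => by rw [← div_neg]; congr 1 <;> ring
  have h1 : ∑ i ∈ C, ∑ j ∈ C with j ≠ i, (ξ i - y - (ξ j - y)) *
      ((β i : ℝ) * (β j : ℝ) / (ξ i - ξ j)) = (∑ i ∈ C, (β i : ℝ)) ^ 2 - C.card := by
    have h2 : ∀ i ∈ C, ∑ j ∈ C with j ≠ i, (ξ i - y - (ξ j - y)) *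
        ((β i : ℝ) * (β j : ℝ) / (ξ i - ξ j)) = (β i : ℝ) * (∑ j ∈ C, (β j : ℝ)) - 1 := by
      intro i hi
      have h3 : ∀ j ∈ C.filter (· ≠ i), (ξ i - y - (ξ j - y)) *
          ((β i : ℝ) * (β j : ℝ) / (ξ i - ξ j)) = (β i : ℝ) * β j := fun j hj => by
        have hj := Finset.mem_filter.1 hj
        have := sub_ne_zero.2 (hinj i hi j hj.1 hj.2)
        field_simp; ring
      rw [Finset.sum_congr rfl h3, Finset.filter_ne', ← Finset.mul_sum,
        ← Finset.add_sum_erase C _ hi]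
      have : (β i : ℝ) * β i = 1 := by rcases hC i hi with h | h <;> simp [h]
      linear_combination -this
    rw [Finset.sum_congr rfl h2, Finset.sum_sub_distrib, ← Finset.sum_mul]
    simp; ring
  rw [h1] at this
  have h4 : ∑ i ∈ C, (ξ i - y) * (1 / (n : ℝ) * ∑ j ∈ C with j ≠ i,
      (β i : ℝ) * (β j : ℝ) / (ξ i - ξ j)) = 1 / (n : ℝ) * ∑ i ∈ C, (ξ i - y) *
        ∑ j ∈ C with j ≠ i, (β i : ℝ) * (β j : ℝ) / (ξ i - ξ j) := by
    rw [Finset.mul_sum]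
    refine Finset.sum_congr rfl fun i _ => by ring
  rw [h4, this]; ring

theorem IsFlow.injOn (h : IsFlow x β α τ) {t : ℝ} (ht : t ∈ Ico α τ) {i j : Fin n} (hi : β i ≠ 0)
    (hj : β j ≠ 0) (hne : j ≠ i) : x t i ≠ x t j := by
  rcases lt_or_gt_of_ne hne with h' | h'
  · exact ((h.mem t ht).2 i j h' (mul_ne_zero hi hj)).ne'
  · exact ((h.mem t ht).2 j i h' (mul_ne_zero hj hi)).ne

theorem IsFlow.tendsto (h : IsFlow x β α τ) (i : Fin n) :
    Tendsto (fun t => x t i) (𝓝[<] τ) (𝓝 (x τ i)) := by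
  refine ((h.cont i) τ ⟨h.lt.le, le_rfl⟩).tendsto.mono_left (nhdsWithin_le_iff.2 ?_)
  filter_upwards [Ioo_mem_nhdsLT h.lt] with t ht
  exact ⟨ht.1.le, ht.2.le⟩

/-- The forces from outside the cluster are bounded up to the collision. -/
theorem IsFlow.exists_externalForce_bound (h : IsFlow x β α τ) (y : ℝ) :
    ∃ A > 0, ∀ᶠ t in 𝓝[<] τ, ∀ i ∈ cluster β (x τ) y,
      |externalForce β (cluster β (x τ) y) (x t) i| ≤ A := by
  set C := cluster β (x τ) y with hC
  have h1 : ∀ i ∈ C, Tendsto (fun t => externalForce β C (x t) i) (𝓝[<] τ)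
      (𝓝 (externalForce β C (x τ) i)) := by
    intro i hi
    unfold externalForce
    refine (tendsto_finsetSum _ fun j hj => ?_).const_mul _
    by_cases hj0 : β j = 0
    · simp [hj0]
    · refine tendsto_const_nhds.div ((h.tendsto i).sub (h.tendsto j)) (sub_ne_zero.2 fun he => ?_)
      refine (Finset.mem_filter.1 hj).2 (mem_cluster.2 ⟨hj0, ?_⟩)
      rw [← he]; exact (mem_cluster.1 hi).2
  refine ⟨∑ i ∈ C, |externalForce β C (x τ) i| + 1,
    add_pos_of_nonneg_of_pos (Finset.sum_nonneg fun _ _ => abs_nonneg _) one_pos, ?_⟩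
  refine (Filter.eventually_all_finset C).2 fun i hi => ?_
  have h2 := Finset.single_le_sum (f := fun i => |externalForce β C (x τ) i|)
    (fun _ _ => abs_nonneg _) hi
  have h3 := (h1 i hi).abs
  exact (h3.eventually_lt_const (by linarith)).mono fun t ht => ht.le

/-- A function on `[t, τ]` whose derivative is bounded. -/
theorem abs_sub_le_of_hasDerivAt {f f' : ℝ → ℝ} {t τ K : ℝ} (htτ : t ≤ τ)
    (hf : ContinuousOn f (Icc t τ)) (hf' : ∀ s ∈ Ico t τ, HasDerivAt f (f' s) s)
    (hK : ∀ s ∈ Ico t τ, |f' s| ≤ K) : |f τ - f t| ≤ K * (τ - t) :=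
  norm_image_sub_le_of_norm_deriv_right_le_segment hf
    (fun s hs => (hf' s hs).hasDerivWithinAt) hK τ ⟨htτ, le_rfl⟩

/-- Asymptotics of the first two moments of a cluster before the collision. -/
theorem IsFlow.exists_moment_bounds (h : IsFlow x β α τ) (y : ℝ) :
    ∃ A > 0, ∀ᶠ t in 𝓝[<] τ,
      |∑ i ∈ cluster β (x τ) y, (x t i - y)| ≤ A * (τ - t) ∧
      ∑ i ∈ cluster β (x τ) y, (x t i - y) ^ 2 ≤ A * (τ - t) ∧
      (2 ≤ (cluster β (x τ) y).card →
        τ - t ≤ A * ∑ i ∈ cluster β (x τ) y, (x t i - y) ^ 2) := by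
  set C := cluster β (x τ) y with hC
  rcases C.eq_empty_or_nonempty with he | ⟨i₀, hi₀⟩
  · refine ⟨1, one_pos, ?_⟩
    filter_upwards [Ioo_mem_nhdsLT h.lt] with t ht
    simp [he, ht.2.le]
  have hn : (0 : ℝ) < 1 / n := one_div_nat_pos i₀
  obtain ⟨A, hA, hev⟩ := h.exists_externalForce_bound y
  rw [← hC] at hev
  set m : ℝ := (C.card : ℝ) with hm
  have hm1 : 1 ≤ m := by
    rw [hm]; exact_mod_cast Finset.card_pos.2 ⟨i₀, hi₀⟩
  have hCτ : ∀ i ∈ C, x τ i = y := fun i hi => (mem_cluster.1 hi).2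
  have hC1 : ∀ i ∈ C, β i = 1 ∨ β i = -1 := fun i hi => h.charge_eq (mem_cluster.1 hi).1
  have hC0 : ∀ i ∈ C, β i ≠ 0 := fun i hi => (mem_cluster.1 hi).1
  obtain ⟨s, hs, hsum⟩ := h.exists_cluster_sums y
  have hB : (∑ i ∈ C, (β i : ℝ)) ^ 2 ≤ 1 := by
    have := hsum C subset_rfl fun i _ j hj _ => hj
    have h2 : (∑ i ∈ C, (β i : ℝ)) = ((∑ i ∈ C, β i : ℤ) : ℝ) := by push_cast; rfl
    rw [h2]
    rcases this with h | h <;> rw [h]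
    · norm_num
    · rcases hs with h | h <;> rw [h] <;> norm_num
  have hB0 : 0 ≤ (∑ i ∈ C, (β i : ℝ)) ^ 2 := sq_nonneg _
  -- Once the members are within `η` of `y`, the external forces change the second moment at a rate
  -- of at most `2 m η A = 1/(2n)`, half of the internal rate `1/n` that is available for two or
  -- more particles.
  set η : ℝ := 1 / n / (4 * A * m) with hη
  have hη0 : 0 < η := by positivity
  have hclose : ∀ᶠ t in 𝓝[<] τ, ∀ i ∈ C, |x t i - y| ≤ η := by
    refine (Filter.eventually_all_finset C).2 fun i hi => ?_
    have h1 : Tendsto (fun t => |x t i - y|) (𝓝[<] τ) (𝓝 |x τ i - y|) :=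
      ((h.tendsto i).sub_const y).abs
    rw [hCτ i hi, sub_self, abs_zero] at h1
    exact (h1.eventually_lt_const hη0).mono fun t ht => ht.le
  obtain ⟨t₀, ht₀, ht₀'⟩ := mem_nhdsLT_iff_exists_Ico_subset.1
    (hev.and (hclose.and (Ioo_mem_nhdsLT h.lt)))
  have hder1 : ∀ t ∈ Ico t₀ τ, HasDerivAt (fun t => ∑ i ∈ C, (x t i - y))
      (∑ i ∈ C, externalForce β C (x t) i) t := fun t ht => by
    have hm' := (ht₀' ht).2.2
    rw [← sum_velocity_cluster]
    exact HasDerivAt.fun_sum fun i _ => (h.ode t hm' i).sub_const y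
  have hder2 : ∀ t ∈ Ico t₀ τ, HasDerivAt (fun t => ∑ i ∈ C, (x t i - y) ^ 2)
      (1 / (n : ℝ) * ((∑ i ∈ C, (β i : ℝ)) ^ 2 - m) +
        2 * ∑ i ∈ C, (x t i - y) * externalForce β C (x t) i) t := fun t ht => by
    have hm' := (ht₀' ht).2.2
    rw [hm, ← sum_mul_velocity_cluster hC1 (fun i hi j hj hne =>
      h.injOn ⟨hm'.1.le, hm'.2⟩ (hC0 i hi) (hC0 j hj) hne), Finset.mul_sum]
    refine HasDerivAt.fun_sum fun i _ => ?_
    have := ((h.ode t hm' i).sub_const y).fun_pow 2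
    simpa [mul_assoc] using this
  have hext1 : ∀ t ∈ Ico t₀ τ, |∑ i ∈ C, externalForce β C (x t) i| ≤ m * A := fun t ht => by
    refine (Finset.abs_sum_le_sum_abs _ _).trans ((Finset.sum_le_sum (ht₀' ht).1).trans ?_)
    simp [hm]
  have hext2 : ∀ t ∈ Ico t₀ τ, |∑ i ∈ C, (x t i - y) * externalForce β C (x t) i| ≤
      1 / n / 4 := fun t ht => by
    refine (Finset.abs_sum_le_sum_abs _ _).trans ((Finset.sum_le_sum (g := fun _ => η * A)
      fun i hi => ?_).trans (le_of_eq ?_))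
    · rw [abs_mul]
      exact mul_le_mul ((ht₀' ht).2.1 i hi) ((ht₀' ht).1 i hi) (abs_nonneg _) hη0.le
    · have : m ≠ 0 := by positivity
      rw [Finset.sum_const, nsmul_eq_mul, ← hm, hη]
      field_simp
  have hcont : ∀ i, ContinuousOn (fun t => x t i) (Icc t₀ τ) := fun i =>
    (h.cont i).mono fun t ht => by
      have := (ht₀' ⟨le_rfl, ht₀⟩).2.2
      exact ⟨this.1.le.trans ht.1, ht.2⟩
  have hc1 : ContinuousOn (fun t => ∑ i ∈ C, (x t i - y)) (Icc t₀ τ) :=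
    continuousOn_finsetSum C fun i _ => (hcont i).sub continuousOn_const
  have hc2 : ContinuousOn (fun t => ∑ i ∈ C, (x t i - y) ^ 2) (Icc t₀ τ) :=
    continuousOn_finsetSum C fun i _ => ((hcont i).sub continuousOn_const).pow 2
  have hsub : ∀ t ∈ Ioo t₀ τ, Icc t τ ⊆ Icc t₀ τ := fun t ht => Icc_subset_Icc_left ht.1.le
  have hsub' : ∀ t ∈ Ioo t₀ τ, Ico t τ ⊆ Ico t₀ τ := fun t ht => Ico_subset_Ico_left ht.1.le
  refine ⟨m * A + 1 / n * (m + 1) + 4 * n, by positivity, ?_⟩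
  have hn0 : (0 : ℝ) ≤ n := Nat.cast_nonneg n
  filter_upwards [Ioo_mem_nhdsLT ht₀] with t ht
  have htτ : 0 < τ - t := sub_pos.2 ht.2
  have hmA : 0 ≤ m * A := by positivity
  have hm3 : 0 ≤ 1 / (n : ℝ) * (m + 1) := by positivity
  refine ⟨?_, ?_, fun hcard => ?_⟩
  · have := abs_sub_le_of_hasDerivAt ht.2.le (hc1.mono (hsub t ht))
      (fun s hs => hder1 s (hsub' t ht hs)) fun s hs => hext1 s (hsub' t ht hs)
    have h0 : ∑ i ∈ C, (x τ i - y) = 0 :=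
      Finset.sum_eq_zero fun i hi => by rw [hCτ i hi, sub_self]
    rw [h0, zero_sub, abs_neg] at this
    refine this.trans ?_
    gcongr
    linarith
  · have := abs_sub_le_of_hasDerivAt (K := 1 / (n : ℝ) * (m + 1)) ht.2.le
      (hc2.mono (hsub t ht))
      (fun s hs => hder2 s (hsub' t ht hs)) fun s hs => by
        have h1 := abs_le.1 (hext2 s (hsub' t ht hs))
        rw [abs_le]
        constructor <;> nlinarith
    have h0 : ∑ i ∈ C, (x τ i - y) ^ 2 = 0 :=
      Finset.sum_eq_zero fun i hi => by rw [hCτ i hi, sub_self]; simp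
    rw [h0, zero_sub, abs_neg] at this
    refine (le_abs_self _).trans (this.trans ?_)
    gcongr
    linarith
  · have hm2 : 2 ≤ m := by rw [hm]; exact_mod_cast hcard
    have hmono : ∀ s ∈ Ico t τ, HasDerivWithinAt (fun t => ∑ i ∈ C, (x t i - y) ^ 2)
      (1 / (n : ℝ) * ((∑ i ∈ C, (β i : ℝ)) ^ 2 - m) +
        2 * ∑ i ∈ C, (x s i - y) * externalForce β C (x s) i) (Ici s) s := fun s hs =>
      (hder2 s (hsub' t ht hs)).hasDerivWithinAt
    -- The square of the total charge is at most 1 and `m ≥ 2`, so the second moment decreases at a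
    -- rate of at least `1/n - 1/(2n)`. As it vanishes at `τ`, it is at least `(τ - t)/(2n)` before.
    have := image_le_of_deriv_right_le_deriv_boundary (f := fun t => ∑ i ∈ C, (x t i - y) ^ 2)
      (a := t) (b := τ) (hc2.mono (hsub t ht)) hmono
      (B := fun s => (∑ i ∈ C, (x t i - y) ^ 2) - 1 / n / 2 * (s - t))
      (B' := fun _ => -(1 / n / 2)) (by simp) (by fun_prop) (fun s hs => by
        have h1 : HasDerivAt (fun s : ℝ => s - t) 1 s := (hasDerivAt_id s).sub_const t
        have := (h1.const_mul (1 / n / 2 : ℝ)).const_sub (∑ i ∈ C, (x t i - y) ^ 2)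
        simpa using this.hasDerivWithinAt) (fun s hs => by
        have h1 := abs_le.1 (hext2 s (hsub' t ht hs))
        nlinarith) (x := τ) ⟨ht.2.le, le_rfl⟩
    have h0 : ∑ i ∈ C, (x τ i - y) ^ 2 = 0 :=
      Finset.sum_eq_zero fun i hi => by rw [hCτ i hi, sub_self]; simp
    rw [h0] at this
    have hS : 0 ≤ ∑ i ∈ C, (x t i - y) ^ 2 := Finset.sum_nonneg fun _ _ => sq_nonneg _
    have hnp : (0 : ℝ) < n := by
      rcases hn0.eq_or_lt with h | h
      · rw [← h] at hn; simp at hn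
      · exact h
    have h2 : τ - t ≤ 2 * n * ∑ i ∈ C, (x t i - y) ^ 2 := by
      have : 1 / (n : ℝ) / 2 * (τ - t) ≤ ∑ i ∈ C, (x t i - y) ^ 2 := by linarith
      calc τ - t = 2 * n * (1 / (n : ℝ) / 2 * (τ - t)) := by field_simp
        _ ≤ _ := by gcongr
    refine h2.trans ?_
    gcongr
    linarith

end Cluster

/-! ### The step function near a point of space-time -/

section Local

variable {n : ℕ}

/-- The left limit at `y` of the step function of the state `(ξ, b)`. -/
def leftValue (b : Fin n → ℤ) (ξ : Fin n → ℝ) (y : ℝ) : ℝ :=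
  (1 / (n : ℝ)) * ∑ i with ξ i < y, (b i : ℝ)

/-- Particles that are elsewhere than `y` in the reference state `ξ₀` keep their side of `y` under
small changes. Only those located at `y` matter for the local profile, and neutral ones among them
contribute nothing. -/
theorem stepFunction_eq_leftValue_add {ξ₀ ξ : Fin n → ℝ} {y y' : ℝ}
    (h : ∀ i, ξ₀ i ≠ y → (ξ i ≤ y' ↔ ξ₀ i < y)) (b : Fin n → ℤ) :
    stepFunction ξ b y' = leftValue b ξ₀ y +
      (1 / (n : ℝ)) * ∑ i ∈ cluster b ξ₀ y with ξ i ≤ y', (b i : ℝ) := by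
  unfold stepFunction leftValue cluster
  rw [← mul_add, Finset.filter_filter, Finset.sum_filter, Finset.sum_filter,
    ← Finset.sum_add_distrib]
  congr 1
  refine Finset.sum_congr rfl fun i _ => ?_
  simp only [sub_nonneg]
  by_cases hi : ξ₀ i = y
  · by_cases hb : b i = 0
    · simp [hb]
    · simp [hi, hb]
  · simp [hi, h i hi]

theorem exists_local_radius (ξ₀ : Fin n → ℝ) (y : ℝ) :
    ∃ r > 0, ∀ ξ : Fin n → ℝ, (∀ i, |ξ i - ξ₀ i| < r) → ∀ y', |y' - y| < r →
      ∀ i, ξ₀ i ≠ y → (ξ i ≤ y' ↔ ξ₀ i < y) := by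
  have h : ∀ i, ∃ r > 0, ξ₀ i ≠ y → 2 * r ≤ |ξ₀ i - y| := fun i => by
    by_cases hi : ξ₀ i = y
    · exact ⟨1, one_pos, fun h => absurd hi h⟩
    · exact ⟨|ξ₀ i - y| / 2, half_pos (abs_pos.2 (sub_ne_zero.2 hi)), fun _ => by linarith⟩
  choose r hr hrle using h
  obtain ⟨r₀, hr₀, hle⟩ : ∃ r₀ > 0, ∀ i, r₀ ≤ r i := by
    rcases isEmpty_or_nonempty (Fin n) with he | hne
    · exact ⟨1, one_pos, fun i => he.elim i⟩
    · obtain ⟨i, hi⟩ := Finite.exists_min r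
      exact ⟨r i, hr i, hi⟩
  refine ⟨r₀, hr₀, fun ξ hξ y' hy' i hi => ?_⟩
  have h1 := abs_lt.1 (hξ i)
  have h2 := abs_lt.1 hy'
  have h3 := hrle i hi
  have h4 := hle i
  rcases abs_cases (ξ₀ i - y) with ⟨h5, _⟩ | ⟨h5, _⟩
  · exact ⟨fun h => by linarith, fun h => by linarith⟩
  · exact ⟨fun h => by linarith, fun h => by linarith⟩

theorem abs_stepFunction_le {ξ : Fin n → ℝ} {b : Fin n → ℤ} (h : (ξ, b) ∈ stateSpace n) (y : ℝ) :
    |stepFunction ξ b y| ≤ 1 := by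
  unfold stepFunction
  rw [abs_mul, abs_of_nonneg (by positivity : (0 : ℝ) ≤ 1 / n)]
  have h1 : |∑ i, (b i : ℝ) * (if 0 ≤ y - ξ i then 1 else 0)| ≤ n := by
    refine (Finset.abs_sum_le_sum_abs _ _).trans ((Finset.sum_le_sum (g := fun _ => (1 : ℝ))
      fun i _ => ?_).trans (by simp))
    rcases h.1 i with h | h | h <;> simp only at h <;> rw [h] <;> split_ifs <;> simp
  calc 1 / (n : ℝ) * _ ≤ 1 / (n : ℝ) * n := by gcongr
    _ ≤ 1 := by rw [one_div]; exact inv_mul_le_one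

theorem cluster_subsingleton {ξ : Fin n → ℝ} {b : Fin n → ℤ} (h : (ξ, b) ∈ stateSpace n) {y : ℝ}
    {i j : Fin n} (hi : i ∈ cluster b ξ y) (hj : j ∈ cluster b ξ y) : i = j := by
  have hi := mem_cluster.1 hi
  have hj := mem_cluster.1 hj
  by_contra hne
  rcases lt_or_gt_of_ne hne with h' | h'
  · have := h.2 j i h' (mul_ne_zero hj.1 hi.1)
    simp only [hi.2, hj.2, lt_irrefl] at this
  · have := h.2 i j h' (mul_ne_zero hi.1 hj.1)
    simp only [hi.2, hj.2, lt_irrefl] at this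

theorem cluster_eq_empty_or_singleton {ξ : Fin n → ℝ} {b : Fin n → ℤ}
    (h : (ξ, b) ∈ stateSpace n) (y : ℝ) :
    cluster b ξ y = ∅ ∨ ∃ i, cluster b ξ y = {i} ∧ (b i = 1 ∨ b i = -1) := by
  rcases (cluster b ξ y).eq_empty_or_nonempty with he | ⟨i, hi⟩
  · exact Or.inl he
  · refine Or.inr ⟨i, Finset.eq_singleton_iff_unique_mem.2
      ⟨hi, fun j hj => cluster_subsingleton h hj hi⟩, charge_eq_of_ne_zero h (mem_cluster.1 hi).1⟩

theorem sum_cluster_eq (b : Fin n → ℤ) (ξ : Fin n → ℝ) (y : ℝ) :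
    ∑ i ∈ cluster b ξ y, b i = ∑ i with ξ i = y, b i := by
  unfold cluster
  rw [Finset.sum_filter, Finset.sum_filter]
  refine Finset.sum_congr rfl fun i _ => ?_
  by_cases hb : b i = 0 <;> simp [hb]

/-- Charge exchanges within the points of the line do not change the values of the step function
at a distance. -/
theorem leftValue_congr {b β : Fin n → ℤ} {ξ : Fin n → ℝ}
    (h : ∀ y, ∑ i with ξ i = y, b i = ∑ i with ξ i = y, β i) (y : ℝ) :
    leftValue b ξ y = leftValue β ξ y := by
  have key : ∀ c : Fin n → ℤ, ∑ i with ξ i < y, (c i : ℝ) =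
      ∑ v ∈ (Finset.univ.image ξ).filter (· < y), ((∑ i with ξ i = v, c i : ℤ) : ℝ) := by
    intro c
    rw [← Finset.sum_fiberwise_of_maps_to (g := ξ)
      (t := (Finset.univ.image ξ).filter (· < y)) (fun i hi => by
        simp only [Finset.mem_filter, Finset.mem_univ, true_and] at hi
        simp [hi])]
    refine Finset.sum_congr rfl fun v hv => ?_
    push_cast
    refine Finset.sum_congr ?_ fun _ _ => rfl
    ext i
    simp only [Finset.mem_filter, Finset.mem_univ, true_and]
    exact ⟨fun h => h.2, fun h => ⟨h ▸ (Finset.mem_filter.1 hv).2, h⟩⟩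
  unfold leftValue
  rw [key b, key β]
  simp only [h]

variable {x : ℝ → Fin n → ℝ} {b : ℝ → Fin n → ℤ}

theorem ParticleEvolution.abs_le (h : ParticleEvolution x b) :
    ∀ p ∈ Q, |particleStep x b p| ≤ 1 := fun p hp =>
  abs_stepFunction_le (h.mem p.1 (le_of_lt hp)) p.2

theorem ParticleEvolution.eventually_local (h : ParticleEvolution x b) {τ : ℝ} (hτ : 0 ≤ τ)
    (y : ℝ) : ∀ᶠ p : ℝ × ℝ in 𝓝 (τ, y), 0 ≤ p.1 → ∀ i, x τ i ≠ y →
      (x p.1 i ≤ p.2 ↔ x τ i < y) := by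
  obtain ⟨r, hr, hloc⟩ := exists_local_radius (x τ) y
  have h1 : ∀ᶠ t in 𝓝 τ, 0 ≤ t → ∀ i, |x t i - x τ i| < r := by
    have h2 : ∀ i, ∀ᶠ t in 𝓝[Ici 0] τ, |x t i - x τ i| < r := fun i => by
      have h3 : Tendsto (fun t => |x t i - x τ i|) (𝓝[Ici 0] τ) (𝓝 |x τ i - x τ i|) :=
        ((h.cont i τ hτ).tendsto.sub_const _).abs
      exact h3.eventually_lt_const (by simpa using hr)
    have h4 := eventually_nhdsWithin_iff.1 (eventually_all.2 h2)
    exact h4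
  have h5 : ∀ᶠ y' in 𝓝 y, |y' - y| < r := by
    filter_upwards [Metric.ball_mem_nhds y hr] with y' hy'
    simpa [Real.dist_eq] using hy'
  filter_upwards [h1.prod_nhds h5] with p hp hp0
  exact hloc (x p.1) (hp.1 hp0) p.2 hp.2

/-- The values of the step function near `(τ, y)` from time `τ` on. -/
theorem ParticleEvolution.eventually_eq_right (h : ParticleEvolution x b) {τ : ℝ} (hτ : 0 ≤ τ)
    (y : ℝ) : ∀ᶠ p : ℝ × ℝ in 𝓝 (τ, y), τ ≤ p.1 → particleStep x b p =
      leftValue (b τ) (x τ) y +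
        (1 / (n : ℝ)) * ∑ i ∈ cluster (b τ) (x τ) y with x p.1 i ≤ p.2, (b τ i : ℝ) := by
  obtain ⟨δ, hδ, hr⟩ := h.right τ hτ
  have h1 : ∀ᶠ p : ℝ × ℝ in 𝓝 (τ, y), p.1 < τ + δ :=
    (continuous_fst.tendsto (τ, y)).eventually_lt_const (by simpa using hδ)
  filter_upwards [h.eventually_local hτ y, h1] with p hp hp1 hτp
  unfold particleStep
  rw [(hr p.1 ⟨hτp, hp1⟩).1]
  exact stepFunction_eq_leftValue_add (hp (hτ.trans hτp)) _

theorem le_upperEnv_of_curve {u : ℝ × ℝ → ℝ} {C : ℝ} (hu : ∀ p ∈ Q, |u p| ≤ C) {τ y c : ℝ}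
    (hτ : 0 ≤ τ) {γ : ℝ → ℝ} (hγ : Tendsto γ (𝓝[>] τ) (𝓝 y))
    (h : ∀ᶠ t in 𝓝[>] τ, c ≤ u (t, γ t)) : c ≤ upperEnv Q u (τ, y) := by
  refine le_upperEnv hu ?_
  have h1 : Tendsto (fun t => (t, γ t)) (𝓝[>] τ) (𝓝[Q] (τ, y)) := by
    refine tendsto_nhdsWithin_of_tendsto_nhds_of_eventually_within _ ?_ ?_
    · exact (tendsto_nhdsWithin_of_tendsto_nhds tendsto_id).prodMk_nhds hγ
    · filter_upwards [self_mem_nhdsWithin] with t ht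
      exact hτ.trans_lt ht
  exact h1.frequently h.frequently

theorem ParticleEvolution.tendsto_right (h : ParticleEvolution x b) {τ : ℝ} (hτ : 0 ≤ τ)
    (i : Fin n) : Tendsto (fun t => x t i) (𝓝[>] τ) (𝓝 (x τ i)) := by
  refine (h.cont i τ hτ).tendsto.mono_left (nhdsWithin_mono _ fun t ht => ?_)
  exact hτ.trans (le_of_lt ht)

/-- The upper envelope is at least the larger one of the two one-sided limits. -/
theorem ParticleEvolution.le_upperEnv (h : ParticleEvolution x b) {τ : ℝ} (hτ : 0 ≤ τ) (y : ℝ) :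
    leftValue (b τ) (x τ) y +
      (1 / (n : ℝ)) * ∑ i ∈ cluster (b τ) (x τ) y, max 0 (b τ i : ℝ) ≤
      upperEnv Q (particleStep x b) (τ, y) := by
  have hloc := h.eventually_eq_right hτ y
  have along : ∀ γ : ℝ → ℝ, Tendsto γ (𝓝[>] τ) (𝓝 y) → ∀ᶠ t in 𝓝[>] τ,
      particleStep x b (t, γ t) = leftValue (b τ) (x τ) y +
        (1 / (n : ℝ)) * ∑ i ∈ cluster (b τ) (x τ) y with x t i ≤ γ t, (b τ i : ℝ) := by
    intro γ hγ
    have h1 : Tendsto (fun t => (t, γ t)) (𝓝[>] τ) (𝓝 (τ, y)) :=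
      (tendsto_nhdsWithin_of_tendsto_nhds tendsto_id).prodMk_nhds hγ
    filter_upwards [h1.eventually hloc, self_mem_nhdsWithin] with t ht ht'
    exact ht (le_of_lt ht')
  rcases cluster_eq_empty_or_singleton (h.mem τ hτ) y with he | ⟨i, hi, hb⟩
  · refine le_upperEnv_of_curve h.abs_le hτ (γ := fun _ => y) tendsto_const_nhds ?_
    filter_upwards [along (fun _ => y) tendsto_const_nhds] with t ht
    rw [ht, he]; simp
  · have hxi : x τ i = y := (mem_cluster.1 (hi ▸ Finset.mem_singleton_self i)).2
    have hti := h.tendsto_right hτ i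
    rw [hxi] at hti
    rcases hb with hb | hb
    · refine le_upperEnv_of_curve h.abs_le hτ hti ?_
      filter_upwards [along _ hti] with t ht
      rw [ht, hi]; simp [Finset.filter_singleton, hb]
    -- The larger value lies to the left of a negative charge. The curve stays strictly to the left
    -- of the particle and still ends at `y`.
    · have hγ : Tendsto (fun t => x t i - (t - τ)) (𝓝[>] τ) (𝓝 y) := by
        have h2 : Tendsto (fun t => t - τ) (𝓝[>] τ) (𝓝 (τ - τ)) :=
          tendsto_nhdsWithin_of_tendsto_nhds ((continuous_sub_right τ).tendsto τ)
        simpa using hti.sub h2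
      refine le_upperEnv_of_curve h.abs_le hτ hγ ?_
      filter_upwards [along _ hγ, self_mem_nhdsWithin] with t ht ht'
      have ht' : τ < t := ht'
      have h3 : ¬ (x t i ≤ x t i - (t - τ)) := by linarith
      rw [ht, hi]; simp [Finset.filter_singleton, hb, not_le.2 ht']

/-- The situation just before time `τ` near the point `y`. -/
theorem ParticleEvolution.exists_flow_before (h : ParticleEvolution x b) {τ : ℝ} (hτ : 0 < τ) :
    ∃ (α : ℝ) (β : Fin n → ℤ), 0 < α ∧ IsFlow x β α τ ∧ (∀ t ∈ Ico α τ, b t = β) ∧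
      (∀ i, b τ i = β i ∨ b τ i = 0) ∧
      ∀ y, ∑ i with x τ i = y, b τ i = ∑ i with x τ i = y, β i := by
  obtain ⟨δ, hδ, hδτ, β, h1, h2, h3⟩ := h.left τ hτ
  refine ⟨τ - δ / 2, β, by linarith, ⟨by linarith, fun t ht => ?_, fun i => ?_, fun t ht i => ?_⟩,
    fun t ht => ?_, h2, h3⟩
  · have := h.mem t (by linarith [ht.1])
    rwa [(h1 t ⟨by linarith [ht.1], ht.2⟩).1] at this
  · refine (h.cont i).mono fun t ht => ?_
    simp only [mem_Ici]; linarith [ht.1]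
  · exact (h1 t ⟨by linarith [ht.1], ht.2⟩).2 i
  · exact (h1 t ⟨by linarith [ht.1], ht.2⟩).1

/-- The values of the step function near `(τ, y)` before time `τ`. -/
theorem ParticleEvolution.eventually_eq_left (h : ParticleEvolution x b) {τ α : ℝ}
    {β : Fin n → ℤ} (hα : 0 < α) (hf : IsFlow x β α τ) (hβ : ∀ t ∈ Ico α τ, b t = β)
    (hsum : ∀ y, ∑ i with x τ i = y, b τ i = ∑ i with x τ i = y, β i) (y : ℝ) :
    ∀ᶠ p : ℝ × ℝ in 𝓝 (τ, y), p.1 < τ → particleStep x b p =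
      leftValue (b τ) (x τ) y +
        (1 / (n : ℝ)) * ∑ i ∈ cluster β (x τ) y with x p.1 i ≤ p.2, (β i : ℝ) := by
  have h1 : ∀ᶠ p : ℝ × ℝ in 𝓝 (τ, y), α < p.1 :=
    (continuous_fst.tendsto (τ, y)).eventually_const_lt hf.lt
  have hτ : 0 ≤ τ := hα.le.trans hf.lt.le
  filter_upwards [h.eventually_local hτ y, h1] with p hp hp1 hτp
  unfold particleStep
  rw [hβ p.1 ⟨hp1.le, hτp⟩, leftValue_congr hsum]
  exact stepFunction_eq_leftValue_add (hp (hα.le.trans hp1.le)) _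

/-- Initial segments of the cluster in space are initial segments in the numbering. -/
theorem IsFlow.initial_segment {β : Fin n → ℤ} {α τ : ℝ} (hf : IsFlow x β α τ) {t : ℝ}
    (ht : t ∈ Ico α τ) (y y' : ℝ) : ∀ i ∈ (cluster β (x τ) y).filter (fun i => x t i ≤ y'),
      ∀ j ∈ cluster β (x τ) y, j < i → j ∈ (cluster β (x τ) y).filter (fun i => x t i ≤ y') := by
  intro i hi j hj hji
  have hi := Finset.mem_filter.1 hi
  refine Finset.mem_filter.2 ⟨hj, le_trans (LT.lt.le ?_) hi.2⟩
  exact (hf.mem t ht).2 i j hji (mul_ne_zero (mem_cluster.1 hi.1).1 (mem_cluster.1 hj).1)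

/-- The structure of the step function and of its upper envelope near a point `(τ, y)`, `τ > 0`. -/
theorem ParticleEvolution.exists_profile (h : ParticleEvolution x b) {τ : ℝ} (hτ : 0 < τ) (y : ℝ) :
    ∃ (α : ℝ) (β : Fin n → ℤ) (s : ℤ), 0 < α ∧ IsFlow x β α τ ∧ (∀ t ∈ Ico α τ, b t = β) ∧
      (∀ i, b τ i = β i ∨ b τ i = 0) ∧
      (∀ y, ∑ i with x τ i = y, b τ i = ∑ i with x τ i = y, β i) ∧
      (s = 1 ∨ s = -1) ∧
      (∑ i ∈ cluster β (x τ) y, β i = 0 ∨ ∑ i ∈ cluster β (x τ) y, β i = s) ∧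
      (∀ᶠ p in 𝓝 (τ, y), particleStep x b p ≤
        leftValue (b τ) (x τ) y + (1 / (n : ℝ)) * max 0 (s : ℝ)) ∧
      (cluster β (x τ) y = ∅ →
        ∀ᶠ p in 𝓝 (τ, y), particleStep x b p = leftValue (b τ) (x τ) y) ∧
      ∀ᶠ t in 𝓝[<] τ, ∀ i ∈ cluster β (x τ) y,
        leftValue (b τ) (x τ) y + (1 / (n : ℝ)) * max 0 (s : ℝ) ≤
          upperEnv Q (particleStep x b) (t, x t i) := by
  obtain ⟨α, β, hα, hf, hβ, hb, hsum⟩ := h.exists_flow_before hτ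
  obtain ⟨s, hs, hD⟩ := hf.exists_cluster_sums y
  set C := cluster β (x τ) y with hC
  set k := leftValue (b τ) (x τ) y with hk
  have hleft := h.eventually_eq_left hα hf hβ hsum y
  have hright := h.eventually_eq_right hτ.le y
  have hn : (0 : ℝ) ≤ 1 / n := by positivity
  have htot : ∑ i ∈ C, β i = 0 ∨ ∑ i ∈ C, β i = s := hD C subset_rfl fun i _ j hj _ => hj
  have hleτ : ∀ᶠ p : ℝ × ℝ in 𝓝 (τ, y), α < p.1 :=
    (continuous_fst.tendsto (τ, y)).eventually_const_lt hf.lt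
  have hval : ∀ t ∈ Ico α τ, ∀ y', (∑ i ∈ C with x t i ≤ y', (β i : ℝ)) = 0 ∨
      (∑ i ∈ C with x t i ≤ y', (β i : ℝ)) = s := fun t ht y' => by
    have := hD (C.filter fun i => x t i ≤ y') (Finset.filter_subset _ _)
      (hf.initial_segment ht y y')
    exact_mod_cast this
  have hmaxs : (s : ℝ) ≤ max 0 (s : ℝ) := le_max_right _ _
  have hmax0 : (0 : ℝ) ≤ max 0 (s : ℝ) := le_max_left _ _
  have hpost : cluster (b τ) (x τ) y ⊆ C := fun i hi => by
    have hi := mem_cluster.1 hi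
    refine mem_cluster.2 ⟨?_, hi.2⟩
    rcases hb i with h' | h'
    · rw [← h']; exact hi.1
    · exact absurd h' hi.1
  refine ⟨α, β, s, hα, hf, hβ, hb, hsum, hs, htot, ?_, fun hCe => ?_, ?_⟩
  · filter_upwards [hleft, hright, hleτ] with p hp1 hp2 hp3
    rcases lt_or_ge p.1 τ with h' | h'
    · rw [hp1 h']
      have : (∑ i ∈ C with x p.1 i ≤ p.2, (β i : ℝ)) ≤ max 0 (s : ℝ) := by
        rcases hval p.1 ⟨hp3.le, h'⟩ p.2 with h'' | h'' <;> rw [h'']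
        · exact hmax0
        · exact hmaxs
      gcongr
    · rw [hp2 h']
      have h3 : (∑ i ∈ cluster (b τ) (x τ) y with x p.1 i ≤ p.2, (b τ i : ℝ)) ≤
          max 0 (s : ℝ) := by
        -- From `τ` on at most one charged particle is left at `y`, and by conservation its charge
        -- is the net charge of the group, 0 or `s`.
        rcases cluster_eq_empty_or_singleton (h.mem τ hτ.le) y with he | ⟨i, hi, -⟩
        · rw [he]; simp
        · rw [hi, Finset.filter_singleton]
          split_ifs
          · have h4 := sum_cluster_eq (b τ) (x τ) y
            rw [hsum y, ← sum_cluster_eq β (x τ) y, hi, Finset.sum_singleton, ← hC] at h4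
            rw [Finset.sum_singleton, h4]
            rcases htot with h'' | h'' <;> rw [h'']
            · simp
            · exact hmaxs
          · simp
      gcongr
  · have hpe : cluster (b τ) (x τ) y = ∅ := Finset.subset_empty.1 (hCe ▸ hpost)
    filter_upwards [hleft, hright] with p hp1 hp2
    rcases lt_or_ge p.1 τ with h' | h'
    · rw [hp1 h', hCe]; simp [hk]
    · rw [hp2 h', hpe]; simp [hk]
  · have hcurve : ∀ᶠ t in 𝓝[<] τ, ∀ i ∈ C, ∀ᶠ y' in 𝓝 (x t i), particleStep x b (t, y') = k +
        (1 / (n : ℝ)) * ∑ i ∈ C with x t i ≤ y', (β i : ℝ) := by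
      refine (Filter.eventually_all_finset C).2 fun i hi => ?_
      have h1 : Tendsto (fun t => (t, x t i)) (𝓝[<] τ) (𝓝 (τ, y)) := by
        refine (tendsto_nhdsWithin_of_tendsto_nhds tendsto_id).prodMk_nhds ?_
        have := hf.tendsto i
        rwa [(mem_cluster.1 hi).2] at this
      filter_upwards [h1.eventually hleft.eventually_nhds, self_mem_nhdsWithin] with t ht ht'
      have h2 : Tendsto (fun y' => (t, y')) (𝓝 (x t i)) (𝓝 (t, x t i)) :=
        (Continuous.prodMk_right t).tendsto _
      exact (h2.eventually ht).mono fun y' hy' => hy' ht'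
    filter_upwards [hcurve, Ioo_mem_nhdsLT hf.lt] with t ht htα i hi
    have htm : t ∈ Ico α τ := ⟨htα.1.le, htα.2⟩
    have ht0 : 0 < t := hα.trans htα.1
    have h1 : k + (1 / (n : ℝ)) * ∑ j ∈ C with x t j ≤ x t i, (β j : ℝ) ≤
        upperEnv Q (particleStep x b) (t, x t i) := by
      rw [← (ht i hi).self_of_nhds]
      exact self_le_upperEnv ht0 h.abs_le
    have h2 : k + (1 / (n : ℝ)) * ∑ j ∈ C with x t j < x t i, (β j : ℝ) ≤
        upperEnv Q (particleStep x b) (t, x t i) := by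
      refine AnnihilatingParticles.le_upperEnv h.abs_le ?_
      have h3 : Tendsto (fun y' => (t, y')) (𝓝[<] (x t i)) (𝓝[Q] (t, x t i)) := by
        refine tendsto_nhdsWithin_of_tendsto_nhds_of_eventually_within _ ?_
          (Eventually.of_forall fun _ => ht0)
        exact tendsto_nhdsWithin_of_tendsto_nhds ((Continuous.prodMk_right t).tendsto _)
      refine h3.frequently (Eventually.frequently ?_)
      have h4 : ∀ᶠ y' in 𝓝[<] (x t i), ∀ j ∈ C, (x t j ≤ y' ↔ x t j < x t i) := by
        refine (Filter.eventually_all_finset C).2 fun j hj => ?_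
        by_cases hji : x t j < x t i
        · filter_upwards [Ioo_mem_nhdsLT hji] with y' hy'
          exact ⟨fun _ => hji, fun _ => hy'.1.le⟩
        · filter_upwards [self_mem_nhdsWithin] with y' hy'
          have hy' : y' < x t i := hy'
          exact ⟨fun h => h.trans_lt hy', fun h => absurd h hji⟩
      filter_upwards [h4, nhdsWithin_le_nhds (ht i hi)] with y' hy' hy''
      rw [hy'', Finset.filter_congr hy']
    have hdiff : (∑ j ∈ C with x t j ≤ x t i, (β j : ℝ)) =
        β i + ∑ j ∈ C with x t j < x t i, (β j : ℝ) := by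
      have : C.filter (fun j => x t j ≤ x t i) = insert i (C.filter fun j => x t j < x t i) := by
        ext j
        simp only [Finset.mem_filter, Finset.mem_insert]
        constructor
        · rintro ⟨hj, hle⟩
          by_cases hji : j = i
          · exact Or.inl hji
          · refine Or.inr ⟨hj, lt_of_le_of_ne hle ?_⟩
            exact hf.injOn htm (mem_cluster.1 hj).1 (mem_cluster.1 hi).1 (Ne.symm hji)
        · rintro (rfl | ⟨hj, hlt⟩)
          · exact ⟨hi, le_rfl⟩
          · exact ⟨hj, hlt.le⟩
      rw [this, Finset.sum_insert (by simp)]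
    have hlow : (∑ j ∈ C with x t j < x t i, (β j : ℝ)) = 0 ∨
        (∑ j ∈ C with x t j < x t i, (β j : ℝ)) = s := by
      have := hD (C.filter fun j => x t j < x t i) (Finset.filter_subset _ _) ?_
      · exact_mod_cast this
      · intro j hj l hl hlj
        have hj := Finset.mem_filter.1 hj
        refine Finset.mem_filter.2 ⟨hl, lt_trans ?_ hj.2⟩
        exact (hf.mem t htm).2 j l hlj (mul_ne_zero (mem_cluster.1 hj.1).1 (mem_cluster.1 hl).1)
    have hup := hval t htm (x t i)
    have hi0 : (β i : ℝ) ≠ 0 := by exact_mod_cast (mem_cluster.1 hi).1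
    -- The partial sums on the two sides of the particle `i` differ by `β i ≠ 0` and lie in `{0,
    -- s}`. So both values occur, and one of the two sides shows the larger one.
    rcases hup with hup | hup <;> rcases hlow with hlow | hlow
    · exact absurd (by linarith) hi0
    · rcases le_total 0 (s : ℝ) with hs0 | hs0
      · rw [max_eq_right hs0, ← hlow]; exact h2
      · rw [max_eq_left hs0, ← hup]; exact h1
    · rcases le_total 0 (s : ℝ) with hs0 | hs0
      · rw [max_eq_right hs0, ← hup]; exact h1
      · rw [max_eq_left hs0, ← hlow]; exact h2
    · exact absurd (by linarith) hi0

end Local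

/-! ### One-sided derivatives and sums over steps -/

section OneSided

theorem deriv_nonpos_of_left {G : ℝ → ℝ} {g' τ : ℝ} (hG : HasDerivWithinAt G g' (Iic τ) τ)
    (h : ∀ᶠ t in 𝓝[<] τ, G τ ≤ G t) : g' ≤ 0 := by
  have h1 := hasDerivWithinAt_iff_tendsto_slope.1 hG
  have h2 : Iic τ \ {τ} = Iio τ := by ext; simp [lt_iff_le_and_ne]
  rw [h2] at h1
  refine le_of_tendsto h1 ?_
  filter_upwards [h, self_mem_nhdsWithin] with t ht ht'
  have ht' : t < τ := ht'
  rw [slope_def_field]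
  exact div_nonpos_of_nonneg_of_nonpos (by linarith) (by linarith)

theorem deriv_nonneg_of_right {G : ℝ → ℝ} {g' τ : ℝ} (hG : HasDerivWithinAt G g' (Ici τ) τ)
    (h : ∀ᶠ t in 𝓝[>] τ, G τ ≤ G t) : 0 ≤ g' := by
  have h1 := hasDerivWithinAt_iff_tendsto_slope.1 hG
  have h2 : Ici τ \ {τ} = Ioi τ := by ext; simp only [Set.mem_sdiff, mem_Ici, mem_singleton_iff, mem_Ioi]; exact ⟨fun h => lt_of_le_of_ne h.1 (Ne.symm h.2), fun h => ⟨h.le, h.ne'⟩⟩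
  rw [h2] at h1
  refine ge_of_tendsto h1 ?_
  filter_upwards [h, self_mem_nhdsWithin] with t ht ht'
  have ht' : τ < t := ht'
  rw [slope_def_field]
  exact div_nonneg (by linarith) (by linarith)

theorem integral_sum_stepIncrement {ι : Type*} (s : Finset ι) (c a : ι → ℝ) {r : ℝ} (hr : 0 < r)
    (ha : ∀ j ∈ s, r < |a j|) {h : ℝ → ℝ} (hh : Measurable h) {B : ℝ} (hB : ∀ z, |h z| ≤ B) :
    ∫ z in {z : ℝ | r < |z|}, (∑ j ∈ s, c j * stepIncrement (a j) z + h z) / z ^ 2 =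
      ∑ j ∈ s, c j / a j + ∫ z in {z : ℝ | r < |z|}, h z / z ^ 2 := by
  have hi : ∀ j, IntegrableOn (fun z => stepIncrement (a j) z / z ^ 2) {z : ℝ | r < |z|} :=
    fun j => integrableOn_div_sq hr (measurableSet_lt_abs r) subset_rfl
      (measurable_stepIncrement _) fun z _ => abs_stepIncrement_le _ z
  have h1 : ∀ z, (∑ j ∈ s, c j * stepIncrement (a j) z + h z) / z ^ 2 =
      ∑ j ∈ s, c j * (stepIncrement (a j) z / z ^ 2) + h z / z ^ 2 := fun z => by
    rw [add_div, Finset.sum_div]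
    simp only [mul_div_assoc]
  simp only [h1]
  rw [integral_add (integrable_finsetSum _ fun j _ => (hi j).const_mul (c j))
    (integrableOn_div_sq hr (measurableSet_lt_abs r) subset_rfl hh fun z _ => hB z),
    integral_finsetSum _ fun j _ => (hi j).const_mul (c j)]
  congr 1
  refine Finset.sum_congr rfl fun j hj => ?_
  rw [integral_const_mul, integral_stepIncrement hr (ha j hj), mul_one_div]

/-- With the Heaviside function for `F`: at the time of a collision the step function is the same
for the charges before and after, so that the nonlocal term can be computed with the former. -/
theorem sum_charge_congr {n : ℕ} {b β : Fin n → ℤ} {ξ : Fin n → ℝ}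
    (h : ∀ y, ∑ i with ξ i = y, b i = ∑ i with ξ i = y, β i) (F : ℝ → ℝ) :
    ∑ i, (b i : ℝ) * F (ξ i) = ∑ i, (β i : ℝ) * F (ξ i) := by
  have key : ∀ c : Fin n → ℤ, ∑ i, (c i : ℝ) * F (ξ i) =
      ∑ v ∈ Finset.univ.image ξ, ((∑ i with ξ i = v, c i : ℤ) : ℝ) * F v := by
    intro c
    rw [← Finset.sum_fiberwise_of_maps_to (g := ξ) (t := Finset.univ.image ξ)
      (fun i _ => Finset.mem_image_of_mem _ (Finset.mem_univ i))]
    refine Finset.sum_congr rfl fun v _ => ?_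
    push_cast
    rw [Finset.sum_mul]
    refine Finset.sum_congr rfl fun i hi => ?_
    rw [(Finset.mem_filter.1 hi).2]
  rw [key b, key β]
  simp only [h]

end OneSided

/-! ### The step function is a viscosity solution -/

section Viscosity

variable {n : ℕ} {x : ℝ → Fin n → ℝ} {b : ℝ → Fin n → ℤ}

/-- Where a charge survives, the envelope is the larger one-sided limit. The second bound is for
complete annihilations: no charge is left, but the envelope may remember one quantum from earlier
times, and the bumps of the barrier have to cover that. Where no particle sits, there is no excess.
-/
theorem ParticleEvolution.upperEnv_le (h : ParticleEvolution x b) {τ : ℝ} (hτ : 0 ≤ τ) (y : ℝ) :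
    ((cluster (b τ) (x τ) y).Nonempty → upperEnv Q (particleStep x b) (τ, y) ≤
      leftValue (b τ) (x τ) y +
        (1 / (n : ℝ)) * ∑ i ∈ cluster (b τ) (x τ) y, max 0 (b τ i : ℝ)) ∧
    upperEnv Q (particleStep x b) (τ, y) ≤ leftValue (b τ) (x τ) y + 1 / n ∧
    ((∀ i, x τ i ≠ y) →
      upperEnv Q (particleStep x b) (τ, y) ≤ leftValue (b τ) (x τ) y) := by
  have hn : (0 : ℝ) ≤ 1 / n := by positivity
  have hcl := mem_closure_Q (p := (τ, y)) hτ
  rcases hτ.eq_or_lt with rfl | hτ0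
  · have key : upperEnv Q (particleStep x b) (0, y) ≤ leftValue (b 0) (x 0) y +
        (1 / (n : ℝ)) * ∑ i ∈ cluster (b 0) (x 0) y, max 0 (b 0 i : ℝ) := by
      refine AnnihilatingParticles.upperEnv_le hcl h.abs_le ?_
      filter_upwards [nhdsWithin_le_nhds (h.eventually_eq_right le_rfl y), self_mem_nhdsWithin]
        with p hp hpQ
      rw [hp (le_of_lt hpQ)]
      gcongr
      rw [Finset.sum_filter]
      refine Finset.sum_le_sum fun i _ => ?_
      split_ifs
      · exact le_max_right _ _
      · exact le_max_left _ _
    refine ⟨fun _ => key, key.trans ?_, fun hi => key.trans ?_⟩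
    · gcongr
      rcases cluster_eq_empty_or_singleton (h.mem 0 le_rfl) y with he | ⟨i, hi, hb⟩
      · simp [he]
      · rw [hi, Finset.sum_singleton]
        have : max 0 (b 0 i : ℝ) ≤ 1 := by rcases hb with hb | hb <;> rw [hb] <;> norm_num
        calc 1 / (n : ℝ) * max 0 (b 0 i : ℝ) ≤ 1 / n * 1 := by gcongr
          _ = 1 / n := mul_one _
    · have : cluster (b 0) (x 0) y = ∅ :=
        Finset.eq_empty_of_forall_notMem fun i hi' => hi i (mem_cluster.1 hi').2
      simp [this]
  · obtain ⟨α, β, s, hα, hf, hβ, hb, hsum, hs, htot, hle, hemp, -⟩ := h.exists_profile hτ0 y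
    have hU := AnnihilatingParticles.upperEnv_le hcl h.abs_le (nhdsWithin_le_nhds hle)
    refine ⟨fun ⟨i, hi⟩ => hU.trans ?_, hU.trans ?_, fun hi => ?_⟩
    · rcases cluster_eq_empty_or_singleton (h.mem τ hτ) y with he | ⟨j, hj, hbj⟩
      · simp [he] at hi
      · have h4 := sum_cluster_eq (b τ) (x τ) y
        rw [hsum y, ← sum_cluster_eq β (x τ) y, hj, Finset.sum_singleton] at h4
        have : b τ j = s := by
          rcases htot with h' | h' <;> omega
        rw [hj, Finset.sum_singleton, this]
    · gcongr
      have : max 0 (s : ℝ) ≤ 1 := by rcases hs with hb | hb <;> rw [hb] <;> norm_num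
      calc 1 / (n : ℝ) * max 0 (s : ℝ) ≤ 1 / n * 1 := by gcongr
        _ = 1 / n := mul_one _
    · have : cluster β (x τ) y = ∅ :=
        Finset.eq_empty_of_forall_notMem fun i hi' => hi i (mem_cluster.1 hi').2
      exact AnnihilatingParticles.upperEnv_le hcl h.abs_le
        (nhdsWithin_le_nhds ((hemp this).mono fun p hp => hp.le))

theorem hasFDerivAt_of_contDiffOn_Q {φ : ℝ × ℝ → ℝ} (hφ : ContDiffOn ℝ 2 φ Q) {τ y : ℝ}
    (hτ : 0 < τ) : ∃ φ' : ℝ × ℝ →L[ℝ] ℝ, HasFDerivAt φ φ' (τ, y) ∧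
      (∀ p, φ' p = p.1 * dt φ (τ, y) + p.2 * dx φ (τ, y)) ∧
      HasDerivAt (fun t => φ (t, y)) (dt φ (τ, y)) τ ∧
      HasDerivAt (fun z => φ (τ, z)) (dx φ (τ, y)) y := by
  have hd : DifferentiableAt ℝ φ (τ, y) :=
    (hφ.differentiableOn (by norm_num)).differentiableAt (isOpen_Q.mem_nhds hτ)
  have h1 : HasDerivAt (fun t => φ (t, y)) (fderiv ℝ φ (τ, y) (1, 0)) τ := by
    have h2 : HasDerivAt (fun t : ℝ => (t, y)) (1, 0) τ :=
      (hasDerivAt_id τ).prodMk (hasDerivAt_const τ y)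
    exact HasFDerivAt.comp_hasDerivAt (x := τ) hd.hasFDerivAt h2
  have h3 : HasDerivAt (fun z => φ (τ, z)) (fderiv ℝ φ (τ, y) (0, 1)) y := by
    have h2 : HasDerivAt (fun z : ℝ => (τ, z)) (0, 1) y :=
      (hasDerivAt_const y τ).prodMk (hasDerivAt_id y)
    exact HasFDerivAt.comp_hasDerivAt (x := y) hd.hasFDerivAt h2
  have h4 : dt φ (τ, y) = fderiv ℝ φ (τ, y) (1, 0) := h1.deriv
  have h5 : dx φ (τ, y) = fderiv ℝ φ (τ, y) (0, 1) := h3.deriv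
  refine ⟨fderiv ℝ φ (τ, y), hd.hasFDerivAt, fun p => ?_, h4 ▸ h1, h5 ▸ h3⟩
  have : p = p.1 • ((1 : ℝ), (0 : ℝ)) + p.2 • ((0 : ℝ), (1 : ℝ)) := by ext <;> simp
  conv_lhs => rw [this]
  rw [map_add, map_smul, map_smul, h4, h5]
  rfl

/-- Colliding particles cannot all stay on one side of a transversal curve. -/
theorem false_of_transversal_collision {ι : Type*} (C : Finset ι) (e : ℝ → ι → ℝ) {τ A K D : ℝ}
    (hA : 0 < A) (hK : 0 ≤ K) (hD : D ≠ 0)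
    (h1 : ∀ᶠ t in 𝓝[<] τ, |∑ i ∈ C, e t i| ≤ A * (τ - t))
    (h2 : ∀ᶠ t in 𝓝[<] τ, τ - t ≤ A * ∑ i ∈ C, (e t i) ^ 2)
    (h3 : ∀ᶠ t in 𝓝[<] τ, ∀ i ∈ C, 0 ≤ D * e t i + K * (τ - t) + |D| / 2 * |e t i|) : False := by
  have hD0 : 0 < |D| := abs_pos.2 hD
  set A₂ := A + C.card * (4 * K / |D|) with hA₂
  have hA₂0 : 0 < A₂ := by positivity
  have h4 : Tendsto (fun t => A * A₂ ^ 2 * (τ - t)) (𝓝[<] τ) (𝓝 (A * A₂ ^ 2 * (τ - τ))) :=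
    tendsto_nhdsWithin_of_tendsto_nhds (Continuous.tendsto (by fun_prop) τ)
  have h5 := h4.eventually_lt_const (show A * A₂ ^ 2 * (τ - τ) < 1 by simp)
  obtain ⟨t, ht1, ht2, ht3, ht4, ht5⟩ :=
    (h1.and (h2.and (h3.and (h5.and self_mem_nhdsWithin)))).exists
  have ht5 : t < τ := ht5
  have htτ : 0 < τ - t := sub_pos.2 ht5
  obtain ⟨σ, hσ, hσD⟩ : ∃ σ : ℝ, (σ = 1 ∨ σ = -1) ∧ D = σ * |D| := by
    rcases abs_cases D with ⟨h, _⟩ | ⟨h, _⟩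
    · exact ⟨1, Or.inl rfl, by rw [h]; ring⟩
    · exact ⟨-1, Or.inr rfl, by rw [h]; ring⟩
  have habs : ∀ r : ℝ, |σ * r| = |r| := fun r => by
    rw [abs_mul]; rcases hσ with h | h <;> rw [h] <;> simp
  -- All particles lie on the side `σ` up to `O(τ - t)`. Then the bound for the first moment
  -- controls the sum of moduli, the second moment is `O((τ - t)²)`, and its linear lower bound
  -- fails for `t` close to `τ`.
  have h6 : ∀ i ∈ C, |e t i| ≤ σ * e t i + 4 * K / |D| * (τ - t) := fun i hi => by
    have h7 := ht3 i hi
    rw [← habs (e t i)] at h7 ⊢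
    have h8 : D * e t i = |D| * (σ * e t i) := by
      conv_lhs => rw [hσD]
      ring
    rw [h8] at h7
    have h9 : 0 ≤ 4 * K / |D| * (τ - t) := by positivity
    rcases abs_cases (σ * e t i) with ⟨h, _⟩ | ⟨h, h'⟩
    · rw [h]; linarith
    · rw [h] at h7 ⊢
      have h10 : |D| * (4 * K / |D| * (τ - t)) = 4 * K * (τ - t) := by field_simp
      by_contra! hcon
      nlinarith
  have h7 : ∑ i ∈ C, |e t i| ≤ A₂ * (τ - t) := by
    refine (Finset.sum_le_sum h6).trans ?_
    rw [Finset.sum_add_distrib, ← Finset.mul_sum, Finset.sum_const, nsmul_eq_mul, hA₂, add_mul,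
      mul_assoc]
    exact add_le_add ((le_abs_self _).trans ((habs _).le.trans ht1)) le_rfl
  have h8 : ∑ i ∈ C, (e t i) ^ 2 ≤ (A₂ * (τ - t)) ^ 2 := by
    calc ∑ i ∈ C, (e t i) ^ 2 = ∑ i ∈ C, |e t i| ^ 2 := by simp
      _ ≤ (∑ i ∈ C, |e t i|) ^ 2 := Finset.sum_sq_le_sq_sum_of_nonneg fun _ _ => abs_nonneg _
      _ ≤ _ := by
        gcongr
  have h9 : τ - t ≤ A * (A₂ * (τ - t)) ^ 2 := ht2.trans (by gcongr)
  have h10 : 1 * (τ - t) ≤ (A * A₂ ^ 2 * (τ - t)) * (τ - t) := by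
    calc 1 * (τ - t) = τ - t := one_mul _
      _ ≤ _ := h9
      _ = _ := by ring
  have := le_of_mul_le_mul_right h10 htτ
  linarith

/-- The increments of the step function of a state at a particle. -/
theorem stepFunction_sub_eq {β : Fin n → ℤ} {ξ : Fin n → ℝ} {i : Fin n} {y : ℝ}
    (hi : cluster β ξ y = {i}) (z : ℝ) :
    stepFunction ξ β (y + z) - leftValue β ξ y = (1 / (n : ℝ)) *
      (∑ j with j ≠ i ∧ β j ≠ 0, (β j : ℝ) * stepIncrement (ξ j - y) z +
        (β i : ℝ) * if 0 ≤ z then 1 else 0) := by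
  have hiy : β i ≠ 0 ∧ ξ i = y := mem_cluster.1 (hi ▸ Finset.mem_singleton_self i)
  have hne : ∀ j, j ≠ i → β j ≠ 0 → ξ j ≠ y := fun j hj hb he => by
    have : j ∈ cluster β ξ y := mem_cluster.2 ⟨hb, he⟩
    rw [hi] at this
    exact hj (Finset.mem_singleton.1 this)
  unfold stepFunction leftValue
  rw [← mul_sub]
  congr 1
  rw [Finset.sum_filter, Finset.sum_filter, ← Finset.sum_sub_distrib,
    ← Finset.add_sum_erase _ _ (Finset.mem_univ i),
    ← Finset.add_sum_erase Finset.univ (fun j => if j ≠ i ∧ β j ≠ 0 then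
      (β j : ℝ) * stepIncrement (ξ j - y) z else 0) (Finset.mem_univ i)]
  simp only [ne_eq, not_true_eq_false, false_and, if_false, zero_add, hiy.2, lt_irrefl, sub_zero,
    add_sub_cancel_left]
  rw [add_comm]
  congr 1
  refine Finset.sum_congr rfl fun j hj => ?_
  have hji := Finset.ne_of_mem_erase hj
  by_cases hb : β j = 0
  · simp [hb]
  · have hjy := hne j hji hb
    simp only [hji, hb, not_false_eq_true, and_self, if_true, stepIncrement]
    have h1 : (0 ≤ y + z - ξ j) ↔ (ξ j - y ≤ z) := by constructor <;> intro h <;> linarith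
    have h2 : (ξ j < y) ↔ (ξ j - y ≤ 0) :=
      ⟨fun h => by linarith, fun h => lt_of_le_of_ne (by linarith) hjy⟩
    simp only [h1, h2]
    split_ifs <;> ring

theorem exists_int_sum_stepIncrement (s : Finset (Fin n)) (β : Fin n → ℤ) (a : Fin n → ℝ) (z : ℝ) :
    ∃ m : ℤ, ∑ j ∈ s, (β j : ℝ) * stepIncrement (a j) z = m := by
  refine ⟨∑ j ∈ s, β j * ((if a j ≤ z then 1 else 0) - if a j ≤ 0 then 1 else 0), ?_⟩
  push_cast
  rfl

theorem IsFlow.hasDerivWithinAt_left {β : Fin n → ℤ} {α τ : ℝ} (hf : IsFlow x β α τ) {i : Fin n}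
    {y : ℝ} (hi : cluster β (x τ) y = {i}) :
    HasDerivWithinAt (fun t => x t i) (velocity β (x τ) i) (Iic τ) τ := by
  have hiy : β i ≠ 0 ∧ x τ i = y := mem_cluster.1 (hi ▸ Finset.mem_singleton_self i)
  have hmem : Ioo α τ ∈ 𝓝[<] τ := Ioo_mem_nhdsLT hf.lt
  refine hasDerivWithinAt_Iic_of_tendsto_deriv (s := Ioo α τ)
    (fun t ht => (hf.ode t ht i).differentiableAt.differentiableWithinAt)
    ((hf.cont i τ ⟨hf.lt.le, le_rfl⟩).mono Ioo_subset_Icc_self) hmem ?_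
  have h1 : Tendsto (fun t => velocity β (x t) i) (𝓝[<] τ) (𝓝 (velocity β (x τ) i)) := by
    unfold velocity
    refine (tendsto_finsetSum _ fun j hj => ?_).const_mul _
    by_cases hb : β j = 0
    · simp [hb]
    · refine tendsto_const_nhds.div ((hf.tendsto i).sub (hf.tendsto j)) (sub_ne_zero.2 fun he => ?_)
      have : j ∈ cluster β (x τ) y := mem_cluster.2 ⟨hb, he ▸ hiy.2⟩
      rw [hi, Finset.mem_singleton] at this
      exact (Finset.mem_filter.1 hj).2 this
  refine h1.congr' ?_
  filter_upwards [hmem] with t ht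
  exact (hf.ode t ht i).deriv.symm

theorem abs_upperEnv_step_le (h : ParticleEvolution x b) {t : ℝ} (ht : 0 ≤ t) (y : ℝ) :
    |upperEnv Q (particleStep x b) (t, y)| ≤ 1 :=
  abs_upperEnv_le (mem_closure_Q ht) h.abs_le

/-- The only information used from the past is that the envelope equals the top value `M` along the
colliding trajectories. For a single particle this yields the inequality for its speed; for several
it excludes noncritical contact; for quartic test functions the second moment bound suffices. -/
theorem ParticleEvolution.isSubsolution (h : ParticleEvolution x b) (hn : 0 < n) {ρ : ℝ}
    (hρ : 0 < ρ) : IsSubsolution ρ (1 / (n : ℝ)) (upperEnv Q (particleStep x b)) := by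
  have husc := (upperSemicontinuousOn_upperEnv h.abs_le).mono subset_closure
  refine ⟨husc, ⟨1, fun p hp => abs_upperEnv_step_le h (le_of_lt hp) p.2⟩, ?_⟩
  rintro φ hφ ⟨τ, y⟩ hτ hmax
  have hτ : 0 < τ := hτ
  have hε : (0 : ℝ) < 1 / n := by positivity
  obtain ⟨α, β, s, hα, hf, hβ, hb, hsum, hs, htot, hle, hemp, hcurve⟩ := h.exists_profile hτ y
  obtain ⟨φ', hφ', hφ'eq, hdt, hdx⟩ := hasFDerivAt_of_contDiffOn_Q (y := y) hφ hτ
  set U := upperEnv Q (particleStep x b) with hU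
  set k := leftValue (b τ) (x τ) y with hk
  set C := cluster β (x τ) y with hC
  set M := k + 1 / (n : ℝ) * max 0 (s : ℝ) with hM
  have hUM : U (τ, y) ≤ M :=
    AnnihilatingParticles.upperEnv_le (mem_closure_Q hτ.le) h.abs_le (nhdsWithin_le_nhds hle)
  have hmax' : ∀ t z, 0 < t → U (t, z) - φ (t, z) ≤ U (τ, y) - φ (τ, y) := fun t z ht =>
    hmax (show (t, z) ∈ Q from ht)
  rcases C.eq_empty_or_nonempty with hCe | ⟨i₀, hi₀⟩
  · -- no charged particle at the point
    have hUk : ∀ᶠ p in 𝓝 (τ, y), U p = k := by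
      filter_upwards [(hemp hCe).eventually_nhds, isOpen_Q.mem_nhds (show (τ, y) ∈ Q from hτ)]
        with p hp hpQ
      refine le_antisymm ?_ ?_
      · exact AnnihilatingParticles.upperEnv_le (subset_closure hpQ) h.abs_le
          (nhdsWithin_le_nhds (hp.mono fun q hq => hq.le))
      · rw [← hp.self_of_nhds]; exact self_le_upperEnv hpQ h.abs_le
    have hmin : ∀ᶠ p in 𝓝 (τ, y), φ (τ, y) ≤ φ p := by
      filter_upwards [hUk, isOpen_Q.mem_nhds (show (τ, y) ∈ Q from hτ)] with p hp hpQ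
      have := hmax' p.1 p.2 hpQ
      rw [hp, hUk.self_of_nhds] at this
      linarith
    have h1 : dt φ (τ, y) = 0 := by
      refine IsLocalMin.hasDerivAt_eq_zero ?_ hdt
      exact (Continuous.prodMk_left y).continuousAt.eventually hmin
    have h2 : dx φ (τ, y) = 0 := by
      refine IsLocalMin.hasDerivAt_eq_zero ?_ hdx
      exact (Continuous.prodMk_right τ).continuousAt.eventually hmin
    exact ⟨fun h => absurd h2 h, fun _ => h1.le⟩
  -- On the trajectories the envelope is at least `M`, and at the contact point it is at most `M`;
  -- hence the test function was not smaller there.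
  have hpast : ∀ᶠ t in 𝓝[<] τ, ∀ i ∈ C, φ (τ, y) ≤ φ (t, x t i) := by
    filter_upwards [hcurve, Ioo_mem_nhdsLT hτ] with t ht ht0 i hi
    have h1 := hmax' t (x t i) ht0.1
    have h2 := ht i hi
    linarith
  obtain ⟨A, hA, hmom⟩ := hf.exists_moment_bounds y
  rw [← hC] at hmom
  refine ⟨fun hD => ?_, fun ⟨c, g, hg⟩ => ?_⟩
  · by_cases hcard : 2 ≤ C.card
    · -- a genuine collision
      exfalso
      set D := dx φ (τ, y) with hDdef
      -- Linearisation of `φ` at the contact point with relative error `|D| / 2` turns the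
      -- inequality along the trajectories into one-sidedness of the particles.
      refine false_of_transversal_collision C (fun t i => x t i - y) (τ := τ) (A := A)
        (K := |dt φ (τ, y)| + |D| / 2) (D := D) hA (by positivity) hD (hmom.mono fun t ht => ht.1)
        (hmom.mono fun t ht => ht.2.2 hcard) ?_
      have h1 : ∀ᶠ p in 𝓝 (τ, y), |φ p - φ (τ, y) - φ' (p - (τ, y))| ≤ |D| / 2 * ‖p - (τ, y)‖ :=
        hφ'.isLittleO.def (c := |D| / 2) (by have := abs_pos.2 hD; positivity)
      have h2 : ∀ᶠ t in 𝓝[<] τ, ∀ i ∈ C, |φ (t, x t i) - φ (τ, y) - φ' ((t, x t i) - (τ, y))| ≤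
          |D| / 2 * ‖(t, x t i) - (τ, y)‖ := by
        refine (Filter.eventually_all_finset C).2 fun i hi => ?_
        have h3 : Tendsto (fun t => (t, x t i)) (𝓝[<] τ) (𝓝 (τ, y)) := by
          refine (tendsto_nhdsWithin_of_tendsto_nhds tendsto_id).prodMk_nhds ?_
          have := hf.tendsto i
          rwa [(mem_cluster.1 hi).2] at this
        exact h3.eventually h1
      filter_upwards [h2, hpast, self_mem_nhdsWithin] with t ht1 ht2 ht3 i hi
      have ht3 : t < τ := ht3
      have h4 := (_root_.abs_le.1 (ht1 i hi)).2
      have h5 := ht2 i hi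
      rw [hφ'eq] at h4
      simp only [Prod.mk_sub_mk] at h4
      have h6 : ‖((t - τ, x t i - y) : ℝ × ℝ)‖ ≤ (τ - t) + |x t i - y| := by
        rw [Prod.norm_def, Real.norm_eq_abs, Real.norm_eq_abs, abs_of_neg (by linarith : t - τ < 0)]
        have := abs_nonneg (x t i - y)
        exact max_le (by linarith) (by linarith)
      have h7 : |D| / 2 * ‖((t - τ, x t i - y) : ℝ × ℝ)‖ ≤
          |D| / 2 * ((τ - t) + |x t i - y|) := by gcongr
      have h8 : (t - τ) * dt φ (τ, y) ≤ |dt φ (τ, y)| * (τ - t) := by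
        have := neg_abs_le (dt φ (τ, y))
        nlinarith
      linarith
    · -- a single particle
      have hcard1 : C.card = 1 := by
        have := Finset.card_pos.2 ⟨i₀, hi₀⟩
        omega
      obtain ⟨i, hi⟩ := Finset.card_eq_one.1 hcard1
      have hiC : i ∈ C := hi ▸ Finset.mem_singleton_self i
      have hiy : β i ≠ 0 ∧ x τ i = y := mem_cluster.1 hiC
      have hsβ : s = β i := by
        rw [hi, Finset.sum_singleton] at htot
        rcases htot with h' | h'
        · exact absurd h' hiy.1
        · exact h'.symm
      have hβi := hf.charge_eq hiy.1
      have hkβ : k = leftValue β (x τ) y := leftValue_congr hsum y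
      have huβ : ∀ z, particleStep x b (τ, z) = stepFunction (x τ) β z := fun z => by
        unfold particleStep stepFunction
        simp only
        rw [sum_charge_congr hsum fun v => if 0 ≤ z - v then 1 else 0]
      set s' : Finset (Fin n) := {j | j ≠ i ∧ β j ≠ 0} with hs'
      have hinc : ∀ z, particleStep x b (τ, y + z) - M = (1 / (n : ℝ)) *
          (∑ j ∈ s', (β j : ℝ) * stepIncrement (x τ j - y) z +
            ((β i : ℝ) * (if 0 ≤ z then 1 else 0) - max 0 (β i : ℝ))) := fun z => by
        have := stepFunction_sub_eq hi z
        rw [huβ, hM, hsβ, hkβ]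
        linear_combination this
      have hUu : ∀ z, particleStep x b (τ, z) ≤ U (τ, z) := fun z => self_le_upperEnv hτ h.abs_le
      have hs'ne : ∀ j ∈ s', x τ j - y ≠ 0 := fun j hj he => by
        have hj := (Finset.mem_filter.1 hj).2
        have : j ∈ C := mem_cluster.2 ⟨hj.2, by linarith⟩
        rw [hi, Finset.mem_singleton] at this
        exact hj.1 this
      -- sign of the slope
      have hflat : ∀ᶠ z in 𝓝 (0 : ℝ), ∀ j ∈ s', stepIncrement (x τ j - y) z = 0 := by
        refine (Filter.eventually_all_finset s').2 fun j hj => ?_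
        rcases lt_or_gt_of_ne (hs'ne j hj) with h' | h'
        · filter_upwards [lt_mem_nhds h'] with z hz
          simp [stepIncrement, hz.le, h'.le]
        · filter_upwards [gt_mem_nhds h'] with z hz
          simp [stepIncrement, not_le.2 hz, not_le.2 h']
      have hside : ∀ᶠ z in 𝓝 (0 : ℝ), 0 < (β i : ℝ) * z → φ (τ, y) ≤ φ (τ, y + z) := by
        filter_upwards [hflat] with z hz hβz
        have h1 := hinc z
        rw [Finset.sum_eq_zero fun j hj => by rw [hz j hj, mul_zero], zero_add] at h1
        have h2 : (β i : ℝ) * (if 0 ≤ z then 1 else 0) - max 0 (β i : ℝ) = 0 := by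
          rcases hβi with hb | hb
          · rw [hb] at hβz ⊢
            have : 0 ≤ z := by push_cast at hβz; linarith
            simp [this]
          · rw [hb] at hβz ⊢
            have : ¬ 0 ≤ z := by push_cast at hβz; linarith
            simp [this]
        rw [h2, mul_zero] at h1
        have h3 := hUu (y + z)
        have h4 := hmax' τ (y + z) hτ
        linarith
      have hdx0 : HasDerivAt (fun z => φ (τ, y + z)) (dx φ (τ, y)) 0 := by
        have h1 : HasDerivAt (fun z : ℝ => y + z) 1 0 := (hasDerivAt_id (0 : ℝ)).const_add y
        have h2 : HasDerivAt (fun z => φ (τ, z)) (dx φ (τ, y)) (y + 0) := by simpa using hdx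
        simpa [Function.comp_def] using HasDerivAt.comp (0 : ℝ) h2 h1
      have hsign : dx φ (τ, y) * β i = |dx φ (τ, y)| := by
        rcases hβi with hb | hb
        · have : 0 ≤ dx φ (τ, y) := by
            refine deriv_nonneg_of_right hdx0.hasDerivWithinAt ?_
            filter_upwards [nhdsWithin_le_nhds hside, self_mem_nhdsWithin] with z hz hz0
            have hz0 : (0 : ℝ) < z := hz0
            simpa using hz (by rw [hb]; simpa using hz0)
          rw [hb, abs_of_nonneg this]; simp
        · have : dx φ (τ, y) ≤ 0 := by
            refine deriv_nonpos_of_left hdx0.hasDerivWithinAt ?_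
            filter_upwards [nhdsWithin_le_nhds hside, self_mem_nhdsWithin] with z hz hz0
            have hz0 : z < (0 : ℝ) := hz0
            simpa using hz (by rw [hb]; push_cast; linarith)
          rw [hb, abs_of_nonpos this]; simp
      -- speed of the interface
      have hspeed : dt φ (τ, y) + velocity β (x τ) i * dx φ (τ, y) ≤ 0 := by
        have h1 : HasDerivWithinAt (fun t => (t, x t i)) (1, velocity β (x τ) i) (Iic τ) τ :=
          (hasDerivWithinAt_id τ _).prodMk (hf.hasDerivWithinAt_left hi)
        have h2 : HasFDerivAt φ φ' (τ, x τ i) := by rw [hiy.2]; exact hφ'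
        have h3 := HasFDerivAt.comp_hasDerivWithinAt (x := τ) h2 h1
        rw [hφ'eq] at h3
        have h4 := deriv_nonpos_of_left h3 (hpast.mono fun t ht => by
          simpa [hiy.2] using ht i hiC)
        simpa using h4
      set S := ∑ j ∈ s', (1 / (n : ℝ)) * (β j : ℝ) / (x τ j - y) with hS
      have hvel : velocity β (x τ) i = -(β i * S) := by
        unfold velocity
        rw [hS, Finset.mul_sum, Finset.mul_sum, ← Finset.sum_neg_distrib]
        symm
        refine Finset.sum_subset_zero_on_sdiff (fun j hj => ?_) (fun j hj => ?_) fun j hj => ?_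
        · exact Finset.mem_filter.2 ⟨Finset.mem_univ _, (Finset.mem_filter.1 hj).2.1⟩
        · have hj' := Finset.mem_sdiff.1 hj
          have : β j = 0 := by
            by_contra hb
            exact hj'.2 (Finset.mem_filter.2
              ⟨Finset.mem_univ _, (Finset.mem_filter.1 hj'.1).2, hb⟩)
          simp [this]
        · have := hs'ne j hj
          rw [hiy.2, ← neg_sub (x τ j) y]
          field_simp
      -- the nonlocal operator
      let g : ℝ → ℝ := fun z => ∑ j ∈ s', (1 / (n : ℝ) * β j) * stepIncrement (x τ j - y) z +
        1 / n * (β i / 2 * SignType.sign z)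
      have hgm : Measurable fun z : ℝ => 1 / (n : ℝ) * ((β i : ℝ) / 2 * SignType.sign z) := by
        have h1 : Measurable fun z : ℝ => ((SignType.sign z : SignType) : ℝ) := by
          have h2 : (fun z : ℝ => ((SignType.sign z : SignType) : ℝ)) =
              fun z => (if 0 < z then 1 else 0) - if z < 0 then 1 else 0 := by
            ext z
            rcases lt_trichotomy z 0 with hz | hz | hz
            · simp [hz, not_lt.2 hz.le, sign_neg hz]
            · simp [hz]
            · simp [hz, not_lt.2 hz.le, sign_pos hz]
          rw [h2]
          exact (Measurable.ite measurableSet_Ioi measurable_const measurable_const).sub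
            (Measurable.ite measurableSet_Iio measurable_const measurable_const)
        fun_prop
      have hgs : Measurable fun z => ∑ j ∈ s', (1 / (n : ℝ) * β j) *
          stepIncrement (x τ j - y) z :=
        Finset.measurable_fun_sum _ fun j _ => (measurable_stepIncrement _).const_mul _
      have hsb : ∀ z : ℝ, |1 / (n : ℝ) * ((β i : ℝ) / 2 * SignType.sign z)| ≤
          |1 / (n : ℝ) * ((β i : ℝ) / 2)| := fun z => by
        rw [← mul_assoc, abs_mul]
        refine mul_le_of_le_one_right (abs_nonneg _) ?_
        rcases lt_trichotomy z 0 with hz | hz | hz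
        · simp [sign_neg hz]
        · simp [hz]
        · simp [sign_pos hz]
      have hgb : ∀ z, |g z| ≤ ∑ j ∈ s', |1 / (n : ℝ) * β j| + |1 / (n : ℝ) * ((β i : ℝ) / 2)| := by
        intro z
        refine (abs_add_le _ _).trans (add_le_add ((Finset.abs_sum_le_sum_abs _ _).trans
          (Finset.sum_le_sum fun j _ => ?_)) (hsb z))
        rw [abs_mul]
        exact mul_le_of_le_one_right (abs_nonneg _) (abs_stepIncrement_le _ _)
      have hgU : ∀ z ≠ 0, g z ≤ stairUpper (1 / n) (U (τ, y + z) - U (τ, y)) := by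
        intro z hz
        obtain ⟨m, hm⟩ := exists_int_sum_stepIncrement s' β (fun j => x τ j - y) z
        obtain ⟨m', hm', hm''⟩ : ∃ m' : ℤ,
            (β i : ℝ) * (if 0 ≤ z then 1 else 0) - max 0 (β i : ℝ) = m' ∧
            (m' : ℝ) + 1 / 2 = (β i : ℝ) / 2 * SignType.sign z := by
          rcases lt_or_gt_of_ne hz with hz | hz <;> rcases hβi with hb | hb
          · exact ⟨-1, by rw [hb]; norm_num [not_le.2 hz], by rw [hb, sign_neg hz]; norm_num⟩
          · exact ⟨0, by rw [hb]; norm_num [not_le.2 hz], by rw [hb, sign_neg hz]; norm_num⟩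
          · exact ⟨0, by rw [hb]; norm_num [hz.le], by rw [hb, sign_pos hz]; norm_num⟩
          · exact ⟨-1, by rw [hb]; norm_num [hz.le], by rw [hb, sign_pos hz]; norm_num⟩
        have h1 := hinc z
        rw [hm, hm'] at h1
        have h2 : 1 / (n : ℝ) * ((m + m' : ℤ) : ℝ) ≤ U (τ, y + z) - U (τ, y) := by
          have := hUu (y + z)
          push_cast
          linarith
        refine le_trans (le_of_eq ?_) (stairUpper_mono hε h2)
        rw [stairUpper_int_mul hε]
        simp only [g, mul_assoc]
        rw [← Finset.mul_sum, hm, ← hm'']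
        push_cast; ring
      obtain ⟨r₀, hr₀, hop⟩ := le_nonlocalOp (ρ := ρ) (f := fun z => φ (τ, z))
        (u := fun z => U (τ, z)) (x := y) hε hρ hdx hD
        (continuous_iff_continuousAt.2 fun z =>
          (hasFDerivAt_of_contDiffOn_Q (y := z) hφ hτ).choose_spec.2.2.2.continuousAt)
        (measurable_slice_of_upperSemicontinuousOn husc hτ)
        (fun z => abs_upperEnv_step_le h hτ.le z)
        (fun z => by have := hmax' τ (y + z) hτ; linarith) (hgs.add hgm) hgb hgU
      obtain ⟨r₁, hr₁, hr₁s⟩ : ∃ r₁ > 0, ∀ j ∈ s', r₁ < |x τ j - y| := by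
        rcases s'.eq_empty_or_nonempty with he | hne
        · exact ⟨1, one_pos, by simp [he]⟩
        · obtain ⟨j, hj, hmin⟩ := s'.exists_min_image (fun j => |x τ j - y|) hne
          have := abs_pos.2 (hs'ne j hj)
          exact ⟨|x τ j - y| / 2, by linarith, fun l hl => by have := hmin l hl; linarith⟩
      have hr : 0 < min r₀ r₁ / 2 := by positivity
      have hr0 : min r₀ r₁ / 2 < r₀ := by have := min_le_left r₀ r₁; linarith
      have hr1 : min r₀ r₁ / 2 < r₁ := by have := min_le_right r₀ r₁; linarith
      have h1 := hop _ ⟨hr, hr0⟩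
      simp only [Pi.add_apply] at h1
      rw [integral_sum_stepIncrement s' _ _ hr (fun j hj => hr1.trans (hr₁s j hj)) hgm hsb,
        setIntegral_odd_eq_zero (measurableSet_lt_abs _) (by intro z; simp) (by
          intro z _
          rw [Left.sign_neg, neg_sq]
          push_cast; ring), add_zero] at h1
      rw [hvel] at hspeed
      have h2 : dt φ (τ, y) ≤ S * |dx φ (τ, y)| := by
        rw [← hsign]; linarith
      refine h2.trans ?_
      unfold hamiltonian
      gcongr
  · -- quartic test functions
    -- Since `(x t i₀ - y)² ≤ A (τ - t)`, the term `K (t - τ)²` dominates the quartic one along the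
    -- trajectory, and its derivative at `τ` is zero.
    obtain ⟨K, hK⟩ : ∃ K, K = |c| * A ^ 2 := ⟨_, rfl⟩
    have h0 : HasDerivAt (fun t => φ (t, y) + K * (t - τ) ^ 2) (dt φ (τ, y)) τ := by
      have h1 : HasDerivAt (fun t => K * (t - τ) ^ 2) 0 τ := by
        have := (((hasDerivAt_id τ).sub_const τ).fun_pow 2).const_mul K
        simpa using this
      simpa using hdt.fun_add h1
    refine deriv_nonpos_of_left h0.hasDerivWithinAt ?_
    filter_upwards [hpast, hmom, Ioo_mem_nhdsLT hτ] with t ht1 ht2 ht3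
    have h1 := ht1 i₀ hi₀
    have hφt : ∀ z, φ (t, z) = c * |z - y| ^ 4 + g t := fun z => hg (t, z) ht3.1
    have h2 : (x t i₀ - y) ^ 2 ≤ A * (τ - t) :=
      (Finset.single_le_sum (f := fun i => (x t i - y) ^ 2) (fun i _ => sq_nonneg _) hi₀).trans
        ht2.2.1
    have h3 : c * |x t i₀ - y| ^ 4 ≤ K * (t - τ) ^ 2 := by
      have h4 : |x t i₀ - y| ^ 4 = ((x t i₀ - y) ^ 2) ^ 2 := by
        rw [Even.pow_abs (by decide)]; ring
      rw [h4, hK]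
      calc c * ((x t i₀ - y) ^ 2) ^ 2 ≤ |c| * ((x t i₀ - y) ^ 2) ^ 2 := by
            gcongr; exact le_abs_self c
        _ ≤ |c| * (A * (τ - t)) ^ 2 := by gcongr
        _ = _ := by ring
    have h5 := hφt (x t i₀)
    have h6 := hφt y
    simp only [sub_self, abs_zero, ne_eq, OfNat.ofNat_ne_zero, not_false_eq_true, zero_pow,
      mul_zero, zero_add, add_zero] at h6 ⊢
    linarith

end Viscosity

/-! ### Envelopes at the initial time -/

section Initial

variable {n : ℕ} {x : ℝ → Fin n → ℝ} {b : ℝ → Fin n → ℤ}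

theorem particleStep_neg (x : ℝ → Fin n → ℝ) (b : ℝ → Fin n → ℤ) :
    particleStep x (-b) = -particleStep x b := by
  ext p
  simp [particleStep, stepFunction, ← mul_neg, ← Finset.sum_neg_distrib]
  exact Or.inl (Finset.sum_congr rfl fun i _ => by split_ifs <;> simp)

theorem stepFunction_neg (ξ : Fin n → ℝ) (β : Fin n → ℤ) :
    stepFunction ξ (-β) = -stepFunction ξ β := by
  ext p
  simp [stepFunction, ← mul_neg, ← Finset.sum_neg_distrib]
  exact Or.inl (Finset.sum_congr rfl fun i _ => by split_ifs <;> simp)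

theorem sum_filter_le_sum_max (s : Finset (Fin n)) (p : Fin n → Prop) [DecidablePred p]
    (c : Fin n → ℝ) : ∑ i ∈ s with p i, c i ≤ ∑ i ∈ s, max 0 (c i) := by
  rw [Finset.sum_filter]
  refine Finset.sum_le_sum fun i _ => ?_
  split_ifs
  · exact le_max_right _ _
  · exact le_max_left _ _

/-- The same closed formula as in the lower bound `ParticleEvolution.le_upperEnv`; this identifies
the trace of the space-time envelope with the envelope of the datum. -/
theorem upperEnv_stepFunction {ξ : Fin n → ℝ} {β : Fin n → ℤ} (h : (ξ, β) ∈ stateSpace n) (y : ℝ) :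
    upperEnv univ (stepFunction ξ β) y = leftValue β ξ y +
      (1 / (n : ℝ)) * ∑ i ∈ cluster β ξ y, max 0 (β i : ℝ) := by
  have hn : (0 : ℝ) ≤ 1 / n := by positivity
  have hC : ∀ z ∈ univ, |stepFunction ξ β z| ≤ 1 := fun z _ => abs_stepFunction_le h z
  obtain ⟨r, hr, hloc⟩ := exists_local_radius ξ y
  have hval : ∀ y', |y' - y| < r → stepFunction ξ β y' = leftValue β ξ y +
      (1 / (n : ℝ)) * ∑ i ∈ cluster β ξ y with ξ i ≤ y', (β i : ℝ) := fun y' hy' =>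
    stepFunction_eq_leftValue_add (hloc ξ (fun i => by simpa using hr) y' hy') β
  refine le_antisymm (upperEnv_le (by simp) hC ?_) (le_upperEnv hC ?_)
  · rw [nhdsWithin_univ]
    filter_upwards [Metric.ball_mem_nhds y hr] with y' hy'
    rw [hval y' (by simpa [Real.dist_eq] using hy')]
    gcongr
    exact sum_filter_le_sum_max _ _ _
  · rw [nhdsWithin_univ]
    have hy : ∀ᶠ y' in 𝓝 y, stepFunction ξ β y' = leftValue β ξ y +
        (1 / (n : ℝ)) * ∑ i ∈ cluster β ξ y with ξ i ≤ y', (β i : ℝ) := by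
      filter_upwards [Metric.ball_mem_nhds y hr] with y' hy'
      exact hval y' (by simpa [Real.dist_eq] using hy')
    rcases cluster_eq_empty_or_singleton h y with he | ⟨i, hi, hb⟩
    · refine Eventually.frequently (hy.mono fun y' hy' => ?_)
      rw [hy', he]; simp
    · have hxi : ξ i = y := (mem_cluster.1 (hi ▸ Finset.mem_singleton_self i)).2
      rcases hb with hb | hb
      · refine fun hcon => hcon.self_of_nhds ?_
        simp only
        rw [hy.self_of_nhds, hi]; simp [Finset.filter_singleton, hb, hxi]
      · have h1 : ∃ᶠ y' in 𝓝[<] y, leftValue β ξ y + (1 / (n : ℝ)) *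
            ∑ i ∈ cluster β ξ y, max 0 (β i : ℝ) ≤ stepFunction ξ β y' := by
          refine Eventually.frequently ?_
          filter_upwards [nhdsWithin_le_nhds hy, self_mem_nhdsWithin] with y' hy' hlt
          have hlt : y' < y := hlt
          rw [hy', hi]; simp [Finset.filter_singleton, hb, hxi, not_le.2 hlt]
        exact h1.filter_mono nhdsWithin_le_nhds

theorem ParticleEvolution.upperEnv_zero (h : ParticleEvolution x b) (y : ℝ) :
    upperEnv Q (particleStep x b) (0, y) = upperEnv univ (stepFunction (x 0) (b 0)) y := by
  rw [upperEnv_stepFunction (h.mem 0 le_rfl)]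
  refine le_antisymm ?_ (h.le_upperEnv le_rfl y)
  refine AnnihilatingParticles.upperEnv_le (mem_closure_Q le_rfl) h.abs_le ?_
  filter_upwards [nhdsWithin_le_nhds (h.eventually_eq_right le_rfl y), self_mem_nhdsWithin]
    with p hp hpQ
  rw [hp (LT.lt.le hpQ)]
  gcongr
  exact sum_filter_le_sum_max _ _ _

theorem ParticleEvolution.hasInitialEnvelopes (h : ParticleEvolution x b) :
    HasInitialEnvelopes (particleStep x b) (stepFunction (x 0) (b 0)) := by
  refine fun y => ⟨h.upperEnv_zero y, ?_⟩
  rw [lowerEnv_eq_neg (mem_closure_Q le_rfl) h.abs_le, ← particleStep_neg, h.neg.upperEnv_zero,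
    lowerEnv_eq_neg (C := 1) (by simp) fun z _ => abs_stepFunction_le (h.mem 0 le_rfl) z,
    ← stepFunction_neg]
  rfl

end Initial

/-! ### Exchanging sub- and supersolutions by negation -/

section Negation

variable {ε ρ : ℝ}

/-- A `limUnder` commutes with negation only when the limit exists. Here the truncated integrals are
eventually constant, because the slope is not zero. -/
theorem pvIntegral_stairLower (hε : 0 < ε) (hρ : 0 < ρ) {f : ℝ → ℝ} {f' x : ℝ}
    (hf : HasDerivAt f f' x) (hf' : f' ≠ 0) (hc : Continuous f) :
    pvIntegral ρ (fun z => stairLower ε (f (x + z) - f x)) =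
      -pvIntegral ρ (fun z => stairUpper ε (-f (x + z) - -f x)) := by
  obtain ⟨r, hr, h⟩ := exists_stairUpper_odd hε hf.fun_neg (neg_ne_zero.2 hf')
  have hm : Measurable fun z => stairUpper ε (-f (x + z) - -f x) :=
    measurable_stairUpper.comp (by fun_prop)
  obtain ⟨B, hB⟩ := (isCompact_Icc (a := x - ρ) (b := x + ρ)).exists_bound_of_continuousOn
    (f := fun y => -f y - -f x) (by fun_prop)
  have hB' : ∀ z, |z| < ρ → |stairUpper ε (-f (x + z) - -f x)| ≤ B + ε := fun z hz => by
    refine (abs_stairUpper_le hε _).trans ?_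
    have := abs_lt.1 hz
    gcongr
    exact hB (x + z) ⟨by linarith, by linarith⟩
  have hq : 0 < min r ρ / 2 := by positivity
  have hqr : min r ρ / 2 < r := by have := min_le_left r ρ; linarith
  have hqρ : min r ρ / 2 < ρ := by have := min_le_right r ρ; linarith
  have h1 : (fun z => stairLower ε (f (x + z) - f x)) =
      fun z => -stairUpper ε (-f (x + z) - -f x) := by
    ext z
    rw [stairLower_eq_neg]
    congr 2; ring
  rw [h1, pvIntegral_eq hq hm hB' (fun z hz => h z (hz.trans hqr.le)) hqρ,
    pvIntegral_eq hq hm.fun_neg (B := B + ε) (fun z hz => by rw [abs_neg]; exact hB' z hz)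
    (fun z hz hz0 => by rw [h z (hz.trans hqr.le) hz0]) hqρ, ← integral_neg]
  simp only [neg_div]

theorem hamiltonian_stairLower (hε : 0 < ε) (hρ : 0 < ρ) {ψ v w : ℝ × ℝ → ℝ} {p : ℝ × ℝ}
    (hp : p ∈ Q) (hψ : ContDiffOn ℝ 2 ψ Q) (hvw : ∀ p ∈ Q, v p = -w p) (hd : dx ψ p ≠ 0) :
    hamiltonian (stairLower ε) ρ ψ v p = -hamiltonian (stairUpper ε) ρ (-ψ) w p := by
  obtain ⟨t, y⟩ := p
  have hdx := (hasFDerivAt_of_contDiffOn_Q (y := y) hψ hp).choose_spec.2.2.2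
  have hc : Continuous fun z => ψ (t, z) := continuous_iff_continuousAt.2 fun z =>
    (hasFDerivAt_of_contDiffOn_Q (y := z) hψ hp).choose_spec.2.2.2.continuousAt
  have h1 : dx (-ψ) (t, y) = -dx ψ (t, y) := hdx.fun_neg.deriv
  unfold hamiltonian nonlocalOp
  simp only
  rw [pvIntegral_stairLower hε hρ hdx hd hc, h1, abs_neg, ← neg_mul, neg_add, ← integral_neg]
  congr 2
  refine integral_congr_ae (Eventually.of_forall fun z => ?_)
  simp only
  rw [hvw _ (show (t, y + z) ∈ Q from hp), hvw _ hp, stairLower_eq_neg, neg_div]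
  congr 3; ring

/-- The two staircases are reflections of each other and the class of test functions is symmetric.
Everything about supersolutions is obtained through this from the subsolution for the negated
charges. -/
theorem isSupersolution_iff_neg (hε : 0 < ε) (hρ : 0 < ρ) {v w : ℝ × ℝ → ℝ}
    (hvw : ∀ p ∈ Q, v p = -w p) : IsSupersolution ρ ε v ↔ IsSubsolution ρ ε w := by
  have hdt : ∀ (ψ : ℝ × ℝ → ℝ) p, dt (-ψ) p = -dt ψ p := fun ψ p => by
    unfold dt; simp
  have hdx : ∀ (ψ : ℝ × ℝ → ℝ) p, dx (-ψ) p = -dx ψ p := fun ψ p => by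
    unfold dx; simp
  have hquart : ∀ (ψ : ℝ × ℝ → ℝ) p, IsQuarticAt ψ p → IsQuarticAt (-ψ) p := by
    rintro ψ p ⟨c, g, h⟩
    exact ⟨-c, -g, fun q hq => by rw [Pi.neg_apply, h q hq]; simp; ring⟩
  constructor
  · rintro ⟨h1, ⟨C, h2⟩, h3⟩
    have hwv : ∀ p ∈ Q, w p = -v p := fun p hp => by rw [hvw p hp, neg_neg]
    refine ⟨fun p hp c hc => ?_, ⟨C, fun p hp => by rw [hwv p hp, abs_neg]; exact h2 p hp⟩,
      fun φ hφ p hp hmax => ?_⟩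
    · filter_upwards [h1 p hp (-c) (by have hc : w p < c := hc; rw [hwv p hp] at hc; linarith), self_mem_nhdsWithin] with q hq hqQ
      rw [hwv q hqQ]; linarith
    · obtain ⟨h4, h5⟩ := h3 (-φ) hφ.neg p hp fun q hq => by
        have := hmax hq
        simp only [mem_ofPred_eq, Pi.neg_apply] at this ⊢
        rw [hvw q hq, hvw p hp]; linarith
      refine ⟨fun hd => ?_, fun hqu => ?_⟩
      · have h6 := h4 (by rw [hdx]; exact neg_ne_zero.2 hd)
        rw [hamiltonian_stairLower (ψ := -φ) hε hρ hp hφ.neg hvw (by rw [hdx]; exact neg_ne_zero.2 hd),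
          neg_neg, hdt] at h6
        linarith
      · have h6 := h5 (hquart _ _ hqu)
        rw [hdt] at h6
        linarith
  · rintro ⟨h1, ⟨C, h2⟩, h3⟩
    refine ⟨fun p hp c hc => ?_, ⟨C, fun p hp => by rw [hvw p hp, abs_neg]; exact h2 p hp⟩,
      fun φ hφ p hp hmin => ?_⟩
    · filter_upwards [h1 p hp (-c) (by have hc : c < v p := hc; rw [hvw p hp] at hc; linarith), self_mem_nhdsWithin] with q hq hqQ
      rw [hvw q hqQ]; linarith
    · obtain ⟨h4, h5⟩ := h3 (-φ) hφ.neg p hp fun q hq => by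
        have := hmin hq
        simp only [mem_ofPred_eq, Pi.neg_apply] at this ⊢
        rw [hvw q hq, hvw p hp] at this; linarith
      refine ⟨fun hd => ?_, fun hqu => ?_⟩
      · have h6 := h4 (by rw [hdx]; exact neg_ne_zero.2 hd)
        rw [hamiltonian_stairLower hε hρ hp hφ hvw hd]
        rw [hdt] at h6
        linarith
      · have h6 := h5 (hquart _ _ hqu)
        rw [hdt] at h6
        linarith

theorem ParticleEvolution.isViscositySolution {n : ℕ} {x : ℝ → Fin n → ℝ} {b : ℝ → Fin n → ℤ}
    (h : ParticleEvolution x b) (hn : 0 < n) (hρ : 0 < ρ) :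
    IsViscositySolution ρ (1 / (n : ℝ)) (particleStep x b) := by
  refine ⟨⟨1, h.abs_le⟩, h.isSubsolution hn hρ, ?_⟩
  refine (isSupersolution_iff_neg (by positivity) hρ fun p hp => ?_).2 (h.neg.isSubsolution hn hρ)
  rw [lowerEnv_eq_neg (subset_closure hp) h.abs_le, ← particleStep_neg]

end Negation

/-! ### Layered barriers -/

section Layers

variable {Λ : Type*} [Fintype Λ] [DecidableEq Λ] {ε κ : ℝ} {f : Λ → ℝ → ℝ} {i : Λ} {y : ℝ}

/-- All layers but `i` are saturated at `y`, so rounding them up at `y + z` changes the increment to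
an integer multiple of `ε`. The layer `i` is positive at `y`, so its own increment is below 1: its
floor is at most 0, and at most `-1` if it decreases. The offset of the staircase accounts for
`1/2`. -/
theorem stairUpper_layers_le (hε : 0 < ε) (h1 : ∀ k x, f k x ≤ 1)
    (hi : 0 < f i y) (hk : ∀ k ≠ i, f k y = 0 ∨ f k y = 1) (z : ℝ) :
    stairUpper ε (κ + ε * ∑ k, f k (y + z) - (κ + ε * ∑ k, f k y)) ≤
      ε * (∑ k ∈ Finset.univ.erase i, ((if 0 < f k (y + z) then 1 else 0) - f k y) +
        ((if f i y ≤ f i (y + z) then 1 else 0) - 1 / 2)) := by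
  obtain ⟨m, hm⟩ : ∃ m : ℤ,
      ∑ k ∈ Finset.univ.erase i, ((if 0 < f k (y + z) then (1 : ℝ) else 0) - f k y) = m := by
    refine ⟨∑ k ∈ Finset.univ.erase i,
      ((if 0 < f k (y + z) then 1 else 0) - if f k y = 1 then 1 else 0), ?_⟩
    push_cast
    refine Finset.sum_congr rfl fun k hk' => ?_
    congr 1
    rcases hk k (Finset.ne_of_mem_erase hk') with h | h <;> simp [h]
  have hle : ∑ k ∈ Finset.univ.erase i, (f k (y + z) - f k y) ≤ m := by
    rw [← hm]
    refine Finset.sum_le_sum fun k _ => ?_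
    gcongr
    split_ifs with h
    · exact h1 k _
    · exact not_lt.1 h
  have h2 : κ + ε * ∑ k, f k (y + z) - (κ + ε * ∑ k, f k y) =
      ε * (∑ k ∈ Finset.univ.erase i, (f k (y + z) - f k y) + (f i (y + z) - f i y)) := by
    rw [Finset.sum_erase_eq_sub (Finset.mem_univ i), Finset.sum_sub_distrib]
    ring
  unfold stairUpper
  rw [h2, mul_div_cancel_left₀ _ hε.ne', hm]
  have h3 : ⌊∑ k ∈ Finset.univ.erase i, (f k (y + z) - f k y) + (f i (y + z) - f i y)⌋ ≤
      m + ((if f i y ≤ f i (y + z) then 1 else 0) - 1) := by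
    rw [← Int.lt_add_one_iff, Int.floor_lt]
    push_cast
    have := h1 i (y + z)
    split_ifs with h
    · linarith
    · have := not_le.1 h
      linarith
  have h4 : ((⌊∑ k ∈ Finset.univ.erase i, (f k (y + z) - f k y) +
      (f i (y + z) - f i y)⌋ : ℤ) : ℝ) ≤ m + ((if f i y ≤ f i (y + z) then 1 else 0) - 1) := by
    have := (Int.cast_le (R := ℝ)).2 h3
    push_cast at this
    exact this
  refine mul_le_mul_of_nonneg_left ?_ hε.le
  linarith

/-- The majorants of the layers are only required almost everywhere, since those of the active layer
fail at isolated points such as `z = 0`. -/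
theorem integral_layers_le (hε : 0 < ε) (h0 : ∀ k x, 0 ≤ f k x) (h1 : ∀ k x, f k x ≤ 1)
    (hf : ∀ k, Measurable (f k)) (hi : 0 < f i y) (hk : ∀ k ≠ i, f k y = 0 ∨ f k y = 1)
    {g : Λ → ℝ → ℝ} {m : Λ → ℝ} {B r : ℝ} (hg : ∀ k, Measurable (g k)) (hgB : ∀ k z, |g k z| ≤ B)
    (hr : 0 < r) (hgk : ∀ k ≠ i, ∀ᵐ z, (if 0 < f k (y + z) then 1 else 0) - f k y ≤ g k z)
    (hgi : ∀ᵐ z, (if f i y ≤ f i (y + z) then 1 else 0) - 1 / 2 ≤ g i z)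
    (hm : ∀ k, ∫ z in {z : ℝ | r < |z|}, g k z / z ^ 2 = m k) :
    ∫ z in {z : ℝ | r < |z|},
      stairUpper ε (κ + ε * ∑ k, f k (y + z) - (κ + ε * ∑ k, f k y)) / z ^ 2 ≤
      ε * ∑ k, m k := by
  have hint : ∀ k, IntegrableOn (fun z => g k z / z ^ 2) {z : ℝ | r < |z|} := fun k =>
    integrableOn_div_sq hr (measurableSet_lt_abs r) subset_rfl (hg k) fun z _ => hgB k z
  have h2 : ε * ∑ k, m k = ∫ z in {z : ℝ | r < |z|}, ε * ∑ k, g k z / z ^ 2 := by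
    rw [integral_const_mul, integral_finsetSum _ fun k _ => hint k]
    simp only [hm]
  rw [h2]
  have hfm : Measurable fun z =>
      stairUpper ε (κ + ε * ∑ k, f k (y + z) - (κ + ε * ∑ k, f k y)) :=
    measurable_stairUpper.comp (by fun_prop)
  refine setIntegral_mono_ae ?_ ((integrable_finsetSum _ fun k _ => hint k).const_mul ε) ?_
  · refine integrableOn_div_sq (B := |ε| * (Fintype.card Λ : ℝ) + ε) hr (measurableSet_lt_abs r)
      subset_rfl hfm fun z _ => (abs_stairUpper_le hε _).trans ?_
    have h3 : κ + ε * ∑ k, f k (y + z) - (κ + ε * ∑ k, f k y) =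
        ε * ∑ k, (f k (y + z) - f k y) := by rw [Finset.sum_sub_distrib]; ring
    rw [h3, abs_mul]
    gcongr
    refine (Finset.abs_sum_le_sum_abs _ _).trans
      ((Finset.sum_le_sum (g := fun _ => (1 : ℝ)) fun k _ => ?_).trans (by simp))
    rw [abs_le]
    constructor <;> linarith [h0 k y, h0 k (y + z), h1 k y, h1 k (y + z)]
  · have h5 : ∀ᵐ z, ∀ k ≠ i, (if 0 < f k (y + z) then 1 else 0) - f k y ≤ g k z := by
      rw [ae_all_iff]
      intro k
      rw [ae_all_iff]
      exact hgk k
    filter_upwards [h5, hgi] with z hz hzi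
    rw [← Finset.sum_div, ← mul_div_assoc]
    gcongr
    refine (stairUpper_layers_le hε h1 hi hk z).trans ?_
    rw [← Finset.sum_erase_add _ _ (Finset.mem_univ i)]
    gcongr with k hk'
    exact hz k (Finset.ne_of_mem_erase hk')

end Layers

/-! ### The profile of the layers -/

section Transition

theorem differentiable_smoothTransition : Differentiable ℝ Real.smoothTransition :=
  (Real.smoothTransition.contDiff (n := 1)).differentiable (by norm_num)

/-- Equality would make the monotone function constant on `[s, s₀]` and its derivative from the left
zero. This gives strict monotonicity exactly at the points where a layer is active. -/
theorem lt_of_deriv_ne_zero {χ : ℝ → ℝ} (hχ : Monotone χ) {s₀ s : ℝ} (h : deriv χ s₀ ≠ 0)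
    (hs : s < s₀) : χ s < χ s₀ := by
  refine lt_of_le_of_ne (hχ hs.le) fun he => h ?_
  have hd : DifferentiableAt ℝ χ s₀ := by
    by_contra hd
    exact h (deriv_zero_of_not_differentiableAt hd)
  have h1 : HasDerivWithinAt χ 0 (Icc s s₀) s₀ := by
    refine (hasDerivWithinAt_const s₀ (Icc s s₀) (χ s₀)).congr (fun u hu => ?_) rfl
    exact le_antisymm (hχ hu.2) (he ▸ hχ hu.1)
  exact (uniqueDiffOn_Icc hs s₀ ⟨hs.le, le_rfl⟩).eq_deriv _ hd.hasDerivAt.hasDerivWithinAt h1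

theorem deriv_smoothTransition_nonneg (s : ℝ) : 0 ≤ deriv Real.smoothTransition s :=
  Real.smoothTransition.monotone.deriv_nonneg

theorem deriv_smoothTransition_eq_zero {s : ℝ} (hs : s ≤ 0 ∨ 1 ≤ s) :
    deriv Real.smoothTransition s = 0 := by
  rcases hs with hs | hs
  · refine IsLocalMin.deriv_eq_zero (Eventually.of_forall fun u => ?_)
    rw [Real.smoothTransition.zero_of_nonpos hs]
    exact Real.smoothTransition.nonneg u
  · refine IsLocalMax.deriv_eq_zero (Eventually.of_forall fun u => ?_)
    rw [Real.smoothTransition.one_of_one_le hs]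
    exact Real.smoothTransition.le_one u

theorem deriv_smoothTransition_pos {s : ℝ} (hs : deriv Real.smoothTransition s ≠ 0) :
    0 < deriv Real.smoothTransition s :=
  lt_of_le_of_ne (deriv_smoothTransition_nonneg s) hs.symm

theorem deriv_smoothTransition_ne_zero {s : ℝ} (hs : deriv Real.smoothTransition s ≠ 0) :
    0 < s ∧ s < 1 := by
  by_contra! h
  refine hs (deriv_smoothTransition_eq_zero ?_)
  by_contra! h'
  exact absurd (h h'.1) (not_le.2 h'.2)

theorem eventually_smoothTransition_le {s : ℝ} (hs : 0 < deriv Real.smoothTransition s) :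
    ∀ᶠ u in 𝓝 (0 : ℝ), 0 ≤ u → Real.smoothTransition (s - u) ≤
      Real.smoothTransition s - deriv Real.smoothTransition s / 2 * u := by
  have h := (hasDerivAt_iff_isLittleO_nhds_zero.1
    (differentiable_smoothTransition s).hasDerivAt).def (half_pos hs)
  have h2 : Tendsto (fun u : ℝ => -u) (𝓝 0) (𝓝 0) := by simpa using (continuous_neg (G := ℝ)).tendsto 0
  filter_upwards [h2.eventually h] with u hu hu0
  rw [Real.norm_eq_abs, Real.norm_eq_abs, abs_neg, abs_of_nonneg hu0, smul_eq_mul] at hu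
  have := (abs_le.1 hu).2
  rw [sub_eq_add_neg]
  linarith

end Transition

/-! ### A single wall and a single bump -/

section WallBump

/-- The argument of the profile of a smoothed jump moving along the curve `a`. -/
def wallArg (δ L τ σ : ℝ) (a : ℝ → ℝ) (q : ℝ × ℝ) : ℝ :=
  σ * (q.2 - a q.1) / δ + Real.exp (L * (q.1 - τ))

/-- The argument of the profile of a smoothed point excess at `p`, shrinking in time. -/
def bumpArg (δ c τ p : ℝ) (q : ℝ × ℝ) : ℝ :=
  1 - ((q.2 - p) ^ 2 + c * (q.1 - τ)) / δ ^ 2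

/-- The arguments of all the layers. -/
def layerArg {ι μ : Type*} (δ L c τ : ℝ) (σ : ι → ℝ) (a : ι → ℝ → ℝ) (p : μ → ℝ) :
    ι ⊕ μ → ℝ × ℝ → ℝ :=
  Sum.elim (fun k => wallArg δ L τ (σ k) (a k)) fun k => bumpArg δ c τ (p k)

/-- The layered barrier. -/
def layerBarrier {ι μ : Type*} [Fintype ι] [Fintype μ] (ε κ δ L c τ : ℝ) (σ : ι → ℝ)
    (a : ι → ℝ → ℝ) (p : μ → ℝ) (q : ℝ × ℝ) : ℝ :=
  κ + ε * ∑ k, Real.smoothTransition (layerArg δ L c τ σ a p k q)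

variable {δ L τ σ c t y : ℝ} {a : ℝ → ℝ}

theorem hasDerivAt_wallArg_right (z : ℝ) :
    HasDerivAt (fun z => wallArg δ L τ σ a (t, z)) (σ / δ) z := by
  unfold wallArg
  have h := ((((hasDerivAt_id z).sub_const (a t)).const_mul σ).div_const δ).add_const
    (Real.exp (L * (t - τ)))
  simpa using h

theorem hasDerivAt_wallArg_left {a' : ℝ} (ha : HasDerivAt a a' t) :
    HasDerivAt (fun s => wallArg δ L τ σ a (s, y))
      (-(σ * a') / δ + L * Real.exp (L * (t - τ))) t := by
  unfold wallArg
  have h1 := (((ha.const_sub y).const_mul σ).div_const δ)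
  have h2 : HasDerivAt (fun s => L * (s - τ)) L t := by
    simpa using ((hasDerivAt_id t).sub_const τ).const_mul L
  have h3 := h1.fun_add h2.exp
  exact h3.congr_deriv (by ring)

theorem hasDerivAt_bumpArg_right {p : ℝ} (z : ℝ) :
    HasDerivAt (fun z => bumpArg δ c τ p (t, z)) (-(2 * (z - p)) / δ ^ 2) z := by
  unfold bumpArg
  have h := ((((((hasDerivAt_id z).sub_const p).fun_pow 2).add_const (c * (t - τ))).div_const
    (δ ^ 2)).const_sub 1)
  exact h.congr_deriv (by simp; ring)

theorem hasDerivAt_bumpArg_left {p : ℝ} :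
    HasDerivAt (fun s => bumpArg δ c τ p (s, y)) (-c / δ ^ 2) t := by
  unfold bumpArg
  have h2 : HasDerivAt (fun s => (y - p) ^ 2 + c * (s - τ)) c t := by
    simpa using (((hasDerivAt_id t).sub_const τ).const_mul c).const_add ((y - p) ^ 2)
  have h := ((h2.div_const (δ ^ 2)).const_sub 1)
  exact h.congr_deriv (by ring)

/-- The offset is between 1 and 2: at distance `2δ` the wall has already gone down to 0 on its low
side, whereas on its high side it is saturated up to the centre. -/
theorem wallArg_of_le (hδ : 0 < δ) (hE : Real.exp (L * (t - τ)) ≤ 2)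
    (h : 2 * δ ≤ |y - a t|) (hσ : σ = 1 ∨ σ = -1) (hL : 1 ≤ Real.exp (L * (t - τ))) :
    (0 ≤ σ * (y - a t) → 1 ≤ wallArg δ L τ σ a (t, y)) ∧
      (σ * (y - a t) ≤ 0 → wallArg δ L τ σ a (t, y) ≤ 0) := by
  have habs : |σ * (y - a t)| = |y - a t| := by
    rw [abs_mul]; rcases hσ with h | h <;> rw [h] <;> simp
  rw [← habs] at h
  unfold wallArg
  simp only
  refine ⟨fun h0 => ?_, fun h0 => ?_⟩
  · have : 0 ≤ σ * (y - a t) / δ := by positivity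
    linarith
  · rw [abs_of_nonpos h0] at h
    have : σ * (y - a t) / δ ≤ -2 := by
      rw [div_le_iff₀ hδ]; linarith
    linarith

theorem wallArg_extreme (hδ : 0 < δ) (hE : Real.exp (L * (t - τ)) ≤ 2)
    (h : 2 * δ ≤ |y - a t|) (hσ : σ = 1 ∨ σ = -1) (hL : 1 ≤ Real.exp (L * (t - τ))) :
    wallArg δ L τ σ a (t, y) ≤ 0 ∨ 1 ≤ wallArg δ L τ σ a (t, y) := by
  have := wallArg_of_le hδ hE h hσ hL
  rcases le_total 0 (σ * (y - a t)) with h0 | h0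
  · exact Or.inr (this.1 h0)
  · exact Or.inl (this.2 h0)

theorem bumpArg_nonpos {p : ℝ} (hδ : 0 < δ) (hc : 0 ≤ c) (ht : τ ≤ t) (h : δ ≤ |y - p|) :
    bumpArg δ c τ p (t, y) ≤ 0 := by
  unfold bumpArg
  simp only
  have h1 : δ ^ 2 ≤ (y - p) ^ 2 := by rw [← sq_abs (y - p)]; gcongr
  have h2 : 0 ≤ c * (t - τ) := mul_nonneg hc (sub_nonneg.2 ht)
  rw [sub_nonpos, one_le_div (by positivity)]
  linarith

/-- The increments of a wall, away from its layer. -/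
theorem wall_increment_le (hδ : 0 < δ) (hσ : σ = 1 ∨ σ = -1)
    (h : wallArg δ L τ σ a (t, y) ≤ 0 ∨ 1 ≤ wallArg δ L τ σ a (t, y))
    (hy : a t - σ * δ * Real.exp (L * (t - τ)) - y ≠ 0) (z : ℝ) :
    (if 0 < Real.smoothTransition (wallArg δ L τ σ a (t, y + z)) then (1 : ℝ) else 0) -
      Real.smoothTransition (wallArg δ L τ σ a (t, y)) ≤
      σ * stepIncrement (a t - σ * δ * Real.exp (L * (t - τ)) - y) z := by
  have hpos : ∀ s, 0 < Real.smoothTransition s ↔ 0 < s := fun s =>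
    ⟨fun h => by
      by_contra! hs
      exact h.ne' (Real.smoothTransition.zero_of_nonpos hs), Real.smoothTransition.pos_of_pos⟩
  have h1 : Real.smoothTransition (wallArg δ L τ σ a (t, y)) =
      if 0 < wallArg δ L τ σ a (t, y) then 1 else 0 := by
    rcases h with h | h
    · rw [Real.smoothTransition.zero_of_nonpos h, if_neg (not_lt.2 h)]
    · rw [Real.smoothTransition.one_of_one_le h, if_pos (one_pos.trans_le h)]
  have h2 : ∀ x, 0 < wallArg δ L τ σ a (t, x) ↔
      0 < σ * (x - (a t - σ * δ * Real.exp (L * (t - τ)))) := fun x => by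
    have h3 : wallArg δ L τ σ a (t, x) =
        (σ * (x - (a t - σ * δ * Real.exp (L * (t - τ))))) / δ := by
      have hσ2 : σ * σ = 1 := by rcases hσ with h | h <;> rw [h] <;> norm_num
      unfold wallArg
      simp only
      field_simp
      linear_combination (-δ * Real.exp (L * (t - τ))) * hσ2
    rw [h3]
    exact div_pos_iff_of_pos_right hδ
  rw [h1]
  simp only [hpos, h2]
  set α := a t - σ * δ * Real.exp (L * (t - τ))
  unfold stepIncrement
  rcases hσ with h | h
  · rw [h]
    have e1 : (0 < 1 * (y - α)) ↔ (α - y ≤ 0) :=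
      ⟨fun h => by linarith, fun h => by have := lt_of_le_of_ne h hy; linarith⟩
    have e2 : (0 < 1 * (y + z - α)) → (α - y ≤ z) := fun h => by linarith
    simp only [e1]
    rw [one_mul, one_mul]
    refine sub_le_sub_right ?_ _
    split_ifs with h3 h4
    · rfl
    · exact absurd (e2 (by linarith)) h4
    · norm_num
    · rfl
  · rw [h]
    have e1 : (0 < -1 * (y - α)) ↔ ¬ (α - y ≤ 0) := by
      rw [not_le]; constructor <;> intro h <;> linarith
    have e2 : (0 < -1 * (y + z - α)) ↔ ¬ (α - y ≤ z) := by
      rw [not_le]; constructor <;> intro h <;> linarith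
    simp only [e1, e2]
    split_ifs <;> norm_num

/-- At all times after `τ` the bump is at most the indicator of its initial support, a dipole of two
unit steps at distance `2δ`. -/
theorem ae_bump_increment_le {p : ℝ} (hδ : 0 < δ) (hc : 0 ≤ c) (ht : τ ≤ t) (h : δ < |y - p|) :
    ∀ᵐ z, (if 0 < Real.smoothTransition (bumpArg δ c τ p (t, y + z)) then (1 : ℝ) else 0) -
      Real.smoothTransition (bumpArg δ c τ p (t, y)) ≤
      stepIncrement (p - δ - y) z - stepIncrement (p + δ - y) z := by
  have h0 : Real.smoothTransition (bumpArg δ c τ p (t, y)) = 0 :=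
    Real.smoothTransition.zero_of_nonpos (bumpArg_nonpos hδ hc ht h.le)
  refine Eventually.of_forall fun z => ?_
  rw [h0, sub_zero]
  have h1 : (p - δ - y ≤ 0) ↔ (p + δ - y ≤ 0) := by
    rcases lt_abs.1 h with h | h
    · constructor <;> intro <;> linarith
    · constructor <;> intro <;> linarith
  unfold stepIncrement
  simp only [h1]
  rw [sub_sub_sub_cancel_right]
  by_cases hz : 0 < Real.smoothTransition (bumpArg δ c τ p (t, y + z))
  · have h2 : |y + z - p| < δ := by
      by_contra! h'
      rw [Real.smoothTransition.zero_of_nonpos (bumpArg_nonpos hδ hc ht h')] at hz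
      exact lt_irrefl _ hz
    have := abs_lt.1 h2
    rw [if_pos hz, if_pos (by linarith), if_neg (by linarith)]
    norm_num
  · rw [if_neg hz]
    split_ifs with h3 h4 h4
    · norm_num
    · norm_num
    · exfalso; linarith
    · norm_num

/-- Toward its low side the active wall strictly decreases. The resulting bound is odd in `z`, so a
wall exerts no force on itself. -/
theorem own_wall_le (hδ : 0 < δ) (hσ : σ = 1 ∨ σ = -1)
    (h : deriv Real.smoothTransition (wallArg δ L τ σ a (t, y)) ≠ 0) {z : ℝ} (hz : z ≠ 0) :
    (if Real.smoothTransition (wallArg δ L τ σ a (t, y)) ≤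
        Real.smoothTransition (wallArg δ L τ σ a (t, y + z)) then (1 : ℝ) else 0) - 1 / 2 ≤
      σ * (SignType.sign z / 2) := by
  have h1 : σ * z < 0 → Real.smoothTransition (wallArg δ L τ σ a (t, y + z)) <
      Real.smoothTransition (wallArg δ L τ σ a (t, y)) := fun h' => by
    refine lt_of_deriv_ne_zero Real.smoothTransition.monotone h ?_
    unfold wallArg
    simp only
    gcongr 1
    rw [div_lt_div_iff_of_pos_right hδ]
    linarith
  rcases lt_or_gt_of_ne hz with hz | hz <;> rcases hσ with hs | hs
  · rw [if_neg (not_le.2 (h1 (by rw [hs]; linarith))), hs, sign_neg hz]; norm_num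
  · rw [hs, sign_neg hz]; split_ifs <;> norm_num
  · rw [hs, sign_pos hz]; split_ifs <;> norm_num
  · rw [if_neg (not_le.2 (h1 (by rw [hs]; linarith))), hs, sign_pos hz]; norm_num

/-- On the flank, only the points between `y` and its mirror image about `p` can be as high. The
bound has integral `-1/(2|p - y|)`, which is large and negative; this is what makes bumps shrink. -/
theorem own_bump_le {p : ℝ} (hδ : 0 < δ)
    (h : deriv Real.smoothTransition (bumpArg δ c τ p (t, y)) ≠ 0) (hy : p - y ≠ 0) {z : ℝ}
    (hz : z ≠ 0) (hz2 : z ≠ 2 * (p - y)) :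
    (if Real.smoothTransition (bumpArg δ c τ p (t, y)) ≤
        Real.smoothTransition (bumpArg δ c τ p (t, y + z)) then (1 : ℝ) else 0) - 1 / 2 ≤
      SignType.sign (p - y) * (SignType.sign z / 2 - stepIncrement (2 * (p - y)) z) := by
  have h1 : (p - y) ^ 2 < (y + z - p) ^ 2 → Real.smoothTransition (bumpArg δ c τ p (t, y + z)) <
      Real.smoothTransition (bumpArg δ c τ p (t, y)) := fun h' => by
    refine lt_of_deriv_ne_zero Real.smoothTransition.monotone h ?_
    unfold bumpArg
    simp only
    have : (y - p) ^ 2 < (y + z - p) ^ 2 := by nlinarith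
    gcongr
  unfold stepIncrement
  rcases lt_or_gt_of_ne hy with he | he <;> rcases lt_or_gt_of_ne hz with hz' | hz'
  · rw [sign_neg he, sign_neg hz', if_pos (by linarith : 2 * (p - y) ≤ 0)]
    rcases lt_or_gt_of_ne hz2 with h2 | h2
    · rw [if_neg (not_le.2 (h1 (by nlinarith))), if_neg (not_le.2 h2)]; norm_num
    · rw [if_pos h2.le]; split_ifs <;> norm_num
  · rw [if_neg (not_le.2 (h1 (by nlinarith))), sign_neg he, sign_pos hz',
      if_pos (by linarith : 2 * (p - y) ≤ 0), if_pos (by linarith)]; norm_num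
  · rw [if_neg (not_le.2 (h1 (by nlinarith))), sign_pos he, sign_neg hz',
      if_neg (by linarith : ¬ 2 * (p - y) ≤ 0), if_neg (by linarith)]; norm_num
  · rw [sign_pos he, sign_pos hz', if_neg (by linarith : ¬ 2 * (p - y) ≤ 0)]
    rcases lt_or_gt_of_ne hz2 with h2 | h2
    · rw [if_neg (not_le.2 h2)]; split_ifs <;> norm_num
    · rw [if_neg (not_le.2 (h1 (by nlinarith))), if_pos h2.le]; norm_num

end WallBump

/-! ### Configurations of layers and the barrier inequality -/

section Barrier

variable {ι μ : Type*} [Fintype ι] [Fintype μ] {ε κ δ L c τ t d : ℝ} {σ : ι → ℝ}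
  {a : ι → ℝ → ℝ} {p : μ → ℝ}

/-- The configuration of layers at time `t`: widths are small with respect to separations. -/
structure LayerConfig (δ L τ t d : ℝ) (σ : ι → ℝ) (a : ι → ℝ → ℝ) (p : μ → ℝ) : Prop where
  width_pos : 0 < δ
  width_le : 8 * δ ≤ d
  count : 8 * ((Fintype.card (ι ⊕ μ) : ℕ) : ℝ) * δ ≤ d
  time : τ ≤ t
  exp_ge : 1 ≤ Real.exp (L * (t - τ))
  exp_le : Real.exp (L * (t - τ)) ≤ 2
  sign : ∀ k, σ k = 1 ∨ σ k = -1
  walls : ∀ k l, k ≠ l → d ≤ |a k t - a l t|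
  wall_bump : ∀ k l, d ≤ |a k t - p l|
  bumps : ∀ k l, k ≠ l → d ≤ |p k - p l|

/-- The center of a layer at time `t`. -/
def layerCenter (a : ι → ℝ → ℝ) (p : μ → ℝ) (t : ℝ) : ι ⊕ μ → ℝ := Sum.elim (fun k => a k t) p

/-- The increments by which the increments of the layers are bounded. -/
def layerJump (δ L τ t y : ℝ) (σ : ι → ℝ) (a : ι → ℝ → ℝ) (p : μ → ℝ) : ι ⊕ μ → ℝ → ℝ :=
  Sum.elim (fun k z => σ k * stepIncrement (a k t - σ k * δ * Real.exp (L * (t - τ)) - y) z)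
    fun k z => stepIncrement (p k - δ - y) z - stepIncrement (p k + δ - y) z

/-- The integrals of the bounding increments. -/
def layerForce (δ L τ t y : ℝ) (σ : ι → ℝ) (a : ι → ℝ → ℝ) (p : μ → ℝ) : ι ⊕ μ → ℝ :=
  Sum.elim (fun k => σ k / (a k t - σ k * δ * Real.exp (L * (t - τ)) - y))
    fun k => 1 / (p k - δ - y) - 1 / (p k + δ - y)

namespace LayerConfig

theorem abs_center_sub (h : LayerConfig δ L τ t d σ a p) {k l : ι ⊕ μ} (hkl : k ≠ l) :
    d ≤ |layerCenter a p t k - layerCenter a p t l| := by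
  rcases k with k | k <;> rcases l with l | l
  · exact h.walls k l (by simpa using hkl)
  · exact h.wall_bump k l
  · rw [abs_sub_comm]; exact h.wall_bump l k
  · exact h.bumps k l (by simpa using hkl)

theorem layerArg_extreme (h : LayerConfig δ L τ t d σ a p) (hc : 0 ≤ c) {k : ι ⊕ μ} {y : ℝ}
    (hy : 2 * δ ≤ |y - layerCenter a p t k|) :
    layerArg δ L c τ σ a p k (t, y) ≤ 0 ∨ 1 ≤ layerArg δ L c τ σ a p k (t, y) := by
  rcases k with k | k
  · exact wallArg_extreme h.width_pos h.exp_le hy (h.sign k) h.exp_ge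
  · exact Or.inl (bumpArg_nonpos h.width_pos hc h.time (by
      have := h.width_pos
      have : 2 * δ ≤ |y - p k| := hy
      linarith))

theorem layerArg_lt (h : LayerConfig δ L τ t d σ a p) (hc : 0 ≤ c) {k : ι ⊕ μ} {y : ℝ}
    (hy : 2 * δ < |y - layerCenter a p t k|) :
    layerArg δ L c τ σ a p k (t, y) < 0 ∨ 1 < layerArg δ L c τ σ a p k (t, y) := by
  have hd := h.width_pos
  rcases k with k | k
  · have hy : 2 * δ < |y - a k t| := hy
    have habs : |σ k * (y - a k t)| = |y - a k t| := by
      rw [abs_mul]; rcases h.sign k with h | h <;> rw [h] <;> simp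
    rw [← habs] at hy
    simp only [layerArg, Sum.elim_inl, wallArg]
    have h1 := h.exp_ge
    have h2 := h.exp_le
    rcases lt_abs.1 hy with h' | h'
    · right
      have : 0 < σ k * (y - a k t) / δ := div_pos (by linarith) hd
      linarith
    · left
      have : σ k * (y - a k t) / δ < -2 := by
        rw [div_lt_iff₀ hd]; linarith
      linarith
  · left
    have hy : 2 * δ < |y - p k| := hy
    simp only [layerArg, Sum.elim_inr, bumpArg]
    have h1 : δ ^ 2 < (y - p k) ^ 2 := by
      rw [← sq_abs (y - p k)]
      exact pow_lt_pow_left₀ (by linarith) hd.le two_ne_zero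
    have h2 : 0 ≤ c * (t - τ) := mul_nonneg hc (sub_nonneg.2 h.time)
    rw [sub_neg, one_lt_div (by positivity)]
    linarith

theorem abs_sub_center_lt (h : LayerConfig δ L τ t d σ a p) (hc : 0 ≤ c) {k : ι ⊕ μ} {y : ℝ}
    (hy : deriv Real.smoothTransition (layerArg δ L c τ σ a p k (t, y)) ≠ 0) :
    |y - layerCenter a p t k| < 2 * δ := by
  by_contra! h'
  exact hy (deriv_smoothTransition_eq_zero (h.layerArg_extreme hc h'))

theorem far_of_near (h : LayerConfig δ L τ t d σ a p) {i k : ι ⊕ μ} (hki : k ≠ i) {y : ℝ}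
    (hy : |y - layerCenter a p t i| < 2 * δ) : d - 2 * δ < |layerCenter a p t k - y| := by
  have h1 := h.abs_center_sub hki
  have h2 := abs_sub_le (layerCenter a p t k) y (layerCenter a p t i)
  linarith

theorem abs_wall_sub (h : LayerConfig δ L τ t d σ a p) {k : ι} {y : ℝ}
    (hy : d - 2 * δ < |a k t - y|) :
    d / 2 < |a k t - σ k * δ * Real.exp (L * (t - τ)) - y| := by
  have h0 := h.width_pos
  have h1 : |σ k * δ * Real.exp (L * (t - τ))| ≤ 2 * δ := by
    have h2 : |σ k| = 1 := by rcases h.sign k with h | h <;> rw [h] <;> simp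
    rw [abs_mul, abs_mul, h2, abs_of_pos h0, abs_of_pos (Real.exp_pos _)]
    have := h.exp_le
    nlinarith
  have h2 := abs_sub_abs_le_abs_sub (a k t - y) (σ k * δ * Real.exp (L * (t - τ)))
  have h3 : a k t - y - σ k * δ * Real.exp (L * (t - τ)) =
    a k t - σ k * δ * Real.exp (L * (t - τ)) - y := by ring
  rw [h3] at h2
  have := h.width_le
  linarith

theorem abs_bump_sub (h : LayerConfig δ L τ t d σ a p) {k : μ} {y s : ℝ}
    (hy : d - 2 * δ < |p k - y|) (hs : |s| ≤ δ) : d / 2 < |p k + s - y| := by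
  have h0 := h.width_pos
  have h2 := abs_sub_abs_le_abs_sub (p k - y) (-s)
  have h3 : p k - y - -s = p k + s - y := by ring
  rw [h3, abs_neg] at h2
  have := h.width_le
  linarith

theorem integral_layerJump (h : LayerConfig δ L τ t d σ a p) {k : ι ⊕ μ} {y r : ℝ}
    (hy : d - 2 * δ < |layerCenter a p t k - y|) (hr : 0 < r) (hrd : r ≤ d / 2) :
    ∫ z in {z : ℝ | r < |z|}, layerJump δ L τ t y σ a p k z / z ^ 2 =
      layerForce δ L τ t y σ a p k := by
  have hd := h.width_pos
  rcases k with k | k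
  · simp only [layerJump, layerForce, Sum.elim_inl, mul_div_assoc]
    rw [integral_const_mul, integral_stepIncrement hr (hrd.trans_lt (h.abs_wall_sub hy)),
      mul_one_div]
  · simp only [layerJump, layerForce, Sum.elim_inr, sub_div]
    have hi : ∀ b, IntegrableOn (fun z => stepIncrement b z / z ^ 2) {z : ℝ | r < |z|} :=
      fun b => integrableOn_div_sq hr (measurableSet_lt_abs r) subset_rfl
        (measurable_stepIncrement _) fun z _ => abs_stepIncrement_le _ z
    rw [integral_sub (hi _) (hi _), integral_stepIncrement hr, integral_stepIncrement hr]
    · exact hrd.trans_lt (h.abs_bump_sub hy (by rw [abs_of_pos hd]))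
    · have := h.abs_bump_sub (s := -δ) hy (by rw [abs_neg, abs_of_pos hd])
      rw [← sub_eq_add_neg] at this
      exact hrd.trans_lt this

theorem ae_increment_le (h : LayerConfig δ L τ t d σ a p) (hc : 0 ≤ c) {k : ι ⊕ μ} {y : ℝ}
    (hy : d - 2 * δ < |layerCenter a p t k - y|) :
    ∀ᵐ z, (if 0 < Real.smoothTransition (layerArg δ L c τ σ a p k (t, y + z)) then (1 : ℝ) else 0) -
      Real.smoothTransition (layerArg δ L c τ σ a p k (t, y)) ≤ layerJump δ L τ t y σ a p k z := by
  have hd := h.width_pos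
  have hd8 := h.width_le
  have hy2 : 2 * δ ≤ |y - layerCenter a p t k| := by rw [abs_sub_comm]; linarith
  have hext := h.layerArg_extreme hc hy2
  rcases k with k | k
  · exact Eventually.of_forall fun z => wall_increment_le hd (h.sign k) hext
      (abs_pos.1 ((by linarith : 0 < d / 2).trans (h.abs_wall_sub hy))) z
  · exact ae_bump_increment_le hd hc h.time (by
      have : 2 * δ ≤ |y - p k| := hy2
      linarith)

theorem measurable_layerJump (y : ℝ) (k : ι ⊕ μ) : Measurable (layerJump δ L τ t y σ a p k) := by
  rcases k with k | k
  · exact (measurable_stepIncrement _).const_mul _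
  · exact (measurable_stepIncrement _).sub (measurable_stepIncrement _)

theorem abs_layerJump_le (h : LayerConfig δ L τ t d σ a p) (y : ℝ) (k : ι ⊕ μ) (z : ℝ) :
    |layerJump δ L τ t y σ a p k z| ≤ 2 := by
  rcases k with k | k
  · have h2 : |σ k| = 1 := by rcases h.sign k with h | h <;> rw [h] <;> simp
    simp only [layerJump, Sum.elim_inl, abs_mul, h2, one_mul]
    exact (abs_stepIncrement_le _ _).trans one_le_two
  · simp only [layerJump, Sum.elim_inr]
    refine (abs_sub _ _).trans ?_
    linarith [abs_stepIncrement_le (p k - δ - y) z, abs_stepIncrement_le (p k + δ - y) z]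

/-- The far layers act on a layer, up to an error, as point charges. -/
theorem layerForce_le (h : LayerConfig δ L τ t d σ a p) {y : ℝ} {k : μ}
    (hy : d - 2 * δ < |p k - y|) : layerForce δ L τ t y σ a p (Sum.inr k) ≤ 8 * δ / d ^ 2 := by
  have hd := h.width_pos
  have hd8 := h.width_le
  simp only [layerForce, Sum.elim_inr]
  have h1 := h.abs_bump_sub (s := -δ) hy (by rw [abs_neg, abs_of_pos hd])
  have h2 := h.abs_bump_sub (s := δ) hy (by rw [abs_of_pos hd])
  rw [← sub_eq_add_neg] at h1
  have h3 : p k - δ - y ≠ 0 := abs_pos.1 (by linarith)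
  have h4 : p k + δ - y ≠ 0 := abs_pos.1 (by linarith)
  have h5 : 1 / (p k - δ - y) - 1 / (p k + δ - y) = 2 * δ / ((p k - δ - y) * (p k + δ - y)) := by
    rw [div_sub_div _ _ h3 h4]; congr 1; ring
  rw [h5]
  refine (le_abs_self _).trans ?_
  rw [abs_div, abs_mul (p k - δ - y), abs_of_pos (by linarith : 0 < 2 * δ)]
  rw [div_le_div_iff₀ (mul_pos (by linarith) (by linarith)) (by nlinarith)]
  have h6 : d / 2 * (d / 2) ≤ |p k - δ - y| * |p k + δ - y| :=
    mul_le_mul h1.le h2.le (by linarith) (by linarith)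
  nlinarith

/-- The end of a wall and the evaluation point are each within `2δ` of the respective centres, so
the two fractions differ by at most `4δ` over a denominator of at least `d²/2`. -/
theorem layerForce_le_inl (h : LayerConfig δ L τ t d σ a p) {y : ℝ} {i k : ι} (hki : k ≠ i)
    (hy : |y - a i t| < 2 * δ) :
    layerForce δ L τ t y σ a p (Sum.inl k) ≤ σ k / (a k t - a i t) + 8 * δ / d ^ 2 := by
  have hd := h.width_pos
  have hd8 := h.width_le
  have hfar : d - 2 * δ < |a k t - y| :=
    h.far_of_near (i := Sum.inl i) (k := Sum.inl k) (by simpa using hki) hy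
  have h1 := h.abs_wall_sub hfar
  have h2 := h.walls k i hki
  simp only [layerForce, Sum.elim_inl]
  set α := a k t - σ k * δ * Real.exp (L * (t - τ)) with hα
  have h3 : α - y ≠ 0 := abs_pos.1 (by linarith)
  have h4 : a k t - a i t ≠ 0 := abs_pos.1 (by linarith)
  have hσ : |σ k| = 1 := by rcases h.sign k with h | h <;> rw [h] <;> simp
  have h5 : |σ k * δ * Real.exp (L * (t - τ))| ≤ 2 * δ := by
    rw [abs_mul, abs_mul, hσ, abs_of_pos hd, abs_of_pos (Real.exp_pos _)]
    have := h.exp_le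
    nlinarith
  have h6 : σ k / (α - y) - σ k / (a k t - a i t) =
      σ k * (σ k * δ * Real.exp (L * (t - τ)) + (y - a i t)) / ((α - y) * (a k t - a i t)) := by
    rw [div_sub_div _ _ h3 h4]; congr 1; rw [hα]; ring
  have h7 : |σ k / (α - y) - σ k / (a k t - a i t)| ≤ 8 * δ / d ^ 2 := by
    rw [h6, abs_div, abs_mul, abs_mul (α - y), hσ, one_mul]
    rw [div_le_div_iff₀ (mul_pos (by linarith) (by linarith)) (by nlinarith)]
    have h8 : |σ k * δ * Real.exp (L * (t - τ)) + (y - a i t)| ≤ 4 * δ :=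
      (abs_add_le _ _).trans (by linarith)
    have h9 : d / 2 * d ≤ |α - y| * |a k t - a i t| :=
      mul_le_mul h1.le h2 (by linarith) (by linarith)
    calc _ ≤ 4 * δ * d ^ 2 := by gcongr
      _ = 8 * δ * (d / 2 * d) := by ring
      _ ≤ _ := by gcongr
  linarith [(abs_le.1 h7).2]

/-- A crude bound, sufficient on the flank of a bump, where the own contribution is larger by a
factor of order `d/δ`. -/
theorem layerForce_le_two_div (h : LayerConfig δ L τ t d σ a p) {y : ℝ} {k : ι ⊕ μ}
    (hy : d - 2 * δ < |layerCenter a p t k - y|) : layerForce δ L τ t y σ a p k ≤ 2 / d := by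
  have hd := h.width_pos
  have hd8 := h.width_le
  rcases k with k | k
  · have h1 := h.abs_wall_sub hy
    have hσ : |σ k| = 1 := by rcases h.sign k with h | h <;> rw [h] <;> simp
    simp only [layerForce, Sum.elim_inl]
    refine (le_abs_self _).trans ?_
    rw [abs_div, hσ, div_le_div_iff₀ (by linarith) (by linarith)]
    linarith
  · refine (h.layerForce_le hy).trans ?_
    rw [div_le_div_iff₀ (by nlinarith) (by linarith)]
    nlinarith

end LayerConfig

/-- The space and time derivatives of the arguments of the layers. -/
def layerSlope (δ : ℝ) (σ : ι → ℝ) (p : μ → ℝ) (y : ℝ) : ι ⊕ μ → ℝ :=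
  Sum.elim (fun k => σ k / δ) fun k => -(2 * (y - p k)) / δ ^ 2

/-- The time derivatives of the arguments of the layers. -/
def layerSpeed (δ L c τ t : ℝ) (σ : ι → ℝ) (a' : ι → ℝ) : ι ⊕ μ → ℝ :=
  Sum.elim (fun k => -(σ k * a' k) / δ + L * Real.exp (L * (t - τ))) fun _ => -c / δ ^ 2

theorem hasDerivAt_layerArg_right (y : ℝ) (k : ι ⊕ μ) :
    HasDerivAt (fun z => layerArg δ L c τ σ a p k (t, z)) (layerSlope δ σ p y k) y := by
  rcases k with k | k
  · exact hasDerivAt_wallArg_right y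
  · exact hasDerivAt_bumpArg_right y

theorem hasDerivAt_layer_right (y : ℝ) (k : ι ⊕ μ) :
    HasDerivAt (fun z => Real.smoothTransition (layerArg δ L c τ σ a p k (t, z)))
      (deriv Real.smoothTransition (layerArg δ L c τ σ a p k (t, y)) * layerSlope δ σ p y k) y :=
  (differentiable_smoothTransition _).hasDerivAt.comp y (hasDerivAt_layerArg_right y k)

theorem hasDerivAt_layer_left {a' : ι → ℝ} (ha : ∀ k, HasDerivAt (a k) (a' k) t) (y : ℝ)
    (k : ι ⊕ μ) :
    HasDerivAt (fun s => Real.smoothTransition (layerArg δ L c τ σ a p k (s, y)))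
      (deriv Real.smoothTransition (layerArg δ L c τ σ a p k (t, y)) *
        layerSpeed δ L c τ t σ a' k) t := by
  have h : HasDerivAt (fun s => layerArg δ L c τ σ a p k (s, y)) (layerSpeed δ L c τ t σ a' k) t := by
    rcases k with k | k
    · exact hasDerivAt_wallArg_left (ha k)
    · exact hasDerivAt_bumpArg_left
  exact (differentiable_smoothTransition _).hasDerivAt.comp t h

theorem dx_layerBarrier (y : ℝ) : dx (layerBarrier ε κ δ L c τ σ a p) (t, y) =
    ε * ∑ k, deriv Real.smoothTransition (layerArg δ L c τ σ a p k (t, y)) *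
      layerSlope δ σ p y k :=
  (((HasDerivAt.fun_sum fun k _ => hasDerivAt_layer_right y k).const_mul ε).const_add κ).deriv

theorem dt_layerBarrier {a' : ι → ℝ} (ha : ∀ k, HasDerivAt (a k) (a' k) t) (y : ℝ) :
    dt (layerBarrier ε κ δ L c τ σ a p) (t, y) =
    ε * ∑ k, deriv Real.smoothTransition (layerArg δ L c τ σ a p k (t, y)) *
      layerSpeed δ L c τ t σ a' k :=
  (((HasDerivAt.fun_sum fun k _ => hasDerivAt_layer_left ha y k).const_mul ε).const_add κ).deriv

/-- The nonlocal term of the layered barrier at a layer. -/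
theorem LayerConfig.integral_le (h : LayerConfig δ L τ t d σ a p) (hε : 0 < ε) (hc : 0 ≤ c)
    {i : ι ⊕ μ} {y : ℝ}
    (hi : deriv Real.smoothTransition (layerArg δ L c τ σ a p i (t, y)) ≠ 0)
    {g : ℝ → ℝ} {m r : ℝ} (hg : Measurable g) (hgB : ∀ z, |g z| ≤ 2) (hr : 0 < r) (hrd : r ≤ d / 2)
    (hgi : ∀ᵐ z, (if Real.smoothTransition (layerArg δ L c τ σ a p i (t, y)) ≤
      Real.smoothTransition (layerArg δ L c τ σ a p i (t, y + z)) then (1 : ℝ) else 0) - 1 / 2 ≤ g z)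
    (hm : ∫ z in {z : ℝ | r < |z|}, g z / z ^ 2 = m)
    {F : ι ⊕ μ → ℝ} (hF : ∀ k ≠ i, layerForce δ L τ t y σ a p k ≤ F k) (hFi : m ≤ F i) :
    ∫ z in {z : ℝ | r < |z|}, stairUpper ε (layerBarrier ε κ δ L c τ σ a p (t, y + z) -
      layerBarrier ε κ δ L c τ σ a p (t, y)) / z ^ 2 ≤ ε * ∑ k, F k := by
  classical
  have hd := h.width_pos
  have hd8 := h.width_le
  have hnear := h.abs_sub_center_lt hc hi
  have hfar : ∀ k ≠ i, d - 2 * δ < |layerCenter a p t k - y| := fun k hk => h.far_of_near hk hnear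
  have hext : ∀ k ≠ i, layerArg δ L c τ σ a p k (t, y) ≤ 0 ∨ 1 ≤ layerArg δ L c τ σ a p k (t, y) :=
    fun k hk => h.layerArg_extreme hc (by rw [abs_sub_comm]; linarith [hfar k hk])
  refine (integral_layers_le
    (f := fun k x => Real.smoothTransition (layerArg δ L c τ σ a p k (t, x)))
    (g := Function.update (layerJump δ L τ t y σ a p) i g)
    (m := Function.update (layerForce δ L τ t y σ a p) i m) (B := 2) (i := i) hε
    (fun k x => Real.smoothTransition.nonneg _) (fun k x => Real.smoothTransition.le_one _)
    (fun k => ?_) (Real.smoothTransition.pos_of_pos (deriv_smoothTransition_ne_zero hi).1)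
    (fun k hk => ?_) (fun k => ?_) (fun k z => ?_) hr (fun k hk => ?_) ?_ fun k => ?_).trans ?_
  · exact Continuous.measurable (continuous_iff_continuousAt.2 fun x =>
      (hasDerivAt_layer_right x k).continuousAt)
  · exact (hext k hk).imp Real.smoothTransition.zero_of_nonpos Real.smoothTransition.one_of_one_le
  · rcases eq_or_ne k i with rfl | hk
    · simpa using hg
    · simpa [hk] using LayerConfig.measurable_layerJump y k
  · rcases eq_or_ne k i with rfl | hk
    · simpa using hgB z
    · simpa [hk] using h.abs_layerJump_le y k z
  · simpa [hk] using h.ae_increment_le hc (hfar k hk)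
  · simpa using hgi
  · rcases eq_or_ne k i with rfl | hk
    · simpa using hm
    · simpa [hk] using h.integral_layerJump (hfar k hk) hr hrd
  · gcongr with k
    rcases eq_or_ne k i with rfl | hk
    · simpa using hFi
    · simpa [hk] using hF k hk

theorem integral_sign_div_sq (r s : ℝ) :
    ∫ z in {z : ℝ | r < |z|}, s * (SignType.sign z / 2) / z ^ 2 = 0 := by
  refine setIntegral_odd_eq_zero (measurableSet_lt_abs r) (by intro z; simp) fun z _ => ?_
  rw [Left.sign_neg, neg_sq]
  push_cast
  ring

theorem measurable_coe_sign : Measurable fun z : ℝ => ((SignType.sign z : SignType) : ℝ) := by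
  have h2 : (fun z : ℝ => ((SignType.sign z : SignType) : ℝ)) =
      fun z => (if 0 < z then 1 else 0) - if z < 0 then 1 else 0 := by
    ext z
    rcases lt_trichotomy z 0 with hz | hz | hz
    · simp [hz, not_lt.2 hz.le, sign_neg hz]
    · simp [hz]
    · simp [hz, not_lt.2 hz.le, sign_pos hz]
  rw [h2]
  exact (Measurable.ite measurableSet_Ioi measurable_const measurable_const).sub
    (Measurable.ite measurableSet_Iio measurable_const measurable_const)

theorem abs_coe_sign_le (z : ℝ) : |((SignType.sign z : SignType) : ℝ)| ≤ 1 := by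
  rcases lt_trichotomy z 0 with hz | hz | hz
  · simp [sign_neg hz]
  · simp [hz]
  · simp [sign_pos hz]

/-- The layered barrier is a barrier, if its walls are at least as fast as required. -/
theorem LayerConfig.isBarrierAt (h : LayerConfig δ L τ t d σ a p) (hε : 0 < ε) (hL : 0 ≤ L)
    {a' : ι → ℝ} (ha : ∀ k, HasDerivAt (a k) (a' k) t)
    (hvel : ∀ i, ε * (∑ k, σ k / (a k t - a i t) +
      (Fintype.card (ι ⊕ μ) : ℕ) * (8 * δ / d ^ 2)) ≤ -(σ i * a' i) + δ * L) (y : ℝ) :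
    IsBarrierAt ε (layerBarrier ε κ δ L (ε / 2) τ σ a p) t y := by
  classical
  have hd := h.width_pos
  have hd8 := h.width_le
  have hc : 0 ≤ ε / 2 := by positivity
  set D : ι ⊕ μ → ℝ := fun k =>
    deriv Real.smoothTransition (layerArg δ L (ε / 2) τ σ a p k (t, y)) with hD
  by_cases hex : ∃ i, D i ≠ 0
  swap
  · push Not at hex
    have hdx : dx (layerBarrier ε κ δ L (ε / 2) τ σ a p) (t, y) = 0 := by
      rw [dx_layerBarrier, Finset.sum_eq_zero fun k _ => mul_eq_zero_of_left (hex k) _, mul_zero]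
    have hdt : dt (layerBarrier ε κ δ L (ε / 2) τ σ a p) (t, y) = 0 := by
      rw [dt_layerBarrier ha, Finset.sum_eq_zero fun k _ => mul_eq_zero_of_left (hex k) _, mul_zero]
    exact ⟨fun h => absurd hdx h, fun _ => Or.inl hdt.ge⟩
  obtain ⟨i, hi⟩ := hex
  have hDi : 0 < D i := deriv_smoothTransition_pos hi
  have hnear := h.abs_sub_center_lt hc hi
  have hfar : ∀ k ≠ i, d - 2 * δ < |layerCenter a p t k - y| := fun k hk => h.far_of_near hk hnear
  -- The layers are confined to distance `2δ` from centres that are at least `8δ` apart. Hence one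
  -- term survives in both derivatives.
  have hD0 : ∀ k ≠ i, D k = 0 := fun k hk => deriv_smoothTransition_eq_zero
    (h.layerArg_extreme hc (by rw [abs_sub_comm]; linarith [hfar k hk]))
  have hdx : dx (layerBarrier ε κ δ L (ε / 2) τ σ a p) (t, y) = ε * (D i * layerSlope δ σ p y i) := by
    rw [dx_layerBarrier, Finset.sum_eq_single i (fun k _ hk =>
      mul_eq_zero_of_left (hD0 k hk) _) (by simp)]
  have hdt : dt (layerBarrier ε κ δ L (ε / 2) τ σ a p) (t, y) =
      ε * (D i * layerSpeed δ L (ε / 2) τ t σ a' i) := by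
    rw [dt_layerBarrier ha, Finset.sum_eq_single i (fun k _ hk =>
      mul_eq_zero_of_left (hD0 k hk) _) (by simp)]
  rcases i with i | i
  · refine ⟨fun _ => ⟨d / 2, by linarith, fun r hr => ?_⟩, fun h0 => ?_⟩
    · have hint := h.integral_le (κ := κ) hε hc hi (g := fun z => σ i * (SignType.sign z / 2)) (m := 0)
        (F := Sum.elim (fun k => σ k / (a k t - a i t) + 8 * δ / d ^ 2) fun _ => 8 * δ / d ^ 2)
        ((measurable_coe_sign.div_const 2).const_mul _) (fun z => ?_) hr.1 hr.2.le ?_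
        (integral_sign_div_sq r _) ?_ ?_
      · have hvi := hvel i
        have hsum : ∑ k, (Sum.elim (fun k => σ k / (a k t - a i t) + 8 * δ / d ^ 2)
            (fun _ => 8 * δ / d ^ 2) : ι ⊕ μ → ℝ) k =
            ∑ k, σ k / (a k t - a i t) + (Fintype.card (ι ⊕ μ) : ℕ) * (8 * δ / d ^ 2) := by
          rw [Fintype.sum_sum_type]
          simp only [Sum.elim_inl, Sum.elim_inr, Finset.sum_add_distrib, Finset.sum_const,
            Finset.card_univ, Fintype.card_sum, nsmul_eq_mul]
          push_cast; ring
        rw [hsum] at hint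
        have hσ : |σ i| = 1 := by rcases h.sign i with h | h <;> rw [h] <;> simp
        have habs : |dx (layerBarrier ε κ δ L (ε / 2) τ σ a p) (t, y)| = ε * D (Sum.inl i) / δ := by
          rw [hdx, abs_mul, abs_mul, abs_of_pos hε, abs_of_pos hDi]
          simp only [layerSlope, Sum.elim_inl, abs_div, hσ, abs_of_pos hd]
          ring
        rw [habs, hdt]
        simp only [layerSpeed, Sum.elim_inl]
        -- The slope of the wall is `ε D / δ` in modulus, and its time derivative carries the same
        -- factor `D`. The increasing offset contributes at least `L`, that is, an additional speed
        -- `δ L`.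
        calc _ ≤ (-(σ i * a' i) + δ * L) * (ε * D (Sum.inl i) / δ) := by
              gcongr
              exact hint.trans hvi
          _ = ε * (D (Sum.inl i) * (-(σ i * a' i) / δ + L * 1)) := by field_simp
          _ ≤ _ := by
              gcongr
              exact h.exp_ge
      · have hσ : |σ i| = 1 := by rcases h.sign i with h | h <;> rw [h] <;> simp
        rw [abs_mul, hσ, abs_div, abs_two]
        have := abs_coe_sign_le z
        linarith
      · filter_upwards [compl_mem_ae_iff.2 (measure_singleton (0 : ℝ))] with z hz
        exact own_wall_le hd (h.sign i) hi hz
      · rintro (k | k) hk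
        · exact h.layerForce_le_inl (by simpa using hk) hnear
        · exact h.layerForce_le (hfar _ hk)
      · simp only [Sum.elim_inl, sub_self, div_zero, zero_add]
        positivity
    · exfalso
      rw [hdx] at h0
      have : layerSlope δ σ p y (Sum.inl i) ≠ 0 := by
        simp only [layerSlope, Sum.elim_inl]
        rcases h.sign i with h | h <;> rw [h] <;> simp [hd.ne']
      exact (mul_ne_zero hε.ne' (mul_ne_zero hi this)) h0
  · rcases eq_or_ne y (p i) with hyp | hyp
    · -- the tip of a bump
      -- At its tip the shrinking bump has a negative time derivative, so the first alternative for
      -- critical points fails; its quadratic maximum provides the second one.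
      refine ⟨fun h0 => ?_, fun _ => Or.inr ⟨ε * (D (Sum.inr i) / 2 / δ ^ 2), by positivity, ?_⟩⟩
      · exfalso
        apply h0
        rw [hdx]
        simp [layerSlope, hyp]
      · have hconst : ∀ k ≠ Sum.inr i, ∀ᶠ u in 𝓝 (0 : ℝ),
            Real.smoothTransition (layerArg δ L (ε / 2) τ σ a p k (t, y + u)) =
              Real.smoothTransition (layerArg δ L (ε / 2) τ σ a p k (t, y)) := by
          intro k hk
          have hcont : Tendsto (fun u => layerArg δ L (ε / 2) τ σ a p k (t, y + u)) (𝓝 0)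
              (𝓝 (layerArg δ L (ε / 2) τ σ a p k (t, y))) := by
            have h1 : Tendsto (fun u => y + u) (𝓝 0) (𝓝 y) := by
              simpa using (continuous_const_add y).tendsto 0
            exact (hasDerivAt_layerArg_right y k).continuousAt.tendsto.comp h1
          rcases h.layerArg_lt (c := ε / 2) hc (k := k) (y := y)
            (by rw [abs_sub_comm]; linarith [hfar k hk]) with h' | h'
          · filter_upwards [hcont.eventually_lt_const h'] with u hu
            rw [Real.smoothTransition.zero_of_nonpos h'.le,
              Real.smoothTransition.zero_of_nonpos hu.le]
          · filter_upwards [hcont.eventually_const_lt h'] with u hu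
            rw [Real.smoothTransition.one_of_one_le h'.le,
              Real.smoothTransition.one_of_one_le hu.le]
        have htip : ∀ᶠ u in 𝓝 (0 : ℝ),
            Real.smoothTransition (layerArg δ L (ε / 2) τ σ a p (Sum.inr i) (t, y + u)) ≤
              Real.smoothTransition (layerArg δ L (ε / 2) τ σ a p (Sum.inr i) (t, y)) -
                D (Sum.inr i) / 2 / δ ^ 2 * u ^ 2 := by
          have h1 := eventually_smoothTransition_le hDi
          have h2 : Tendsto (fun u : ℝ => u ^ 2 / δ ^ 2) (𝓝 0) (𝓝 0) := by
            have : Tendsto (fun u : ℝ => u ^ 2 / δ ^ 2) (𝓝 0) (𝓝 (0 ^ 2 / δ ^ 2)) :=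
              Continuous.tendsto (by fun_prop) 0
            simpa using this
          filter_upwards [h2.eventually h1] with u hu
          have h3 := hu (by positivity)
          have h4 : layerArg δ L (ε / 2) τ σ a p (Sum.inr i) (t, y + u) =
              layerArg δ L (ε / 2) τ σ a p (Sum.inr i) (t, y) - u ^ 2 / δ ^ 2 := by
            simp only [layerArg, Sum.elim_inr, bumpArg, hyp]
            ring
          rw [h4]
          refine h3.trans (le_of_eq ?_)
          simp only [hD]
          ring
        have hall : ∀ᶠ u in 𝓝 (0 : ℝ), ∀ k ≠ Sum.inr i,
            Real.smoothTransition (layerArg δ L (ε / 2) τ σ a p k (t, y + u)) =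
              Real.smoothTransition (layerArg δ L (ε / 2) τ σ a p k (t, y)) := by
          rw [eventually_all]
          intro k
          by_cases hk : k = Sum.inr i
          · exact Eventually.of_forall fun u h => absurd hk h
          · exact (hconst k hk).mono fun u h _ => h
        filter_upwards [hall, htip] with u hu1 hu2
        unfold layerBarrier
        rw [← Finset.sum_erase_add _ _ (Finset.mem_univ (Sum.inr i)),
          ← Finset.sum_erase_add _ _ (Finset.mem_univ (Sum.inr i)),
          Finset.sum_congr rfl fun k hk => hu1 k (Finset.ne_of_mem_erase hk)]
        have := mul_le_mul_of_nonneg_left hu2 hε.le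
        linarith
    · -- the flank of a bump
      set e := p i - y with he
      have he0 : e ≠ 0 := sub_ne_zero.2 hyp.symm
      have he' : 0 < |e| := abs_pos.2 he0
      have heδ : |e| < δ := by
        by_contra! h'
        refine hi (deriv_smoothTransition_eq_zero (Or.inl ?_))
        exact bumpArg_nonpos hd hc h.time (by rwa [abs_sub_comm])
      have hslope : |dx (layerBarrier ε κ δ L (ε / 2) τ σ a p) (t, y)| =
          ε * (D (Sum.inr i) * (2 * |e| / δ ^ 2)) := by
        rw [hdx, abs_mul, abs_mul, abs_of_pos hε, abs_of_pos hDi]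
        congr 2
        simp only [layerSlope, Sum.elim_inr]
        rw [abs_div, abs_neg, abs_mul, abs_two, abs_sub_comm, abs_of_pos (by positivity : 0 < δ ^ 2)]
      -- The truncation must stay below `2|e|`, the distance to the mirror point, for the full value
      -- `1/(2|e|)` to be collected.
      refine ⟨fun _ => ⟨min (d / 2) (2 * |e|), lt_min (by linarith) (by positivity), fun r hr => ?_⟩, fun h0 => ?_⟩
      · have hrd : r ≤ d / 2 := hr.2.le.trans (min_le_left _ _)
        have hre : r < |2 * e| := by
          rw [abs_mul, abs_two]; exact hr.2.trans_le (min_le_right _ _)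
        have hse : (SignType.sign e : ℝ) * (1 / (2 * e)) = 1 / (2 * |e|) := by
          rcases lt_or_gt_of_ne he0 with h' | h'
          · rw [sign_neg h', abs_of_neg h', show ((-1 : SignType) : ℝ) = -1 by norm_num]; field_simp
          · rw [sign_pos h', abs_of_pos h', show ((1 : SignType) : ℝ) = 1 by norm_num, one_mul]
        have hint := h.integral_le (κ := κ) hε hc hi
          (g := fun z => SignType.sign e * (SignType.sign z / 2 - stepIncrement (2 * e) z))
          (m := -(1 / (2 * |e|)))
          (F := Function.update (fun _ => 2 / d) (Sum.inr i) (-(1 / (2 * |e|))))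
          (((measurable_coe_sign.div_const 2).sub (measurable_stepIncrement _)).const_mul _)
          (fun z => ?_) hr.1 hrd ?_ ?_ ?_ ?_
        · rw [hslope, hdt]
          simp only [layerSpeed, Sum.elim_inr]
          have hsum : ∑ k, Function.update (fun _ : ι ⊕ μ => 2 / d) (Sum.inr i) (-(1 / (2 * |e|))) k ≤
              -(1 / (2 * |e|)) + (Fintype.card (ι ⊕ μ) : ℕ) * (2 / d) := by
            rw [Finset.sum_update_of_mem (Finset.mem_univ _), Finset.sum_const, nsmul_eq_mul]
            have hd0 : 0 < d := by linarith
            refine add_le_add le_rfl (mul_le_mul_of_nonneg_right ?_ (by positivity))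
            exact_mod_cast Finset.card_le_univ _
          have hN := h.count
          -- Multiplied by `2|e|`, the own force becomes `-1` and the other layers contribute at
          -- most `1/2`, because `|e| < δ` and `8 δ` times their number is at most `d`. The
          -- remaining `-ε/2` is the rate at which the bump is lowered.
          have key : (∫ z in {z : ℝ | r < |z|}, stairUpper ε
              (layerBarrier ε κ δ L (ε / 2) τ σ a p (t, y + z) -
                layerBarrier ε κ δ L (ε / 2) τ σ a p (t, y)) / z ^ 2) * (2 * |e|) ≤ -(ε / 2) := by
            have h1 := hint.trans (mul_le_mul_of_nonneg_left hsum hε.le)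
            calc _ ≤ ε * (-(1 / (2 * |e|)) + (Fintype.card (ι ⊕ μ) : ℕ) * (2 / d)) * (2 * |e|) := by
                  gcongr
              _ = ε * (-1 + (4 * (Fintype.card (ι ⊕ μ) : ℕ) * |e|) / d) := by
                  have : d ≠ 0 := by linarith
                  field_simp
                  ring
              _ ≤ ε * (-1 + 1 / 2) := by
                  have : (4 * (Fintype.card (ι ⊕ μ) : ℕ) * |e|) / d ≤ 1 / 2 := by
                    rw [div_le_div_iff₀ (by linarith) two_pos]
                    have : (4 * (Fintype.card (ι ⊕ μ) : ℕ) * |e|) ≤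
                      4 * (Fintype.card (ι ⊕ μ) : ℕ) * δ := by gcongr
                    linarith
                  gcongr
              _ = _ := by ring
          calc _ = ((∫ z in {z : ℝ | r < |z|}, stairUpper ε
              (layerBarrier ε κ δ L (ε / 2) τ σ a p (t, y + z) -
                layerBarrier ε κ δ L (ε / 2) τ σ a p (t, y)) / z ^ 2) * (2 * |e|)) *
                (ε * D (Sum.inr i) / δ ^ 2) := by ring
            _ ≤ -(ε / 2) * (ε * D (Sum.inr i) / δ ^ 2) := by gcongr
            _ = _ := by ring
        · rw [abs_mul]
          refine (mul_le_of_le_one_left (abs_nonneg _) (abs_coe_sign_le e)).trans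
            ((abs_sub _ _).trans ?_)
          rw [abs_div, abs_two]
          have := abs_coe_sign_le z
          have := abs_stepIncrement_le (2 * e) z
          linarith
        · filter_upwards [compl_mem_ae_iff.2 (measure_singleton (0 : ℝ)),
            compl_mem_ae_iff.2 (measure_singleton (2 * e))] with z hz hz2
          exact own_bump_le hd hi he0 hz hz2
        · have hi1 : IntegrableOn (fun z => stepIncrement (2 * e) z / z ^ 2) {z : ℝ | r < |z|} :=
            integrableOn_div_sq hr.1 (measurableSet_lt_abs r) subset_rfl
              (measurable_stepIncrement _) fun z _ => abs_stepIncrement_le _ z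
          have hi2 : IntegrableOn (fun z : ℝ => SignType.sign e * (SignType.sign z / 2) / z ^ 2)
              {z : ℝ | r < |z|} := by
            refine integrableOn_div_sq (B := 1) hr.1 (measurableSet_lt_abs r) subset_rfl
              ((measurable_coe_sign.div_const 2).const_mul _) fun z _ => ?_
            rw [abs_mul, abs_div, abs_two]
            have h1 := abs_coe_sign_le z
            have h2 := abs_coe_sign_le e
            have h3 := abs_nonneg ((SignType.sign z : SignType) : ℝ)
            nlinarith
          have h1 : (fun z : ℝ => SignType.sign e * (SignType.sign z / 2 - stepIncrement (2 * e) z) /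
              z ^ 2) = fun z => SignType.sign e * (SignType.sign z / 2) / z ^ 2 -
                SignType.sign e * (stepIncrement (2 * e) z / z ^ 2) := by
            ext z; ring
          rw [h1, integral_sub hi2 (hi1.const_mul _), integral_sign_div_sq, integral_const_mul,
            integral_stepIncrement hr.1 hre, hse, zero_sub]
        · intro k hk
          simpa [hk] using h.layerForce_le_two_div (hfar k hk)
        · simp
      · exfalso
        have := abs_pos.2 he0
        rw [← abs_eq_zero, hslope] at h0
        have : 0 < ε * (D (Sum.inr i) * (2 * |e| / δ ^ 2)) := by positivity
        linarith

end Barrier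

/-! ### Regularity of trajectories -/

section Smoothness

variable {n : ℕ} {x : ℝ → Fin n → ℝ} {β : Fin n → ℤ}

theorem contDiffOn_velocity {I : Set ℝ} {m : WithTop ℕ∞}
    (hs : ∀ t ∈ I, ∀ i j, i ≠ j → β i ≠ 0 → β j ≠ 0 → x t i ≠ x t j)
    (hx : ∀ i, ContDiffOn ℝ m (fun t => x t i) I) (i : Fin n) :
    ContDiffOn ℝ m (fun t => velocity β (x t) i) I := by
  unfold velocity
  refine contDiffOn_const.mul (ContDiffOn.sum fun j hj => ?_)
  by_cases hb : β i = 0 ∨ β j = 0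
  · have : ((β i : ℝ) * (β j : ℝ)) = 0 := by rcases hb with h | h <;> simp [h]
    simp only [this, zero_div]
    exact contDiffOn_const
  · push Not at hb
    exact contDiffOn_const.div ((hx i).sub (hx j)) fun t ht =>
      sub_ne_zero.2 (hs t ht i j (Finset.mem_filter.1 hj).2.symm hb.1 hb.2)

/-- A bootstrap: while charges are separated, the velocity is as smooth as the positions, and the
equation gains one derivative. Test functions built on trajectories must be `C²`. -/
theorem contDiffOn_two_of_ode {I : Set ℝ} (hI : IsOpen I)
    (hs : ∀ t ∈ I, ∀ i j, i ≠ j → β i ≠ 0 → β j ≠ 0 → x t i ≠ x t j)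
    (hode : ∀ t ∈ I, ∀ i, HasDerivAt (fun s => x s i) (velocity β (x t) i) t) (i : Fin n) :
    ContDiffOn ℝ 2 (fun t => x t i) I := by
  have step : ∀ m : ℕ, (∀ i, ContDiffOn ℝ m (fun t => x t i) I) →
      ∀ i, ContDiffOn ℝ (m + 1) (fun t => x t i) I := fun m hm i => by
    rw [contDiffOn_succ_iff_deriv_of_isOpen hI]
    refine ⟨fun t ht => (hode t ht i).differentiableAt.differentiableWithinAt, fun h => by simp at h,
      (contDiffOn_velocity hs hm i).congr fun t ht => (hode t ht i).deriv⟩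
  have h0 : ∀ i, ContDiffOn ℝ ((0 : ℕ) : WithTop ℕ∞) (fun t => x t i) I := fun i => by
    rw [Nat.cast_zero, contDiffOn_zero]
    exact fun t ht => (hode t ht i).continuousAt.continuousWithinAt
  have h1 := step 0 h0
  have h2 := step 1 (by simpa using h1) i
  norm_num at h2
  exact h2

end Smoothness

/-! ### Smoothness, boundedness and Lipschitz continuity of the barrier -/

section BarrierRegularity

variable {ι μ : Type*} [Fintype ι] [Fintype μ] {ε κ δ L c τ T d : ℝ} {σ : ι → ℝ}
  {a : ι → ℝ → ℝ} {p : μ → ℝ}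

theorem contDiffOn_layerBarrier {m : ℕ∞} {I : Set ℝ} (ha : ∀ k, ContDiffOn ℝ m (a k) I) :
    ContDiffOn ℝ m (layerBarrier ε κ δ L c τ σ a p) (I ×ˢ univ) := by
  unfold layerBarrier
  refine contDiffOn_const.add (contDiffOn_const.mul (ContDiffOn.sum fun k _ => ?_))
  refine Real.smoothTransition.contDiff.comp_contDiffOn ?_
  rcases k with k | k
  · have h1 : ContDiffOn ℝ m (fun q : ℝ × ℝ => a k q.1) (I ×ˢ univ) :=
      (ha k).comp contDiff_fst.contDiffOn fun q hq => hq.1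
    simp only [layerArg, Sum.elim_inl]
    unfold wallArg
    refine ContDiffOn.add (ContDiffOn.div_const (contDiffOn_const.mul
      (contDiff_snd.contDiffOn.sub h1)) _) ?_
    exact (Real.contDiff_exp.comp (by fun_prop)).contDiffOn
  · simp only [layerArg, Sum.elim_inr]
    unfold bumpArg
    exact ContDiff.contDiffOn (by fun_prop)

theorem abs_layerBarrier_le (hε : 0 < ε) (q : ℝ × ℝ) :
    |layerBarrier ε κ δ L c τ σ a p q| ≤ |κ| + ε * (Fintype.card (ι ⊕ μ) : ℕ) := by
  unfold layerBarrier
  refine (abs_add_le _ _).trans (add_le_add le_rfl ?_)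
  rw [abs_mul, abs_of_pos hε]
  gcongr
  refine (Finset.abs_sum_le_sum_abs _ _).trans
      ((Finset.sum_le_sum (g := fun _ => (1 : ℝ)) fun k _ => ?_).trans (by simp))
  rw [abs_of_nonneg (Real.smoothTransition.nonneg _)]
  exact Real.smoothTransition.le_one _

theorem exists_deriv_smoothTransition_bound : ∃ K, ∀ s, |deriv Real.smoothTransition s| ≤ K := by
  have hc : Continuous (deriv Real.smoothTransition) :=
    (Real.smoothTransition.contDiff (n := 1)).continuous_deriv le_rfl
  obtain ⟨K, hK⟩ := (isCompact_Icc (a := (0 : ℝ)) (b := 1)).exists_bound_of_continuousOn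
    hc.continuousOn
  refine ⟨max K 0, fun s => ?_⟩
  by_cases hs : s ∈ Icc (0 : ℝ) 1
  · exact (hK s hs).trans (le_max_left _ _)
  · rw [deriv_smoothTransition_eq_zero, abs_zero]
    · exact le_max_right _ _
    · by_contra! h
      exact hs ⟨h.1.le, h.2.le⟩

/-- The argument of a bump has unbounded slope, but this matters only where the profile is not
constant, namely for `|y - p| < δ`, where the slope is at most `2/δ`. The constant may degenerate
with `δ`; it only enters the choice of the quartic penalty. -/
theorem exists_layerBarrier_lipschitz (hε : 0 < ε) (hδ : 0 < δ) (hc : 0 ≤ c)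
    (hσ : ∀ k, σ k = 1 ∨ σ k = -1) {t : ℝ} (ht : τ ≤ t) : ∃ K, ∀ y z,
      layerBarrier ε κ δ L c τ σ a p (t, y) - layerBarrier ε κ δ L c τ σ a p (t, z) ≤
        K * |y - z| := by
  obtain ⟨K, hK⟩ := exists_deriv_smoothTransition_bound
  have hK0 : 0 ≤ K := (abs_nonneg _).trans (hK 0)
  have hbound : ∀ (k : ι ⊕ μ) (y : ℝ), ‖deriv Real.smoothTransition (layerArg δ L c τ σ a p k (t, y)) *
      layerSlope δ σ p y k‖ ≤ K * (2 / δ) := by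
    intro k y
    rw [norm_mul, Real.norm_eq_abs, Real.norm_eq_abs]
    by_cases h0 : deriv Real.smoothTransition (layerArg δ L c τ σ a p k (t, y)) = 0
    · rw [h0, abs_zero, zero_mul]; positivity
    refine mul_le_mul (hK _) ?_ (abs_nonneg _) hK0
    rcases k with k | k
    · have h2 : |σ k| = 1 := by rcases hσ k with h | h <;> rw [h] <;> simp
      simp only [layerSlope, Sum.elim_inl, abs_div, h2, abs_of_pos hδ]
      gcongr
      norm_num
    · have h3 : |y - p k| < δ := by
        by_contra! h'
        exact h0 (deriv_smoothTransition_eq_zero (Or.inl (bumpArg_nonpos hδ hc ht h')))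
      simp only [layerSlope, Sum.elim_inr, abs_div, abs_neg, abs_mul, abs_two,
        abs_of_pos (by positivity : 0 < δ ^ 2)]
      rw [div_le_div_iff₀ (by positivity) hδ]
      nlinarith
  have hd : ∀ y, HasDerivAt (fun z => layerBarrier ε κ δ L c τ σ a p (t, z)) (ε * ∑ k,
      deriv Real.smoothTransition (layerArg δ L c τ σ a p k (t, y)) * layerSlope δ σ p y k) y :=
    fun y => ((HasDerivAt.fun_sum fun k _ => hasDerivAt_layer_right y k).const_mul ε).const_add κ
  refine ⟨ε * ((Fintype.card (ι ⊕ μ) : ℕ) * (K * (2 / δ))), fun y z => ?_⟩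
  refine (le_abs_self _).trans ?_
  refine Convex.norm_image_sub_le_of_norm_hasDerivWithin_le (s := univ)
    (f := fun z => layerBarrier ε κ δ L c τ σ a p (t, z))
    (fun w _ => (hd w).hasDerivWithinAt) (fun w _ => ?_) convex_univ (mem_univ z) (mem_univ y)
  rw [norm_mul, Real.norm_of_nonneg hε.le]
  gcongr
  refine (norm_sum_le _ _).trans ((Finset.sum_le_sum fun k _ => hbound k w).trans ?_)
  simp

end BarrierRegularity

/-! ### The barrier attached to a state of the particle system -/

section ParticleBarrier

variable {n : ℕ}

/-- The indices of the walls: the charged particles and, far away on each side, `N` walls that keep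
the barrier high at infinity. -/
abbrev WallIndex (β : Fin n → ℤ) (N : ℕ) : Type := {i : Fin n // β i ≠ 0} ⊕ (Bool × Fin N)

def sideSign (s : Bool) : ℝ := if s then 1 else -1

def wallSign (β : Fin n → ℤ) (N : ℕ) : WallIndex β N → ℝ :=
  Sum.elim (fun i => (β i : ℝ)) fun q => sideSign q.1

/-- The far walls start beyond `R` with spacing `D` on both sides, are high on their outer side, and
move inward with unit speed. Moving inward raises the barrier, and that speed pays for all forces
acting on them. -/
def wallCurve (x : ℝ → Fin n → ℝ) (β : Fin n → ℤ) (N : ℕ) (τ R D : ℝ) :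
    WallIndex β N → ℝ → ℝ :=
  Sum.elim (fun i t => x t i) fun q t => sideSign q.1 * (R + D * ((q.2 : ℕ) + 1) - (t - τ))

/-- The velocities of the walls. -/
def wallVelocity (β : Fin n → ℤ) (N : ℕ) (ξ : Fin n → ℝ) : WallIndex β N → ℝ :=
  Sum.elim (fun i => velocity β ξ i) fun q => -sideSign q.1

/-- The positions of the particles at which there is no charged particle. -/
def neutralPoints (β : Fin n → ℤ) (ξ : Fin n → ℝ) : Finset ℝ :=
  (Finset.univ.image ξ).filter fun q => ∀ i, β i ≠ 0 → ξ i ≠ q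

theorem sideSign_eq (s : Bool) : sideSign s = 1 ∨ sideSign s = -1 := by
  cases s <;> simp [sideSign]

theorem abs_sideSign (s : Bool) : |sideSign s| = 1 := by
  rcases sideSign_eq s with h | h <;> rw [h] <;> simp

variable {x : ℝ → Fin n → ℝ} {β : Fin n → ℤ} {N : ℕ} {τ R D t d δ L : ℝ}

theorem le_abs_sub_far {v : ℝ} (hv : |v| ≤ R - 1) (hD : 0 ≤ D) (ht : t - τ ≤ 1)
    (q : Bool × Fin N) :
    D ≤ |v - sideSign q.1 * (R + D * ((q.2 : ℕ) + 1) - (t - τ))| := by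
  have h1 := abs_sub_abs_le_abs_sub (sideSign q.1 * (R + D * ((q.2 : ℕ) + 1) - (t - τ))) v
  rw [abs_mul, abs_sideSign, one_mul] at h1
  have h2 := le_abs_self (R + D * ((q.2 : ℕ) + 1) - (t - τ))
  have h3 : 0 ≤ D * (q.2 : ℕ) := by positivity
  rw [abs_sub_comm]
  linarith

theorem le_abs_far_sub_far (hR : 1 ≤ R) (hD : 0 ≤ D) (ht : t - τ ≤ 1) {q q' : Bool × Fin N}
    (hq : q ≠ q') : D ≤ |sideSign q.1 * (R + D * ((q.2 : ℕ) + 1) - (t - τ)) -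
      sideSign q'.1 * (R + D * ((q'.2 : ℕ) + 1) - (t - τ))| := by
  obtain ⟨s, j⟩ := q
  obtain ⟨s', j'⟩ := q'
  have h3 : 0 ≤ D * (j : ℕ) := by positivity
  have h4 : 0 ≤ D * (j' : ℕ) := by positivity
  have hsame : s = s' → D ≤ |D * ((j : ℕ) - (j' : ℕ) : ℝ)| := fun h => by
    have hj : (j : ℕ) ≠ (j' : ℕ) := fun h' => hq (by rw [h, Fin.ext h'])
    rw [abs_mul, abs_of_nonneg hD]
    refine le_mul_of_one_le_right hD ?_
    rcases lt_or_gt_of_ne hj with h' | h'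
    · have : ((j : ℕ) : ℝ) + 1 ≤ (j' : ℕ) := by exact_mod_cast h'
      rw [abs_of_neg (by linarith)]; linarith
    · have : ((j' : ℕ) : ℝ) + 1 ≤ (j : ℕ) := by exact_mod_cast h'
      rw [abs_of_pos (by linarith)]; linarith
  cases s <;> cases s' <;> simp only [sideSign, if_true, Bool.false_eq_true, if_false]
  · convert hsame rfl using 1
    rw [← abs_neg]; congr 1; ring
  · rw [abs_of_nonpos (by linarith)]; linarith
  · rw [abs_of_nonneg (by linarith)]; linarith
  · convert hsame rfl using 1
    congr 1; ring

/-- The particles at time `t` are separated, also from the neutral points, and they are confined. -/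
structure Separated (x : ℝ → Fin n → ℝ) (β : Fin n → ℤ) (P : Finset ℝ) (t d R : ℝ) : Prop where
  particles : ∀ i j, i ≠ j → β i ≠ 0 → β j ≠ 0 → d ≤ |x t i - x t j|
  neutral : ∀ i, β i ≠ 0 → ∀ q ∈ P, d ≤ |x t i - q|
  points : ∀ q ∈ P, ∀ q' ∈ P, q ≠ q' → d ≤ |q - q'|
  confined : ∀ i, |x t i| ≤ R - 1
  confined_points : ∀ q ∈ P, |q| ≤ R - 1

variable {P : Finset ℝ}

theorem Separated.le_abs_wall_sub_far (hs : Separated x β P t d R) (hR : 1 ≤ R) (hD : 0 ≤ D)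
    (ht : t - τ ≤ 1) {k : WallIndex β N} {q : Bool × Fin N} (hk : k ≠ Sum.inr q) :
    D ≤ |wallCurve x β N τ R D k t - wallCurve x β N τ R D (Sum.inr q) t| := by
  rcases k with k | k
  · exact le_abs_sub_far (hs.confined k) hD ht q
  · exact le_abs_far_sub_far hR hD ht (by simpa using hk)

theorem Separated.layerConfig (hs : Separated x β P t d R) (hβ : ∀ i, β i ≠ 0 → β i = 1 ∨ β i = -1)
    (hR : 1 ≤ R) (hD : 0 ≤ D) (hdD : d ≤ D) (hτ : τ ≤ t) (ht : t - τ ≤ 1) (hδ : 0 < δ)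
    (hδd : 8 * δ ≤ d) (hδN : 8 * ((Fintype.card (WallIndex β N ⊕ P) : ℕ) : ℝ) * δ ≤ d)
    (hL : 0 ≤ L) (hE : Real.exp (L * (t - τ)) ≤ 2) :
    LayerConfig δ L τ t d (wallSign β N) (wallCurve x β N τ R D) (fun q : P => (q : ℝ)) where
  width_pos := hδ
  width_le := hδd
  count := hδN
  time := hτ
  exp_ge := Real.one_le_exp (mul_nonneg hL (sub_nonneg.2 hτ))
  exp_le := hE
  sign k := by
    rcases k with k | k
    · rcases hβ k k.2 with h | h <;> simp [wallSign, h]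
    · exact sideSign_eq _
  walls k l hkl := by
    rcases l with l | l
    · rcases k with k | k
      · exact hs.particles k l (fun h => hkl (by rw [Subtype.ext h])) k.2 l.2
      · rw [abs_sub_comm]
        exact hdD.trans (hs.le_abs_wall_sub_far hR hD ht hkl.symm)
    · exact hdD.trans (hs.le_abs_wall_sub_far hR hD ht hkl)
  wall_bump k q := by
    rcases k with k | k
    · exact hs.neutral k k.2 q q.2
    · rw [abs_sub_comm]
      exact hdD.trans (le_abs_sub_far (hs.confined_points q q.2) hD ht k)
  bumps q q' h := hs.points q q.2 q' q'.2 fun h' => h (Subtype.ext h')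

theorem sum_subtype_charged (f : Fin n → ℝ) (hf : ∀ i, β i = 0 → f i = 0) :
    ∑ i : {i : Fin n // β i ≠ 0}, f i = ∑ i, f i := by
  rw [← Finset.sum_subtype (Finset.univ.filter fun i => β i ≠ 0) (by simp) f]
  exact Finset.sum_filter_of_ne fun i _ hi h => hi (hf i h)

/-- The force balance of the walls is the particle equation multiplied by the charge, since the
square of the charge is 1. -/
theorem sum_wallSign_div (hβ : ∀ i, β i ≠ 0 → β i = 1 ∨ β i = -1) {i : Fin n} (hi : β i ≠ 0) :
    (1 / (n : ℝ)) * ∑ k : {k : Fin n // β k ≠ 0}, (β k : ℝ) / (x t k - x t i) =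
      -(β i * velocity β (x t) i) := by
  rw [sum_subtype_charged (fun k => (β k : ℝ) / (x t k - x t i)) fun k h => by simp [h]]
  unfold velocity
  have hii : (β i : ℝ) * β i = 1 := by rcases hβ i hi with h | h <;> simp [h]
  rw [mul_left_comm, ← mul_neg]
  congr 1
  rw [Finset.mul_sum, ← Finset.sum_neg_distrib]
  symm
  refine Finset.sum_subset_zero_on_sdiff (Finset.subset_univ _) (fun j hj => ?_) fun j _ => ?_
  · have : j = i := by simpa using hj
    simp [this]
  · rw [← neg_sub (x t j), div_neg, mul_neg, neg_neg, mul_div_assoc, ← mul_assoc, hii, one_mul]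

/-- At a particle, the exact force cancels the speed; the far walls add at most `M/D ≤ δ`, and the
errors from the widths are at most `M · 8δ/d²`. Both are covered by `δ L`. At a far wall all
distances are at least `D`, and the unit inward speed dominates. -/
theorem Separated.velocity_le (hs : Separated x β P t d R)
    (hβ : ∀ i, β i ≠ 0 → β i = 1 ∨ β i = -1) (hR : 1 ≤ R) (ht : t - τ ≤ 1) (hδ : 0 < δ)
    (hn : 0 < n) (hd : 0 < d)
    (hD : 1 + ((Fintype.card (WallIndex β N ⊕ P) : ℕ) : ℝ) * (1 / δ + 1) ≤ D)
    (hL : 1 + 8 * ((Fintype.card (WallIndex β N ⊕ P) : ℕ) : ℝ) / d ^ 2 ≤ L) (i : WallIndex β N) :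
    (1 / (n : ℝ)) * (∑ k, wallSign β N k /
        (wallCurve x β N τ R D k t - wallCurve x β N τ R D i t) +
      (Fintype.card (WallIndex β N ⊕ P) : ℕ) * (8 * δ / d ^ 2)) ≤
        -(wallSign β N i * wallVelocity β N (x t) i) + δ * L := by
  set M : ℝ := ((Fintype.card (WallIndex β N ⊕ P) : ℕ) : ℝ) with hM
  have hM0 : 0 ≤ M := Nat.cast_nonneg _
  have hn1 : (1 : ℝ) / n ≤ 1 := by
    rw [div_le_one (by positivity)]
    exact_mod_cast hn
  have hn0 : (0 : ℝ) ≤ 1 / n := by positivity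
  have hMδ : 0 ≤ M * (1 / δ) := by positivity
  have hD0 : 0 < D := by nlinarith
  have hMD : M / D ≤ δ := by
    rw [div_le_iff₀ hD0]
    calc M = δ * (M * (1 / δ)) := by field_simp
      _ ≤ δ * D := by gcongr; nlinarith
  have hMD1 : M / D ≤ 1 := by
    rw [div_le_one hD0]; nlinarith
  have hLδ : M * (8 * δ / d ^ 2) ≤ δ * L - δ := by
    calc M * (8 * δ / d ^ 2) = δ * (1 + 8 * M / d ^ 2) - δ := by ring
      _ ≤ _ := by gcongr
  have hLδ0 : 0 ≤ M * (8 * δ / d ^ 2) := by positivity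
  have hσ : ∀ k : WallIndex β N, |wallSign β N k| = 1 := fun k => by
    rcases k with k | k
    · rcases hβ k k.2 with h | h <;> simp [wallSign, h]
    · exact abs_sideSign _
  have hcard : ((Fintype.card (WallIndex β N) : ℕ) : ℝ) ≤ M := by
    rw [hM, Nat.cast_le]
    exact Fintype.card_le_of_injective Sum.inl Sum.inl_injective
  rcases i with i | i
  · have hfar : ∑ q : Bool × Fin N, wallSign β N (Sum.inr q) /
        (wallCurve x β N τ R D (Sum.inr q) t - wallCurve x β N τ R D (Sum.inl i) t) ≤ M / D := by
      refine (Finset.sum_le_sum (g := fun _ => 1 / D) fun q _ => ?_).trans ?_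
      · refine (le_abs_self _).trans ?_
        rw [abs_div, hσ, abs_sub_comm]
        have := hs.le_abs_wall_sub_far (τ := τ) hR hD0.le ht (k := Sum.inl i) (q := q) (by simp)
        gcongr
      · rw [Finset.sum_const, nsmul_eq_mul, mul_one_div]
        gcongr
        refine le_trans ?_ hcard
        rw [Fintype.card_sum, Finset.card_univ]
        push_cast
        linarith [Nat.cast_nonneg (α := ℝ) (Fintype.card {i : Fin n // β i ≠ 0})]
    have hparticles := sum_wallSign_div (x := x) (t := t) hβ i.2
    rw [Fintype.sum_sum_type, mul_add, mul_add]
    have h1 : (1 / (n : ℝ)) * (M * (8 * δ / d ^ 2)) ≤ 1 * (M * (8 * δ / d ^ 2)) := by gcongr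
    have h2 : (1 / (n : ℝ)) * ∑ q : Bool × Fin N, wallSign β N (Sum.inr q) /
        (wallCurve x β N τ R D (Sum.inr q) t - wallCurve x β N τ R D (Sum.inl i) t) ≤ δ := by
      calc _ ≤ 1 / (n : ℝ) * (M / D) := by gcongr
        _ ≤ 1 * (M / D) := by gcongr
        _ ≤ δ := by linarith
    simp only [wallSign, wallCurve, wallVelocity, Sum.elim_inl, Sum.elim_inr] at h2 hparticles ⊢
    rw [hparticles]
    linarith
  · have hall : ∑ k, wallSign β N k /
        (wallCurve x β N τ R D k t - wallCurve x β N τ R D (Sum.inr i) t) ≤ M / D := by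
      refine (Finset.sum_le_sum (g := fun _ => 1 / D) fun k _ => ?_).trans ?_
      · rcases eq_or_ne k (Sum.inr i) with rfl | hk
        · rw [sub_self, div_zero]; positivity
        refine (le_abs_self _).trans ?_
        rw [abs_div, hσ]
        have := hs.le_abs_wall_sub_far (τ := τ) hR hD0.le ht hk
        gcongr
      · rw [Finset.sum_const, nsmul_eq_mul, mul_one_div, Finset.card_univ]
        gcongr
    have h1 : -(wallSign β N (Sum.inr i) * wallVelocity β N (x t) (Sum.inr i)) = 1 := by
      rcases sideSign_eq i.1 with h | h <;> simp [wallSign, wallVelocity, h]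
    rw [h1]
    calc _ ≤ 1 / (n : ℝ) * (M / D + M * (8 * δ / d ^ 2)) := by gcongr
      _ ≤ 1 * (M / D + M * (8 * δ / d ^ 2)) := by gcongr
      _ ≤ _ := by linarith

end ParticleBarrier

/-! ### Values of the barrier compared with the envelope -/

section Values

variable {n : ℕ} {x : ℝ → Fin n → ℝ} {β : Fin n → ℤ} {N : ℕ} {τ R D t d δ L c : ℝ} {P : Finset ℝ}

/-- The barrier built on a state of the particle system. -/
def particleBarrier (x : ℝ → Fin n → ℝ) (β : Fin n → ℤ) (N : ℕ) (P : Finset ℝ)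
    (δ L τ R D : ℝ) : ℝ × ℝ → ℝ :=
  layerBarrier (1 / (n : ℝ)) ((1 / (n : ℝ)) * ∑ i : {i : Fin n // β i ≠ 0}, min 0 (β i : ℝ)) δ L
    ((1 / (n : ℝ)) / 2) τ (wallSign β N) (wallCurve x β N τ R D) fun q : P => (q : ℝ)

/-- The contribution of a particle to the upper envelope. -/
def particleTop (β : Fin n → ℤ) (ξ : Fin n → ℝ) (y : ℝ) (i : Fin n) : ℝ :=
  if ξ i < y then (β i : ℝ) else if ξ i = y then max 0 (β i : ℝ) else 0

theorem leftValue_add_eq (β : Fin n → ℤ) (ξ : Fin n → ℝ) (y : ℝ) :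
    leftValue β ξ y + (1 / (n : ℝ)) * ∑ i ∈ cluster β ξ y, max 0 (β i : ℝ) =
      (1 / (n : ℝ)) * ∑ i : {i : Fin n // β i ≠ 0}, particleTop β ξ y i := by
  rw [sum_subtype_charged (particleTop β ξ y) fun i h => by simp [particleTop, h]]
  unfold leftValue cluster particleTop
  rw [← mul_add, Finset.sum_filter, Finset.sum_filter, ← Finset.sum_add_distrib]
  congr 1
  refine Finset.sum_congr rfl fun i _ => ?_
  by_cases hb : β i = 0
  · simp [hb]
  · rcases lt_trichotomy (ξ i) y with h | h | h
    · simp [h, h.ne, hb]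
    · simp [h, hb]
    · simp [h.ne', not_lt.2 h.le, hb]

theorem particleBarrier_eq (t y : ℝ) : particleBarrier x β N P δ L τ R D (t, y) = (1 / (n : ℝ)) *
    (∑ i : {i : Fin n // β i ≠ 0}, (min 0 (β i : ℝ) +
      Real.smoothTransition (wallArg δ L τ (β i) (fun t => x t i) (t, y))) +
    ∑ q : Bool × Fin N, Real.smoothTransition (wallArg δ L τ (sideSign q.1)
      (fun t => sideSign q.1 * (R + D * ((q.2 : ℕ) + 1) - (t - τ))) (t, y)) +
    ∑ q : P, Real.smoothTransition (bumpArg δ ((1 / (n : ℝ)) / 2) τ q (t, y))) := by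
  unfold particleBarrier layerBarrier
  rw [Fintype.sum_sum_type, Fintype.sum_sum_type, Finset.sum_add_distrib]
  simp only [layerArg, wallSign, wallCurve, Sum.elim_inl, Sum.elim_inr]
  ring

/-- The offset is at least 1, so the wall is fully up at the particle itself and on its high side.
The constant `min 0 (β i)` normalises a negative wall to go from 0 down to `-1`. -/
theorem particleTop_le (hβ : ∀ i, β i ≠ 0 → β i = 1 ∨ β i = -1) (hδ : 0 < δ) (hL : 0 ≤ L)
    (ht : τ ≤ t) {i : Fin n} (hi : β i ≠ 0) (y : ℝ) :
    particleTop β (x t) y i ≤ min 0 (β i : ℝ) +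
      Real.smoothTransition (wallArg δ L τ (β i) (fun t => x t i) (t, y)) := by
  have hE : 1 ≤ Real.exp (L * (t - τ)) := Real.one_le_exp (mul_nonneg hL (sub_nonneg.2 ht))
  have h1 : 0 ≤ (β i : ℝ) * (y - x t i) →
      Real.smoothTransition (wallArg δ L τ (β i) (fun t => x t i) (t, y)) = 1 := fun h => by
    refine Real.smoothTransition.one_of_one_le ?_
    unfold wallArg
    have : 0 ≤ (β i : ℝ) * (y - x t i) / δ := by positivity
    simp only
    linarith
  have h0 := Real.smoothTransition.nonneg (wallArg δ L τ (β i) (fun t => x t i) (t, y))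
  unfold particleTop
  rcases hβ i hi with h | h
  · have hb : (β i : ℝ) = 1 := by rw [h]; norm_num
    rw [hb] at h1 h0 ⊢
    rw [min_eq_left zero_le_one, max_eq_right zero_le_one, zero_add]
    split_ifs with h2 h3
    · exact (h1 (by linarith)).ge
    · exact (h1 (by linarith)).ge
    · exact h0
  · have hb : (β i : ℝ) = -1 := by rw [h]; norm_num
    rw [hb] at h1 h0 ⊢
    rw [min_eq_right (by norm_num), max_eq_left (by norm_num)]
    split_ifs with h2 h3
    · linarith
    · linarith [h1 (by linarith)]
    · have := not_lt.1 h2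
      linarith [h1 (by linarith)]

/-- The converse bound, valid off the transition region and also at the particle itself, where the
profile being at most 1 is enough. -/
theorem eq_particleTop (hβ : ∀ i, β i ≠ 0 → β i = 1 ∨ β i = -1) (hδ : 0 < δ) (hL : 0 ≤ L)
    (ht : τ ≤ t) (hE : Real.exp (L * (t - τ)) ≤ 2) {i : Fin n} (hi : β i ≠ 0) {y : ℝ}
    (hy : x t i ≠ y → 2 * δ ≤ |y - x t i|) :
    min 0 (β i : ℝ) + Real.smoothTransition (wallArg δ L τ (β i) (fun t => x t i) (t, y)) ≤
      particleTop β (x t) y i := by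
  have hE1 : 1 ≤ Real.exp (L * (t - τ)) := Real.one_le_exp (mul_nonneg hL (sub_nonneg.2 ht))
  have h1 := Real.smoothTransition.le_one (wallArg δ L τ (β i) (fun t => x t i) (t, y))
  unfold particleTop
  by_cases hxy : x t i = y
  · rw [if_neg (by simp [hxy]), if_pos hxy]
    rcases hβ i hi with h | h <;> rw [h] at h1 ⊢ <;> norm_num at h1 ⊢
    · exact h1
    · exact h1
  have hσ : (β i : ℝ) = 1 ∨ (β i : ℝ) = -1 := by exact_mod_cast hβ i hi
  obtain ⟨h2, h3⟩ := wallArg_of_le (a := fun t => x t i) hδ hE (hy hxy) hσ hE1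
  rcases lt_or_gt_of_ne hxy with h4 | h4
  · rw [if_pos h4]
    rcases hσ with h | h
    · rw [h] at h1 ⊢; norm_num; exact h1
    · rw [Real.smoothTransition.zero_of_nonpos (h3 (by rw [h]; linarith)), h]; norm_num
  · rw [if_neg (not_lt.2 h4.le), if_neg h4.ne']
    rcases hσ with h | h
    · rw [Real.smoothTransition.zero_of_nonpos (h3 (by rw [h]; linarith)), h]; norm_num
    · rw [h] at h1 ⊢; norm_num; exact h1

theorem le_particleBarrier (hβ : ∀ i, β i ≠ 0 → β i = 1 ∨ β i = -1) (hδ : 0 < δ) (hL : 0 ≤ L)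
    (ht : τ ≤ t) (y : ℝ) :
    leftValue β (x t) y + (1 / (n : ℝ)) * ∑ i ∈ cluster β (x t) y, max 0 (β i : ℝ) ≤
      particleBarrier x β N P δ L τ R D (t, y) := by
  rw [leftValue_add_eq, particleBarrier_eq]
  gcongr
  have h1 := Finset.sum_nonneg fun (q : Bool × Fin N) (_ : q ∈ Finset.univ) =>
    Real.smoothTransition.nonneg (wallArg δ L τ (sideSign q.1)
      (fun t => sideSign q.1 * (R + D * ((q.2 : ℕ) + 1) - (t - τ))) (t, y))
  have h2 := Finset.sum_nonneg fun (q : P) (_ : q ∈ Finset.univ) =>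
    Real.smoothTransition.nonneg (bumpArg δ ((1 / (n : ℝ)) / 2) τ q (t, y))
  have h3 := Finset.sum_le_sum fun (i : {i : Fin n // β i ≠ 0}) (_ : i ∈ Finset.univ) =>
    particleTop_le (x := x) (L := L) hβ hδ hL ht i.2 y
  linarith

/-- At time `τ` a bump has height one quantum at its centre, which covers the excess that the
envelope may have after a complete annihilation. -/
theorem le_particleBarrier_of_mem (hβ : ∀ i, β i ≠ 0 → β i = 1 ∨ β i = -1) (hδ : 0 < δ)
    (hL : 0 ≤ L) {y : ℝ} (hy : y ∈ P) :
    leftValue β (x τ) y + 1 / (n : ℝ) ≤ particleBarrier x β N P δ L τ R D (τ, y) := by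
  have h4 : leftValue β (x τ) y + 1 / (n : ℝ) ≤
      (leftValue β (x τ) y + (1 / (n : ℝ)) * ∑ i ∈ cluster β (x τ) y, max 0 (β i : ℝ)) +
        (1 / (n : ℝ)) * 1 := by
    have : 0 ≤ (1 / (n : ℝ)) * ∑ i ∈ cluster β (x τ) y, max 0 (β i : ℝ) :=
      mul_nonneg (by positivity) (Finset.sum_nonneg fun i _ => le_max_left _ _)
    linarith
  refine h4.trans ?_
  rw [leftValue_add_eq, particleBarrier_eq, ← mul_add]
  refine mul_le_mul_of_nonneg_left ?_ (by positivity)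
  have h1 := Finset.sum_nonneg fun (q : Bool × Fin N) (_ : q ∈ Finset.univ) =>
    Real.smoothTransition.nonneg (wallArg δ L τ (sideSign q.1)
      (fun t => sideSign q.1 * (R + D * ((q.2 : ℕ) + 1) - (t - τ))) (τ, y))
  have h2 := Finset.single_le_sum (s := Finset.univ)
    (f := fun q : P => Real.smoothTransition (bumpArg δ ((1 / (n : ℝ)) / 2) τ q (τ, y)))
    (fun q _ => Real.smoothTransition.nonneg _) (Finset.mem_univ ⟨y, hy⟩)
  have h5 : Real.smoothTransition (bumpArg δ ((1 / (n : ℝ)) / 2) τ y (τ, y)) = 1 :=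
    Real.smoothTransition.one_of_one_le (by simp [bumpArg])
  simp only [h5] at h2
  have h3 := Finset.sum_le_sum fun (i : {i : Fin n // β i ≠ 0}) (_ : i ∈ Finset.univ) =>
    particleTop_le (x := x) (L := L) hβ hδ hL (le_refl τ) i.2 y
  linarith

/-- At a fixed later point small `δ` makes the barrier exact: walls are saturated there, far walls
have not started, and the bumps are gone because `δ²` is at most the amount by which they have been
lowered. -/
theorem particleBarrier_le (hβ : ∀ i, β i ≠ 0 → β i = 1 ∨ β i = -1) (hδ : 0 < δ) (hL : 0 ≤ L)
    (ht : τ ≤ t) (ht1 : t - τ ≤ 1) (hE : Real.exp (L * (t - τ)) ≤ 2) {y : ℝ}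
    (hy : ∀ i, x t i ≠ y → 2 * δ ≤ |y - x t i|) (hyR : |y| ≤ R - 1) (hδD : 2 * δ ≤ D)
    (hδt : δ ^ 2 ≤ (1 / (n : ℝ)) / 2 * (t - τ)) :
    particleBarrier x β N P δ L τ R D (t, y) ≤
    leftValue β (x t) y + (1 / (n : ℝ)) * ∑ i ∈ cluster β (x t) y, max 0 (β i : ℝ) := by
  have hE1 : 1 ≤ Real.exp (L * (t - τ)) := Real.one_le_exp (mul_nonneg hL (sub_nonneg.2 ht))
  rw [leftValue_add_eq, particleBarrier_eq]
  gcongr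
  rw [Finset.sum_eq_zero (s := Finset.univ) (f := fun q : P =>
    Real.smoothTransition (bumpArg δ ((1 / (n : ℝ)) / 2) τ q (t, y))), add_zero,
    Finset.sum_eq_zero (s := Finset.univ) (f := fun q : Bool × Fin N =>
      Real.smoothTransition (wallArg δ L τ (sideSign q.1)
      (fun t => sideSign q.1 * (R + D * ((q.2 : ℕ) + 1) - (t - τ))) (t, y))), add_zero]
  · exact Finset.sum_le_sum fun i _ => eq_particleTop hβ hδ hL ht hE i.2 (hy i)
  · intro q _
    have hfar := le_abs_sub_far hyR (by linarith) ht1 (D := D) q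
    refine Real.smoothTransition.zero_of_nonpos ((wallArg_of_le (a := fun t =>
      sideSign q.1 * (R + D * ((q.2 : ℕ) + 1) - (t - τ))) hδ hE (hδD.trans hfar)
      (sideSign_eq q.1) hE1).2 ?_)
    have h3 : 0 ≤ D * (q.2 : ℕ) := mul_nonneg (by linarith) (Nat.cast_nonneg _)
    have h4 := abs_le.1 hyR
    rcases sideSign_eq q.1 with h | h <;> rw [h] <;> linarith
  · intro q _
    refine Real.smoothTransition.zero_of_nonpos ?_
    unfold bumpArg
    simp only
    rw [sub_nonpos, one_le_div (by positivity)]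
    have := sq_nonneg (y - q)
    linarith

/-- The barrier is high at infinity. -/
theorem le_particleBarrier_far (hn : 0 < n) (hβ : ∀ i, β i ≠ 0 → β i = 1 ∨ β i = -1) (hδ : 0 < δ)
    (hL : 0 ≤ L) (ht : τ ≤ t) (hD : 0 ≤ D) {C : ℝ} (hN : C + 1 ≤ (1 / (n : ℝ)) * N) {y : ℝ}
    (hy : R + D * N ≤ |y|) : C ≤ particleBarrier x β N P δ L τ R D (t, y) := by
  have hE1 : 1 ≤ Real.exp (L * (t - τ)) := Real.one_le_exp (mul_nonneg hL (sub_nonneg.2 ht))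
  rw [particleBarrier_eq]
  have h2 := Finset.sum_nonneg fun (q : P) (_ : q ∈ Finset.univ) =>
    Real.smoothTransition.nonneg (bumpArg δ ((1 / (n : ℝ)) / 2) τ q (t, y))
  have h3 : -(n : ℝ) ≤ ∑ i : {i : Fin n // β i ≠ 0}, (min 0 (β i : ℝ) +
      Real.smoothTransition (wallArg δ L τ (β i) (fun t => x t i) (t, y))) := by
    calc -(n : ℝ) ≤ ∑ i : {i : Fin n // β i ≠ 0}, (-1 : ℝ) := by
          rw [Finset.sum_const, nsmul_eq_mul, Finset.card_univ]
          have : ((Fintype.card {i : Fin n // β i ≠ 0} : ℕ) : ℝ) ≤ n := by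
            exact_mod_cast (Fintype.card_subtype_le _).trans (Fintype.card_fin n).le
          linarith
      _ ≤ _ := by
          refine Finset.sum_le_sum fun i _ => ?_
          have := Real.smoothTransition.nonneg (wallArg δ L τ (β i) (fun t => x t i) (t, y))
          have : (-1 : ℝ) ≤ min 0 (β i : ℝ) := by
            rcases hβ i i.2 with h | h <;> rw [h] <;> norm_num
          linarith
  have h4 : (N : ℝ) ≤ ∑ q : Bool × Fin N, Real.smoothTransition (wallArg δ L τ (sideSign q.1)
      (fun t => sideSign q.1 * (R + D * ((q.2 : ℕ) + 1) - (t - τ))) (t, y)) := by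
    rw [Fintype.sum_prod_type_right]
    calc (N : ℝ) = ∑ _j : Fin N, (1 : ℝ) := by simp
      _ ≤ _ := Finset.sum_le_sum fun j _ => ?_
    -- Only the walls on the side of `y` are used. All `N` of them lie between the origin and `y`,
    -- hence are fully up.
    obtain ⟨s, hs⟩ : ∃ s, sideSign s * y = |y| := by
      rcases abs_cases y with h | h
      · exact ⟨true, by rw [h.1]; simp [sideSign]⟩
      · exact ⟨false, by rw [h.1]; simp [sideSign]⟩
    have h5 : Real.smoothTransition (wallArg δ L τ (sideSign s)
        (fun t => sideSign s * (R + D * ((j : ℕ) + 1) - (t - τ))) (t, y)) = 1 := by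
      refine Real.smoothTransition.one_of_one_le ?_
      unfold wallArg
      simp only
      have hss : sideSign s * sideSign s = 1 := by
        rcases sideSign_eq s with h | h <;> rw [h] <;> norm_num
      have h6 : sideSign s * (y - sideSign s * (R + D * ((j : ℕ) + 1) - (t - τ))) =
          |y| - (R + D * ((j : ℕ) + 1) - (t - τ)) := by
        rw [← hs]; linear_combination (-(R + D * ((j : ℕ) + 1) - (t - τ))) * hss
      have h7 : ((j : ℕ) : ℝ) + 1 ≤ N := by exact_mod_cast j.2
      have h8 : D * ((j : ℕ) + 1) ≤ D * N := by gcongr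
      have : 0 ≤ sideSign s * (y - sideSign s * (R + D * ((j : ℕ) + 1) - (t - τ))) / δ := by
        rw [h6]
        exact div_nonneg (by linarith) hδ.le
      linarith
    refine h5.ge.trans ?_
    exact Finset.single_le_sum (s := Finset.univ) (f := fun s => Real.smoothTransition
      (wallArg δ L τ (sideSign s) (fun t => sideSign s * (R + D * ((j : ℕ) + 1) - (t - τ))) (t, y)))
      (fun s _ => Real.smoothTransition.nonneg _) (Finset.mem_univ s)
  have hnn : (0 : ℝ) < n := by exact_mod_cast hn
  calc C ≤ (1 / (n : ℝ)) * (-(n : ℝ) + N + 0) := by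
        have : (1 / (n : ℝ)) * n = 1 := by field_simp
        linarith
    _ ≤ _ := by gcongr

end Values

/-! ### Comparison forward in time -/

section Forward

variable {n : ℕ} {x : ℝ → Fin n → ℝ} {b : ℝ → Fin n → ℤ}

theorem eventually_mul_le {A B : ℝ} (hB : 0 < B) : ∀ᶠ δ in 𝓝[>] (0 : ℝ), A * δ ≤ B := by
  have h : Tendsto (fun δ => A * δ) (𝓝[>] (0 : ℝ)) (𝓝 (A * 0)) :=
    tendsto_nhdsWithin_of_tendsto_nhds (Continuous.tendsto (by fun_prop) 0)
  rw [mul_zero] at h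
  exact (h.eventually_lt_const hB).mono fun δ h => h.le

theorem exists_separation (ξ : Fin n → ℝ) :
    ∃ d > 0, ∀ i j, ξ i ≠ ξ j → 4 * d ≤ |ξ i - ξ j| := by
  have h : ∀ᶠ d in 𝓝[>] (0 : ℝ), ∀ i j, ξ i ≠ ξ j → 4 * d ≤ |ξ i - ξ j| := by
    rw [eventually_all]
    intro i
    rw [eventually_all]
    intro j
    by_cases hij : ξ i = ξ j
    · exact Eventually.of_forall fun d h => absurd hij h
    · exact (eventually_mul_le (abs_pos.2 (sub_ne_zero.2 hij))).mono fun d h _ => h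
  obtain ⟨d, hd, hd0⟩ := (h.and self_mem_nhdsWithin).exists
  exact ⟨d, hd0, hd⟩

/-- Distances of at least `4d` between distinct initial positions leave at least `d` after
displacements by at most `d` each. Equal positions can only involve neutral particles, as a state
has at most one charge per point. -/
theorem separated_of_close {ξ : Fin n → ℝ} {β : Fin n → ℤ} (hξ : (ξ, β) ∈ stateSpace n)
    {d R t : ℝ} (hd : 0 < d) (hsep : ∀ i j, ξ i ≠ ξ j → 4 * d ≤ |ξ i - ξ j|)
    (hclose : ∀ i, |x t i - ξ i| ≤ d) (hR : ∀ i, |ξ i| + d + 1 ≤ R) :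
    Separated x β (neutralPoints β ξ) t d R where
  particles i j hij hi hj := by
    have hne : ξ i ≠ ξ j := fun he => by
      have hi' : i ∈ cluster β ξ (ξ j) := mem_cluster.2 ⟨hi, he⟩
      have hj' : j ∈ cluster β ξ (ξ j) := mem_cluster.2 ⟨hj, rfl⟩
      exact hij (cluster_subsingleton hξ hi' hj')
    have h1 := hsep i j hne
    have h2 := hclose i
    have h3 := hclose j
    have h4 := abs_sub_le (ξ i) (x t i) (ξ j)
    have h5 := abs_sub_le (x t i) (x t j) (ξ j)
    rw [abs_sub_comm (ξ i) (x t i)] at h4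
    linarith
  neutral i hi q hq := by
    obtain ⟨hq1, hq2⟩ := Finset.mem_filter.1 hq
    obtain ⟨k, -, rfl⟩ := Finset.mem_image.1 hq1
    have h1 := hsep i k (hq2 i hi)
    have h2 := hclose i
    have h4 := abs_sub_le (ξ i) (x t i) (ξ k)
    rw [abs_sub_comm (ξ i) (x t i)] at h4
    linarith
  points q hq q' hq' hne := by
    obtain ⟨k, -, rfl⟩ := Finset.mem_image.1 (Finset.mem_filter.1 hq).1
    obtain ⟨k', -, rfl⟩ := Finset.mem_image.1 (Finset.mem_filter.1 hq').1
    have h1 := hsep k k' hne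
    linarith
  confined i := by
    have h1 := hclose i
    have h2 := abs_sub_abs_le_abs_sub (x t i) (ξ i)
    linarith [hR i]
  confined_points q hq := by
    obtain ⟨k, -, rfl⟩ := Finset.mem_image.1 (Finset.mem_filter.1 hq).1
    linarith [hR k]

theorem hasDerivAt_wallCurve {β : Fin n → ℤ} {N : ℕ} {τ R D t : ℝ}
    (hode : ∀ i, HasDerivAt (fun s => x s i) (velocity β (x t) i) t) (k : WallIndex β N) :
    HasDerivAt (wallCurve x β N τ R D k) (wallVelocity β N (x t) k) t := by
  rcases k with k | k
  · exact hode k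
  · have h := (((hasDerivAt_id t).sub_const τ).const_sub (R + D * ((k.2 : ℕ) + 1))).const_mul
      (sideSign k.1)
    exact h.congr_deriv (by simp [wallVelocity])

/-- The comparison with the particle system is propagated forward in time. -/
theorem ParticleEvolution.exists_forward_comparison (h : ParticleEvolution x b) (hn : 0 < n)
    {ρ : ℝ} (hρ : 0 < ρ) {V : ℝ × ℝ → ℝ} (hV : IsSubsolution ρ (1 / (n : ℝ)) V)
    (hVu : UpperSemicontinuousOn V (closure Q)) {C : ℝ} (hVC : ∀ t, 0 ≤ t → ∀ y, |V (t, y)| ≤ C)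
    {τ : ℝ} (hτ : 0 ≤ τ) (hVU : ∀ y, V (τ, y) ≤ upperEnv Q (particleStep x b) (τ, y)) :
    ∃ δ₁ > 0, ∀ t ∈ Ico τ (τ + δ₁), ∀ y, V (t, y) ≤ upperEnv Q (particleStep x b) (t, y) := by
  have hnR : (0 : ℝ) < n := by exact_mod_cast hn
  have hε : (0 : ℝ) < 1 / n := by positivity
  obtain ⟨δ₀, hδ₀, hr⟩ := h.right τ hτ
  set β := b τ with hβdef
  set P := neutralPoints β (x τ) with hP
  have hstate := h.mem τ hτ
  have hβ : ∀ i, β i ≠ 0 → β i = 1 ∨ β i = -1 := fun i hi => charge_eq_of_ne_zero hstate hi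
  obtain ⟨d, hd, hsep⟩ := exists_separation (x τ)
  obtain ⟨δ₂, hδ₂, hclose⟩ : ∃ δ₂ > 0, ∀ t ∈ Ico τ (τ + δ₂), ∀ i, |x t i - x τ i| ≤ d := by
    have h1 : ∀ᶠ t in 𝓝[≥] τ, ∀ i, |x t i - x τ i| ≤ d := by
      rw [eventually_all]
      intro i
      have h2 : Tendsto (fun t => |x t i - x τ i|) (𝓝[≥] τ) (𝓝 |x τ i - x τ i|) :=
        ((((h.cont i τ hτ).mono (Ici_subset_Ici.2 hτ)).tendsto).sub_const _).abs
      rw [sub_self, abs_zero] at h2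
      exact (h2.eventually_lt_const hd).mono fun t ht => ht.le
    obtain ⟨u, hu, hus⟩ := (mem_nhdsGE_iff_exists_Ico_subset).1 h1
    exact ⟨u - τ, sub_pos.2 hu, fun t ht => hus (by simpa using ht)⟩
  obtain ⟨N, hN⟩ := exists_nat_ge ((C + 1) * n)
  have hN' : C + 1 ≤ (1 / (n : ℝ)) * N := by
    rw [one_div_mul_eq_div, le_div_iff₀ hnR]; exact hN
  set M : ℝ := ((Fintype.card (WallIndex β N ⊕ P) : ℕ) : ℝ) with hM
  have hM0 : 0 ≤ M := Nat.cast_nonneg _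
  set L := 1 + 8 * M / d ^ 2 with hLdef
  have hL : 0 < L := by positivity
  have hlog : 0 < Real.log 2 := Real.log_pos one_lt_two
  set δ₁ := min (min δ₀ δ₂) (min 1 (Real.log 2 / L)) with hδ₁
  have hδ₁0 : 0 < δ₁ := by positivity
  have hsub0 : δ₁ ≤ δ₀ := (min_le_left _ _).trans (min_le_left _ _)
  have hsub2 : δ₁ ≤ δ₂ := (min_le_left _ _).trans (min_le_right _ _)
  have hsub1 : δ₁ ≤ 1 := (min_le_right _ _).trans (min_le_left _ _)
  have hsubL : δ₁ ≤ Real.log 2 / L := (min_le_right _ _).trans (min_le_right _ _)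
  have hE : ∀ t, t < τ + δ₁ → Real.exp (L * (t - τ)) ≤ 2 := fun t ht => by
    rw [← Real.le_log_iff_exp_le two_pos]
    have h1 : t - τ ≤ Real.log 2 / L := by linarith
    rw [le_div_iff₀ hL] at h1
    linarith
  refine ⟨δ₁, hδ₁0, fun t₁ ht₁ y₁ => ?_⟩
  rcases ht₁.1.eq_or_lt with rfl | hlt
  · exact hVU y₁
  have hbt : b t₁ = β := (hr t₁ ⟨ht₁.1, by linarith [ht₁.2]⟩).1
  refine le_trans ?_ (h.le_upperEnv (hτ.trans ht₁.1) y₁)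
  rw [hbt]
  set R := ∑ i, |x τ i| + d + |y₁| + 1 with hR
  have hsum0 : 0 ≤ ∑ i, |x τ i| := Finset.sum_nonneg fun i _ => abs_nonneg _
  have hRi : ∀ i, |x τ i| + d + 1 ≤ R := fun i => by
    have := Finset.single_le_sum (f := fun i => |x τ i|) (fun i _ => abs_nonneg _)
      (Finset.mem_univ i)
    linarith [abs_nonneg y₁]
  have hR1 : 1 ≤ R := by linarith [abs_nonneg y₁]
  -- The width is chosen after the target point `(t₁, y₁)`: small enough for the barrier to coincide
  -- there with the envelope and for the bumps to have vanished at `t₁`.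
  obtain ⟨δ, ⟨hδ8, hδM, hδ1, hδy, hδt⟩, hδ⟩ : ∃ δ : ℝ, (8 * δ ≤ d ∧ 8 * M * δ ≤ d ∧ 2 * δ ≤ 1 ∧
      (∀ i, x t₁ i ≠ y₁ → 2 * δ ≤ |y₁ - x t₁ i|) ∧ 1 * δ ≤ (1 / (n : ℝ)) / 2 * (t₁ - τ)) ∧ 0 < δ := by
    have h5 : ∀ᶠ δ in 𝓝[>] (0 : ℝ), ∀ i, x t₁ i ≠ y₁ → 2 * δ ≤ |y₁ - x t₁ i| := by
      rw [eventually_all]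
      intro i
      by_cases hij : x t₁ i = y₁
      · exact Eventually.of_forall fun d h => absurd hij h
      · exact (eventually_mul_le (abs_pos.2 (sub_ne_zero.2 (Ne.symm hij)))).mono fun d h _ => h
    have h6 : 0 < (1 / (n : ℝ)) / 2 * (t₁ - τ) := mul_pos (by positivity) (sub_pos.2 hlt)
    obtain ⟨δ, h1⟩ := ((eventually_mul_le hd).and ((eventually_mul_le hd).and
      ((eventually_mul_le one_pos).and (h5.and ((eventually_mul_le h6).and
        self_mem_nhdsWithin))))).exists
    exact ⟨δ, ⟨h1.1, h1.2.1, h1.2.2.1, h1.2.2.2.1, h1.2.2.2.2.1⟩, h1.2.2.2.2.2⟩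
  -- The far walls are moved out as `δ` decreases, so that their total force `M/D` is at most `δ`.
  set D := 1 + M * (1 / δ + 1) + d with hD
  have hMδ : 0 ≤ M * (1 / δ + 1) := by positivity
  have hsepT : ∀ t ∈ Ico τ (τ + δ₁), Separated x β P t d R := fun t ht =>
    separated_of_close hstate hd hsep (hclose t ⟨ht.1, by linarith [ht.2]⟩) hRi
  have hode : ∀ t ∈ Ioo τ (τ + δ₁), ∀ i, HasDerivAt (fun s => x s i) (velocity β (x t) i) t :=
    fun t ht => (hr t ⟨ht.1.le, by linarith [ht.2]⟩).2 ht.1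
  have hcurveC : ∀ k, ContDiffOn ℝ ((2 : ℕ∞) : WithTop ℕ∞) (wallCurve x β N τ R D k)
      (Ioo τ (τ + δ₁)) := fun k => by
    rcases k with k | k
    · refine contDiffOn_two_of_ode isOpen_Ioo (fun t ht i j hij hi hj he => ?_) hode k
      have := (hsepT t ⟨ht.1.le, ht.2⟩).particles i j hij hi hj
      rw [he, sub_self, abs_zero] at this
      linarith
    · exact ContDiff.contDiffOn (by simp only [wallCurve, Sum.elim_inr]; fun_prop)
  have hcurve0 : ∀ k, ContDiffOn ℝ ((0 : ℕ∞) : WithTop ℕ∞) (wallCurve x β N τ R D k)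
      (Ico τ (τ + δ₁)) := fun k => by
    rw [WithTop.coe_zero, contDiffOn_zero]
    rcases k with k | k
    · exact (h.cont k).mono fun t ht => hτ.trans ht.1
    · exact Continuous.continuousOn (by simp only [wallCurve, Sum.elim_inr]; fun_prop)
  obtain ⟨K, hK⟩ := exists_layerBarrier_lipschitz (ι := WallIndex β N) (μ := P)
    (ε := 1 / (n : ℝ)) (κ := (1 / (n : ℝ)) * ∑ i : {i : Fin n // β i ≠ 0}, min 0 (β i : ℝ))
    (L := L) (c := (1 / (n : ℝ)) / 2) (σ := wallSign β N)
    (a := wallCurve x β N τ R D) (p := fun q : P => (q : ℝ)) hε hδ (by positivity)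
    (fun k => by
      rcases k with k | k
      · rcases hβ k k.2 with h | h <;> simp [wallSign, h]
      · exact sideSign_eq _) (le_refl τ)
  have hsmall : δ ^ 2 ≤ (1 / (n : ℝ)) / 2 * (t₁ - τ) := by nlinarith
  refine (hV.le_of_barrier hε hρ hVu hVC hτ (T := τ + δ₁)
    (φ := particleBarrier x β N P δ L τ R D)
    (contDiffOn_layerBarrier hcurveC)
    (by have := contDiffOn_layerBarrier (ε := 1 / (n : ℝ)) (δ := δ) (L := L) (τ := τ)
          (κ := (1 / (n : ℝ)) * ∑ i : {i : Fin n // β i ≠ 0}, min 0 (β i : ℝ))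
          (c := (1 / (n : ℝ)) / 2) (σ := wallSign β N) (p := fun q : P => (q : ℝ)) hcurve0
        exact this.continuousOn)
    (fun t _ y => abs_layerBarrier_le hε (t, y)) hK (R := R + D * N)
    (fun t ht y hy => le_particleBarrier_far hn hβ hδ hL.le ht.1 (by linarith) hN' hy)
    (fun t ht y => ?_) (fun y => ?_) t₁ ht₁ y₁).trans
    (particleBarrier_le hβ hδ hL.le ht₁.1 (by linarith [ht₁.2]) (hE t₁ ht₁.2) hδy
      (by linarith) (by linarith) hsmall)
  · have ht' : t ∈ Ico τ (τ + δ₁) := ⟨ht.1.le, ht.2⟩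
    have hs := hsepT t ht'
    exact (hs.layerConfig hβ hR1 (by linarith) (by linarith) ht'.1 (by linarith [ht.2]) hδ hδ8 hδM
      hL.le (hE t ht.2)).isBarrierAt hε hL.le (fun k => hasDerivAt_wallCurve (hode t ht) k)
      (hs.velocity_le hβ hR1 (by linarith [ht.2]) hδ hn hd (by linarith) le_rfl) y
  -- Initially the envelope is covered by a wall where a charge sits, by a bump where only neutral
  -- particles sit, and elsewhere it does not exceed the left value.
  · obtain ⟨h1, h2, h3⟩ := h.upperEnv_le hτ y
    have hlow := le_particleBarrier (N := N) (P := P) (R := R) (D := D) (x := x) (L := L) hβ hδ hL.le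
      (le_refl τ) y
    by_cases hne : (cluster β (x τ) y).Nonempty
    · exact (hVU y).trans ((h1 hne).trans hlow)
    by_cases hy : ∀ i, x τ i ≠ y
    · have h4 : leftValue β (x τ) y ≤ leftValue β (x τ) y +
          (1 / (n : ℝ)) * ∑ i ∈ cluster β (x τ) y, max 0 (β i : ℝ) :=
        le_add_of_nonneg_right (mul_nonneg hε.le (Finset.sum_nonneg fun i _ => le_max_left _ _))
      exact (hVU y).trans ((h3 hy).trans (h4.trans hlow))
    · push Not at hy
      obtain ⟨i, hi⟩ := hy
      have hyP : y ∈ P := by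
        refine Finset.mem_filter.2 ⟨Finset.mem_image.2 ⟨i, Finset.mem_univ i, hi⟩, fun j hj he => ?_⟩
        exact hne ⟨j, mem_cluster.2 ⟨hj, he⟩⟩
      exact (hVU y).trans (h2.trans (le_particleBarrier_of_mem hβ hδ hL.le hyP))

end Forward

/-! ### A rising well, and comparison at a limit time -/

section StaticBarrier

/-- The nonlocal term of a bounded `C²` function, times the slope, is bounded. -/
theorem integral_stairUpper_mul_slope_le {ε : ℝ} (hε : 0 < ε) {f : ℝ → ℝ} (hf : Continuous f)
    {y D K K₁ B θ r : ℝ} (hD : D ≠ 0) (hK : ∀ z, |f (y + z) - f y - D * z| ≤ K * z ^ 2)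
    (hK₁ : ∀ z, |f (y + z) - f y| ≤ K₁ * |z|) (hDK : |D| ≤ K₁) (hB : ∀ z, |f (y + z) - f y| ≤ B)
    (hθ : 0 < θ) (hθK : θ * K < 1) (hθK₁ : θ * K₁ ^ 2 < ε) (hr : 0 < r) (hrD : r < θ * |D|) :
    (∫ z in {z : ℝ | r < |z|}, stairUpper ε (f (y + z) - f y) / z ^ 2) * |D| ≤
      2 * (B + 2 * ε) / θ := by
  have hD0 : 0 < |D| := abs_pos.2 hD
  set r₁ := θ * |D| with hr₁
  have hr₁0 : 0 < r₁ := by positivity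
  have hB0 : 0 ≤ B := (abs_nonneg _).trans (hB 0)
  obtain ⟨σ, hσ⟩ : ∃ σ : ℝ, σ = ((SignType.sign D : SignType) : ℝ) := ⟨_, rfl⟩
  have hσD : σ * D = |D| := by rw [hσ, sign_mul_self]
  have hσ1 : |σ| ≤ 1 := hσ ▸ abs_coe_sign_le D
  -- Within radius `r₁ = θ |D|` the linear part of the increment dominates the quadratic remainder
  -- and the staircase is `±ε/2`, an odd function. Outside, the bound `B + 2ε` costs `2 (B +
  -- 2ε)/r₁`, and the factor `1/|D|` in it is compensated by the slope.
  have hle : ∀ z : ℝ, z ≠ 0 → stairUpper ε (f (y + z) - f y) ≤ (ε * σ) * (SignType.sign z / 2) +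
      ((B + 2 * ε) * stepIncrement r₁ z + -(B + 2 * ε) * stepIncrement (-r₁) z) := by
    intro z hz
    have hz0 : 0 < |z| := abs_pos.2 hz
    have hst : 0 ≤ stepIncrement r₁ z ∧ stepIncrement (-r₁) z ≤ 0 ∧
        (r₁ < |z| → stepIncrement r₁ z - stepIncrement (-r₁) z = 1) := by
      unfold stepIncrement
      rw [if_neg (not_le.2 hr₁0), if_pos (by linarith : -r₁ ≤ 0)]
      refine ⟨by split_ifs <;> norm_num, by split_ifs <;> norm_num, fun h => ?_⟩
      rcases lt_abs.1 h with h | h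
      · rw [if_pos h.le, if_pos (by linarith)]; norm_num
      · rw [if_neg (by linarith), if_neg (by linarith)]; norm_num
    rcases le_or_gt |z| r₁ with hzr | hzr
    · have h1 : |f (y + z) - f y| < ε := by
        refine (hK₁ z).trans_lt ?_
        have hK0 : 0 ≤ K₁ := hD0.le.trans hDK
        calc K₁ * |z| ≤ K₁ * (θ * K₁) := by gcongr; exact hzr.trans (by rw [hr₁]; gcongr)
          _ = θ * K₁ ^ 2 := by ring
          _ < ε := hθK₁
      have h2 : |f (y + z) - f y - D * z| < |D| * |z| := by
        refine (hK z).trans_lt ?_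
        rw [← sq_abs, sq, ← mul_assoc]
        refine mul_lt_mul_of_pos_right ?_ hz0
        rcases le_or_gt K 0 with hK0 | hK0
        · nlinarith
        · calc K * |z| ≤ K * r₁ := by gcongr
            _ = θ * K * |D| := by rw [hr₁]; ring
            _ < 1 * |D| := by gcongr
            _ = |D| := one_mul _
      have h3 : stairUpper ε (f (y + z) - f y) ≤ (ε * σ) * (SignType.sign z / 2) := by
        have h4 := abs_lt.1 h2
        have h5 := abs_lt.1 h1
        rcases lt_or_gt_of_ne hD with hD' | hD' <;> rcases lt_or_gt_of_ne hz with hz' | hz'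
        · rw [stairUpper_of_nonneg hε _ h5.2, hσ, sign_neg hD', sign_neg hz']
          · norm_num; linarith
          · rw [abs_of_neg hD', abs_of_neg hz'] at h4; linarith
        · rw [stairUpper_of_neg hε _ h5.1.le, hσ, sign_neg hD', sign_pos hz']
          · norm_num; linarith
          · rw [abs_of_neg hD', abs_of_pos hz'] at h4; linarith
        · rw [stairUpper_of_neg hε _ h5.1.le, hσ, sign_pos hD', sign_neg hz']
          · norm_num; linarith
          · rw [abs_of_pos hD', abs_of_neg hz'] at h4; linarith
        · rw [stairUpper_of_nonneg hε _ h5.2, hσ, sign_pos hD', sign_pos hz']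
          · norm_num; linarith
          · rw [abs_of_pos hD', abs_of_pos hz'] at h4; linarith
      have h6 : 0 ≤ (B + 2 * ε) * stepIncrement r₁ z := mul_nonneg (by positivity) hst.1
      have h7 : 0 ≤ -(B + 2 * ε) * stepIncrement (-r₁) z :=
        mul_nonneg_of_nonpos_of_nonpos (by linarith) hst.2.1
      linarith
    · have h1 := (abs_le.1 (abs_stairUpper_le hε (f (y + z) - f y))).2
      have h2 := hB z
      have h3 : |(ε * σ) * (SignType.sign z / 2)| ≤ ε := by
        rw [abs_mul, abs_mul, abs_of_pos hε, abs_div, abs_two]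
        have := abs_coe_sign_le z
        have := abs_nonneg ((SignType.sign z : SignType) : ℝ)
        calc ε * |σ| * (|((SignType.sign z : SignType) : ℝ)| / 2) ≤ ε * 1 * (2 / 2) := by
              gcongr; linarith
          _ = ε := by norm_num
      have h4 := (abs_le.1 h3).1
      have h5 : (B + 2 * ε) * stepIncrement r₁ z + -(B + 2 * ε) * stepIncrement (-r₁) z =
          B + 2 * ε := by
        have := hst.2.2 hzr
        linear_combination (B + 2 * ε) * this
      rw [h5]
      linarith
  have hi : ∀ b, IntegrableOn (fun z => stepIncrement b z / z ^ 2) {z : ℝ | r < |z|} :=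
    fun b => integrableOn_div_sq hr (measurableSet_lt_abs r) subset_rfl
      (measurable_stepIncrement _) fun z _ => abs_stepIncrement_le _ z
  have hi2 : IntegrableOn (fun z : ℝ => (ε * σ) * (SignType.sign z / 2) / z ^ 2)
      {z : ℝ | r < |z|} := by
    refine integrableOn_div_sq (B := |ε * σ|) hr (measurableSet_lt_abs r) subset_rfl
      ((measurable_coe_sign.div_const 2).const_mul _) fun z _ => ?_
    rw [abs_mul]
    refine mul_le_of_le_one_right (abs_nonneg _) ?_
    rw [abs_div, abs_two]
    have := abs_coe_sign_le z
    linarith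
  have hi3 : IntegrableOn (fun z => (B + 2 * ε) * (stepIncrement r₁ z / z ^ 2) +
      -(B + 2 * ε) * (stepIncrement (-r₁) z / z ^ 2)) {z : ℝ | r < |z|} :=
    ((hi _).const_mul _).add ((hi _).const_mul _)
  have hfm : Measurable fun z => stairUpper ε (f (y + z) - f y) :=
    measurable_stairUpper.comp (by fun_prop)
  have hint : ∫ z in {z : ℝ | r < |z|}, stairUpper ε (f (y + z) - f y) / z ^ 2 ≤
      2 * (B + 2 * ε) / r₁ := by
    calc _ ≤ ∫ z in {z : ℝ | r < |z|}, ((ε * σ) * (SignType.sign z / 2) / z ^ 2 +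
          ((B + 2 * ε) * (stepIncrement r₁ z / z ^ 2) +
            -(B + 2 * ε) * (stepIncrement (-r₁) z / z ^ 2))) := by
          refine setIntegral_mono_on ?_ (hi2.add hi3)
            (measurableSet_lt_abs r) fun z hz => ?_
          · exact integrableOn_div_sq (B := B + ε) hr (measurableSet_lt_abs r) subset_rfl hfm
              fun z _ => (abs_stairUpper_le hε _).trans (by linarith [hB z])
          · have hz : r < |z| := hz
            have h1 := hle z (abs_pos.1 (hr.trans hz))
            have h2 : 0 < z ^ 2 := by
              have := abs_pos.1 (hr.trans hz); positivity
            calc _ ≤ _ := div_le_div_of_nonneg_right h1 h2.le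
              _ = _ := by ring
      _ = 2 * (B + 2 * ε) / r₁ := by
          rw [integral_add hi2 hi3,
            integral_add ((hi _).const_mul _) ((hi _).const_mul _), integral_sign_div_sq,
            integral_const_mul, integral_const_mul,
            integral_stepIncrement hr (by rwa [abs_of_pos hr₁0]),
            integral_stepIncrement hr (by rwa [abs_neg, abs_of_pos hr₁0])]
          field_simp
          ring
  calc _ ≤ 2 * (B + 2 * ε) / r₁ * |D| := by gcongr
    _ = _ := by rw [hr₁]; field_simp

/-- A smooth well of radius `r`. -/
def well (r : ℝ) (z : ℝ) : ℝ := Real.smoothTransition (z ^ 2 / r ^ 2)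

theorem contDiff_well (r : ℝ) {m : ℕ∞} : ContDiff ℝ m (well r) :=
  Real.smoothTransition.contDiff.comp (by fun_prop)

theorem well_eq_one {r z : ℝ} (hr : 0 < r) (hz : r ≤ |z|) : well r z = 1 := by
  refine Real.smoothTransition.one_of_one_le ?_
  rw [one_le_div (by positivity), ← sq_abs z]
  gcongr

/-- Up to the constant 1 the well has compact support, so the function and its derivative are
globally Lipschitz, which gives all three bounds. -/
theorem exists_well_bounds {r : ℝ} (hr : 0 < r) : ∃ K ≥ 0, ∀ y z,
    |deriv (well r) y| ≤ K ∧ |well r (y + z) - well r y| ≤ K * |z| ∧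
      |well r (y + z) - well r y - deriv (well r) y * z| ≤ K * z ^ 2 := by
  have hC : ContDiff ℝ 2 (fun z => 1 - well r z) :=
    contDiff_const.sub (contDiff_well r (m := 2))
  have hcs : HasCompactSupport fun z => 1 - well r z := by
    refine HasCompactSupport.intro (isCompact_Icc (a := -r) (b := r)) fun z hz => ?_
    rw [well_eq_one hr, sub_self]
    by_contra! h
    exact hz (abs_le.1 h.le)
  have hd : ∀ z, deriv (fun z => 1 - well r z) z = -deriv (well r) z := fun z => by
    simp
  obtain ⟨K₁, hK₁⟩ := (hC.of_le one_le_two).lipschitzWith_of_hasCompactSupport hcs (by norm_num)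
  have hC' : ContDiff ℝ 1 (deriv fun z => 1 - well r z) := by
    have : ContDiff ℝ (1 + 1) (fun z => 1 - well r z) := by norm_num; exact hC
    exact (contDiff_succ_iff_deriv.1 this).2.2
  obtain ⟨K₂, hK₂⟩ := hC'.lipschitzWith_of_hasCompactSupport hcs.deriv (by norm_num)
  have hdiff : Differentiable ℝ (well r) := (contDiff_well r (m := 1)).differentiable (by norm_num)
  have hlip : ∀ y z, |deriv (well r) (y + z) - deriv (well r) y| ≤ K₂ * |z| := fun y z => by
    have := hK₂.dist_le_mul (y + z) y
    simp only [Real.dist_eq, hd, add_sub_cancel_left] at this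
    rwa [← abs_neg, neg_sub, ← neg_sub_neg]
  refine ⟨max K₁ K₂, le_max_of_le_left K₁.2, fun y z => ⟨?_, ?_, ?_⟩⟩
  · have := norm_deriv_le_of_lipschitz (x₀ := y) hK₁
    rw [hd, norm_neg] at this
    exact this.trans (le_max_left _ _)
  · have := hK₁.dist_le_mul (y + z) y
    simp only [Real.dist_eq, add_sub_cancel_left, sub_sub_sub_cancel_left] at this
    rw [abs_sub_comm]
    exact this.trans (by gcongr; exact le_max_left _ _)
  · have h1 : ∀ u ∈ uIcc 0 z, HasDerivWithinAt (fun u => well r (y + u) - deriv (well r) y * u)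
        (deriv (well r) (y + u) - deriv (well r) y) (uIcc 0 z) u := fun u _ => by
      have h2 : HasDerivAt (fun u => well r (y + u)) (deriv (well r) (y + u)) u := by
        have h3 : HasDerivAt (fun u : ℝ => y + u) 1 u := (hasDerivAt_id u).const_add y
        simpa [Function.comp_def] using (hdiff (y + u)).hasDerivAt.comp u h3
      have h4 : HasDerivAt (fun u => deriv (well r) y * u) (deriv (well r) y) u := by
        simpa using (hasDerivAt_id u).const_mul (deriv (well r) y)
      exact (h2.fun_sub h4).hasDerivWithinAt
    have h5 := Convex.norm_image_sub_le_of_norm_hasDerivWithin_le (C := K₂ * |z|) h1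
      (fun u hu => (hlip y u).trans (by
        have : |u| ≤ |z| := by simpa using abs_sub_left_of_mem_uIcc hu
        gcongr)) (convex_uIcc 0 z) left_mem_uIcc right_mem_uIcc
    simp only [Real.norm_eq_abs, add_zero, mul_zero, sub_zero] at h5
    have h6 : well r (y + z) - well r y - deriv (well r) y * z =
      well r (y + z) - deriv (well r) y * z - well r y := by ring
    rw [h6]
    calc _ ≤ K₂ * |z| * |z| := h5
      _ = K₂ * z ^ 2 := by rw [mul_assoc, ← sq, sq_abs]
      _ ≤ _ := by gcongr; exact le_max_right _ _

variable {ε ρ : ℝ}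

/-- An upper bound on a subsolution near a point for earlier times extends to that point. -/
theorem IsSubsolution.le_of_past (hε : 0 < ε) (hρ : 0 < ρ) {V : ℝ × ℝ → ℝ}
    (hV : IsSubsolution ρ ε V) (hVu : UpperSemicontinuousOn V (closure Q)) {C : ℝ}
    (hVC : ∀ t, 0 ≤ t → ∀ y, |V (t, y)| ≤ C) {τ y A : ℝ} (hτ : 0 < τ) (hA : -C ≤ A)
    (h : ∀ᶠ p in 𝓝 (τ, y), 0 < p.1 → p.1 < τ → V p ≤ A) : V (τ, y) ≤ A := by
  have hC0 : 0 ≤ C := (abs_nonneg _).trans (hVC τ hτ.le y)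
  obtain ⟨r, hr, hVr⟩ := Metric.eventually_nhds_iff.1 h
  obtain ⟨K, hK0, hK⟩ := exists_well_bounds hr
  -- The depth of the well: from any level `A ≥ -C` the rim lies above `C`, so only the past bound
  -- inside the well is needed.
  set H := 2 * C + 1 with hH
  have hH0 : 0 < H := by positivity
  obtain ⟨θ, hθ, hθK, hθK₁⟩ : ∃ θ > 0, θ * (H * K) < 1 ∧ θ * (H * K) ^ 2 < ε := by
    have h1 : ∀ᶠ θ in 𝓝[>] (0 : ℝ), (H * K) * θ ≤ 1 / 2 := eventually_mul_le (by norm_num)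
    have h2 : ∀ᶠ θ in 𝓝[>] (0 : ℝ), (H * K) ^ 2 * θ ≤ ε / 2 := eventually_mul_le (by linarith)
    obtain ⟨θ, ⟨h3, h4⟩, h5⟩ := ((h1.and h2).and self_mem_nhdsWithin).exists
    exact ⟨θ, h5, by linarith, by linarith⟩
  -- The bound for the nonlocal term times the slope. It depends on the well only, not on the
  -- starting time, so the loss `s η` can be made arbitrarily small.
  set s := 2 * (H + 2 * ε) / θ with hs
  have hs0 : 0 < s := by positivity
  refine le_of_forall_pos_le_add fun e he => ?_
  obtain ⟨η, ⟨hη1, hη2, hη3⟩, hη⟩ : ∃ η : ℝ, (s * η ≤ e ∧ 2 * η ≤ r ∧ 2 * η ≤ τ) ∧ 0 < η := by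
    obtain ⟨η, ⟨h1, h2, h3⟩, h4⟩ := (((eventually_mul_le he).and ((eventually_mul_le hr).and
      (eventually_mul_le hτ))).and self_mem_nhdsWithin).exists
    exact ⟨η, ⟨h1, h2, h3⟩, h4⟩
  set φ : ℝ × ℝ → ℝ := fun q => A + s * (q.1 - (τ - η)) + H * well r (q.2 - y) with hφ
  have hwell0 : ∀ z, 0 ≤ well r z := fun z => Real.smoothTransition.nonneg _
  have hwell1 : ∀ z, well r z ≤ 1 := fun z => Real.smoothTransition.le_one _
  have hsm : ContDiff ℝ 2 φ := by
    have h1 : ContDiff ℝ 2 fun q : ℝ × ℝ => well r (q.2 - y) :=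
      (contDiff_well r (m := 2)).comp (by fun_prop)
    exact ContDiff.add (by fun_prop) (contDiff_const.mul h1)
  have hbound := hV.le_of_barrier hε hρ hVu hVC (a := τ - η) (T := τ + η) (by linarith) (φ := φ)
    hsm.contDiffOn hsm.continuous.continuousOn (B := |A| + s * (2 * η) + H)
    (fun t ht z => ?_) (L := H * K) (fun u v => ?_) (R := |y| + r) (fun t ht z hz => ?_)
    (fun t ht z => ?_) (fun z => ?_) τ ⟨by linarith, by linarith⟩ y
  · refine hbound.trans ?_
    have : well r (y - y) = 0 := by simp [well]
    simp only [hφ, this]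
    linarith
  · have h1 : |s * (t - (τ - η))| ≤ s * (2 * η) := by
      rw [abs_mul, abs_of_pos hs0, abs_of_nonneg (by linarith [ht.1])]
      gcongr
      linarith [ht.2]
    have h2 : |H * well r (z - y)| ≤ H := by
      rw [abs_of_nonneg (mul_nonneg hH0.le (hwell0 _))]
      exact mul_le_of_le_one_right hH0.le (hwell1 _)
    exact (abs_add_le _ _).trans (add_le_add ((abs_add_le _ _).trans (add_le_add le_rfl h1)) h2)
  · have h1 := (hK (v - y) (u - v)).2.1
    rw [show v - y + (u - v) = u - y by ring] at h1
    simp only [hφ]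
    calc _ = H * (well r (u - y) - well r (v - y)) := by ring
      _ ≤ H * (K * |u - v|) := by
        gcongr
        exact (le_abs_self _).trans h1
      _ = _ := by ring
  · have h1 : well r (z - y) = 1 := well_eq_one hr (by
      have := abs_sub_abs_le_abs_sub z y
      linarith)
    simp only [hφ, h1]
    have : 0 ≤ s * (t - (τ - η)) := mul_nonneg hs0.le (by linarith [ht.1])
    linarith
  · have hdw : HasDerivAt (fun z => φ (t, z)) (H * deriv (well r) (z - y)) z := by
      have h1 : HasDerivAt (fun z => well r (z - y)) (deriv (well r) (z - y)) z := by
        have h3 : HasDerivAt (fun u : ℝ => u - y) 1 z := (hasDerivAt_id z).sub_const y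
        have hdiff : Differentiable ℝ (well r) :=
          (contDiff_well r (m := 1)).differentiable (by norm_num)
        simpa [Function.comp_def] using (hdiff (z - y)).hasDerivAt.comp z h3
      exact (h1.const_mul H).const_add (A + s * (t - (τ - η)))
    have hdx : dx φ (t, z) = H * deriv (well r) (z - y) := hdw.deriv
    have hdt : dt φ (t, z) = s := by
      have h1 : HasDerivAt (fun t => φ (t, z)) (s * 1) t :=
        ((((hasDerivAt_id t).sub_const (τ - η)).const_mul s).const_add A).add_const
          (H * well r (z - y))
      rw [mul_one] at h1
      exact h1.deriv
    refine ⟨fun hD => ?_, fun _ => Or.inl (by rw [hdt]; exact hs0.le)⟩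
    rw [hdt]
    refine ⟨θ * |dx φ (t, z)|, mul_pos hθ (abs_pos.2 hD), fun q hq => ?_⟩
    have hinc : ∀ w, φ (t, z + w) - φ (t, z) = H * (well r (z - y + w) - well r (z - y)) :=
      fun w => by
        simp only [hφ]
        rw [show z + w - y = z - y + w by ring]
        ring
    refine integral_stairUpper_mul_slope_le (f := fun z => φ (t, z)) (K := H * K) (K₁ := H * K)
      (B := H) hε (by fun_prop) hD (fun w => ?_) (fun w => ?_) ?_ (fun w => ?_) hθ hθK hθK₁ hq.1 hq.2
    · rw [hinc, hdx, mul_assoc, ← mul_sub, abs_mul, abs_of_pos hH0, mul_assoc H K]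
      gcongr
      exact (hK _ _).2.2
    · rw [hinc, abs_mul, abs_of_pos hH0, mul_assoc H K]
      gcongr
      exact (hK _ _).2.1
    · rw [hdx, abs_mul, abs_of_pos hH0]
      gcongr
      exact (hK _ 0).1
    · rw [hinc, abs_mul, abs_of_pos hH0]
      refine mul_le_of_le_one_right hH0.le ?_
      rw [abs_le]
      constructor <;> linarith [hwell0 (z - y + w), hwell0 (z - y), hwell1 (z - y + w), hwell1 (z - y)]
  · simp only [hφ, sub_self, mul_zero, add_zero]
    rcases lt_or_ge |z - y| r with hz | hz
    · have h1 : V (τ - η, z) ≤ A := by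
        refine hVr ?_ (by simp only; linarith) (by simp only; linarith)
        rw [Prod.dist_eq, Real.dist_eq, Real.dist_eq]
        refine max_lt ?_ hz
        simp only [sub_sub_cancel_left, abs_neg]
        rw [abs_of_pos hη]; linarith
      have := mul_nonneg hH0.le (hwell0 (z - y))
      linarith
    · rw [well_eq_one hr hz]
      have := (abs_le.1 (hVC (τ - η) (by linarith) z)).2
      linarith

end StaticBarrier

/-! ### Global comparison with the particle system -/

section Comparison

variable {n : ℕ} {x : ℝ → Fin n → ℝ} {b : ℝ → Fin n → ℤ}

/-- The comparison with the particle system passes to the limit in time. -/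
theorem ParticleEvolution.le_upperEnv_of_past (h : ParticleEvolution x b) (hn : 0 < n)
    {ρ : ℝ} (hρ : 0 < ρ) {V : ℝ × ℝ → ℝ} (hV : IsSubsolution ρ (1 / (n : ℝ)) V)
    (hVu : UpperSemicontinuousOn V (closure Q)) {C : ℝ} (hC : 1 ≤ C)
    (hVC : ∀ t, 0 ≤ t → ∀ y, |V (t, y)| ≤ C) {τ : ℝ} (hτ : 0 < τ)
    (hpast : ∀ t ∈ Ico 0 τ, ∀ y, V (t, y) ≤ upperEnv Q (particleStep x b) (t, y)) (y : ℝ) :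
    V (τ, y) ≤ upperEnv Q (particleStep x b) (τ, y) := by
  have hε : (0 : ℝ) < 1 / n := by positivity
  obtain ⟨α, β, s, hα, hf, hβ, hb, hsum, hs, htot, hle, hemp, hcurve⟩ := h.exists_profile hτ y
  have key : ∀ M, (∀ᶠ p in 𝓝 (τ, y), particleStep x b p ≤ M) →
      M ≤ upperEnv Q (particleStep x b) (τ, y) →
      V (τ, y) ≤ upperEnv Q (particleStep x b) (τ, y) := fun M hM hMU => by
    have hA := (_root_.abs_le.1 (abs_upperEnv_step_le h hτ.le y)).1
    refine hV.le_of_past hε hρ hVu hVC hτ (by linarith) ?_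
    filter_upwards [hM.eventually_nhds] with p hp hp0 hpτ
    refine (hpast p.1 ⟨hp0.le, hpτ⟩ p.2).trans (le_trans ?_ hMU)
    exact AnnihilatingParticles.upperEnv_le (mem_closure_Q hp0.le) h.abs_le (nhdsWithin_le_nhds hp)
  rcases (cluster β (x τ) y).eq_empty_or_nonempty with hCe | ⟨i, hi⟩
  · have h1 := hemp hCe
    refine key _ (h1.mono fun p hp => hp.le) ?_
    rw [← h1.self_of_nhds]
    exact self_le_upperEnv hτ h.abs_le
  · refine key _ hle ?_
    by_contra! hlt
    -- The envelope is at least the top value along the trajectories that run into `(τ, y)`; by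
    -- semicontinuity it has that value also in the limit.
    have husc := upperSemicontinuousOn_upperEnv h.abs_le (τ, y) (mem_closure_Q hτ.le) _ hlt
    have h3 : Tendsto (fun t => (t, x t i)) (𝓝[<] τ) (𝓝[closure Q] (τ, y)) := by
      refine tendsto_nhdsWithin_of_tendsto_nhds_of_eventually_within _ ?_ ?_
      · refine (tendsto_nhdsWithin_of_tendsto_nhds tendsto_id).prodMk_nhds ?_
        have := hf.tendsto i
        rwa [(mem_cluster.1 hi).2] at this
      · filter_upwards [Ioo_mem_nhdsLT hτ] with t ht
        exact mem_closure_Q ht.1.le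
    obtain ⟨t, ht1, ht2⟩ := ((h3.eventually husc).and hcurve).exists
    exact absurd (ht2 i hi) (not_le.2 ht1)

/-- Subsolutions stay below the upper envelope of the particle system. -/
theorem ParticleEvolution.comparison (h : ParticleEvolution x b) (hn : 0 < n)
    {ρ : ℝ} (hρ : 0 < ρ) {V : ℝ × ℝ → ℝ} (hV : IsSubsolution ρ (1 / (n : ℝ)) V)
    (hVu : UpperSemicontinuousOn V (closure Q)) {C : ℝ}
    (hVC : ∀ t, 0 ≤ t → ∀ y, |V (t, y)| ≤ C)
    (h0 : ∀ y, V (0, y) ≤ upperEnv Q (particleStep x b) (0, y)) :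
    ∀ t, 0 ≤ t → ∀ y, V (t, y) ≤ upperEnv Q (particleStep x b) (t, y) := by
  by_contra! hcon
  -- The set of times of failure. At its infimum the inequality holds, by the initial condition or
  -- by passage from the past, and forward comparison then excludes failure shortly after.
  set S := {t : ℝ | 0 ≤ t ∧ ∃ y, upperEnv Q (particleStep x b) (t, y) < V (t, y)} with hS
  have hne : S.Nonempty := hcon
  have hbdd : BddBelow S := ⟨0, fun t ht => ht.1⟩
  have h1 : 0 ≤ sInf S := le_csInf hne fun t ht => ht.1
  have hpast : ∀ t ∈ Ico 0 (sInf S), ∀ y, V (t, y) ≤ upperEnv Q (particleStep x b) (t, y) := by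
    intro t ht y
    by_contra! hlt
    exact notMem_of_lt_csInf ht.2 hbdd ⟨ht.1, y, hlt⟩
  have hnow : ∀ y, V (sInf S, y) ≤ upperEnv Q (particleStep x b) (sInf S, y) := by
    rcases h1.eq_or_lt with h2 | h2
    · rw [← h2]; exact h0
    · exact h.le_upperEnv_of_past hn hρ hV hVu (le_max_right C 1)
        (fun t ht y => (hVC t ht y).trans (le_max_left _ _)) h2 hpast
  obtain ⟨δ, hδ, hfut⟩ := h.exists_forward_comparison hn hρ hV hVu hVC h1 hnow
  obtain ⟨t, ht, htδ⟩ := exists_lt_of_csInf_lt hne (lt_add_of_pos_right (sInf S) hδ)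
  obtain ⟨y, hy⟩ := ht.2
  exact absurd (hfut t ⟨csInf_le hbdd ht, htδ⟩ y) (not_le.2 hy)

end Comparison

/-! ### Uniqueness of the envelopes -/

section Uniqueness

theorem upperEnv_eq_neg {α : Type*} [TopologicalSpace α] {s : Set α} {f : α → ℝ} {C : ℝ} {a : α}
    (ha : a ∈ closure s) (hf : ∀ p ∈ s, |f p| ≤ C) : upperEnv s f a = -lowerEnv s (-f) a := by
  rw [lowerEnv_eq_neg (C := C) ha (fun p hp => by simpa using hf p hp), neg_neg, neg_neg]

theorem IsViscositySolution.neg {ρ ε : ℝ} (hε : 0 < ε) (hρ : 0 < ρ) {v : ℝ × ℝ → ℝ}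
    (h : IsViscositySolution ρ ε v) : IsViscositySolution ρ ε (-v) := by
  obtain ⟨⟨C, hC⟩, h1, h2⟩ := h
  have hC' : ∀ p ∈ Q, |(-v) p| ≤ C := fun p hp => by simpa using hC p hp
  refine ⟨⟨C, hC'⟩, ?_, ?_⟩
  · exact (isSupersolution_iff_neg hε hρ fun p hp => lowerEnv_eq_neg (subset_closure hp) hC).1 h2
  · refine (isSupersolution_iff_neg hε hρ fun p hp => ?_).2 h1
    rw [lowerEnv_eq_neg (subset_closure hp) hC', neg_neg]

theorem HasInitialEnvelopes.neg {v : ℝ × ℝ → ℝ} (hv : BoundedOnQ v) {u₀ : ℝ → ℝ} {C : ℝ}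
    (hu : ∀ y, |u₀ y| ≤ C) (h : HasInitialEnvelopes v u₀) : HasInitialEnvelopes (-v) (-u₀) := by
  obtain ⟨K, hK⟩ := hv
  have hK' : ∀ p ∈ Q, |(-v) p| ≤ K := fun p hp => by simpa using hK p hp
  refine fun y => ⟨?_, ?_⟩
  · rw [← neg_inj, ← lowerEnv_eq_neg (mem_closure_Q le_rfl) hK,
      ← lowerEnv_eq_neg (C := C) (by simp) (fun y _ => hu y), (h y).2]
  · rw [← neg_inj, ← upperEnv_eq_neg (mem_closure_Q le_rfl) hK,
      ← upperEnv_eq_neg (C := C) (by simp) (fun y _ => hu y), (h y).1]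

variable {n : ℕ} {x : ℝ → Fin n → ℝ} {b : ℝ → Fin n → ℤ}

/-- Off the particles, the step function is locally constant. -/
theorem ParticleEvolution.lowerEnv_eq_self (h : ParticleEvolution x b) {t y : ℝ} (ht : 0 < t)
    (hy : ∀ i, x t i ≠ y) : lowerEnv Q (particleStep x b) (t, y) = particleStep x b (t, y) := by
  obtain ⟨α, β, s, hα, hf, hβ, hb, hsum, hs, htot, hle, hemp, hcurve⟩ := h.exists_profile ht y
  have h1 := hemp (Finset.eq_empty_of_forall_notMem fun i hi => hy i (mem_cluster.1 hi).2)
  have hne : (𝓝[Q] (t, y)).NeBot :=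
    mem_closure_iff_nhdsWithin_neBot.1 (mem_closure_Q (p := (t, y)) ht.le)
  have h2 : ∀ᶠ p in 𝓝[Q] (t, y), particleStep x b p = particleStep x b (t, y) :=
    nhdsWithin_le_nhds (h1.mono fun p hp => hp.trans h1.self_of_nhds.symm)
  exact (tendsto_const_nhds.congr' (h2.mono fun p hp => hp.symm)).liminf_eq

/-- This is where `H(0) = 1` enters: the step function is continuous from the right, and points
slightly to the right are free of particles. -/
theorem eventually_stepFunction_eq (ξ : Fin n → ℝ) (β : Fin n → ℤ) (y : ℝ) :
    ∀ᶠ z in 𝓝[>] y, stepFunction ξ β z = stepFunction ξ β y ∧ ∀ i, ξ i ≠ z := by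
  have h1 : ∀ i, ∀ᶠ z in 𝓝[>] y, (0 ≤ z - ξ i ↔ 0 ≤ y - ξ i) ∧ ξ i ≠ z := fun i => by
    rcases le_or_gt (ξ i) y with hi | hi
    · filter_upwards [self_mem_nhdsWithin] with z hz
      have hz : y < z := hz
      exact ⟨⟨fun _ => by linarith, fun _ => by linarith⟩, by linarith⟩
    · filter_upwards [Ioo_mem_nhdsGT hi] with z hz
      exact ⟨⟨fun _ => by linarith [hz.2], fun _ => by linarith⟩, hz.2.ne'⟩
  filter_upwards [eventually_all.2 h1] with z hz
  refine ⟨?_, fun i => (hz i).2⟩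
  unfold stepFunction
  simp only [fun i => (hz i).1]

/-- An upper semicontinuous function above the lower envelope of the step function is above
the upper envelope. -/
theorem ParticleEvolution.upperEnv_le_of_lowerEnv_le (h : ParticleEvolution x b) {V : ℝ × ℝ → ℝ}
    (hV : UpperSemicontinuousOn V Q) (hle : ∀ p ∈ Q, lowerEnv Q (particleStep x b) p ≤ V p) :
    ∀ p ∈ Q, upperEnv Q (particleStep x b) p ≤ V p := by
  intro p hp
  refine le_of_forall_gt_imp_ge_of_dense fun c hc => ?_
  refine AnnihilatingParticles.upperEnv_le (subset_closure hp) h.abs_le ?_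
  obtain ⟨o, ho, hpo, hsub⟩ := mem_nhdsWithin.1 (hV p hp c hc)
  filter_upwards [inter_mem_nhdsWithin Q (ho.mem_nhds hpo)] with q hq
  have h1 : ∀ᶠ z in 𝓝[>] q.2, (q.1, z) ∈ o :=
    nhdsWithin_le_nhds ((Continuous.prodMk_right q.1).continuousAt.eventually
      (ho.mem_nhds hq.2))
  obtain ⟨z, hzo, hz1, hz2⟩ := (h1.and (eventually_stepFunction_eq (x q.1) (b q.1) q.2)).exists
  have hzQ : (q.1, z) ∈ Q := hq.1
  have h2 := hle _ hzQ
  rw [h.lowerEnv_eq_self hzQ hz2] at h2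
  have h3 : particleStep x b (q.1, z) = particleStep x b q := hz1
  have h4 : V (q.1, z) < c := hsub ⟨hzo, hzQ⟩
  linarith

theorem ParticleEvolution.upperEnv_le_upperEnv (h : ParticleEvolution x b) (hn : 0 < n) {ρ : ℝ}
    (hρ : 0 < ρ) {v : ℝ × ℝ → ℝ} (hv : IsViscositySolution ρ (1 / (n : ℝ)) v)
    (h0 : HasInitialEnvelopes v (stepFunction (x 0) (b 0))) :
    ∀ p ∈ Q, upperEnv Q v p ≤ upperEnv Q (particleStep x b) p := by
  obtain ⟨⟨C, hC⟩, h1, h2⟩ := hv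
  intro p hp
  exact h.comparison hn hρ h1 (upperSemicontinuousOn_upperEnv hC)
    (fun t ht y => abs_upperEnv_le (mem_closure_Q ht) hC)
    (fun y => by rw [(h0 y).1, h.upperEnv_zero]) p.1 (LT.lt.le hp) p.2

theorem ParticleEvolution.lowerEnv_le_lowerEnv (h : ParticleEvolution x b) (hn : 0 < n) {ρ : ℝ}
    (hρ : 0 < ρ) {v : ℝ × ℝ → ℝ} (hv : IsViscositySolution ρ (1 / (n : ℝ)) v)
    (h0 : HasInitialEnvelopes v (stepFunction (x 0) (b 0))) :
    ∀ p ∈ Q, lowerEnv Q (particleStep x b) p ≤ lowerEnv Q v p := by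
  intro p hp
  have hε : (0 : ℝ) < 1 / n := by positivity
  obtain ⟨C, hC⟩ := hv.1
  have h1 := h0.neg hv.1 (abs_stepFunction_le (h.mem 0 le_rfl))
  rw [← stepFunction_neg] at h1
  have h2 := h.neg.upperEnv_le_upperEnv hn hρ (hv.neg hε hρ) h1 p hp
  rw [lowerEnv_eq_neg (subset_closure hp) hC, lowerEnv_eq_neg (subset_closure hp) h.abs_le,
    ← particleStep_neg]
  exact neg_le_neg h2

/-- The nontrivial inequality uses comparison from below: the lower envelope of the step function is
below that of `v`, hence below the upper semicontinuous upper envelope of `v`, and the latter is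
then above the whole step function. -/
theorem ParticleEvolution.upperEnv_eq (h : ParticleEvolution x b) (hn : 0 < n) {ρ : ℝ}
    (hρ : 0 < ρ) {v : ℝ × ℝ → ℝ} (hv : IsViscositySolution ρ (1 / (n : ℝ)) v)
    (h0 : HasInitialEnvelopes v (stepFunction (x 0) (b 0))) :
    ∀ p ∈ Q, upperEnv Q v p = upperEnv Q (particleStep x b) p := by
  intro p hp
  refine le_antisymm (h.upperEnv_le_upperEnv hn hρ hv h0 p hp) ?_
  obtain ⟨C, hC⟩ := hv.1
  refine h.upperEnv_le_of_lowerEnv_le hv.2.1.1 (fun q hq => ?_) p hp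
  exact (h.lowerEnv_le_lowerEnv hn hρ hv h0 q hq).trans
    (lowerEnv_le_upperEnv (subset_closure hq) hC)

theorem ParticleEvolution.lowerEnv_eq (h : ParticleEvolution x b) (hn : 0 < n) {ρ : ℝ}
    (hρ : 0 < ρ) {v : ℝ × ℝ → ℝ} (hv : IsViscositySolution ρ (1 / (n : ℝ)) v)
    (h0 : HasInitialEnvelopes v (stepFunction (x 0) (b 0))) :
    ∀ p ∈ Q, lowerEnv Q v p = lowerEnv Q (particleStep x b) p := by
  intro p hp
  have hε : (0 : ℝ) < 1 / n := by positivity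
  obtain ⟨C, hC⟩ := hv.1
  have h1 := h0.neg hv.1 (abs_stepFunction_le (h.mem 0 le_rfl))
  rw [← stepFunction_neg] at h1
  rw [lowerEnv_eq_neg (subset_closure hp) hC, lowerEnv_eq_neg (subset_closure hp) h.abs_le,
    ← particleStep_neg, h.neg.upperEnv_eq hn hρ (hv.neg hε hρ) h1 p hp]


end Uniqueness

/-! ### Existence for the system of ordinary differential equations -/

section FlowRegularity

variable {n : ℕ} {x : ℝ → Fin n → ℝ} {β : Fin n → ℤ} {α τ : ℝ}

theorem injOn_of_mem {ξ : Fin n → ℝ} (h : (ξ, β) ∈ stateSpace n) {i j : Fin n} (hne : i ≠ j)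
    (hi : β i ≠ 0) (hj : β j ≠ 0) : ξ i ≠ ξ j := by
  rcases lt_or_gt_of_ne hne with h' | h'
  · exact (h.2 j i h' (mul_ne_zero hj hi)).ne
  · exact (h.2 i j h' (mul_ne_zero hi hj)).ne'

theorem continuousOn_velocity {I : Set ℝ} (hm : ∀ t ∈ I, (x t, β) ∈ stateSpace n)
    (hx : ∀ i, ContinuousOn (fun t => x t i) I) (i : Fin n) :
    ContinuousOn (fun t => velocity β (x t) i) I :=
  contDiffOn_zero.1 (contDiffOn_velocity (fun t ht _ _ hne hi hj => injOn_of_mem (hm t ht) hne hi hj)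
    (fun i => contDiffOn_zero.2 (hx i)) i)

/-- A flow satisfies the equation only at interior times. At the start the charges are still
separated, so the velocity is continuous there and the one-sided derivative follows as a limit. -/
theorem IsFlow.hasDerivWithinAt_start (h : IsFlow x β α τ) (i : Fin n) :
    HasDerivWithinAt (fun t => x t i) (velocity β (x α) i) (Ici α) α := by
  refine hasDerivWithinAt_Ici_of_tendsto_deriv (s := Ioo α τ)
    (fun t ht => (h.ode t ht i).differentiableAt.differentiableWithinAt)
    ((h.cont i α ⟨le_rfl, h.lt.le⟩).mono Ioo_subset_Icc_self) (Ioo_mem_nhdsGT h.lt) ?_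
  have h1 := (continuousOn_velocity h.mem (fun i => (h.cont i).mono Ico_subset_Icc_self) i) α
    ⟨le_rfl, h.lt⟩
  refine (h1.tendsto.mono_left (nhdsWithin_le_iff.2 ?_)).congr' ?_
  · filter_upwards [Ioo_mem_nhdsGT h.lt] with t ht using Ioo_subset_Ico_self ht
  · filter_upwards [Ioo_mem_nhdsGT h.lt] with t ht using (h.ode t ht i).deriv.symm

theorem IsFlow.hasDerivWithinAt_end (h : IsFlow x β α τ) (hτ : (x τ, β) ∈ stateSpace n)
    (i : Fin n) : HasDerivWithinAt (fun t => x t i) (velocity β (x τ) i) (Iic τ) τ := by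
  refine hasDerivWithinAt_Iic_of_tendsto_deriv (s := Ioo α τ)
    (fun t ht => (h.ode t ht i).differentiableAt.differentiableWithinAt)
    ((h.cont i τ ⟨h.lt.le, le_rfl⟩).mono Ioo_subset_Icc_self) (Ioo_mem_nhdsLT h.lt) ?_
  have h1 := (continuousOn_velocity (β := β) (I := Icc α τ) (fun t ht => ?_) h.cont i) τ ⟨h.lt.le, le_rfl⟩
  · refine (h1.tendsto.mono_left (nhdsWithin_le_iff.2 ?_)).congr' ?_
    · filter_upwards [Ioo_mem_nhdsLT h.lt] with t ht using Ioo_subset_Icc_self ht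
    · filter_upwards [Ioo_mem_nhdsLT h.lt] with t ht using (h.ode t ht i).deriv.symm
  · rcases ht.2.eq_or_lt with rfl | hlt
    · exact hτ
    · exact h.mem t ⟨ht.1, hlt⟩

theorem IsFlow.hasDerivWithinAt_Ici (h : IsFlow x β α τ) {t : ℝ} (ht : t ∈ Ico α τ) (i : Fin n) :
    HasDerivWithinAt (fun t => x t i) (velocity β (x t) i) (Ici t) t := by
  rcases ht.1.eq_or_lt with rfl | hlt
  · exact h.hasDerivWithinAt_start i
  · exact (h.ode t ⟨hlt, ht.2⟩ i).hasDerivWithinAt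

theorem IsFlow.contDiffOn (h : IsFlow x β α τ) (i : Fin n) :
    ContDiffOn ℝ 1 (fun t => x t i) (Ico α τ) := by
  have hud : UniqueDiffOn ℝ (Ico α τ) := uniqueDiffOn_Ico α τ
  have hder : ∀ t ∈ Ico α τ, HasDerivWithinAt (fun t => x t i) (velocity β (x t) i) (Ico α τ) t := by
    intro t ht
    rcases ht.1.eq_or_lt with rfl | hlt
    · exact (h.hasDerivWithinAt_start i).mono Ico_subset_Ici_self
    · exact (h.ode t ⟨hlt, ht.2⟩ i).hasDerivWithinAt
  rw [contDiffOn_one_iff_derivWithin hud]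
  refine ⟨fun t ht => (hder t ht).differentiableWithinAt, ?_⟩
  exact (continuousOn_velocity h.mem (fun i => (h.cont i).mono Ico_subset_Icc_self) i).congr
    fun t ht => (hder t ht).derivWithin (hud t ht)

theorem IsFlow.mono_right (h : IsFlow x β α τ) {σ : ℝ} (hσ : α < σ) (hστ : σ ≤ τ) :
    IsFlow x β α σ where
  lt := hσ
  mem t ht := h.mem t ⟨ht.1, ht.2.trans_le hστ⟩
  cont i := (h.cont i).mono (Icc_subset_Icc_right hστ)
  ode t ht := h.ode t ⟨ht.1, ht.2.trans_le hστ⟩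

theorem IsFlow.congr (h : IsFlow x β α τ) {y : ℝ → Fin n → ℝ} (hxy : ∀ t ∈ Icc α τ, y t = x t) :
    IsFlow y β α τ where
  lt := h.lt
  mem t ht := by rw [hxy t ⟨ht.1, ht.2.le⟩]; exact h.mem t ht
  cont i := (h.cont i).congr fun t ht => by simp only [hxy t ht]
  ode t ht i := by
    rw [hxy t ⟨ht.1.le, ht.2.le⟩]
    refine (h.ode t ht i).congr_of_eventuallyEq ?_
    filter_upwards [Icc_mem_nhds ht.1 ht.2] with s hs
    rw [hxy s hs]

/-- The charged particles keep a distance `δ`. -/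
def separatedSet (β : Fin n → ℤ) (δ : ℝ) : Set (Fin n → ℝ) :=
  {ξ | ∀ i j, i ≠ j → β i ≠ 0 → β j ≠ 0 → δ ≤ |ξ i - ξ j|}

/-- Each pair contributes a Lipschitz constant `2/δ²`, and the factor `1/n` compensates for the
number of pairs involving one particle. -/
theorem lipschitzOnWith_velocity (hβ : ∀ i, β i = -1 ∨ β i = 0 ∨ β i = 1) {δ : ℝ} (hδ : 0 < δ) :
    LipschitzOnWith (Real.toNNReal (2 / δ ^ 2)) (velocity β) (separatedSet β δ) := by
  refine LipschitzOnWith.of_dist_le_mul fun ξ hξ ζ hζ => ?_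
  have hK : 0 ≤ 2 / δ ^ 2 := by positivity
  rw [Real.coe_toNNReal _ hK]
  refine (dist_pi_le_iff (by positivity)).2 fun i => ?_
  rw [Real.dist_eq, velocity, velocity, ← mul_sub, ← Finset.sum_sub_distrib, abs_mul,
    abs_of_pos (one_div_nat_pos i)]
  have hterm : ∀ j ∈ Finset.univ.filter (· ≠ i), |(β i : ℝ) * β j / (ξ i - ξ j) -
      (β i : ℝ) * β j / (ζ i - ζ j)| ≤ 2 / δ ^ 2 * dist ξ ζ := by
    intro j hj
    have hji := (Finset.mem_filter.1 hj).2
    by_cases hb : β i = 0 ∨ β j = 0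
    · have : ((β i : ℝ) * (β j : ℝ)) = 0 := by rcases hb with h | h <;> simp [h]
      simp only [this, zero_div, sub_self, abs_zero]
      positivity
    push Not at hb
    have h1 := hξ i j hji.symm hb.1 hb.2
    have h2 := hζ i j hji.symm hb.1 hb.2
    have hb1 : ∀ k, β k ≠ 0 → |(β k : ℝ)| = 1 := fun k hk => by
      rcases hβ k with h | h | h
      · simp [h]
      · exact absurd h hk
      · simp [h]
    have h3 : ξ i - ξ j ≠ 0 := abs_pos.1 (hδ.trans_le h1)
    have h4 : ζ i - ζ j ≠ 0 := abs_pos.1 (hδ.trans_le h2)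
    have h5 : (β i : ℝ) * β j / (ξ i - ξ j) - (β i : ℝ) * β j / (ζ i - ζ j) =
        (β i : ℝ) * β j * ((ζ i - ξ i) - (ζ j - ξ j)) / ((ξ i - ξ j) * (ζ i - ζ j)) := by
      field_simp; ring
    have h6 : ∀ k, |ζ k - ξ k| ≤ dist ξ ζ := fun k => by
      rw [abs_sub_comm]; exact dist_le_pi_dist ξ ζ k
    rw [h5, abs_div, abs_mul, abs_mul, abs_mul, hb1 i hb.1, hb1 j hb.2, one_mul, one_mul,
      div_mul_eq_mul_div]
    have h7 : |(ζ i - ξ i) - (ζ j - ξ j)| ≤ 2 * dist ξ ζ :=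
      (abs_sub _ _).trans (by linarith [h6 i, h6 j])
    rw [sq]
    gcongr
  calc _ ≤ 1 / (n : ℝ) * ∑ j with j ≠ i, 2 / δ ^ 2 * dist ξ ζ :=
        mul_le_mul_of_nonneg_left ((Finset.abs_sum_le_sum_abs _ _).trans
          (Finset.sum_le_sum hterm)) (one_div_nat_pos i).le
    _ ≤ 1 / (n : ℝ) * (n * (2 / δ ^ 2 * dist ξ ζ)) := by
        refine mul_le_mul_of_nonneg_left ?_ (one_div_nat_pos i).le
        rw [Finset.sum_const, nsmul_eq_mul]
        refine mul_le_mul_of_nonneg_right ?_ (by positivity)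
        exact_mod_cast (Finset.card_filter_le _ _).trans (by simp)
    _ = _ := by
        have : (0 : ℝ) < n := Nat.cast_pos.2 i.pos
        field_simp

theorem exists_separated {I : Set ℝ} (hI : IsCompact I) (hne : I.Nonempty)
    (hm : ∀ t ∈ I, (x t, β) ∈ stateSpace n) (hx : ∀ i, ContinuousOn (fun t => x t i) I) :
    ∃ δ > 0, ∀ t ∈ I, x t ∈ separatedSet β δ := by
  have h1 : ∀ q : Fin n × Fin n, ∃ δ > 0, q.1 ≠ q.2 → β q.1 ≠ 0 → β q.2 ≠ 0 →
      ∀ t ∈ I, δ ≤ |x t q.1 - x t q.2| := fun q => by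
    by_cases hq : q.1 ≠ q.2 ∧ β q.1 ≠ 0 ∧ β q.2 ≠ 0
    · obtain ⟨t, ht, hmin⟩ := hI.exists_isMinOn hne ((hx q.1).sub (hx q.2)).abs
      exact ⟨_, abs_pos.2 (sub_ne_zero.2 (injOn_of_mem (hm t ht) hq.1 hq.2.1 hq.2.2)),
        fun _ _ _ s hs => hmin hs⟩
    · exact ⟨1, one_pos, fun h1 h2 h3 => absurd ⟨h1, h2, h3⟩ hq⟩
  choose δ hδ hle using h1
  rcases isEmpty_or_nonempty (Fin n × Fin n) with he | hne'
  · exact ⟨1, one_pos, fun t _ i j => (he.false (i, j)).elim⟩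
  · obtain ⟨q, hq⟩ := Finite.exists_min δ
    exact ⟨δ q, hδ q, fun t ht i j hij hi hj => (hq (i, j)).trans (hle (i, j) hij hi hj t ht)⟩

/-- The charges are distinct up to and including the final time, so by compactness both flows stay
in a set of separated configurations, where the velocity is Lipschitz. -/
theorem IsFlow.unique {y : ℝ → Fin n → ℝ} (hx : IsFlow x β α τ) (hy : IsFlow y β α τ)
    (hxτ : (x τ, β) ∈ stateSpace n) (hyτ : (y τ, β) ∈ stateSpace n) (h0 : x α = y α) :
    ∀ t ∈ Icc α τ, x t = y t := by
  have hend : ∀ z : ℝ → Fin n → ℝ, IsFlow z β α τ → (z τ, β) ∈ stateSpace n →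
      ∀ t ∈ Icc α τ, (z t, β) ∈ stateSpace n := fun z hz hzτ t ht => by
    rcases ht.2.eq_or_lt with rfl | hlt
    · exact hzτ
    · exact hz.mem t ⟨ht.1, hlt⟩
  have hne : (Icc α τ).Nonempty := nonempty_Icc.2 hx.lt.le
  obtain ⟨δ₁, hδ₁, h1⟩ := exists_separated isCompact_Icc hne (hend x hx hxτ) hx.cont
  obtain ⟨δ₂, hδ₂, h2⟩ := exists_separated isCompact_Icc hne (hend y hy hyτ) hy.cont
  have hL := lipschitzOnWith_velocity (β := β) (hxτ.1) (lt_min hδ₁ hδ₂)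
  refine ODE_solution_unique_of_mem_Icc_right (v := fun _ => velocity β)
    (s := fun _ => separatedSet β (min δ₁ δ₂)) (fun _ _ => hL) (continuousOn_pi.2 hx.cont)
    (fun t ht => hasDerivWithinAt_pi.2 fun i => hx.hasDerivWithinAt_Ici ht i)
    (fun t ht i j hij hi hj => (min_le_left _ _).trans (h1 t ⟨ht.1, ht.2.le⟩ i j hij hi hj))
    (continuousOn_pi.2 hy.cont)
    (fun t ht => hasDerivWithinAt_pi.2 fun i => hy.hasDerivWithinAt_Ici ht i)
    (fun t ht i j hij hi hj => (min_le_right _ _).trans (h2 t ⟨ht.1, ht.2.le⟩ i j hij hi hj)) h0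

/-- The velocity is continuously differentiable near a separated configuration. The final state is
recorded as well, since separation there is what uniqueness requires. -/
theorem exists_local_flow {ξ : Fin n → ℝ} (h : (ξ, β) ∈ stateSpace n) :
    ∃ (x : ℝ → Fin n → ℝ) (η : ℝ), x 0 = ξ ∧ IsFlow x β 0 η ∧ (x η, β) ∈ stateSpace n := by
  have hv : ContDiffAt ℝ 1 (velocity β) ξ := by
    refine contDiffAt_pi.2 fun i => ?_
    unfold velocity
    refine contDiffAt_const.mul (ContDiffAt.sum fun j hj => ?_)
    by_cases hb : β i = 0 ∨ β j = 0
    · have : ((β i : ℝ) * (β j : ℝ)) = 0 := by rcases hb with h | h <;> simp [h]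
      simp only [this, zero_div]
      exact contDiffAt_const
    · push Not at hb
      exact contDiffAt_const.div ((contDiffAt_apply ℝ ℝ i ξ).sub (contDiffAt_apply ℝ ℝ j ξ))
        (sub_ne_zero.2 (injOn_of_mem h (Finset.mem_filter.1 hj).2.symm hb.1 hb.2))
  obtain ⟨x, hx0, ε, hε, hode⟩ :=
    hv.exists_forall_mem_closedBall_exists_eq_forall_mem_Ioo_hasDerivAt₀ 0
  have hcont : ∀ t ∈ Ioo (-ε) ε, ∀ i, HasDerivAt (fun s => x s i) (velocity β (x t) i) t :=
    fun t ht i => hasDerivAt_pi.1 (hode t ⟨by linarith [ht.1], by linarith [ht.2]⟩) i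
  have hord : ∀ᶠ t in 𝓝 (0 : ℝ), ∀ i j, j < i → β i * β j ≠ 0 → x t j < x t i := by
    refine eventually_all.2 fun i => eventually_all.2 fun j => ?_
    by_cases hij : j < i ∧ β i * β j ≠ 0
    · have h0 := h.2 i j hij.1 hij.2
      simp only [← hx0] at h0
      have h1 := (hcont 0 ⟨by linarith, hε⟩ i).continuousAt
      have h2 := (hcont 0 ⟨by linarith, hε⟩ j).continuousAt
      filter_upwards [h2.eventually_lt h1 h0] with t ht _ _ using ht
    · exact Eventually.of_forall fun t h1 h2 => absurd ⟨h1, h2⟩ hij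
  obtain ⟨η, hη, hηo⟩ := Metric.eventually_nhds_iff.1 hord
  have hmem : ∀ t ∈ Icc 0 (min (ε / 2) (η / 2)), (x t, β) ∈ stateSpace n := fun t ht => by
    refine ⟨h.1, hηo ?_⟩
    rw [Real.dist_eq, sub_zero, abs_of_nonneg ht.1]
    linarith [ht.2, min_le_right (ε / 2) (η / 2)]
  have hpos : 0 < min (ε / 2) (η / 2) := by positivity
  have hsub : ∀ t ∈ Icc 0 (min (ε / 2) (η / 2)), t ∈ Ioo (-ε) ε := fun t ht =>
    ⟨by linarith [ht.1], by linarith [ht.2, min_le_left (ε / 2) (η / 2)]⟩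
  refine ⟨x, min (ε / 2) (η / 2), hx0, ⟨hpos, fun t ht => hmem t ⟨ht.1, ht.2.le⟩,
    fun i t ht => (hcont t (hsub t ht) i).continuousAt.continuousWithinAt,
    fun t ht => hcont t (hsub t ⟨ht.1.le, ht.2.le⟩)⟩, hmem _ ⟨hpos.le, le_rfl⟩⟩

theorem hasDerivAt_shift {f : ℝ → ℝ} {f' T t : ℝ} (h : HasDerivAt f f' (t - T)) :
    HasDerivAt (fun s => f (s - T)) f' t := h.comp_sub_const t T

/-- Two flows, one started where the other one ends, form a flow. -/
theorem IsFlow.concat {y : ℝ → Fin n → ℝ} {σ : ℝ} (hx : IsFlow x β 0 τ) (hy : IsFlow y β 0 σ)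
    (h : x τ = y 0) : IsFlow (fun t => if t ≤ τ then x t else y (t - τ)) β 0 (τ + σ) := by
  have hτ := hx.lt
  have hσ := hy.lt
  have hm0 : (y 0, β) ∈ stateSpace n := hy.mem 0 ⟨le_rfl, hσ⟩
  refine ⟨by linarith, fun t ht => ?_, fun i => ?_, fun t ht i => ?_⟩
  · split_ifs with h1
    · rcases h1.eq_or_lt with rfl | h1
      · rw [h]; exact hm0
      · exact hx.mem t ⟨ht.1, h1⟩
    · exact hy.mem _ ⟨by linarith, by linarith [ht.2]⟩
  · have h1 : ∀ t, (if t ≤ τ then x t else y (t - τ)) i =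
        if t ≤ τ then x t i else y (t - τ) i := fun t => by split_ifs <;> rfl
    simp only [h1]
    have h2 : ContinuousOn (fun t => y (t - τ) i) (Icc τ (τ + σ)) :=
      (hy.cont i).comp (f := fun t => t - τ) (by fun_prop)
        fun t ht => ⟨by linarith [ht.1], by linarith [ht.2]⟩
    have h3 := (ContinuousOn.union_of_isClosed (f := fun t => if t ≤ τ then x t i else y (t - τ) i)
      ((hx.cont i).congr fun t ht => if_pos ht.2)
      (h2.congr fun t ht => ?_) isClosed_Icc isClosed_Icc)
    · rwa [Icc_union_Icc_eq_Icc hτ.le (by linarith)] at h3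
    · simp only
      split_ifs with h4
      · have : t = τ := le_antisymm h4 ht.1
        rw [this, sub_self, h]
      · rfl
  · have h1 : (fun s => (if s ≤ τ then x s else y (s - τ)) i) =
        fun s => if s ≤ τ then x s i else y (s - τ) i := by ext s; split_ifs <;> rfl
    rw [h1]
    rcases lt_trichotomy t τ with hlt | rfl | hgt
    · rw [if_pos hlt.le]
      refine (hx.ode t ⟨ht.1, hlt⟩ i).congr_of_eventuallyEq ?_
      filter_upwards [Iio_mem_nhds hlt] with s hs
      exact if_pos (LT.lt.le hs)
    -- At the junction both one-sided derivatives equal the velocity of the common state, which is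
    -- separated.
    · rw [if_pos le_rfl]
      have h2 : HasDerivWithinAt (fun s => if s ≤ t then x s i else y (s - t) i)
          (velocity β (x t) i) (Iic t) t :=
        (hx.hasDerivWithinAt_end (h ▸ hm0) i).congr (fun s hs => if_pos hs) (if_pos le_rfl)
      have h3 : HasDerivWithinAt (fun s => y (s - t) i) (velocity β (y 0) i) (Ici t) t := by
        have h4 := hy.hasDerivWithinAt_start i
        have h5 : HasDerivWithinAt (fun s : ℝ => s - t) 1 (Ici t) t :=
          ((hasDerivAt_id t).sub_const t).hasDerivWithinAt
        rw [← sub_self t] at h4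
        have h6 := HasDerivWithinAt.comp (h₂ := fun s => y s i) t (by simpa using h4) h5
          (fun s hs => by simpa using hs)
        simpa [Function.comp_def] using h6
      have h4 : HasDerivWithinAt (fun s => if s ≤ t then x s i else y (s - t) i)
          (velocity β (x t) i) (Ici t) t := by
        rw [h]
        refine h3.congr (fun s hs => ?_) (by simp [h])
        split_ifs with h5
        · have : s = t := le_antisymm h5 hs
          rw [this, sub_self, h]
        · rfl
      have h5 := h2.union h4
      rwa [Iic_union_Ici, hasDerivWithinAt_univ] at h5
    · rw [if_neg (not_le.2 hgt)]
      have h2 := hasDerivAt_shift (T := τ) (hy.ode (t - τ) ⟨by linarith, by linarith [ht.2]⟩ i)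
      refine h2.congr_of_eventuallyEq ?_
      filter_upwards [Ioi_mem_nhds hgt] with s hs
      exact if_neg (not_le.2 hs)

end FlowRegularity

/-! ### Limits of the trajectories at a finite final time -/

section FlowLimit

variable {n : ℕ} {x : ℝ → Fin n → ℝ} {β : Fin n → ℤ} {α τ : ℝ}

/-- Interactions conserve momentum: sums of test functions with Lipschitz derivative change at a
bounded rate. -/
theorem abs_sum_mul_velocity_le {ξ : Fin n → ℝ} (h : (ξ, β) ∈ stateSpace n) {φ' : ℝ → ℝ}
    (hφ' : ∀ u v, |φ' u - φ' v| ≤ 2 * |u - v|) : |∑ i, φ' (ξ i) * velocity β ξ i| ≤ n := by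
  have h1 := sum_mul_antisymm Finset.univ (fun i => φ' (ξ i))
    (fun i j => (β i : ℝ) * (β j : ℝ) / (ξ i - ξ j)) fun i j => by rw [← div_neg]; congr 1 <;> ring
  have h2 : ∑ i, φ' (ξ i) * velocity β ξ i = 1 / (n : ℝ) * ∑ i, φ' (ξ i) *
      ∑ j with j ≠ i, (β i : ℝ) * (β j : ℝ) / (ξ i - ξ j) := by
    rw [Finset.mul_sum]
    exact Finset.sum_congr rfl fun i _ => by rw [velocity]; ring
  have h3 : ∀ i, |∑ j with j ≠ i, (φ' (ξ i) - φ' (ξ j)) *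
      ((β i : ℝ) * (β j : ℝ) / (ξ i - ξ j))| ≤ n * 2 := fun i => by
    refine (Finset.abs_sum_le_sum_abs _ _).trans ((Finset.sum_le_sum (g := fun _ => (2 : ℝ))
      fun j hj => ?_).trans ?_)
    · have hb : ∀ k, |(β k : ℝ)| ≤ 1 := fun k => by
        rcases h.1 k with h | h | h <;> simp only at h <;> simp [h]
      by_cases hb0 : β i = 0 ∨ β j = 0
      · have : ((β i : ℝ) * (β j : ℝ)) = 0 := by rcases hb0 with h | h <;> simp [h]
        rw [this]; simp
      push Not at hb0
      have h4 : 0 < |ξ i - ξ j| :=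
        abs_pos.2 (sub_ne_zero.2 (injOn_of_mem h (Finset.mem_filter.1 hj).2.symm hb0.1 hb0.2))
      rw [abs_mul, abs_div, abs_mul, ← mul_div_assoc, div_le_iff₀ h4]
      have h5 : |(β i : ℝ)| * |(β j : ℝ)| ≤ 1 := mul_le_one₀ (hb i) (abs_nonneg _) (hb j)
      calc _ ≤ |φ' (ξ i) - φ' (ξ j)| * 1 := mul_le_mul_of_nonneg_left h5 (abs_nonneg _)
        _ ≤ _ := by rw [mul_one]; exact hφ' _ _
    · rw [Finset.sum_const, nsmul_eq_mul]
      refine mul_le_mul_of_nonneg_right ?_ two_pos.le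
      exact_mod_cast (Finset.card_filter_le _ _).trans (by simp)
  rw [h2, h1, abs_mul, abs_mul, abs_of_nonneg (by positivity : (0 : ℝ) ≤ 1 / n),
    abs_of_pos (by norm_num : (0 : ℝ) < 1 / 2)]
  have h4 : |∑ i, ∑ j with j ≠ i, (φ' (ξ i) - φ' (ξ j)) *
      ((β i : ℝ) * (β j : ℝ) / (ξ i - ξ j))| ≤ n * (n * 2) := by
    refine (Finset.abs_sum_le_sum_abs _ _).trans ((Finset.sum_le_sum fun i _ => h3 i).trans ?_)
    simp
  rcases Nat.eq_zero_or_pos n with h0 | h0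
  · simp [h0]
  · have : (0 : ℝ) < n := Nat.cast_pos.2 h0
    calc _ ≤ 1 / (n : ℝ) * (1 / 2 * (n * (n * 2))) := by gcongr
      _ = n := by field_simp

/-- Single particles may have unbounded speed before a collision, but these symmetric sums have
bounded derivative. -/
theorem exists_tendsto_sum (hτ : α < τ) (hm : ∀ t ∈ Ioo α τ, (x t, β) ∈ stateSpace n)
    (hode : ∀ t ∈ Ioo α τ, ∀ i, HasDerivAt (fun s => x s i) (velocity β (x t) i) t)
    {φ φ' : ℝ → ℝ} (hφ : ∀ u, HasDerivAt φ (φ' u) u)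
    (hφ' : ∀ u v, |φ' u - φ' v| ≤ 2 * |u - v|) :
    ∃ L, Tendsto (fun t => ∑ i, φ (x t i)) (𝓝[<] τ) (𝓝 L) := by
  have hder : ∀ t ∈ Ioo α τ, HasDerivWithinAt (fun t => ∑ i, φ (x t i))
      (∑ i, φ' (x t i) * velocity β (x t) i) (Ioo α τ) t := fun t ht =>
    (HasDerivAt.fun_sum fun i _ => (hφ (x t i)).comp t (hode t ht i)).hasDerivWithinAt
  have hlip : LipschitzOnWith (n : NNReal) (fun t => ∑ i, φ (x t i)) (Ioo α τ) :=
    (convex_Ioo α τ).lipschitzOnWith_of_nnnorm_hasDerivWithin_le hder fun t ht => by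
      rw [← NNReal.coe_le_coe, coe_nnnorm, Real.norm_eq_abs, NNReal.coe_natCast]
      exact abs_sum_mul_velocity_le (hm t ht) hφ'
  -- The value at `τ` of a Lipschitz extension to the line is the limit.
  obtain ⟨g, hg, heq⟩ := hlip.extend_real
  refine ⟨g τ, ((hg.continuous.tendsto τ).mono_left nhdsWithin_le_nhds).congr' ?_⟩
  filter_upwards [Ioo_mem_nhdsLT hτ] with t ht using (heq ht).symm

/-- Test functions that see only the particles to the left of `a`, with Lipschitz derivative
although they are not twice differentiable; the error of the linearisation is at most the square of
the increment. -/
theorem hasDerivAt_max_sq (a u : ℝ) :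
    HasDerivAt (fun u => max (a - u) 0 ^ 2) (-2 * max (a - u) 0) u := by
  have h1 : HasDerivAt (fun v => max (a - v) 0 ^ 2 - max (a - u) 0 ^ 2 +
      2 * max (a - u) 0 * (v - u)) 0 u := by
    have h2 : (fun v => max (a - v) 0 ^ 2 - max (a - u) 0 ^ 2 + 2 * max (a - u) 0 * (v - u))
        =O[𝓝 u] fun v => ‖v - u‖ ^ 2 := by
      refine Asymptotics.IsBigO.of_bound 1 (Eventually.of_forall fun v => ?_)
      simp only [Real.norm_eq_abs, sq_abs, abs_pow, one_mul]
      rw [abs_le]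
      rcases max_cases (a - v) 0 with ⟨h3, h4⟩ | ⟨h3, h4⟩ <;>
        rcases max_cases (a - u) 0 with ⟨h5, h6⟩ | ⟨h5, h6⟩ <;> rw [h3, h5] <;>
        constructor <;> nlinarith
    have := (h2.hasFDerivAt one_lt_two).hasDerivAt
    simpa using this
  have h3 : HasDerivAt (fun v => max (a - u) 0 ^ 2 - 2 * max (a - u) 0 * (v - u))
      (-(2 * max (a - u) 0 * 1)) u :=
    (((hasDerivAt_id u).sub_const u).const_mul _).const_sub _
  have h4 := h1.fun_add h3
  refine (h4.congr_deriv (by ring)).congr_of_eventuallyEq (Eventually.of_forall fun v => ?_)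
  simp only
  ring

/-- Test at `a = ζ i`: earlier particles cancel, and in `ζ` later charged ones do not lie to the
left of `a`. The remaining differences are nonnegative with sum zero, so the one for `i` vanishes
and `ξ i` does not lie to the left of `ζ i`. -/
theorem le_of_sum_max_sq {ξ ζ : Fin n → ℝ} {i : Fin n}
    (h0 : ∀ j, β j = 0 → ξ j = ζ j) (hlt : ∀ j < i, ξ j = ζ j)
    (hζ : ∀ j, i < j → β j ≠ 0 → ζ i ≤ ζ j)
    (hsum : ∑ j, max (ζ i - ξ j) 0 ^ 2 = ∑ j, max (ζ i - ζ j) 0 ^ 2) : ζ i ≤ ξ i := by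
  have h1 : ∑ j, (max (ζ i - ξ j) 0 ^ 2 - max (ζ i - ζ j) 0 ^ 2) = 0 := by
    rw [Finset.sum_sub_distrib, hsum, sub_self]
  have h2 : ∀ j ∈ Finset.univ, 0 ≤ max (ζ i - ξ j) 0 ^ 2 - max (ζ i - ζ j) 0 ^ 2 := fun j _ => by
    by_cases hj0 : β j = 0
    · rw [h0 j hj0, sub_self]
    · rcases lt_or_ge j i with hj | hj
      · rw [hlt j hj, sub_self]
      · have : ζ i ≤ ζ j := by
          rcases hj.eq_or_lt with rfl | hj
          · exact le_rfl
          · exact hζ j hj hj0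
        rw [max_eq_right (by linarith : ζ i - ζ j ≤ 0)]
        have := sq_nonneg (max (ζ i - ξ j) 0)
        linarith
  have h3 := (Finset.sum_eq_zero_iff_of_nonneg h2).1 h1 i (Finset.mem_univ _)
  simp only [sub_self, max_self, ne_eq, OfNat.ofNat_ne_zero, not_false_eq_true, zero_pow,
    sub_zero, pow_eq_zero_iff] at h3
  have := le_max_left (ζ i - ξ i) 0
  linarith

/-- A weakly ordered configuration is determined by the sums `∑ (a - ξ_i)_+²`. -/
theorem eq_of_sum_max_sq {ξ ζ : Fin n → ℝ} (h0 : ∀ j, β j = 0 → ξ j = ζ j)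
    (hξ : ∀ i j, i < j → β i ≠ 0 → β j ≠ 0 → ξ i ≤ ξ j)
    (hζ : ∀ i j, i < j → β i ≠ 0 → β j ≠ 0 → ζ i ≤ ζ j)
    (hsum : ∀ a, ∑ j, max (a - ξ j) 0 ^ 2 = ∑ j, max (a - ζ j) 0 ^ 2) : ξ = ζ := by
  ext i
  induction i using WellFoundedLT.induction with
  | _ i ih =>
    by_cases hi : β i = 0
    · exact h0 i hi
    refine le_antisymm ?_ ?_
    · exact le_of_sum_max_sq (fun j hj => (h0 j hj).symm) (fun j hj => (ih j hj).symm)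
        (fun j hij hj => hξ i j hij hi hj) (hsum _).symm
    · exact le_of_sum_max_sq h0 ih (fun j hij hj => hζ i j hij hi hj) (hsum _)

/-- The particles have limits at the end of a bounded time interval. -/
theorem exists_tendsto_of_ode (hτ : α < τ) (hm : ∀ t ∈ Ioo α τ, (x t, β) ∈ stateSpace n)
    (hode : ∀ t ∈ Ioo α τ, ∀ i, HasDerivAt (fun s => x s i) (velocity β (x t) i) t) :
    ∃ ξ : Fin n → ℝ, Tendsto x (𝓝[<] τ) (𝓝 ξ) := by
  have hIoo : Ioo α τ ∈ 𝓝[<] τ := Ioo_mem_nhdsLT hτ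
  obtain ⟨L, hL⟩ := exists_tendsto_sum hτ hm hode (φ := fun u => u ^ 2) (φ' := fun u => 2 * u)
    (fun u => by simpa using hasDerivAt_pow 2 u)
    (fun u v => by rw [← mul_sub, abs_mul, abs_two])
  choose G hG using fun a => exists_tendsto_sum hτ hm hode
    (φ := fun u => max (a - u) 0 ^ 2) (φ' := fun u => -2 * max (a - u) 0) (hasDerivAt_max_sq a)
    (fun u v => by
      rw [← mul_sub, abs_mul, abs_neg, abs_two]
      refine mul_le_mul_of_nonneg_left ((abs_max_sub_max_le_abs _ _ _).trans ?_) two_pos.le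
      rw [sub_sub_sub_cancel_left, abs_sub_comm])
  set t₀ := (α + τ) / 2 with ht₀
  have ht₀m : t₀ ∈ Ioo α τ := ⟨by linarith, by linarith⟩
  have hconst : ∀ i, β i = 0 → ∀ t ∈ Ioo α τ, x t i = x t₀ i := fun i hi t ht => by
    refine (convex_Ioo α τ).is_const_of_fderivWithin_eq_zero (𝕜 := ℝ) (f := fun t => x t i)
      (fun t ht => (hode t ht i).differentiableAt.differentiableWithinAt) (fun t ht => ?_) ht ht₀m
    have h1 : velocity β (x t) i = 0 := by simp [velocity, hi]
    have h2 := hode t ht i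
    rw [h1] at h2
    have h3 := h2.hasFDerivAt.hasFDerivWithinAt.fderivWithin
      (isOpen_Ioo.uniqueDiffWithinAt (𝕜 := ℝ) ht)
    rw [h3]; simp
  have hbdd : ∀ᶠ t in 𝓝[<] τ, x t ∈ Metric.closedBall (0 : Fin n → ℝ) (Real.sqrt (L + 1)) := by
    filter_upwards [hL.eventually_lt_const (lt_add_one L)] with t ht
    rw [mem_closedBall_zero_iff, pi_norm_le_iff_of_nonneg (Real.sqrt_nonneg _)]
    refine fun i => Real.abs_le_sqrt (le_trans ?_ ht.le)
    exact Finset.single_le_sum (f := fun i => x t i ^ 2) (fun _ _ => sq_nonneg _)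
      (Finset.mem_univ i)
  have hK := isCompact_closedBall (0 : Fin n → ℝ) (Real.sqrt (L + 1))
  -- The second moment keeps the trajectory in a compact set. All its cluster points have the same
  -- neutral positions, the weak order and the same sums, hence coincide.
  have hcl : ∀ ξ, MapClusterPt ξ (𝓝[<] τ) x → (∀ j, β j = 0 → ξ j = x t₀ j) ∧
      (∀ i j, i < j → β i ≠ 0 → β j ≠ 0 → ξ i ≤ ξ j) ∧
      ∀ a, ∑ j, max (a - ξ j) 0 ^ 2 = G a := by
    intro ξ hξ
    have hmem : ∀ S : Set (Fin n → ℝ), IsClosed S → (∀ t ∈ Ioo α τ, x t ∈ S) → ξ ∈ S :=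
      fun S hS h => hS.mem_of_mapClusterPt hξ (Filter.mem_of_superset hIoo h)
    refine ⟨fun j hj => ?_, fun i j hij hi hj => ?_, fun a => ?_⟩
    · exact hmem {ζ | ζ j = x t₀ j} (isClosed_eq (continuous_apply j) continuous_const)
        fun t ht => hconst j hj t ht
    · exact hmem {ζ | ζ i ≤ ζ j} (isClosed_le (continuous_apply i) (continuous_apply j))
        fun t ht => ((hm t ht).2 j i hij (mul_ne_zero hj hi)).le
    · have hc : Continuous fun ζ : Fin n → ℝ => ∑ j, max (a - ζ j) 0 ^ 2 := by fun_prop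
      have h1 := hξ.continuousAt_comp hc.continuousAt
      have h2 : ClusterPt (∑ j, max (a - ξ j) 0 ^ 2) (𝓝 (G a)) := ClusterPt.mono h1 (hG a)
      exact eq_of_nhds_neBot h2
  obtain ⟨ξ, -, hξ⟩ := hK.exists_mapClusterPt_of_frequently hbdd.frequently
  have hne : (𝓝[<] τ).NeBot := inferInstance
  refine ⟨ξ, hK.tendsto_nhds_of_unique_mapClusterPt hbdd fun ζ _ hζ => ?_⟩
  obtain ⟨h1, h2, h3⟩ := hcl ξ hξ
  obtain ⟨h4, h5, h6⟩ := hcl ζ hζ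
  exact eq_of_sum_max_sq (β := β) (fun j hj => by rw [h1 j hj, h4 j hj]) h5 h2
    fun a => by rw [h3, h6]

end FlowLimit

/-! ### Maximal flows and annihilation at a collision -/

section MaximalFlow

variable {n : ℕ} {x : ℝ → Fin n → ℝ} {β : Fin n → ℤ} {α τ : ℝ}

/-- A flow exists for all times or up to a collision. -/
theorem exists_flow {ξ : Fin n → ℝ} (h : (ξ, β) ∈ stateSpace n) :
    (∃ x : ℝ → Fin n → ℝ, x 0 = ξ ∧ ∀ T, 0 < T → IsFlow x β 0 T) ∨
    ∃ (x : ℝ → Fin n → ℝ) (T : ℝ), x 0 = ξ ∧ IsFlow x β 0 T ∧ (x T, β) ∉ stateSpace n := by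
  classical
  refine or_iff_not_imp_right.2 fun hcon => ?_
  push Not at hcon
  set A : Set ℝ := {T | ∃ f : ℝ → Fin n → ℝ, f 0 = ξ ∧ IsFlow f β 0 T} with hA
  have hdown : ∀ T ∈ A, ∀ t, 0 < t → t ≤ T → t ∈ A := fun T ⟨f, hf0, hf⟩ t ht htT =>
    ⟨f, hf0, hf.mono_right ht htT⟩
  have h0A : (0 : ℝ) ∉ A := fun ⟨f, hf0, hf⟩ => lt_irrefl _ hf.lt
  -- By assumption no flow from `ξ` ends in a collision, so uniqueness applies to all of them and
  -- the chosen flow does not matter: `X` is their common trajectory.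
  set X : ℝ → Fin n → ℝ := fun t => if ht : t ∈ A then ht.choose t else ξ with hX
  have hXf : ∀ f T, f 0 = ξ → IsFlow f β 0 T → ∀ t ∈ Icc 0 T, X t = f t := by
    intro f T hf0 hf t ht
    rcases ht.1.eq_or_lt with rfl | hlt
    · rw [hX]; simp only [dif_neg h0A, hf0]
    · have htA : t ∈ A := hdown T ⟨f, hf0, hf⟩ t hlt ht.2
      obtain ⟨h1, h2⟩ := htA.choose_spec
      have h3 := hf.mono_right hlt ht.2
      rw [hX]
      simp only [dif_pos htA]
      exact h2.unique h3 (hcon _ _ h1 h2) (hcon _ _ hf0 h3) (h1.trans hf0.symm) t ⟨hlt.le, le_rfl⟩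
  have hX0 : X 0 = ξ := by rw [hX]; simp only [dif_neg h0A]
  have hXflow : ∀ T ∈ A, IsFlow X β 0 T := fun T ⟨f, hf0, hf⟩ => hf.congr (hXf f T hf0 hf)
  have hnomax : ∀ T ∈ A, ∃ T' ∈ A, T < T' := fun T ⟨f, hf0, hf⟩ => by
    obtain ⟨y, η, hy0, hy, -⟩ := exists_local_flow (hcon f T hf0 hf)
    refine ⟨T + η, ⟨_, ?_, hf.concat hy hy0.symm⟩, by linarith [hy.lt]⟩
    simp only [if_pos hf.lt.le, hf0]
  obtain ⟨T₁, hT₁⟩ : A.Nonempty := by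
    obtain ⟨y, η, hy0, hy, -⟩ := exists_local_flow h
    exact ⟨η, y, hy0, hy⟩
  -- At a finite supremum the trajectories would converge, the limit would give a flow up to that
  -- time, and this flow could be continued beyond it.
  have hunb : ¬ BddAbove A := fun hbdd => by
    have hlub := isLUB_csSup ⟨T₁, hT₁⟩ hbdd
    set T := sSup A with hT
    have hlt : ∀ t < T, ∃ t' ∈ A, t < t' := fun t ht => by
      obtain ⟨t', h1, h2, -⟩ := hlub.exists_between ht
      exact ⟨t', h1, h2⟩
    have hT0 : 0 < T := (hXflow T₁ hT₁).lt.trans_le (hlub.1 hT₁)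
    have hmem : ∀ t ∈ Ico 0 T, (X t, β) ∈ stateSpace n := fun t ht => by
      obtain ⟨t', h1, h2⟩ := hlt t ht.2
      exact (hXflow t' h1).mem t ⟨ht.1, h2⟩
    have hode : ∀ t ∈ Ioo 0 T, ∀ i, HasDerivAt (fun s => X s i) (velocity β (X t) i) t :=
      fun t ht => by
        obtain ⟨t', h1, h2⟩ := hlt t ht.2
        exact (hXflow t' h1).ode t ⟨ht.1, h2⟩
    have hcont : ContinuousOn X (Ico 0 T) := fun t ht => by
      obtain ⟨t', h1, h2⟩ := hlt t ht.2
      refine (continuousOn_pi.2 (hXflow t' h1).cont t ⟨ht.1, h2.le⟩).mono_of_mem_nhdsWithin ?_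
      rw [← Ici_inter_Iic]
      exact inter_mem (nhdsWithin_mono _ Ico_subset_Ici_self self_mem_nhdsWithin)
        (nhdsWithin_le_nhds (Iic_mem_nhds h2))
    obtain ⟨ζ, hζ⟩ := exists_tendsto_of_ode hT0 (fun t ht => hmem t ⟨ht.1.le, ht.2⟩) hode
    have hY : ∀ t < T, Function.update X T ζ t = X t := fun t ht =>
      Function.update_of_ne ht.ne _ _
    have hTA : T ∈ A := by
      refine ⟨Function.update X T ζ, by rw [hY 0 hT0, hX0], hT0, fun t ht => ?_, ?_,
        fun t ht i => ?_⟩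
      · rw [hY t ht.2]; exact hmem t ht
      · refine continuousOn_pi.1 (continuousOn_update_iff.2 ⟨?_, fun _ => ?_⟩)
        · rwa [Icc_sdiff_right]
        · rwa [Icc_sdiff_right, nhdsWithin_Ico_eq_nhdsLT hT0]
      · rw [hY t ht.2]
        refine (hode t ht i).congr_of_eventuallyEq ?_
        filter_upwards [Iio_mem_nhds ht.2] with s hs
        rw [hY s hs]
    obtain ⟨T', hT', hlt'⟩ := hnomax T hTA
    exact absurd (hlub.1 hT') (not_le.2 hlt')
  refine ⟨X, hX0, fun T hT => ?_⟩
  obtain ⟨T', hT', hlt⟩ := not_bddAbove_iff.1 hunb T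
  exact (hXflow T' hT').mono_right hT hlt.le

/-- The charges can be annihilated at a collision. -/
theorem IsFlow.exists_annihilation (h : IsFlow x β α τ) : ∃ β' : Fin n → ℤ,
    (x τ, β') ∈ stateSpace n ∧ (∀ i, β' i = β i ∨ β' i = 0) ∧
      ∀ y, ∑ i with x τ i = y, β' i = ∑ i with x τ i = y, β i := by
  classical
  set m : ℝ → ℤ := fun y => ∑ i ∈ cluster β (x τ) y, β i with hm
  -- In each group the first particle whose charge equals the net charge survives; if the net charge
  -- is 0, none does, as surviving requires a nonzero charge.
  set keep : Fin n → Prop := fun i => β i ≠ 0 ∧ β i = m (x τ i) ∧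
    ∀ j < i, j ∈ cluster β (x τ) (x τ i) → β j ≠ β i with hkeep
  have hkuniq : ∀ i j, keep i → keep j → x τ i = x τ j → i = j := by
    intro i j hi hj hij
    have hb : β i = β j := by rw [hi.2.1, hj.2.1, hij]
    rcases lt_trichotomy i j with hlt | heq | hlt
    · exact absurd hb (hj.2.2 i hlt (mem_cluster.2 ⟨hi.1, hij⟩))
    · exact heq
    · exact absurd hb.symm (hi.2.2 j hlt (mem_cluster.2 ⟨hj.1, hij.symm⟩))
  refine ⟨fun i => if keep i then β i else 0, ⟨fun i => ?_, fun i j hji hb => ?_⟩, fun i => ?_,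
    fun y => ?_⟩
  · simp only
    split_ifs
    · exact (h.mem α ⟨le_rfl, h.lt⟩).1 i
    · simp
  · simp only at hb
    have hi : keep i := by by_contra hk; simp [hk] at hb
    have hj : keep j := by by_contra hk; simp [hk] at hb
    refine lt_of_le_of_ne (h.le_of_lt hji hj.1 hi.1 ⟨h.lt.le, le_rfl⟩) fun he => ?_
    exact hji.ne (hkuniq j i hj hi he)
  · simp only; split_ifs
    · exact Or.inl rfl
    · exact Or.inr rfl
  · rw [← sum_cluster_eq β]
    have htot : m y = 0 ∨ m y = 1 ∨ m y = -1 := by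
      obtain ⟨s, hs, hsum⟩ := h.exists_cluster_sums y
      have := hsum (cluster β (x τ) y) subset_rfl fun i _ j hj _ => hj
      rcases this with h1 | h1
      · exact Or.inl h1
      · right; rcases hs with h2 | h2
        · exact Or.inl (h1.trans h2)
        · exact Or.inr (h1.trans h2)
    have hfib : ∀ i, x τ i = y → (β i = 0 ∨ i ∈ cluster β (x τ) y) := fun i hi => by
      by_cases hb : β i = 0
      · exact Or.inl hb
      · exact Or.inr (mem_cluster.2 ⟨hb, hi⟩)
    change _ = m y
    by_cases hm0 : m y = 0
    · rw [hm0]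
      refine Finset.sum_eq_zero fun i hi => if_neg fun hk => hk.1 ?_
      rw [hk.2.1, (Finset.mem_filter.1 hi).2, hm0]
    -- Otherwise all charges of the group would be `-m y`, and their sum could not be `m y`.
    · have hex : ∃ i ∈ cluster β (x τ) y, β i = m y := by
        by_contra! hno
        have h1 : ∀ i ∈ cluster β (x τ) y, β i = -m y := fun i hi => by
          have h2 := h.charge_eq (mem_cluster.1 hi).1
          have h3 := hno i hi
          omega
        have h2 : m y = (cluster β (x τ) y).card * -m y := by
          conv_lhs => rw [hm]
          simp only
          rw [Finset.sum_congr rfl h1, Finset.sum_const, nsmul_eq_mul]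
        have h3 : (0 : ℤ) ≤ (cluster β (x τ) y).card := Int.natCast_nonneg _
        rcases htot with h4 | h4 | h4 <;> rw [h4] at h2 <;> omega
      have hne : ((cluster β (x τ) y).filter fun i => β i = m y).Nonempty := by
        obtain ⟨i, hi, hb⟩ := hex
        exact ⟨i, Finset.mem_filter.2 ⟨hi, hb⟩⟩
      set i₀ := Finset.min' _ hne with hi₀
      obtain ⟨hi₀c, hi₀b⟩ := Finset.mem_filter.1 (Finset.min'_mem _ hne)
      rw [← hi₀] at hi₀c hi₀b
      have hi₀y := (mem_cluster.1 hi₀c).2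
      have hk₀ : keep i₀ := by
        refine ⟨(mem_cluster.1 hi₀c).1, by rw [hi₀y, hi₀b], fun j hj hjc hb => ?_⟩
        rw [hi₀y] at hjc
        exact absurd (Finset.min'_le _ j (Finset.mem_filter.2 ⟨hjc, hb.trans hi₀b⟩)) (not_le.2 hj)
      rw [Finset.sum_eq_single i₀, if_pos hk₀, hi₀b]
      · intro i hi hne
        refine if_neg fun hk => hne (hkuniq i i₀ hk hk₀ ?_)
        rw [(Finset.mem_filter.1 hi).2, hi₀y]
      · exact fun hno => absurd (by simpa using hi₀y) hno

end MaximalFlow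

/-! ### Gluing flows at the annihilation times -/

section Existence

variable {n : ℕ}

/-- An evolution with the times `S` of annihilation. -/
structure AnnihilatingEvolution (x : ℝ → Fin n → ℝ) (b : ℝ → Fin n → ℤ) (S : Set ℝ) : Prop
    extends ParticleEvolution x b where
  finite : S.Finite
  pos : ∀ t ∈ S, 0 < t
  smooth : ∀ t, 0 < t → t ∉ S → ∃ δ > 0, δ ≤ t ∧ ∀ s ∈ Ioo (t - δ) (t + δ), b s = b t ∧
    ∀ i, HasDerivAt (fun r => x r i) (velocity (b t) (x s) i) s
  decay : ∀ s t, 0 ≤ s → s ≤ t → ∀ i, b t i = b s i ∨ b t i = 0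

theorem AnnihilatingEvolution.of_flow {x : ℝ → Fin n → ℝ} {β : Fin n → ℤ}
    (h : ∀ T, 0 < T → IsFlow x β 0 T) : AnnihilatingEvolution x (fun _ => β) ∅ := by
  have hode : ∀ t, 0 < t → ∀ i, HasDerivAt (fun r => x r i) (velocity β (x t) i) t := fun t ht =>
    (h (t + 1) (by linarith)).ode t ⟨ht, by linarith⟩
  exact
  { mem := fun t ht => (h (t + 1) (by linarith)).mem t ⟨ht, by linarith⟩
    cont := fun i t ht => by
      have ht : 0 ≤ t := ht
      refine ((h (t + 1) (by linarith)).cont i t ⟨ht, by linarith⟩).mono_of_mem_nhdsWithin ?_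
      rw [← Ici_inter_Iic]
      exact inter_mem self_mem_nhdsWithin (nhdsWithin_le_nhds (Iic_mem_nhds (by linarith)))
    right := fun τ hτ => ⟨1, one_pos, fun t ht => ⟨rfl, fun hlt => hode t (by linarith)⟩⟩
    left := fun τ hτ => ⟨τ, hτ, le_rfl, β, fun t ht => ⟨rfl, hode t (by linarith [ht.1])⟩,
      fun i => Or.inl rfl, fun y => rfl⟩
    finite := finite_empty
    pos := fun t ht => absurd ht (notMem_empty t)
    smooth := fun t ht _ => ⟨t, ht, le_rfl, fun s hs => ⟨rfl, hode s (by linarith [hs.1])⟩⟩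
    decay := fun s t _ _ i => Or.inl rfl }

/-- The state `(y, c)`, run from time `T` on, after the flow `x`. -/
theorem AnnihilatingEvolution.concat {x y : ℝ → Fin n → ℝ} {β : Fin n → ℤ} {c : ℝ → Fin n → ℤ}
    {S : Set ℝ} {T : ℝ} (hx : IsFlow x β 0 T) (hy : AnnihilatingEvolution y c S)
    (h0 : y 0 = x T) (hc : ∀ i, c 0 i = β i ∨ c 0 i = 0)
    (hsum : ∀ z, ∑ i with x T i = z, c 0 i = ∑ i with x T i = z, β i) :
    AnnihilatingEvolution (fun t => if t < T then x t else y (t - T))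
      (fun t => if t < T then β else c (t - T)) (insert T ((fun t => t + T) '' S)) := by
  have hT := hx.lt
  have hbefore : ∀ t ∈ Ioo 0 T, ∀ i,
      HasDerivAt (fun r => (if r < T then x r else y (r - T)) i)
        (velocity β (if t < T then x t else y (t - T)) i) t := fun t ht i => by
    rw [if_pos ht.2]
    refine (hx.ode t ht i).congr_of_eventuallyEq ?_
    filter_upwards [Iio_mem_nhds ht.2] with s hs
    have hs : s < T := hs
    simp only [if_pos hs]
  have hafter : ∀ t, T < t → ∀ (γ : Fin n → ℤ) i,
      HasDerivAt (fun r => y r i) (velocity γ (y (t - T)) i) (t - T) →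
      HasDerivAt (fun r => (if r < T then x r else y (r - T)) i)
        (velocity γ (if t < T then x t else y (t - T)) i) t := fun t ht γ i h => by
    rw [if_neg (not_lt.2 ht.le)]
    refine (hasDerivAt_shift h).congr_of_eventuallyEq ?_
    filter_upwards [Ioi_mem_nhds ht] with s hs
    have hs : T < s := hs
    simp only [if_neg (not_lt.2 hs.le)]
  refine { mem := fun t ht => ?_, cont := fun i => ?_, right := fun τ hτ => ?_, left := fun τ hτ => ?_,
           finite := (hy.finite.image _).insert T, pos := ?_, smooth := fun t ht htS => ?_,
           decay := fun s t hs hst i => ?_ }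
  · split_ifs with h
    · exact hx.mem t ⟨ht, h⟩
    · exact hy.mem _ (by linarith)
  · have h1 : ∀ t, (if t < T then x t else y (t - T)) i =
        if t < T then x t i else y (t - T) i := fun t => by split_ifs <;> rfl
    simp only [h1]
    have h2 : ContinuousOn (fun t => y (t - T) i) (Ici T) :=
      (hy.cont i).comp (f := fun t => t - T) (by fun_prop) fun t ht => by
        have ht : T ≤ t := ht
        simpa using ht
    have h3 := ContinuousOn.union_of_isClosed (f := fun t => if t < T then x t i else y (t - T) i)
      ((hx.cont i).congr fun t ht => ?_)
      (h2.congr fun t ht => if_neg (not_lt.2 ht)) isClosed_Icc isClosed_Ici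
    · rwa [Icc_union_Ici_eq_Ici hT.le] at h3
    · simp only
      split_ifs with h4
      · rfl
      · have : t = T := le_antisymm ht.2 (not_lt.1 h4)
        rw [this, sub_self, h0]
  · rcases lt_or_ge τ T with h | h
    · refine ⟨T - τ, by linarith, fun t ht => ?_⟩
      have htT : t < T := by linarith [ht.2]
      simp only [if_pos h]
      exact ⟨if_pos htT, fun hlt => hbefore t ⟨by linarith, htT⟩⟩
    · obtain ⟨δ, hδ, h1⟩ := hy.right (τ - T) (by linarith)
      refine ⟨δ, hδ, fun t ht => ?_⟩
      have h2 := h1 (t - T) ⟨by linarith [ht.1], by linarith [ht.2]⟩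
      simp only [if_neg (not_lt.2 h), if_neg (not_lt.2 (h.trans ht.1))]
      refine ⟨h2.1, fun hlt i => ?_⟩
      have := hafter t (by linarith) _ i (h2.2 (by linarith) i)
      simpa only [if_neg (not_lt.2 (h.trans ht.1))] using this
  · rcases le_or_gt τ T with h | h
    · refine ⟨τ, hτ, le_rfl, β, fun t ht => ?_, fun i => ?_, fun z => ?_⟩
      · have htT : t < T := by linarith [ht.2]
        exact ⟨if_pos htT, hbefore t ⟨by linarith [ht.1], htT⟩⟩
      · rcases h.eq_or_lt with rfl | hlt
        · simpa using hc i
        · exact Or.inl (by simp only [if_pos hlt])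
      · rcases h.eq_or_lt with rfl | hlt
        · simp only [lt_irrefl, if_false, sub_self, h0]
          exact hsum z
        · simp only [if_pos hlt]
    · obtain ⟨δ, hδ, hδτ, γ, h1, h2, h3⟩ := hy.left (τ - T) (by linarith)
      refine ⟨δ, hδ, by linarith, γ, fun t ht => ?_, fun i => ?_, fun z => ?_⟩
      · have htT : T < t := by linarith [ht.1]
        have h4 := h1 (t - T) ⟨by linarith [ht.1], by linarith [ht.2]⟩
        exact ⟨by simp only [if_neg (not_lt.2 htT.le), h4.1],
          fun i => hafter t htT γ i (h4.2 i)⟩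
      · simp only [if_neg (not_lt.2 h.le)]; exact h2 i
      · simp only [if_neg (not_lt.2 h.le)]; exact h3 z
  · rintro t (rfl | ⟨s, hs, rfl⟩)
    · exact hT
    · have := hy.pos s hs
      simp only; linarith
  · rcases lt_trichotomy t T with h | h | h
    · have hpos : 0 < min t (T - t) := lt_min ht (by linarith)
      refine ⟨min t (T - t), hpos, min_le_left _ _, fun s hs => ?_⟩
      have h1 := min_le_left t (T - t)
      have h2 := min_le_right t (T - t)
      have hsT : s < T := by linarith [hs.2]
      simp only [if_pos h]
      exact ⟨if_pos hsT, hbefore s ⟨by linarith [hs.1], hsT⟩⟩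
    · exact absurd (Or.inl h) htS
    · obtain ⟨δ, hδ, hδt, h1⟩ := hy.smooth (t - T) (by linarith) fun hS =>
        htS (Or.inr ⟨t - T, hS, by ring⟩)
      refine ⟨δ, hδ, by linarith, fun s hs => ?_⟩
      have hsT : T < s := by linarith [hs.1]
      have h2 := h1 (s - T) ⟨by linarith [hs.1], by linarith [hs.2]⟩
      simp only [if_neg (not_lt.2 h.le), if_neg (not_lt.2 hsT.le)]
      refine ⟨h2.1, fun i => ?_⟩
      have := hafter s hsT _ i (h2.2 i)
      simpa only [if_neg (not_lt.2 hsT.le)] using this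
  · rcases lt_or_ge t T with h | h
    · rw [if_pos h, if_pos (hst.trans_lt h)]; exact Or.inl rfl
    · rw [if_neg (not_lt.2 h)]
      rcases lt_or_ge s T with h' | h'
      · rw [if_pos h']
        rcases hy.decay 0 (t - T) le_rfl (by linarith) i with h1 | h1
        · rw [h1]; exact hc i
        · exact Or.inr h1
      · rw [if_neg (not_lt.2 h')]
        exact hy.decay _ _ (by linarith) (by linarith) i

/-- Induction on the number of charged particles. When a flow ends in a collision, the old charges
are not admissible for the final positions, so annihilation removes at least one. -/
theorem exists_annihilatingEvolution {ξ : Fin n → ℝ} {β : Fin n → ℤ} (h : (ξ, β) ∈ stateSpace n) :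
    ∃ (x : ℝ → Fin n → ℝ) (b : ℝ → Fin n → ℤ) (S : Set ℝ), x 0 = ξ ∧ b 0 = β ∧
      AnnihilatingEvolution x b S := by
  induction hk : (Finset.univ.filter fun i => β i ≠ 0).card using Nat.strong_induction_on
    generalizing ξ β with
  | _ k ih =>
    rcases exists_flow h with ⟨x, hx0, hx⟩ | ⟨x, T, hx0, hx, hcol⟩
    · exact ⟨x, _, ∅, hx0, rfl, AnnihilatingEvolution.of_flow hx⟩
    · obtain ⟨β', hβ', hdec, hsum⟩ := hx.exists_annihilation
      have hlt : (Finset.univ.filter fun i => β' i ≠ 0).card < k := by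
        rw [← hk]
        refine Finset.card_lt_card (Finset.ssubset_iff_subset_ne.2 ⟨fun i hi => ?_, fun he => ?_⟩)
        · have hi := (Finset.mem_filter.1 hi).2
          rw [(hdec i).resolve_right hi] at hi
          exact Finset.mem_filter.2 ⟨Finset.mem_univ _, hi⟩
        · have : β' = β := by
            ext i
            rcases hdec i with h1 | h1
            · exact h1
            · by_contra hne
              have h2 : i ∈ Finset.univ.filter fun i => β i ≠ 0 :=
                Finset.mem_filter.2 ⟨Finset.mem_univ _, fun h3 => hne (h1.trans h3.symm)⟩
              rw [← he] at h2
              exact (Finset.mem_filter.1 h2).2 h1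
          exact hcol (this ▸ hβ')
      obtain ⟨y, c, S, hy0, hc0, hy⟩ := ih _ hlt hβ' rfl
      refine ⟨_, _, _, ?_, ?_, hy.concat hx hy0 (fun i => hc0 ▸ hdec i) fun z => hc0 ▸ hsum z⟩
      · simp only [if_pos hx.lt, hx0]
      · simp only [if_pos hx.lt]

end Existence

/-! ### From evolutions back to solutions of the particle system -/

section SolutionOfEvolution

variable {n : ℕ} {x : ℝ → Fin n → ℝ} {b : ℝ → Fin n → ℤ} {S : Set ℝ}

theorem ParticleEvolution.leftLim_eq {t δ : ℝ} {β : Fin n → ℤ} (hδ : 0 < δ)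
    (hβ : ∀ s ∈ Ioo (t - δ) t, b s = β) (i : Fin n) :
    Function.leftLim (fun s => b s i) t = β i := by
  refine leftLim_eq_of_tendsto (tendsto_const_nhds.congr' ?_)
  filter_upwards [Ioo_mem_nhdsLT (show t - δ < t by linarith)] with s hs
  rw [hβ s hs]

theorem ParticleEvolution.continuousWithinAt_charge (h : ParticleEvolution x b) {t : ℝ}
    (ht : 0 ≤ t) (T : ℝ) (i : Fin n) : ContinuousWithinAt (fun s => b s i) (Icc t T) t := by
  obtain ⟨δ, hδ, h1⟩ := h.right t ht
  refine tendsto_const_nhds.congr' ?_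
  filter_upwards [self_mem_nhdsWithin,
    mem_nhdsWithin_of_mem_nhds (Iio_mem_nhds (show t < t + δ by linarith))] with s hs hsδ
  rw [(h1 s ⟨hs.1, hsδ⟩).1]

theorem AnnihilatingEvolution.contDiffWithinAt (h : AnnihilatingEvolution x b S) {t T : ℝ}
    (ht : 0 ≤ t) (htS : t ∉ S) (i : Fin n) :
    ContDiffWithinAt ℝ 1 (fun s => x s i) (Icc 0 T) t := by
  rcases ht.eq_or_lt with rfl | hpos
  · obtain ⟨δ, hδ, h1⟩ := h.right 0 le_rfl
    rw [zero_add] at h1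
    have hf : IsFlow x (b 0) 0 δ :=
      ⟨hδ, fun t ht => by rw [← (h1 t ht).1]; exact h.mem t ht.1,
        fun i => (h.cont i).mono Icc_subset_Ici_self,
        fun t ht => (h1 t ⟨ht.1.le, ht.2⟩).2 ht.1⟩
    refine (hf.contDiffOn i 0 ⟨le_rfl, hδ⟩).mono_of_mem_nhdsWithin ?_
    rw [← Ici_inter_Iio]
    exact inter_mem (nhdsWithin_mono _ Icc_subset_Ici_self self_mem_nhdsWithin)
      (nhdsWithin_le_nhds (Iio_mem_nhds hδ))
  · obtain ⟨δ, hδ, hδt, h1⟩ := h.smooth t hpos htS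
    have hf : IsFlow x (b t) (t - δ / 2) (t + δ / 2) :=
      ⟨by linarith, fun s hs => by
          rw [← (h1 s ⟨by linarith [hs.1], by linarith [hs.2]⟩).1]
          exact h.mem s (by linarith [hs.1]),
        fun i s hs => ((h1 s ⟨by linarith [hs.1], by linarith [hs.2]⟩).2
          i).continuousAt.continuousWithinAt,
        fun s hs => (h1 s ⟨by linarith [hs.1], by linarith [hs.2]⟩).2⟩
    refine (hf.contDiffOn i t ⟨by linarith, by linarith⟩).mono_of_mem_nhdsWithin ?_
    exact nhdsWithin_le_nhds (Ico_mem_nhds (by linarith) (by linarith))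

/-- Charges are continuous from the right, so a discontinuity is one from the left. It cannot occur
at a smooth time, and the charge it leads to is not the one before, hence is 0 while the one before
was not. -/
theorem AnnihilatingEvolution.jump (h : AnnihilatingEvolution x b S) {t T : ℝ} {i : Fin n}
    (ht : t ∈ jumpTimes T (fun s => b s i)) : t ∈ S ∧ b t i = 0 ∧
      |Function.leftLim (fun s => b s i) t| = 1 ∧ ∃ δ > 0, ∀ s ∈ Ioo (t - δ) t, b s i ≠ 0 := by
  obtain ⟨⟨ht0, htT⟩, hnc⟩ := ht
  have hright := h.continuousWithinAt_charge ht0 T i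
  have htpos : 0 < t := by
    rcases ht0.eq_or_lt with rfl | h1
    · exact absurd hright hnc
    · exact h1
  have htS : t ∈ S := by
    by_contra htS
    obtain ⟨δ, hδ, -, h1⟩ := h.smooth t htpos htS
    refine hnc (ContinuousAt.continuousWithinAt (tendsto_const_nhds.congr' ?_))
    filter_upwards [Ioo_mem_nhds (show t - δ < t by linarith) (show t < t + δ by linarith)]
      with s hs
    rw [(h1 s hs).1]
  obtain ⟨δ, hδ, hδt, β, h1, h2, -⟩ := h.left t htpos
  have hne : b t i ≠ β i := fun he => by
    refine hnc ?_
    have hleft : ContinuousWithinAt (fun s => b s i) (Icc 0 t) t := by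
      refine tendsto_const_nhds.congr' ?_
      filter_upwards [self_mem_nhdsWithin,
        mem_nhdsWithin_of_mem_nhds (Ioi_mem_nhds (show t - δ < t by linarith))] with s hs hsδ
      rcases hs.2.eq_or_lt with rfl | hlt
      · rfl
      · rw [(h1 s ⟨hsδ, hlt⟩).1, he]
    have := hleft.union hright
    rwa [Icc_union_Icc_eq_Icc ht0 htT] at this
  have hb0 : b t i = 0 := (h2 i).resolve_left hne
  have hβ0 : β i ≠ 0 := fun h0 => hne (hb0.trans h0.symm)
  refine ⟨htS, hb0, ?_, δ, hδ, fun s hs => by rw [(h1 s hs).1]; exact hβ0⟩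
  rw [ParticleEvolution.leftLim_eq hδ fun s hs => (h1 s hs).1]
  have hm := h.mem (t - δ / 2) (by linarith)
  rw [(h1 (t - δ / 2) ⟨by linarith, by linarith⟩).1] at hm
  rcases charge_eq_of_ne_zero hm hβ0 with h3 | h3 <;> simp [h3]

theorem AnnihilatingEvolution.isParticleSolution (h : AnnihilatingEvolution x b S) :
    IsParticleSolution (x 0) (b 0) x b := by
  intro T hT
  refine ⟨fun t ht => h.mem t ht.1, S ∩ Iic T, h.finite.subset inter_subset_left,
    fun t ht => ⟨h.pos t ht.1, ht.2⟩, fun i => ⟨(h.cont i).mono Icc_subset_Ici_self,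
      fun t ht => ?_, fun t ht => h.continuousWithinAt_charge ht.1 T i⟩, ⟨rfl, rfl⟩,
    fun i => ⟨fun t ht t' ht' => ?_, fun t ht => ?_⟩, fun τ hτ y => ?_, fun t ht i => ?_⟩
  · exact (h.contDiffWithinAt ht.1.1 (fun hS => ht.2 ⟨hS, ht.1.2⟩) i).mono Set.sdiff_subset
  -- After a jump the charge is 0 forever, while just before a jump it is nonzero; so there is at
  -- most one.
  · have key : ∀ t ∈ jumpTimes T (fun s => b s i), ∀ t' ∈ jumpTimes T (fun s => b s i),
        ¬ t < t' := fun t ht t' ht' hlt => by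
      obtain ⟨-, h0, -⟩ := h.jump ht
      obtain ⟨-, -, -, δ, hδ, hne⟩ := h.jump ht'
      obtain ⟨s, hs1, hs2⟩ := exists_between (max_lt hlt (show t' - δ < t' by linarith))
      have hts : t ≤ s := ((le_max_left _ _).trans_lt hs1).le
      refine hne s ⟨(le_max_right _ _).trans_lt hs1, hs2⟩ ?_
      rcases h.decay t s ht.1.1 hts i with h1 | h1
      · rw [h1, h0]
      · exact h1
    exact le_antisymm (not_lt.1 (key t' ht' t ht)) (not_lt.1 (key t ht t' ht'))
  · obtain ⟨h1, h2, h3, -⟩ := h.jump ht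
    exact ⟨⟨h1, ht.1.2⟩, h3, h2⟩
  · obtain ⟨δ, hδ, -, β, h1, -, h3⟩ := h.left τ (h.pos τ hτ.1)
    simp only [ParticleEvolution.leftLim_eq hδ fun s hs => (h1 s hs).1, Finset.sum_sub_distrib,
      h3 y, sub_self]
  · obtain ⟨δ, hδ, -, h1⟩ := h.smooth t ht.1.1 fun hS => ht.2 ⟨hS, ht.1.2.le⟩
    exact (h1 t ⟨by linarith, by linarith⟩).2 i

theorem exists_isParticleSolution {x₀ : Fin n → ℝ} {b₀ : Fin n → ℤ}
    (h : (x₀, b₀) ∈ stateSpace n) :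
    ∃ (x : ℝ → Fin n → ℝ) (b : ℝ → Fin n → ℤ), IsParticleSolution x₀ b₀ x b := by
  obtain ⟨x, b, S, hx, hb, he⟩ := exists_annihilatingEvolution h
  exact ⟨x, b, hx ▸ hb ▸ he.isParticleSolution⟩

end SolutionOfEvolution

end AnnihilatingParticles

end

open AnnihilatingParticles

theorem proposition4p5 (n : ℕ) (hn : 2 ≤ n) (x₀ : Fin n → ℝ) (b₀ : Fin n → ℤ)
    (h₀ : (x₀, b₀) ∈ stateSpace n) :
    (∃ (x : ℝ → Fin n → ℝ) (b : ℝ → Fin n → ℤ), IsParticleSolution x₀ b₀ x b) ∧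
    ∀ (x : ℝ → Fin n → ℝ) (b : ℝ → Fin n → ℤ), IsParticleSolution x₀ b₀ x b →
      ∀ ρ : ℝ, 0 < ρ →
        IsViscositySolution ρ (1 / (n : ℝ)) (particleStep x b) ∧
        HasInitialEnvelopes (particleStep x b) (stepFunction x₀ b₀) ∧
        ∀ v : ℝ × ℝ → ℝ, IsViscositySolution ρ (1 / (n : ℝ)) v →
          HasInitialEnvelopes v (stepFunction x₀ b₀) →
          ∀ p ∈ Q, upperEnv Q v p = upperEnv Q (particleStep x b) p ∧
            lowerEnv Q v p = lowerEnv Q (particleStep x b) p := by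
  refine ⟨exists_isParticleSolution h₀, fun x b h ρ hρ => ?_⟩
  have hn0 : 0 < n := by omega
  have he := h.evolution
  obtain ⟨hx0, hb0⟩ := h.initial
  rw [← hx0, ← hb0]
  exact ⟨he.isViscositySolution hn0 hρ, he.hasInitialEnvelopes, fun v hv hv0 p hp =>
    ⟨he.upperEnv_eq hn0 hρ hv hv0 p hp, he.lowerEnv_eq hn0 hρ hv hv0 p hp⟩⟩
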